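/- **Setting.** Let $\mathbb T^2=(\mathbb R/2\pi\mathbb Z)^2$ with Lebesgue measure $dx$, $\mathbf e_k(x)=\frac1{2\pi}e^{ik\cdot x}$ for $k\in\mathbb Z^2$, $H=L^2(\mathbb T^2;\mathbb R)$ with inner product $(\cdot,\cdot)_H$, and for $s\in\mathbb R$ let $H^s=H^s(\mathbb T^2)$ be the real Sobolev space of the distributions $u$ on $\mathbb T^2$ with $\hat u(-k)=\overline{\hat u(k)}$ and $\|u\|_{H^s}^2=\sum_k(1+|k|^2)^s|\hat u(k)|^2<\infty$, where $\hat u(k)=\langle u,\mathbf e_{-k}\rangle$ (so $\hat f(k)=\int f\,\overline{\mathbf e_k}\,dx$ for functions). Write ${}_{H^{-s}}\langle u,v\rangle_{H^s}=\sum_k\hat u(k)\hat v(-k)$ for the dual pairing. Fix $\delta>0$, let $E=H^{-\delta}$, $A=(1-\Delta)^{-1}$, and let $\mu_0=N(0,A^{1+\delta})$ be the free field, i.e. the centred Gaussian probability measure on $E$ with $\int_E(l_1,z)_E(l_2,z)_E\,\mu_0(dz)=(A^{1+\delta}l_1,l_2)_E$ for $l_1,l_2\in E$. Call $\Lambda\subset\mathbb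 R^2$ a cut-off set if it is compact, $\Lambda=-\Lambda$, and $0$ is an interior point of $\Lambda$. For $z\in E$, $x\in\mathbb T^2$, $a\in\mathbb R$, $n\ge 0$ put $$(\Pi_\Lambda z)(x)=\sum_{k\in\Lambda\cap\mathbb Z^2}\hat z(k)\mathbf e_k(x),\qquad \rho_\Lambda=\frac1{2\pi}\Big(\sum_{k\in\Lambda\cap\mathbb Z^2}\frac1{1+|k|^2}\Big)^{1/2},$$ $$\exp_\Lambda(az)_x=\exp\Big(a(\Pi_\Lambda z)(x)-\frac{(a\rho_\Lambda)^2}2\Big),\qquad \Phi_{n,\Lambda}(z)_x=\sqrt{n!}\,\rho_\Lambda^n\,\mathbb H_n\big(\rho_\Lambda^{-1}(\Pi_\Lambda z)(x)\big),$$ where $\mathbb H_n(\xi)=\frac{(-1)^n}{\sqrt{n!}}e^{\xi^2/2}\big(\frac{d}{d\xi}\big)^ne^{-\xi^2/2}$. **Theorem.** Let $0<\alpha\le 1$. For every $n\ge 0$ and $g\in H$ there are the Wick powers $\Phi_n:E\to H^{-\alpha}$ and $\Phi_n(\cdot)(g):E\to\mathbb R$, that is, maps such that for every cut-off set $\Lambda$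 and every $1\le p<\infty$, as $N\to\infty$, $\Phi_{n,N\Lambda}\to\Phi_n$ in $L^p(\mu_0;H^{-\alpha})$ and $(\Phi_{n,N\Lambda}(\cdot),g)_H\to\Phi_n(\cdot)(g)$ in $L^p(\mu_0)$. Moreover: 1. If $|a|<\sqrt{4\pi\alpha}$, the series $:\!\exp(a\cdot)\!:\;=\sum_{n=0}^\infty\frac{a^n}{n!}\Phi_n$ converges in $L^2(\mu_0;H^{-\alpha})$, and for every cut-off set $\Lambda$ $$\lim_{N\to\infty}\exp_{N\Lambda}(a\cdot)=\;:\!\exp(a\cdot)\!:\quad\text{in }L^2(\mu_0;H^{-\alpha}).$$ 2. If $|a|<\sqrt{4\pi}$ and $g\in H$, the series $:\!\exp(a\cdot)\!:(g)=\sum_{n=0}^\infty\frac{a^n}{n!}\Phi_n(\cdot)(g)$ converges in $L^2(\mu_0)$, and for every cut-off set $\Lambda$ $$\lim_{N\to\infty}(\exp_{N\Lambda}(a\cdot),g)_H=\;:\!\exp(a\cdot)\!:(g)\quad\text{in }L^2(\mu_0).$$ If moreover $|a|<\sqrt{4\pi\alpha}$ and $g\in H^\alpha$, then $:\!\exp(az)\!:(g)={}_{H^{-\alpha}}\langle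 :\!\exp(az)\!:,g\rangle_{H^\alpha}$ for $\mu_0$-a.e. $z\in E$. 3. Let $p\ge 2$. If $|a|<\sqrt{4\pi\alpha/(p-1)}$, then $:\!\exp(a\cdot)\!:\;\in L^p(\mu_0;H^{-\alpha})$. If $|a|<\sqrt{4\pi/(p-1)}$ and $g\in H$, then $:\!\exp(a\cdot)\!:(g)\in L^p(\mu_0)$. -/

import Mathlib

open MeasureTheory ProbabilityTheory Filter Topology
open scoped Real ENNReal NNReal ComplexConjugate Pointwise

namespace WickExp

noncomputable section

section Fourier

open scoped ContDiff

instance fact_two_pi_pos : Fact (0 < 2 * π) := ⟨Real.two_pi_pos⟩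

/-- The torus `(ℝ / 2πℤ)²`, with its Lebesgue measure `volume` of total mass `4π²`. -/
abbrev Torus : Type := AddCircle (2 * π) × AddCircle (2 * π)

/-- The space `C^∞(𝕋²; ℂ)` of test functions: smoothness is that of the periodic lift to `ℝ²`. -/
def TestFn : Submodule ℂ (Torus → ℂ) where
  carrier := {φ | ContDiff ℝ ∞ (fun p : ℝ × ℝ => φ ((p.1 : AddCircle (2 * π)), (p.2 : AddCircle (2 * π))))}
  add_mem' := by
    intro φ ψ h₁ h₂
    simp only [Set.mem_ofPred_eq] at h₁ h₂
    exact h₁.add h₂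
  zero_mem' := by
    change ContDiff ℝ ∞ (fun _ : ℝ × ℝ => (0 : ℂ))
    exact contDiff_const
  smul_mem' := by
    intro c φ h
    simp only [Set.mem_ofPred_eq] at h
    exact h.const_smul c

/-- The partial derivative `∂/∂x₁` of a function on the torus. -/
def partial₁ (f : Torus → ℂ) (x : Torus) : ℂ := deriv (fun t : ℝ => f (x.1 + (t : AddCircle (2 * π)), x.2)) 0

/-- The partial derivative `∂/∂x₂` of a function on the torus. -/
def partial₂ (f : Torus → ℂ) (x : Torus) : ℂ := deriv (fun t : ℝ => f (x.1, x.2 + (t : AddCircle (2 * π)))) 0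

/-- The distributions `𝒮'(𝕋²; ℂ)`: linear functionals `u` on `C^∞(𝕋²; ℂ)` such that, for some `N`
and `C`, `|u φ| ≤ C max_{i + j ≤ N} max_x |∂₁^i ∂₂^j φ (x)|` for all `φ`. -/
def Distr : Submodule ℂ (TestFn →ₗ[ℂ] ℂ) where
  carrier := {u | ∃ (N : ℕ) (C : ℝ), ∀ (φ : TestFn) (M : ℝ),
    (∀ i j : ℕ, i + j ≤ N → ∀ x : Torus, ‖partial₁^[i] (partial₂^[j] (φ : Torus → ℂ)) x‖ ≤ M) →
      ‖u φ‖ ≤ C * M}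
  add_mem' := by
    rintro u v ⟨N, C, hu⟩ ⟨N', C', hv⟩
    refine ⟨max N N', C + C', fun φ M hM => ?_⟩
    have h1 := hu φ M fun i j hij => hM i j (hij.trans (le_max_left _ _))
    have h2 := hv φ M fun i j hij => hM i j (hij.trans (le_max_right _ _))
    calc ‖u φ + v φ‖ ≤ ‖u φ‖ + ‖v φ‖ := norm_add_le _ _
      _ ≤ (C + C') * M := by linarith
  zero_mem' := ⟨0, 0, fun φ M _ => by simp⟩
  smul_mem' := by
    rintro c u ⟨N, C, hu⟩
    refine ⟨N, ‖c‖ * C, fun φ M hM => ?_⟩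
    have h1 := hu φ M hM
    calc ‖c • u φ‖ = ‖c‖ * ‖u φ‖ := norm_smul _ _
      _ ≤ ‖c‖ * (C * M) := by gcongr
      _ = ‖c‖ * C * M := by ring

/-- The Fourier mode `𝐞_k (x) = (2π)⁻¹ e^{i k · x}`. -/
def mode (k : ℤ × ℤ) : C(Torus, ℂ) where
  toFun x := (2 * π : ℂ)⁻¹ * (fourier k.1 x.1 * fourier k.2 x.2)
  continuous_toFun := by fun_prop

lemma mode_coe (k : ℤ × ℤ) (s t : ℝ) :
    mode k ((s : AddCircle (2 * π)), (t : AddCircle (2 * π)))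
      = (2 * π : ℂ)⁻¹ * Complex.exp (Complex.I * (k.1 * s + k.2 * t)) := by
  have hpi : (π : ℂ) ≠ 0 := by exact_mod_cast Real.pi_ne_zero
  simp only [mode, ContinuousMap.coe_mk, fourier_coe_apply]
  rw [← Complex.exp_add]
  congr 2
  push_cast
  field_simp

lemma mode_mem (k : ℤ × ℤ) : (mode k : Torus → ℂ) ∈ TestFn := by
  change ContDiff ℝ ∞ (fun p : ℝ × ℝ => mode k ((p.1 : AddCircle (2 * π)), (p.2 : AddCircle (2 * π))))
  simp only [mode_coe]
  have h1 : ContDiff ℝ ∞ (fun p : ℝ × ℝ => (p.1 : ℂ)) := Complex.ofRealCLM.contDiff.comp contDiff_fst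
  have h2 : ContDiff ℝ ∞ (fun p : ℝ × ℝ => (p.2 : ℂ)) := Complex.ofRealCLM.contDiff.comp contDiff_snd
  fun_prop

/-- The Fourier mode as a test function. -/
def modeTest (k : ℤ × ℤ) : TestFn := ⟨mode k, mode_mem k⟩

/-- The Fourier coefficient `û(k)`: the pairing of `u` with `𝐞_k` that extends the `L²` inner
product `(f, 𝐞_k) = ∫ f(x) conj (𝐞_k (x)) dx`, where `conj 𝐞_k = 𝐞_{-k}`. -/
def fourierCoef (u : TestFn →ₗ[ℂ] ℂ) (k : ℤ × ℤ) : ℂ := u (modeTest (-k))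

/-- The eigenvalues `λ_k = 1 + |k|²` of `1 - Δ`. -/
def lam (k : ℤ × ℤ) : ℝ := 1 + ((k.1 : ℝ) ^ 2 + (k.2 : ℝ) ^ 2)

lemma lam_pos (k : ℤ × ℤ) : 0 < lam k := by unfold lam; positivity
lemma one_le_lam (k : ℤ × ℤ) : 1 ≤ lam k := by unfold lam; nlinarith [sq_nonneg (k.1 : ℝ), sq_nonneg (k.2 : ℝ)]
lemma lam_neg (k : ℤ × ℤ) : lam (-k) = lam k := by simp [lam]

/-! ### Fourier analysis of test functions -/

lemma isOpenQuotientMap_coe :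
    IsOpenQuotientMap (fun p : ℝ × ℝ => (((p.1 : AddCircle (2 * π)), (p.2 : AddCircle (2 * π))) : Torus)) := by
  have h : IsOpenQuotientMap (fun s : ℝ => (s : AddCircle (2 * π))) := QuotientAddGroup.isOpenQuotientMap_mk
  exact h.prodMap h

lemma exists_rep (x : Torus) : ∃ p : ℝ × ℝ, x = ((p.1 : AddCircle (2 * π)), (p.2 : AddCircle (2 * π))) := by
  obtain ⟨p, hp⟩ := isOpenQuotientMap_coe.surjective x
  exact ⟨p, hp.symm⟩

lemma TestFn.continuous (φ : TestFn) : Continuous (φ : Torus → ℂ) :=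
  isOpenQuotientMap_coe.isQuotientMap.continuous_iff.2 (by
    have h : ContDiff ℝ ∞ (fun p : ℝ × ℝ => (φ : Torus → ℂ) ((p.1 : AddCircle (2 * π)), (p.2 : AddCircle (2 * π)))) := φ.2
    exact h.continuous)

lemma partial₁_coe (f : Torus → ℂ) (s t : ℝ) :
    partial₁ f ((s : AddCircle (2 * π)), (t : AddCircle (2 * π)))
      = deriv (fun r : ℝ => f ((r : AddCircle (2 * π)), (t : AddCircle (2 * π)))) s := by
  have := deriv_comp_const_add (fun r : ℝ => f ((r : AddCircle (2 * π)), (t : AddCircle (2 * π)))) s 0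
  rw [add_zero] at this
  simpa [partial₁] using this

lemma partial₂_coe (f : Torus → ℂ) (s t : ℝ) :
    partial₂ f ((s : AddCircle (2 * π)), (t : AddCircle (2 * π)))
      = deriv (fun r : ℝ => f ((s : AddCircle (2 * π)), (r : AddCircle (2 * π)))) t := by
  have := deriv_comp_const_add (fun r : ℝ => f ((s : AddCircle (2 * π)), (r : AddCircle (2 * π)))) t 0
  rw [add_zero] at this
  simpa [partial₂] using this

lemma hasDerivAt_fst (φ : TestFn) (s t : ℝ) :
    HasDerivAt (fun r : ℝ => (φ : Torus → ℂ) ((r : AddCircle (2 * π)), (t : AddCircle (2 * π))))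
      (partial₁ φ ((s : AddCircle (2 * π)), (t : AddCircle (2 * π)))) s := by
  rw [partial₁_coe]
  apply DifferentiableAt.hasDerivAt
  have h : ContDiff ℝ ∞ (fun r : ℝ => (φ : Torus → ℂ) ((r : AddCircle (2 * π)), (t : AddCircle (2 * π)))) :=
    ContDiff.comp (g := fun p : ℝ × ℝ => (φ : Torus → ℂ) ((p.1 : AddCircle (2 * π)), (p.2 : AddCircle (2 * π))))
      (f := fun r : ℝ => (r, t)) φ.2 (by fun_prop)
  exact h.differentiable (by simp) s

lemma hasDerivAt_snd (φ : TestFn) (s t : ℝ) :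
    HasDerivAt (fun r : ℝ => (φ : Torus → ℂ) ((s : AddCircle (2 * π)), (r : AddCircle (2 * π))))
      (partial₂ φ ((s : AddCircle (2 * π)), (t : AddCircle (2 * π)))) t := by
  rw [partial₂_coe]
  apply DifferentiableAt.hasDerivAt
  have h : ContDiff ℝ ∞ (fun r : ℝ => (φ : Torus → ℂ) ((s : AddCircle (2 * π)), (r : AddCircle (2 * π)))) :=
    ContDiff.comp (g := fun p : ℝ × ℝ => (φ : Torus → ℂ) ((p.1 : AddCircle (2 * π)), (p.2 : AddCircle (2 * π))))
      (f := fun r : ℝ => (s, r)) φ.2 (by fun_prop)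
  exact h.differentiable (by simp) t

lemma partial₁_mem (φ : TestFn) : partial₁ (φ : Torus → ℂ) ∈ TestFn := by
  set F := fun p : ℝ × ℝ => (φ : Torus → ℂ) ((p.1 : AddCircle (2 * π)), (p.2 : AddCircle (2 * π))) with hF
  have hFc : ContDiff ℝ ∞ F := φ.2
  have : (fun p : ℝ × ℝ => partial₁ (φ : Torus → ℂ) ((p.1 : AddCircle (2 * π)), (p.2 : AddCircle (2 * π))))
      = fun p => fderiv ℝ F p (1, 0) := by
    funext p
    refine (hasDerivAt_fst φ p.1 p.2).unique ?_
    have h1 : HasFDerivAt F (fderiv ℝ F p) ((fun r : ℝ => (r, p.2)) p.1) := (hFc.differentiable (by simp) p).hasFDerivAt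
    exact h1.comp_hasDerivAt p.1 ((hasDerivAt_id p.1).prodMk (hasDerivAt_const p.1 p.2))
  change ContDiff ℝ ∞ (fun p : ℝ × ℝ => partial₁ (φ : Torus → ℂ) ((p.1 : AddCircle (2 * π)), (p.2 : AddCircle (2 * π))))
  rw [this]
  exact (hFc.fderiv_right (m := ∞) (by simp)).clm_apply contDiff_const

lemma partial₂_mem (φ : TestFn) : partial₂ (φ : Torus → ℂ) ∈ TestFn := by
  set F := fun p : ℝ × ℝ => (φ : Torus → ℂ) ((p.1 : AddCircle (2 * π)), (p.2 : AddCircle (2 * π))) with hF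
  have hFc : ContDiff ℝ ∞ F := φ.2
  have : (fun p : ℝ × ℝ => partial₂ (φ : Torus → ℂ) ((p.1 : AddCircle (2 * π)), (p.2 : AddCircle (2 * π))))
      = fun p => fderiv ℝ F p (0, 1) := by
    funext p
    refine (hasDerivAt_snd φ p.1 p.2).unique ?_
    have h1 : HasFDerivAt F (fderiv ℝ F p) ((fun r : ℝ => (p.1, r)) p.2) := (hFc.differentiable (by simp) p).hasFDerivAt
    exact h1.comp_hasDerivAt p.2 ((hasDerivAt_const p.2 p.1).prodMk (hasDerivAt_id p.2))
  change ContDiff ℝ ∞ (fun p : ℝ × ℝ => partial₂ (φ : Torus → ℂ) ((p.1 : AddCircle (2 * π)), (p.2 : AddCircle (2 * π))))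
  rw [this]
  exact (hFc.fderiv_right (m := ∞) (by simp)).clm_apply contDiff_const

lemma iter_mem (φ : TestFn) (i j : ℕ) : partial₁^[i] (partial₂^[j] (φ : Torus → ℂ)) ∈ TestFn := by
  have h2 : ∀ j, partial₂^[j] (φ : Torus → ℂ) ∈ TestFn := by
    intro j
    induction j with
    | zero => exact φ.2
    | succ j ih => rw [Function.iterate_succ_apply']; exact partial₂_mem ⟨_, ih⟩
  induction i with
  | zero => exact h2 j
  | succ i ih => rw [Function.iterate_succ_apply']; exact partial₁_mem ⟨_, ih⟩

/-- The Fourier coefficient `∫ f(x) 𝐞_{-k}(x) dx` of a function. -/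
def coef (f : Torus → ℂ) (k : ℤ × ℤ) : ℂ := ∫ x, f x * mode (-k) x

lemma integrable_of_continuous {f : Torus → ℂ} (hf : Continuous f) : Integrable f volume :=
  hf.integrable_of_hasCompactSupport (HasCompactSupport.of_compactSpace f)

lemma norm_mode (k : ℤ × ℤ) (x : Torus) : ‖mode k x‖ = (2 * π)⁻¹ := by
  have h1 : ‖fourier k.1 x.1‖ = 1 := Circle.norm_coe _
  have h2 : ‖fourier k.2 x.2‖ = 1 := Circle.norm_coe _
  have hpi := Real.pi_pos
  simp only [mode, ContinuousMap.coe_mk, norm_mul, h1, h2]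
  simp [abs_of_pos hpi]

lemma volume_torus : (volume : Measure Torus).real Set.univ = (2 * π) ^ 2 := by
  have hpi := Real.pi_pos
  rw [Measure.volume_eq_prod, ← Set.univ_prod_univ, measureReal_prod_prod]
  simp [measureReal_def, AddCircle.measure_univ, ENNReal.toReal_ofReal, hpi.le, sq]

lemma norm_coef_le {f : Torus → ℂ} {M : ℝ} (hM : ∀ x, ‖f x‖ ≤ M) (k : ℤ × ℤ) :
    ‖coef f k‖ ≤ 2 * π * M := by
  have h := norm_integral_le_of_norm_le_const (μ := (volume : Measure Torus))
    (f := fun x => f x * mode (-k) x) (C := M * (2 * π)⁻¹)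
    (Eventually.of_forall fun x => by
      rw [norm_mul, norm_mode]; gcongr; exact hM x)
  refine h.trans (le_of_eq ?_)
  rw [volume_torus]
  have hpi := Real.pi_pos
  field_simp

end Fourier

lemma mode_add (k : ℤ × ℤ) (x : Torus) (s t : ℝ) :
    mode k (x + ((s : AddCircle (2 * π)), (t : AddCircle (2 * π))))
      = Complex.exp (Complex.I * (k.1 * s + k.2 * t)) * mode k x := by
  obtain ⟨p, rfl⟩ := exists_rep x
  rw [Prod.mk_add_mk, ← AddCircle.coe_add, ← AddCircle.coe_add, mode_coe, mode_coe,
    mul_left_comm, ← Complex.exp_add]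
  congr 2
  push_cast
  ring

instance torus_addRightInvariant : (volume : Measure Torus).IsAddRightInvariant :=
  inferInstanceAs (((volume : Measure (AddCircle (2 * π))).prod
    (volume : Measure (AddCircle (2 * π)))).IsAddRightInvariant)

lemma coef_translate (f : Torus → ℂ) (k : ℤ × ℤ) (s t : ℝ) :
    ∫ x, f (x + ((s : AddCircle (2 * π)), (t : AddCircle (2 * π)))) * mode (-k) x
      = Complex.exp (Complex.I * (k.1 * s + k.2 * t)) * coef f k := by
  have h := integral_add_right_eq_self (μ := (volume : Measure Torus))
    (fun x => f x * mode (-k) (x + (((-s : ℝ) : AddCircle (2 * π)), ((-t : ℝ) : AddCircle (2 * π)))))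
    (((s : ℝ) : AddCircle (2 * π)), ((t : ℝ) : AddCircle (2 * π)))
  have h2 : ∀ x : Torus, x + (((s : ℝ) : AddCircle (2 * π)), ((t : ℝ) : AddCircle (2 * π)))
      + (((-s : ℝ) : AddCircle (2 * π)), ((-t : ℝ) : AddCircle (2 * π))) = x := by
    intro x
    ext <;> simp
  simp only [h2] at h
  rw [h, coef, ← integral_const_mul]
  congr 1
  funext x
  rw [mode_add]
  simp only [Prod.fst_neg, Prod.snd_neg]
  push_cast
  ring_nf

lemma hasDerivAt_fst' (φ : TestFn) (x : Torus) (t : ℝ) :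
    HasDerivAt (fun r : ℝ => (φ : Torus → ℂ) (x + ((r : AddCircle (2 * π)), ((0 : ℝ) : AddCircle (2 * π)))))
      (partial₁ φ (x + ((t : AddCircle (2 * π)), ((0 : ℝ) : AddCircle (2 * π))))) t := by
  obtain ⟨p, rfl⟩ := exists_rep x
  have h := HasDerivAt.comp_const_add p.1 t (hasDerivAt_fst φ (p.1 + t) p.2)
  simpa using h

lemma hasDerivAt_snd' (φ : TestFn) (x : Torus) (t : ℝ) :
    HasDerivAt (fun r : ℝ => (φ : Torus → ℂ) (x + (((0 : ℝ) : AddCircle (2 * π)), (r : AddCircle (2 * π)))))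
      (partial₂ φ (x + (((0 : ℝ) : AddCircle (2 * π)), (t : AddCircle (2 * π))))) t := by
  obtain ⟨p, rfl⟩ := exists_rep x
  have h := HasDerivAt.comp_const_add p.2 t (hasDerivAt_snd φ p.1 (p.2 + t))
  simpa using h

/-- Differentiation under the integral sign, for a function of a translation parameter. -/
lemma coef_deriv_aux {φ ψ : TestFn} (k : ℤ × ℤ) (v : ℝ → Torus) (hv0 : v 0 = 0)
    (h : ∀ x t, HasDerivAt (fun r : ℝ => (φ : Torus → ℂ) (x + v r)) ((ψ : Torus → ℂ) (x + v t)) t) :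
    HasDerivAt (fun t : ℝ => ∫ x, (φ : Torus → ℂ) (x + v t) * mode (-k) x) (coef ψ k) 0 := by
  have hφ := TestFn.continuous φ
  have hψ := TestFn.continuous ψ
  obtain ⟨C, hC⟩ := (isCompact_range hψ).isBounded.exists_norm_le
  have key := hasDerivAt_integral_of_dominated_loc_of_deriv_le (μ := (volume : Measure Torus))
    (F := fun t x => (φ : Torus → ℂ) (x + v t) * mode (-k) x)
    (F' := fun t x => (ψ : Torus → ℂ) (x + v t) * mode (-k) x) (x₀ := (0 : ℝ)) (s := Set.univ)
    (bound := fun _ => C * (2 * π)⁻¹) univ_mem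
    (Eventually.of_forall fun t => (by fun_prop : Continuous fun x : Torus =>
      (φ : Torus → ℂ) (x + v t) * mode (-k) x).aestronglyMeasurable)
    (integrable_of_continuous (by fun_prop))
    ((by fun_prop : Continuous fun x : Torus =>
      (ψ : Torus → ℂ) (x + v 0) * mode (-k) x).aestronglyMeasurable)
    (Eventually.of_forall fun x t _ => by
      rw [norm_mul, norm_mode]
      gcongr
      exact hC _ ⟨_, rfl⟩)
    (integrable_const _)
    (Eventually.of_forall fun x t _ => (h x t).mul_const _)
  have := key.2
  simpa [hv0, coef] using this

lemma coef_partial₁ (φ : TestFn) (k : ℤ × ℤ) :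
    coef (partial₁ φ) k = (Complex.I * k.1) * coef φ k := by
  have h1 := coef_deriv_aux (φ := φ) (ψ := ⟨_, partial₁_mem φ⟩) k
    (fun r => ((r : AddCircle (2 * π)), ((0 : ℝ) : AddCircle (2 * π))))
    (by simp) (fun x t => hasDerivAt_fst' φ x t)
  simp only [coef_translate] at h1
  have h2 : HasDerivAt (fun t : ℝ => Complex.exp (Complex.I * (k.1 * t + k.2 * (0 : ℝ))) * coef φ k)
      (Complex.I * k.1 * coef φ k) 0 := by
    have h3 : HasDerivAt (fun t : ℂ => Complex.exp (Complex.I * (k.1 * t + k.2 * (0 : ℝ))) * coef φ k)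
        (Complex.I * k.1 * coef φ k) ((0 : ℝ) : ℂ) := by
      have h4 : HasDerivAt (fun t : ℂ => Complex.I * (k.1 * t + k.2 * (0 : ℝ))) (Complex.I * k.1)
          ((0 : ℝ) : ℂ) := by
        simpa using (((hasDerivAt_id ((0 : ℝ) : ℂ)).const_mul (k.1 : ℂ)).add_const
          (k.2 * ((0 : ℝ) : ℂ))).const_mul Complex.I
      simpa using (h4.cexp).mul_const (coef φ k)
    exact h3.comp_ofReal
  exact h1.unique h2

lemma coef_partial₂ (φ : TestFn) (k : ℤ × ℤ) :
    coef (partial₂ φ) k = (Complex.I * k.2) * coef φ k := by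
  have h1 := coef_deriv_aux (φ := φ) (ψ := ⟨_, partial₂_mem φ⟩) k
    (fun r => (((0 : ℝ) : AddCircle (2 * π)), (r : AddCircle (2 * π))))
    (by simp) (fun x t => hasDerivAt_snd' φ x t)
  simp only [coef_translate] at h1
  have h2 : HasDerivAt (fun t : ℝ => Complex.exp (Complex.I * (k.1 * (0 : ℝ) + k.2 * t)) * coef φ k)
      (Complex.I * k.2 * coef φ k) 0 := by
    have h3 : HasDerivAt (fun t : ℂ => Complex.exp (Complex.I * (k.1 * (0 : ℝ) + k.2 * t)) * coef φ k)
        (Complex.I * k.2 * coef φ k) ((0 : ℝ) : ℂ) := by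
      have h4 : HasDerivAt (fun t : ℂ => Complex.I * (k.1 * (0 : ℝ) + k.2 * t)) (Complex.I * k.2)
          ((0 : ℝ) : ℂ) := by
        simpa using (((hasDerivAt_id ((0 : ℝ) : ℂ)).const_mul (k.2 : ℂ)).const_add
          (k.1 * ((0 : ℝ) : ℂ))).const_mul Complex.I
      simpa using (h4.cexp).mul_const (coef φ k)
    exact h3.comp_ofReal
  exact h1.unique h2

lemma coef_iter (φ : TestFn) (i j : ℕ) (k : ℤ × ℤ) :
    coef (partial₁^[i] (partial₂^[j] (φ : Torus → ℂ))) k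
      = (Complex.I * k.1) ^ i * (Complex.I * k.2) ^ j * coef φ k := by
  have h2 : ∀ j, coef (partial₂^[j] (φ : Torus → ℂ)) k = (Complex.I * k.2) ^ j * coef φ k := by
    intro j
    induction j with
    | zero => simp
    | succ j ih =>
      rw [Function.iterate_succ_apply']
      have := coef_partial₂ ⟨_, iter_mem φ 0 j⟩ k
      simp only [Function.iterate_zero, id] at this
      rw [this, ih]; ring
  induction i with
  | zero => simp [h2]
  | succ i ih =>
    rw [Function.iterate_succ_apply']
    have := coef_partial₁ ⟨_, iter_mem φ i j⟩ k
    rw [this, ih]; ring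

lemma norm_coef_decay (φ : TestFn) (m : ℕ) {M : ℝ}
    (hM : ∀ i j : ℕ, i + j ≤ 2 * m → ∀ x : Torus, ‖partial₁^[i] (partial₂^[j] (φ : Torus → ℂ)) x‖ ≤ M)
    (k : ℤ × ℤ) : lam k ^ m * ‖coef φ k‖ ≤ 3 ^ m * (2 * π * M) := by
  have h : ∀ i j : ℕ, i + j ≤ 2 * m → |(k.1 : ℝ)| ^ i * |(k.2 : ℝ)| ^ j * ‖coef φ k‖ ≤ 2 * π * M := by
    intro i j hij
    have := norm_coef_le (hM i j hij) k
    rw [coef_iter] at this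
    simpa using this
  have h0 := h 0 0 (by omega)
  have h1 := h (2 * m) 0 (by omega)
  have h2 := h 0 (2 * m) (by omega)
  simp only [pow_zero, one_mul, mul_one, pow_mul, sq_abs] at h0 h1 h2
  have hc := norm_nonneg (coef φ k)
  set A := (k.1 : ℝ) ^ 2 with hA
  set B := (k.2 : ℝ) ^ 2 with hB
  have hA0 : 0 ≤ A := sq_nonneg _
  have hB0 : 0 ≤ B := sq_nonneg _
  have key : lam k ^ m ≤ 3 ^ m * max 1 (max (A ^ m) (B ^ m)) := by
    have h3 : lam k ≤ 3 * max 1 (max A B) := by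
      unfold lam
      have e1 := le_max_left 1 (max A B)
      have e2 := (le_max_left A B).trans (le_max_right 1 _)
      have e3 := (le_max_right A B).trans (le_max_right 1 _)
      linarith
    calc lam k ^ m ≤ (3 * max 1 (max A B)) ^ m := pow_le_pow_left₀ (lam_pos k).le h3 m
      _ = 3 ^ m * max 1 (max A B) ^ m := mul_pow _ _ _
      _ ≤ 3 ^ m * max 1 (max (A ^ m) (B ^ m)) := by
        gcongr
        rcases le_total 1 (max A B) with h | h
        · rw [max_eq_right h]
          rcases le_total A B with h' | h'
          · rw [max_eq_right h']
            exact (le_max_right _ _).trans (le_max_right _ _)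
          · rw [max_eq_left h']
            exact (le_max_left _ _).trans (le_max_right _ _)
        · rw [max_eq_left h, one_pow]
          exact le_max_left _ _
  calc lam k ^ m * ‖coef φ k‖ ≤ 3 ^ m * max 1 (max (A ^ m) (B ^ m)) * ‖coef φ k‖ := by gcongr
    _ = 3 ^ m * (max 1 (max (A ^ m) (B ^ m)) * ‖coef φ k‖) := mul_assoc _ _ _
    _ ≤ 3 ^ m * (2 * π * M) := by
      apply mul_le_mul_of_nonneg_left _ (by positivity)
      rw [max_mul_of_nonneg _ _ hc, max_mul_of_nonneg _ _ hc, one_mul]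
      exact max_le h0 (max_le h1 h2)

lemma summable_lam_rpow {r : ℝ} (hr : 1 < r) : Summable fun k : ℤ × ℤ => lam k ^ (-r) := by
  have h1 : Summable fun n : ℤ => (1 + (n : ℝ) ^ 2) ^ (-(r / 2)) := by
    refine Summable.of_norm_bounded_eventually (Real.summable_abs_int_rpow hr) ?_
    rw [Filter.eventually_cofinite]
    refine (Set.finite_singleton (0 : ℤ)).subset fun n hn => ?_
    by_contra hn0
    apply hn
    have hn1 : (0 : ℝ) < |(n : ℝ)| := abs_pos.2 (by exact_mod_cast hn0)
    rw [Real.norm_of_nonneg (by positivity)]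
    calc (1 + (n : ℝ) ^ 2) ^ (-(r / 2)) ≤ (|(n : ℝ)| ^ 2) ^ (-(r / 2)) := by
          apply Real.rpow_le_rpow_of_nonpos (by positivity)
          · rw [sq_abs]; linarith
          · linarith
      _ = |(n : ℝ)| ^ (-r) := by
          rw [← Real.rpow_natCast, ← Real.rpow_mul hn1.le]
          congr 1; push_cast; ring
  have h2 := h1.mul_of_nonneg h1 (fun n => by positivity) (fun n => by positivity)
  refine Summable.of_nonneg_of_le (fun k => (Real.rpow_pos_of_pos (lam_pos k) _).le) (fun k => ?_) h2
  rw [← Real.mul_rpow (by positivity) (by positivity)]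
  calc lam k ^ (-r) = (lam k ^ 2) ^ (-(r / 2)) := by
        rw [← Real.rpow_natCast, ← Real.rpow_mul (lam_pos k).le]
        congr 1; push_cast; ring
    _ ≤ _ := by
        apply Real.rpow_le_rpow_of_nonpos (by positivity)
        · unfold lam
          nlinarith [sq_nonneg (k.1 : ℝ), sq_nonneg (k.2 : ℝ), sq_nonneg ((k.1 : ℝ) * k.2), sq_nonneg ((k.1 : ℝ) ^2), sq_nonneg ((k.2 : ℝ)^2)]
        · linarith

lemma summable_lam_inv_sq : Summable fun k : ℤ × ℤ => (lam k ^ 2)⁻¹ := by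
  refine (summable_lam_rpow (r := 2) (by norm_num)).congr fun k => ?_
  rw [Real.rpow_neg (lam_pos k).le]
  norm_cast

lemma TestFn.exists_bound (φ : TestFn) (N : ℕ) : ∃ M : ℝ, ∀ i j : ℕ, i + j ≤ N →
    ∀ x : Torus, ‖partial₁^[i] (partial₂^[j] (φ : Torus → ℂ)) x‖ ≤ M := by
  have h : ∀ p : ℕ × ℕ, ∃ M : ℝ, ∀ x : Torus, ‖partial₁^[p.1] (partial₂^[p.2] (φ : Torus → ℂ)) x‖ ≤ M := by
    intro p
    obtain ⟨C, hC⟩ := (isCompact_range (TestFn.continuous ⟨_, iter_mem φ p.1 p.2⟩)).isBounded.exists_norm_le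
    exact ⟨C, fun x => hC _ ⟨x, rfl⟩⟩
  choose M hM using h
  refine ⟨∑ p ∈ Finset.range (N + 1) ×ˢ Finset.range (N + 1), |M p|, fun i j hij x => ?_⟩
  refine (hM (i, j) x).trans ((le_abs_self _).trans ?_)
  exact Finset.single_le_sum (f := fun p => |M p|) (fun p _ => abs_nonneg _)
    (by simp only [Finset.mem_product, Finset.mem_range]; omega)

lemma summable_lam_pow_coef (φ : TestFn) (m : ℕ) : Summable fun k => lam k ^ m * ‖coef φ k‖ := by
  obtain ⟨M, hM⟩ := TestFn.exists_bound φ (2 * (m + 2))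
  refine Summable.of_nonneg_of_le (fun k => mul_nonneg (pow_nonneg (lam_pos k).le _) (norm_nonneg _))
    (fun k => ?_) (summable_lam_inv_sq.mul_left (3 ^ (m + 2) * (2 * π * M)))
  have := norm_coef_decay φ (m + 2) hM k
  have hl := lam_pos k
  rw [← div_eq_mul_inv, le_div_iff₀ (by positivity)]
  calc _ = lam k ^ (m + 2) * ‖coef φ k‖ := by ring
    _ ≤ _ := this

/-- A continuous function on the torus with vanishing Fourier coefficients vanishes. -/
lemma eq_zero_of_coef_eq_zero {f : Torus → ℂ} (hf : Continuous f) (h : ∀ k, coef f k = 0) : f = 0 := by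
  have one : ∀ g : AddCircle (2 * π) → ℂ, Continuous g → (∀ n : ℤ, ∫ y, g y * fourier (-n) y = 0) → ∀ y, g y = 0 := by
    intro g hg h0 y
    have hz : ∀ n, fourierCoeff (⟨g, hg⟩ : C(AddCircle (2 * π), ℂ)) n = 0 := by
      intro n
      have := h0 n
      rw [fourierCoeff, AddCircle.integral_haarAddCircle]
      simp only [ContinuousMap.coe_mk, smul_eq_mul, mul_comm (fourier (-n) _)]
      rw [this, smul_zero]
    have hs : Summable (fourierCoeff (⟨g, hg⟩ : C(AddCircle (2 * π), ℂ))) := by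
      rw [show fourierCoeff (⟨g, hg⟩ : C(AddCircle (2 * π), ℂ)) = fun _ => 0 from funext hz]
      exact summable_zero
    have := has_pointwise_sum_fourier_series_of_summable hs y
    simp only [hz, zero_smul] at this
    exact this.unique hasSum_zero
  have hpi : (2 * π : ℂ)⁻¹ ≠ 0 := inv_ne_zero (by exact_mod_cast Real.two_pi_pos.ne')
  have step : ∀ (k₂ : ℤ) (x₁ : AddCircle (2 * π)), ∫ y, f (x₁, y) * fourier (-k₂) y = 0 := by
    intro k₂
    apply one
    · have hc : Continuous (Function.uncurry fun (x₁ y : AddCircle (2 * π)) => f (x₁, y) * fourier (-k₂) y) := by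
        unfold Function.uncurry
        fun_prop
      have := continuous_parametric_integral_of_continuous (μ := (volume : Measure (AddCircle (2 * π)))) hc
        (s := Set.univ) isCompact_univ
      simpa using this
    · intro n
      have := h (n, k₂)
      rw [coef, Measure.volume_eq_prod, integral_prod _ (by
        rw [← Measure.volume_eq_prod]
        exact integrable_of_continuous (by fun_prop))] at this
      simp only [mode, ContinuousMap.coe_mk, Prod.neg_mk] at this
      have e : ∀ x y : AddCircle (2 * π), f (x, y) * ((2 * π : ℂ)⁻¹ * (fourier (-n) x * fourier (-k₂) y))
          = (2 * π : ℂ)⁻¹ * (f (x, y) * fourier (-k₂) y * fourier (-n) x) := fun x y => by ring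
      simp only [e, integral_const_mul, integral_mul_const] at this
      exact (mul_eq_zero.1 this).resolve_left hpi
  funext x
  exact one (fun y => f (x.1, y)) (by fun_prop) (fun n => step n x.1) x.2

lemma coef_mode (k j : ℤ × ℤ) : coef (mode k) j = if j = k then 1 else 0 := by
  have one : ∀ n : ℤ, ∫ y : AddCircle (2 * π), fourier n y = if n = 0 then (2 * π : ℂ) else 0 := by
    intro n
    have h := congrFun (fourierCoeff_fourier (T := 2 * π) n) 0
    rw [fourierCoeff, AddCircle.integral_haarAddCircle] at h
    simp only [neg_zero, fourier_zero, one_smul, Complex.real_smul] at h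
    have hpi : (2 * π : ℂ) ≠ 0 := by exact_mod_cast Real.two_pi_pos.ne'
    have h' : ∫ y : AddCircle (2 * π), fourier n y = (2 * π : ℂ) * (Pi.single n (1 : ℂ) : ℤ → ℂ) 0 := by
      rw [← h]
      push_cast
      field_simp
    rw [h']
    by_cases hn : n = 0
    · subst hn; simp
    · rw [if_neg hn, Pi.single_eq_of_ne (Ne.symm hn), mul_zero]
  have e : ∀ x : Torus, mode k x * mode (-j) x
      = ((2 * π : ℂ)⁻¹ * fourier (k.1 - j.1) x.1) * ((2 * π : ℂ)⁻¹ * fourier (k.2 - j.2) x.2) := by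
    intro x
    simp only [mode, ContinuousMap.coe_mk, Prod.fst_neg, Prod.snd_neg, sub_eq_add_neg, fourier_add]
    ring
  have hpi : (2 * π : ℂ) ≠ 0 := by exact_mod_cast Real.two_pi_pos.ne'
  rw [coef]
  simp only [e]
  rw [Measure.volume_eq_prod, integral_prod_mul (fun x => (2 * π : ℂ)⁻¹ * fourier (k.1 - j.1) x)
    (fun y => (2 * π : ℂ)⁻¹ * fourier (k.2 - j.2) y), integral_const_mul, integral_const_mul, one, one]
  by_cases h1 : j.1 = k.1
  · by_cases h2 : j.2 = k.2
    · have : j = k := Prod.ext h1 h2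
      subst this
      simp
      field_simp
    · have h3 : j ≠ k := fun h => h2 (by rw [h])
      simp [sub_eq_zero, Ne.symm h2, h3]
  · have h3 : j ≠ k := fun h => h1 (by rw [h])
    simp [sub_eq_zero, Ne.symm h1, h3]

lemma coef_add {f g : Torus → ℂ} (hf : Continuous f) (hg : Continuous g) (k : ℤ × ℤ) :
    coef (f + g) k = coef f k + coef g k := by
  rw [coef, coef, coef, ← integral_add (integrable_of_continuous (by fun_prop))
    (integrable_of_continuous (by fun_prop))]
  simp only [Pi.add_apply, add_mul]

lemma coef_smul (c : ℂ) (f : Torus → ℂ) (k : ℤ × ℤ) : coef (c • f) k = c * coef f k := by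
  rw [coef, coef, ← integral_const_mul]
  simp only [Pi.smul_apply, smul_eq_mul, mul_assoc]

/-- The Fourier coefficient as a linear functional on test functions. -/
def coefL (k : ℤ × ℤ) : TestFn →ₗ[ℂ] ℂ where
  toFun φ := coef φ k
  map_add' φ ψ := coef_add (TestFn.continuous φ) (TestFn.continuous ψ) k
  map_smul' c φ := coef_smul c φ k

/-- Fourier inversion for test functions. -/
lemma hasSum_coef (φ : TestFn) (x : Torus) : HasSum (fun k => coef φ k * mode k x) (φ.1 x) := by
  have hs : Summable fun k => ‖coef φ k • mode k‖ := by
    refine Summable.of_nonneg_of_le (fun _ => norm_nonneg _) (fun k => ?_)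
      ((summable_lam_pow_coef φ 0).mul_right ((2 * π)⁻¹))
    rw [norm_smul]
    simp only [pow_zero, one_mul]
    gcongr
    have hpi := Real.pi_pos
    exact (ContinuousMap.norm_le _ (by positivity)).2 fun x => (norm_mode k x).le
  have hS : HasSum (fun k => coef φ k • mode k) (∑' k, coef φ k • mode k) := hs.of_norm.hasSum
  set S : C(Torus, ℂ) := ∑' k, coef φ k • mode k with hSdef
  have hcoefS : ∀ j, coef S j = coef φ j := by
    intro j
    let T : C(Torus, ℂ) →L[ℂ] ℂ := LinearMap.mkContinuous
      { toFun := fun f : C(Torus, ℂ) => coef f j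
        map_add' := fun f g => coef_add f.continuous g.continuous j
        map_smul' := fun c f => coef_smul c f j } (2 * π) (fun f => by
          exact norm_coef_le (fun x => f.norm_coe_le_norm x) j)
    have h1 : HasSum (fun k => T (coef φ k • mode k)) (T S) := hS.mapL T
    have h2 : (fun k => T (coef φ k • mode k)) = fun k => if k = j then coef φ j else 0 := by
      funext k
      have : T (coef φ k • mode k) = coef φ k * coef (mode k) j := coef_smul (coef φ k) (mode k) j
      rw [this, coef_mode]
      by_cases h : k = j
      · subst h; simp
      · simp [h, Ne.symm h]
    rw [h2] at h1
    exact h1.unique (hasSum_ite_eq j _)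
  have hzero : (S : Torus → ℂ) + (-1 : ℂ) • (φ : Torus → ℂ) = 0 := by
    apply eq_zero_of_coef_eq_zero (S.continuous.add ((TestFn.continuous φ).const_smul (-1 : ℂ)))
    intro k
    rw [coef_add S.continuous ((TestFn.continuous φ).const_smul (-1 : ℂ)), coef_smul, hcoefS]
    ring
  have hx := congrFun hzero x
  simp only [Pi.add_apply, Pi.smul_apply, smul_eq_mul, Pi.zero_apply] at hx
  have : φ.1 x = S x := by linear_combination -hx
  rw [this]
  exact hS.mapL (ContinuousMap.evalCLM ℂ x)

lemma norm_le_tsum_coef (φ : TestFn) (x : Torus) : ‖φ.1 x‖ ≤ ∑' k, ‖coef φ k‖ := by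
  have hs : Summable fun k => ‖coef φ k‖ := by simpa using summable_lam_pow_coef φ 0
  rw [← (hasSum_coef φ x).tsum_eq]
  refine tsum_of_norm_bounded hs.hasSum fun k => ?_
  rw [norm_mul, norm_mode]
  refine mul_le_of_le_one_right (norm_nonneg _) (inv_le_one_of_one_le₀ ?_)
  linarith [Real.pi_gt_three]

/-- A distribution is determined by its values on the Fourier modes. -/
lemma Distr.hasSum (u : Distr) (φ : TestFn) :
    HasSum (fun k => coef φ k * u.1 (modeTest k)) (u.1 φ) := by
  obtain ⟨N, C, hu⟩ := u.2
  have hs := summable_lam_pow_coef φ N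
  set r : Finset (ℤ × ℤ) → TestFn := fun F => φ - ∑ k ∈ F, coef φ k • modeTest k with hr
  have hcoef : ∀ F k, coef (r F) k = if k ∈ F then 0 else coef φ k := by
    intro F k
    have h1 : coefL k (r F) = coefL k φ - ∑ j ∈ F, coef φ j * coefL k (modeTest j) := by
      simp only [hr, map_sub, map_sum, map_smul, smul_eq_mul]
    have h2 : ∀ j, coefL k (modeTest j) = if k = j then 1 else 0 := fun j => coef_mode j k
    simp only [h2, mul_ite, mul_one, mul_zero, Finset.sum_ite_eq] at h1
    change coefL k (r F) = _
    rw [h1]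
    change coef φ k - _ = _
    split_ifs <;> ring
  have hbound : ∀ F i j, i + j ≤ N → ∀ x : Torus,
      ‖partial₁^[i] (partial₂^[j] (r F : Torus → ℂ)) x‖
        ≤ ∑' k : { k // k ∉ F }, lam k ^ N * ‖coef φ k‖ := by
    intro F i j hij x
    have h1 := norm_le_tsum_coef ⟨_, iter_mem (r F) i j⟩ x
    refine h1.trans ?_
    have h2 : ∀ k, ‖coef (partial₁^[i] (partial₂^[j] (r F : Torus → ℂ))) k‖
        ≤ Set.indicator {k | k ∉ F} (fun k => lam k ^ N * ‖coef φ k‖) k := by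
      intro k
      rw [coef_iter, hcoef]
      by_cases hk : k ∈ F
      · simp [hk]
      · rw [if_neg hk, Set.indicator_of_mem (by exact hk)]
        simp only [norm_mul, norm_pow, Complex.norm_I, one_mul, Complex.norm_intCast]
        gcongr
        have hl := one_le_lam k
        have a1 : |(k.1 : ℝ)| ≤ lam k := by
          unfold lam; nlinarith [sq_abs (k.1 : ℝ), sq_nonneg (|(k.1 : ℝ)| - 1), sq_nonneg (k.2 : ℝ), abs_nonneg (k.1 : ℝ)]
        have a2 : |(k.2 : ℝ)| ≤ lam k := by
          unfold lam; nlinarith [sq_abs (k.2 : ℝ), sq_nonneg (|(k.2 : ℝ)| - 1), sq_nonneg (k.1 : ℝ), abs_nonneg (k.2 : ℝ)]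
        calc |(k.1 : ℝ)| ^ i * |(k.2 : ℝ)| ^ j ≤ lam k ^ i * lam k ^ j := by gcongr
          _ = lam k ^ (i + j) := (pow_add _ _ _).symm
          _ ≤ lam k ^ N := pow_le_pow_right₀ hl hij
    have hs' := hs.indicator {k | k ∉ F}
    rw [show (∑' k : { k // k ∉ F }, lam k ^ N * ‖coef φ k‖)
      = ∑' k, Set.indicator {k | k ∉ F} (fun k => lam k ^ N * ‖coef φ k‖) k from
        tsum_subtype {k | k ∉ F} (fun k => lam k ^ N * ‖coef φ k‖)]
    exact Summable.tsum_le_tsum h2 (Summable.of_nonneg_of_le (fun _ => norm_nonneg _) h2 hs') hs'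
  have hle : ∀ F, ‖u.1 (r F)‖ ≤ C * ∑' k : { k // k ∉ F }, lam k ^ N * ‖coef φ k‖ :=
    fun F => hu (r F) _ (hbound F)
  have htend : Tendsto (fun F => u.1 (r F)) atTop (𝓝 0) := by
    refine squeeze_zero_norm hle ?_
    simpa using (tendsto_tsum_compl_atTop_zero (fun k => lam k ^ N * ‖coef φ k‖)).const_mul C
  have : Tendsto (fun F => u.1 φ - u.1 (r F)) atTop (𝓝 (u.1 φ)) := by
    simpa using htend.const_sub (u.1 φ)
  refine this.congr fun F => ?_
  simp [hr]

lemma Distr.ext_fourier {u v : Distr} (h : ∀ k, fourierCoef u.1 k = fourierCoef v.1 k) : u = v := by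
  ext φ
  have h' : ∀ k, u.1 (modeTest k) = v.1 (modeTest k) := fun k => by
    simpa [fourierCoef] using h (-k)
  have h1 := Distr.hasSum u φ
  simp only [h'] at h1
  exact h1.unique (Distr.hasSum v φ)

/-! ### Sobolev spaces -/

lemma fourierCoef_add (u v : TestFn →ₗ[ℂ] ℂ) (k : ℤ × ℤ) :
    fourierCoef (u + v) k = fourierCoef u k + fourierCoef v k := rfl

lemma fourierCoef_smul (c : ℝ) (u : TestFn →ₗ[ℂ] ℂ) (k : ℤ × ℤ) :
    fourierCoef (c • u) k = c * fourierCoef u k := by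
  simp [fourierCoef]

/-- The real Sobolev space `H^s(𝕋²)`: the distributions `u` with `û(-k) = conj (û(k))` and
`∑_k (1 + |k|²)^s |û(k)|² < ∞`. -/
def sobolevSubmodule (s : ℝ) : Submodule ℝ Distr where
  carrier := {u | (Summable fun k => lam k ^ s * ‖fourierCoef u.1 k‖ ^ 2) ∧
    ∀ k, fourierCoef u.1 (-k) = conj (fourierCoef u.1 k)}
  add_mem' := by
    rintro u v ⟨hu, hu'⟩ ⟨hv, hv'⟩
    refine ⟨?_, fun k => ?_⟩
    · refine Summable.of_nonneg_of_le
        (fun k => mul_nonneg (Real.rpow_nonneg (lam_pos k).le _) (sq_nonneg _)) (fun k => ?_)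
        ((hu.add hv).mul_left 2)
      have h1 : ‖fourierCoef (u.1 + v.1) k‖ ≤ ‖fourierCoef u.1 k‖ + ‖fourierCoef v.1 k‖ := norm_add_le _ _
      have h2 : 0 ≤ lam k ^ s := Real.rpow_nonneg (lam_pos k).le _
      change lam k ^ s * ‖fourierCoef (u.1 + v.1) k‖ ^ 2 ≤ _
      calc lam k ^ s * ‖fourierCoef (u.1 + v.1) k‖ ^ 2
          ≤ lam k ^ s * (2 * (‖fourierCoef u.1 k‖ ^ 2 + ‖fourierCoef v.1 k‖ ^ 2)) := by
            gcongr
            nlinarith [norm_nonneg (fourierCoef (u.1 + v.1) k), sq_nonneg (‖fourierCoef u.1 k‖ - ‖fourierCoef v.1 k‖)]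
        _ = _ := by ring
    · change fourierCoef (u.1 + v.1) (-k) = conj (fourierCoef (u.1 + v.1) k)
      rw [fourierCoef_add, fourierCoef_add, hu', hv', map_add]
  zero_mem' := by
    have h : ∀ k, fourierCoef (0 : Distr).1 k = 0 := fun k => rfl
    refine ⟨?_, fun k => ?_⟩
    · simp only [h, norm_zero, ne_eq, OfNat.ofNat_ne_zero, not_false_eq_true, zero_pow, mul_zero]
      exact summable_zero
    · rw [h, h, map_zero]
  smul_mem' := by
    rintro c u ⟨hu, hu'⟩
    have h : ∀ k, fourierCoef (c • u).1 k = c * fourierCoef u.1 k := fun k => fourierCoef_smul c u.1 k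
    refine ⟨?_, fun k => ?_⟩
    · simp only [h, norm_mul, mul_pow]
      refine (hu.mul_left (‖(c : ℂ)‖ ^ 2)).congr fun k => by ring
    · rw [h, h, hu', map_mul, Complex.conj_ofReal]

/-- The real Sobolev space `H^s(𝕋²)` as a type. -/
def Sobolev (s : ℝ) : Type := sobolevSubmodule s

namespace Sobolev

variable {s : ℝ}

instance : AddCommGroup (Sobolev s) := inferInstanceAs (AddCommGroup (sobolevSubmodule s))
instance : Module ℝ (Sobolev s) := inferInstanceAs (Module ℝ (sobolevSubmodule s))

/-- The underlying linear functional on test functions. -/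
def toFunctional (u : Sobolev s) : TestFn →ₗ[ℂ] ℂ := u.1.1

/-- The Fourier coefficient `û(k)` of an element of `H^s`. -/
def hat (u : Sobolev s) (k : ℤ × ℤ) : ℂ := fourierCoef u.toFunctional k

lemma summable_hat (u : Sobolev s) : Summable fun k => lam k ^ s * ‖u.hat k‖ ^ 2 := u.2.1
lemma hat_neg (u : Sobolev s) (k : ℤ × ℤ) : u.hat (-k) = conj (u.hat k) := u.2.2 k
lemma hat_add (u v : Sobolev s) (k : ℤ × ℤ) : (u + v).hat k = u.hat k + v.hat k := rfl
lemma hat_smul (c : ℝ) (u : Sobolev s) (k : ℤ × ℤ) : (c • u).hat k = c * u.hat k :=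
  fourierCoef_smul c u.1.1 k
lemma hat_zero (k : ℤ × ℤ) : (0 : Sobolev s).hat k = 0 := rfl

lemma ext_hat {u v : Sobolev s} (h : ∀ k, u.hat k = v.hat k) : u = v :=
  Subtype.ext (Distr.ext_fourier h)

lemma summable_mul (u v : Sobolev s) :
    Summable fun k => lam k ^ s * (u.hat k * v.hat (-k)).re := by
  refine Summable.of_norm_bounded (u.summable_hat.add v.summable_hat) fun k => ?_
  have h2 : 0 ≤ lam k ^ s := Real.rpow_nonneg (lam_pos k).le _
  have h3 : |(u.hat k * v.hat (-k)).re| ≤ ‖u.hat k‖ * ‖v.hat k‖ := by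
    refine (Complex.abs_re_le_norm _).trans ?_
    rw [hat_neg, norm_mul, Complex.norm_conj]
  rw [Real.norm_eq_abs, abs_mul, abs_of_nonneg h2, ← mul_add]
  gcongr
  nlinarith [sq_nonneg (‖u.hat k‖ - ‖v.hat k‖), sq_nonneg (‖u.hat k‖), sq_nonneg (‖v.hat k‖)]

lemma hat_mul_self (u : Sobolev s) (k : ℤ × ℤ) : (u.hat k * u.hat (-k)).re = ‖u.hat k‖ ^ 2 := by
  rw [hat_neg, Complex.mul_conj, Complex.ofReal_re, Complex.normSq_eq_norm_sq]

/-- The inner product `(u, v)_{H^s} = ∑_k (1 + |k|²)^s û(k) v̂(-k)`. -/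
@[reducible] def core : InnerProductSpace.Core ℝ (Sobolev s) where
  inner u v := ∑' k, lam k ^ s * (u.hat k * v.hat (-k)).re
  conj_inner_symm u v := by
    simp only [conj_trivial]
    congr 1
    funext k
    rw [hat_neg, hat_neg]
    simp only [Complex.mul_re, Complex.conj_re, Complex.conj_im]
    ring
  re_inner_nonneg u := by
    simp only [RCLike.re_to_real]
    refine tsum_nonneg fun k => ?_
    rw [hat_mul_self]
    exact mul_nonneg (Real.rpow_nonneg (lam_pos k).le _) (sq_nonneg _)
  add_left u v w := by
    rw [← (u.summable_mul w).tsum_add (v.summable_mul w)]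
    congr 1
    funext k
    rw [hat_add, add_mul, Complex.add_re]
    ring
  smul_left u v r := by
    simp only [conj_trivial]
    rw [← tsum_mul_left]
    congr 1
    funext k
    rw [hat_smul, mul_assoc, Complex.re_ofReal_mul]
    ring
  definite u hu := by
    have hs := u.summable_mul u
    have h0 : ∀ k, 0 ≤ lam k ^ s * (u.hat k * u.hat (-k)).re := fun k => by
      rw [hat_mul_self]
      exact mul_nonneg (Real.rpow_nonneg (lam_pos k).le _) (sq_nonneg _)
    have h1 := (hs.hasSum_iff.2 hu)
    have h2 := (hasSum_zero_iff_of_nonneg h0).1 h1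
    refine ext_hat fun k => ?_
    have h3 := congrFun h2 k
    rw [hat_mul_self] at h3
    have h4 := (mul_eq_zero.1 h3).resolve_left (Real.rpow_pos_of_pos (lam_pos k) _).ne'
    rw [hat_zero]
    exact norm_eq_zero.1 (pow_eq_zero_iff (two_ne_zero) |>.1 h4)

instance : NormedAddCommGroup (Sobolev s) :=
  @InnerProductSpace.Core.toNormedAddCommGroup ℝ (Sobolev s) _ _ _ core
instance : InnerProductSpace ℝ (Sobolev s) := InnerProductSpace.ofCore core.toCore
instance : MeasurableSpace (Sobolev s) := borel _
instance : BorelSpace (Sobolev s) := ⟨rfl⟩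

lemma inner_eq (u v : Sobolev s) : inner ℝ u v = ∑' k, lam k ^ s * (u.hat k * v.hat (-k)).re := rfl

lemma norm_sq_eq (u : Sobolev s) : ‖u‖ ^ 2 = ∑' k, lam k ^ s * ‖u.hat k‖ ^ 2 := by
  rw [← real_inner_self_eq_norm_sq, inner_eq]
  simp only [hat_mul_self]

/-- The element of `H^s` with prescribed Fourier coefficients. -/
lemma exists_of_coeff (c : ℤ × ℤ → ℂ) (hc : Summable fun k => lam k ^ s * ‖c k‖ ^ 2)
    (hsymm : ∀ k, c (-k) = conj (c k)) : ∃ u : Sobolev s, ∀ k, u.hat k = c k := by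
  obtain ⟨n, hn⟩ := exists_nat_ge (-s / 2)
  set S := ∑' k, lam k ^ s * ‖c k‖ ^ 2
  have hS : 0 ≤ S := tsum_nonneg fun k => mul_nonneg (Real.rpow_nonneg (lam_pos k).le _) (sq_nonneg _)
  have hck : ∀ k, ‖c k‖ ≤ √S * lam k ^ n := by
    intro k
    have h1 : lam k ^ s * ‖c k‖ ^ 2 ≤ S := hc.le_tsum k
      (fun j _ => mul_nonneg (Real.rpow_nonneg (lam_pos j).le _) (sq_nonneg _))
    have h2 : ‖c k‖ ^ 2 ≤ S * lam k ^ (-s) := by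
      rw [Real.rpow_neg (lam_pos k).le, ← div_eq_mul_inv, le_div_iff₀ (Real.rpow_pos_of_pos (lam_pos k) _)]
      linarith
    have h3 : lam k ^ (-s) ≤ (lam k ^ n) ^ 2 := by
      rw [← pow_mul, ← Real.rpow_natCast]
      apply Real.rpow_le_rpow_of_exponent_le (one_le_lam k)
      push_cast
      linarith
    have hl := lam_pos k
    refine abs_le_of_sq_le_sq' ?_ (by positivity) |>.2
    rw [mul_pow, Real.sq_sqrt hS]
    exact h2.trans (by gcongr)
  have hbd : ∀ (φ : TestFn) (M : ℝ),
      (∀ i j : ℕ, i + j ≤ 2 * (n + 2) → ∀ x : Torus, ‖partial₁^[i] (partial₂^[j] (φ : Torus → ℂ)) x‖ ≤ M) →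
      ∀ k, ‖c k * coef φ (-k)‖ ≤ √S * (3 ^ (n + 2) * (2 * π * M)) * (lam k ^ 2)⁻¹ := by
    intro φ M hM k
    have h1 := norm_coef_decay φ (n + 2) hM (-k)
    rw [lam_neg] at h1
    have hl := lam_pos k
    rw [norm_mul, ← div_eq_mul_inv, le_div_iff₀ (by positivity)]
    calc ‖c k‖ * ‖coef φ (-k)‖ * lam k ^ 2 ≤ √S * lam k ^ n * ‖coef φ (-k)‖ * lam k ^ 2 := by
          gcongr; exact hck k
      _ = √S * (lam k ^ (n + 2) * ‖coef φ (-k)‖) := by ring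
      _ ≤ √S * (3 ^ (n + 2) * (2 * π * M)) := by gcongr
  have hsum : ∀ φ : TestFn, Summable fun k => c k * coef φ (-k) := by
    intro φ
    obtain ⟨M, hM⟩ := TestFn.exists_bound φ (2 * (n + 2))
    exact Summable.of_norm_bounded (summable_lam_inv_sq.mul_left _) (hbd φ M hM)
  let u : TestFn →ₗ[ℂ] ℂ :=
    { toFun := fun φ => ∑' k, c k * coef φ (-k)
      map_add' := fun φ ψ => by
        rw [← (hsum φ).tsum_add (hsum ψ)]
        congr 1
        funext k
        have : coef (φ + ψ : TestFn) (-k) = coef φ (-k) + coef ψ (-k) := (coefL (-k)).map_add φ ψ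
        rw [this]; ring
      map_smul' := fun a φ => by
        simp only [RingHom.id_apply, smul_eq_mul]
        rw [← tsum_mul_left]
        congr 1
        funext k
        have : coef (a • φ : TestFn) (-k) = a * coef φ (-k) := (coefL (-k)).map_smul a φ
        rw [this]; ring }
  have hu : u ∈ Distr := by
    refine ⟨2 * (n + 2), √S * (3 ^ (n + 2) * (2 * π)) * ∑' k : ℤ × ℤ, (lam k ^ 2)⁻¹, fun φ M hM => ?_⟩
    have := tsum_of_norm_bounded (summable_lam_inv_sq.mul_left _).hasSum (hbd φ M hM)
    refine this.trans (le_of_eq ?_)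
    rw [tsum_mul_left]
    ring
  have hcoef : ∀ k, fourierCoef u k = c k := by
    intro k
    change ∑' j, c j * coef (mode (-k)) (-j) = c k
    simp only [coef_mode, neg_inj]
    rw [tsum_eq_single k (fun j hj => by simp [hj])]
    simp
  refine ⟨⟨⟨u, hu⟩, ?_, ?_⟩, hcoef⟩
  · simp only [hcoef]; exact hc
  · intro k; simp only [hcoef]; exact hsymm k

/-- The element of `H^s` with prescribed Fourier coefficients. -/
def ofCoeff (c : ℤ × ℤ → ℂ) (hc : Summable fun k => lam k ^ s * ‖c k‖ ^ 2)
    (hsymm : ∀ k, c (-k) = conj (c k)) : Sobolev s := (exists_of_coeff c hc hsymm).choose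

lemma hat_ofCoeff (c : ℤ × ℤ → ℂ) (hc : Summable fun k => lam k ^ s * ‖c k‖ ^ 2)
    (hsymm : ∀ k, c (-k) = conj (c k)) (k : ℤ × ℤ) : (ofCoeff c hc hsymm).hat k = c k :=
  (exists_of_coeff c hc hsymm).choose_spec k

/-- The operator `A^r = (1 - Δ)^{-r}` on `H^s`, for `r ≥ 0`: it multiplies the `k`-th Fourier
coefficient by `λ_k^{-r}`. -/
def resolventPow (r : ℝ) (hr : 0 ≤ r) (u : Sobolev s) : Sobolev s :=
  ofCoeff (fun k => ((lam k ^ (-r) : ℝ) : ℂ) * u.hat k)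
    (by
      refine Summable.of_nonneg_of_le
        (fun k => mul_nonneg (Real.rpow_nonneg (lam_pos k).le _) (sq_nonneg _)) (fun k => ?_) u.summable_hat
      have h1 : 0 ≤ lam k ^ (-r) := Real.rpow_nonneg (lam_pos k).le _
      have h2 : lam k ^ (-r) ≤ 1 := Real.rpow_le_one_of_one_le_of_nonpos (one_le_lam k) (by linarith)
      have h3 : 0 ≤ lam k ^ s := Real.rpow_nonneg (lam_pos k).le _
      rw [norm_mul, Complex.norm_real, Real.norm_of_nonneg h1]
      gcongr
      exact mul_le_of_le_one_left (norm_nonneg _) h2)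
    (fun k => by rw [lam_neg, hat_neg, map_mul, Complex.conj_ofReal])

/-- The duality pairing `⟨u, v⟩ = ∑_k û(k) v̂(-k)` of `H^{-s}` and `H^s`, which extends the inner
product of `L²(𝕋²)`. -/
def pairing (u : Sobolev (-s)) (v : Sobolev s) : ℝ := ∑' k, (u.hat k * v.hat (-k)).re

end Sobolev

/-! ### Functions as distributions -/

/-- The linear functional `φ ↦ ∫ f(x) φ(x) dx` on test functions defined by an integrable real
function `f` on the torus. -/
def functional (f : Torus → ℝ) (hf : Integrable f volume) : TestFn →ₗ[ℂ] ℂ where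
  toFun φ := ∫ x, (f x : ℂ) * (φ : Torus → ℂ) x
  map_add' φ ψ := by
    have h : ∀ φ : TestFn, Integrable (fun x => (f x : ℂ) * (φ : Torus → ℂ) x) volume := fun φ => by
      obtain ⟨C, hC⟩ := (isCompact_range (TestFn.continuous φ)).isBounded.exists_norm_le
      exact hf.ofReal.mul_bdd (c := C) (TestFn.continuous φ).aestronglyMeasurable
        (Eventually.of_forall fun x => hC _ ⟨x, rfl⟩)
    rw [← integral_add (h φ) (h ψ)]
    congr 1
    funext x
    exact mul_add _ _ _
  map_smul' c φ := by
    simp only [RingHom.id_apply, smul_eq_mul]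
    rw [← integral_const_mul]
    congr 1
    funext x
    change (f x : ℂ) * (c * (φ : Torus → ℂ) x) = _
    ring

lemma functional_mem (f : Torus → ℝ) (hf : Integrable f volume) : functional f hf ∈ Distr := by
  refine ⟨0, ∫ x, |f x|, fun φ M hM => ?_⟩
  change ‖∫ x, (f x : ℂ) * (φ : Torus → ℂ) x‖ ≤ _
  rw [← integral_mul_const]
  refine norm_integral_le_of_norm_le (hf.abs.mul_const M) (Eventually.of_forall fun x => ?_)
  rw [norm_mul, Complex.norm_real, Real.norm_eq_abs]
  gcongr
  exact hM 0 0 le_rfl x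

/-- Bessel's inequality for continuous functions. -/
lemma summable_coef_sq (f : C(Torus, ℂ)) : Summable fun k => ‖coef f k‖ ^ 2 := by
  have hin : ∀ g h : C(Torus, ℂ), inner ℂ (ContinuousMap.toLp (E := ℂ) 2 (volume : Measure Torus) ℂ g)
      (ContinuousMap.toLp (E := ℂ) 2 (volume : Measure Torus) ℂ h) = ∫ x, h x * conj (g x) :=
    fun g h => ContinuousMap.inner_toLp (𝕜 := ℂ) (volume : Measure Torus) g h
  have hconj : ∀ k x, conj (mode k x) = mode (-k) x := by
    intro k x
    simp only [mode, ContinuousMap.coe_mk, map_mul, Prod.fst_neg, Prod.snd_neg, fourier_neg]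
    rw [map_inv₀, map_mul, Complex.conj_ofReal, map_ofNat]
  have hon : Orthonormal ℂ fun k => ContinuousMap.toLp (E := ℂ) 2 (volume : Measure Torus) ℂ (mode k) := by
    rw [orthonormal_iff_ite]
    intro i j
    rw [hin]
    simp only [hconj]
    exact coef_mode j i
  have := hon.inner_products_summable (ContinuousMap.toLp (E := ℂ) 2 (volume : Measure Torus) ℂ f)
  refine this.congr fun k => ?_
  rw [hin]
  simp only [hconj]
  rfl

/-- A continuous real function on the torus, as an element of `H^{-α}(𝕋²)` for `α ≥ 0`: the
distribution `φ ↦ ∫ f(x) φ(x) dx`. -/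
def Sobolev.ofContinuous {α : ℝ} (hα : 0 ≤ α) (f : C(Torus, ℝ)) : Sobolev (-α) :=
  ⟨⟨functional f (f.continuous.integrable_of_hasCompactSupport (HasCompactSupport.of_compactSpace f)),
    functional_mem _ _⟩, by
    let F : C(Torus, ℂ) := ⟨fun x => (f x : ℂ), by fun_prop⟩
    have h : ∀ k, fourierCoef (functional f
        (f.continuous.integrable_of_hasCompactSupport (HasCompactSupport.of_compactSpace f))) k = coef F k :=
      fun k => rfl
    refine ⟨?_, fun k => ?_⟩
    · simp only [h]
      refine Summable.of_nonneg_of_le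
        (fun k => mul_nonneg (Real.rpow_nonneg (lam_pos k).le _) (sq_nonneg _)) (fun k => ?_)
        (summable_coef_sq F)
      exact mul_le_of_le_one_left (sq_nonneg _)
        (Real.rpow_le_one_of_one_le_of_nonpos (one_le_lam k) (by linarith))
    · rw [h, h, coef, coef, ← integral_conj]
      congr 1
      funext x
      simp only [F, mode, ContinuousMap.coe_mk, map_mul, Prod.fst_neg, Prod.snd_neg, fourier_neg, map_inv₀,
        Complex.conj_ofReal, Complex.conj_conj, map_ofNat, neg_neg]⟩

/-! ### The free field -/

/-- `μ` is the space-time free field `N(0, A^{1+δ})` on `E = H^{-δ}(𝕋²)`: the centred Gaussian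
probability measure with `∫ (l₁, z)_E (l₂, z)_E μ(dz) = (A^{1+δ} l₁, l₂)_E`. -/
structure IsFreeField (δ : ℝ) (hδ : 0 < δ) (μ : Measure (Sobolev (-δ))) : Prop where
  isGaussian : IsGaussian μ
  mean_zero : ∀ l : Sobolev (-δ), ∫ z, inner ℝ l z ∂μ = 0
  covariance : ∀ l₁ l₂ : Sobolev (-δ), ∫ z, inner ℝ l₁ z * inner ℝ l₂ z ∂μ
    = inner ℝ (l₁.resolventPow (1 + δ) (by linarith)) l₂

/-! ### Cut-off fields -/

/-- The sets `Λ ⊆ ℝ²` used for cut-offs: compact, symmetric, with `0` in the interior. -/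
structure IsCutoff (Λ : Set (ℝ × ℝ)) : Prop where
  isCompact : IsCompact Λ
  neg_eq : -Λ = Λ
  zero_mem : (0 : ℝ × ℝ) ∈ interior Λ

open Classical in
/-- The finite set `Λ ∩ ℤ²` (for bounded `Λ`, see `mem_modes`). -/
def modes (Λ : Set (ℝ × ℝ)) : Finset (ℤ × ℤ) :=
  if h : {k : ℤ × ℤ | ((k.1 : ℝ), (k.2 : ℝ)) ∈ Λ}.Finite then h.toFinset else ∅

lemma mem_modes {Λ : Set (ℝ × ℝ)} (hΛ : Bornology.IsBounded Λ) (k : ℤ × ℤ) :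
    k ∈ modes Λ ↔ ((k.1 : ℝ), (k.2 : ℝ)) ∈ Λ := by
  have h : {k : ℤ × ℤ | ((k.1 : ℝ), (k.2 : ℝ)) ∈ Λ}.Finite := by
    obtain ⟨R, hR⟩ := hΛ.exists_norm_le
    obtain ⟨n, hn⟩ := exists_nat_ge R
    refine ((Set.finite_Icc (-(n : ℤ)) n).prod (Set.finite_Icc (-(n : ℤ)) n)).subset fun k hk => ?_
    have h1 := (hR _ hk).trans hn
    rw [Prod.norm_def, max_le_iff, Real.norm_eq_abs, Real.norm_eq_abs, abs_le, abs_le] at h1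
    obtain ⟨⟨h2, h3⟩, h4, h5⟩ := h1
    simp only at h2 h3 h4 h5
    exact ⟨⟨by exact_mod_cast h2, by exact_mod_cast h3⟩, ⟨by exact_mod_cast h4, by exact_mod_cast h5⟩⟩
  rw [modes, dif_pos h]
  simp

variable {δ : ℝ}

/-- The projection `(Π_Λ z)(x) = ∑_{k ∈ Λ ∩ ℤ²} ẑ(k) 𝐞_k(x)`, a real-valued continuous function
(the sum is real since `Λ = -Λ` and `ẑ(-k) = conj (ẑ(k))`). -/
def proj (Λ : Set (ℝ × ℝ)) (z : Sobolev (-δ)) : C(Torus, ℝ) where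
  toFun x := (∑ k ∈ modes Λ, z.hat k * mode k x).re
  continuous_toFun := by fun_prop

/-- The standard deviation `ρ_Λ = (2π)⁻¹ (∑_{k ∈ Λ ∩ ℤ²} (1 + |k|²)⁻¹)^{1/2}` of `(Π_Λ z)(x)` under
the free field. -/
def rho (Λ : Set (ℝ × ℝ)) : ℝ := (2 * π)⁻¹ * √(∑ k ∈ modes Λ, (lam k)⁻¹)

/-- The cut-off exponential `exp_Λ(a z)_x = exp (a (Π_Λ z)(x) - (a ρ_Λ)² / 2)`. -/
def wickExpCutoff (a : ℝ) (Λ : Set (ℝ × ℝ)) (z : Sobolev (-δ)) : C(Torus, ℝ) where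
  toFun x := Real.exp (a * proj Λ z x - (a * rho Λ) ^ 2 / 2)
  continuous_toFun := by fun_prop

/-- The normalized Hermite polynomial
`ℍ_n(ξ) = ((-1)^n / √(n!)) e^{ξ²/2} (d/dξ)^n e^{-ξ²/2}`; `Polynomial.hermite n` is the `n`-th
probabilists' Hermite polynomial (see `Polynomial.hermite_eq_deriv_gaussian`). -/
def hermiteN (n : ℕ) (ξ : ℝ) : ℝ := (√(n.factorial : ℝ))⁻¹ * Polynomial.aeval ξ (Polynomial.hermite n)

/-- The regularized Wick power `Φ_{n,Λ}(z)_x = √(n!) ρ_Λ^n ℍ_n (ρ_Λ⁻¹ (Π_Λ z)(x))`. -/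
def wickPowerCutoff (n : ℕ) (Λ : Set (ℝ × ℝ)) (z : Sobolev (-δ)) : C(Torus, ℝ) where
  toFun x := √(n.factorial : ℝ) * rho Λ ^ n * hermiteN n ((rho Λ)⁻¹ * proj Λ z x)
  continuous_toFun := by unfold hermiteN; fun_prop

/-- The real Hilbert space `H = L²(𝕋²)`. -/
abbrev L2 : Type := Lp ℝ 2 (volume : Measure Torus)

/-- The tested function `(f, g)_H = ∫ f(x) g(x) dx`. -/
def test (f : C(Torus, ℝ)) (g : L2) : ℝ := ∫ x, f x * g x

/-- `g ∈ L²(𝕋²)` and `h ∈ H^s(𝕋²)` are the same distribution. -/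
def SameDistr {s : ℝ} (g : L2) (h : Sobolev s) : Prop :=
  h.toFunctional = functional g ((Lp.memLp g).integrable one_le_two)

/-- Convergence `F N → G` in `L^p(μ; K)`; that all functions belong to `L^p(μ; K)` is part of it. -/
def TendstoLp {Ω K : Type*} [MeasurableSpace Ω] [NormedAddCommGroup K] (p : ℝ≥0∞) (μ : Measure Ω)
    (F : ℕ → Ω → K) (G : Ω → K) : Prop :=
  (∀ N, MemLp (F N) p μ) ∧ MemLp G p μ ∧ Tendsto (fun N => eLpNorm (F N - G) p μ) atTop (𝓝 0)

/-- `Φ` is the Wick power `Φ_n`: the limit of `Φ_{n,NΛ}` in `L^p(μ; H^{-α})` for all `1 ≤ p < ∞`,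
the same for every `Λ`. -/
def IsWickPower {α : ℝ} (hα : 0 ≤ α) (μ : Measure (Sobolev (-δ))) (n : ℕ)
    (Φ : Sobolev (-δ) → Sobolev (-α)) : Prop :=
  ∀ Λ, IsCutoff Λ → ∀ p : ℝ≥0∞, 1 ≤ p → p ≠ ∞ →
    TendstoLp p μ (fun N z => Sobolev.ofContinuous hα (wickPowerCutoff n ((N : ℝ) • Λ) z)) Φ

/-- `Φg` is the tested Wick power `Φ_n(·)(g)`: the limit of `(Φ_{n,NΛ}, g)_H` in `L^p(μ)` for all
`1 ≤ p < ∞`, the same for every `Λ`. -/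
def IsTestedWickPower (μ : Measure (Sobolev (-δ))) (n : ℕ) (g : L2) (Φg : Sobolev (-δ) → ℝ) : Prop :=
  ∀ Λ, IsCutoff Λ → ∀ p : ℝ≥0∞, 1 ≤ p → p ≠ ∞ →
    TendstoLp p μ (fun N z => test (wickPowerCutoff n ((N : ℝ) • Λ) z) g) Φg

/-! ### Existence of the free field -/

section Existence

variable {δ : ℝ}

/-- Fourier coefficients of the random series: `λ_k^{-1/2} ((1 + i) ω_k + (1 - i) ω_{-k}) / 2`. -/
def seriesCoef (ω : ℤ × ℤ → ℝ) (k : ℤ × ℤ) : ℂ :=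
  ((lam k ^ (-(1 / 2) : ℝ) : ℝ) : ℂ) * (((1 + Complex.I) * ω k + (1 - Complex.I) * ω (-k)) / 2)

lemma seriesCoef_neg (ω : ℤ × ℤ → ℝ) (k : ℤ × ℤ) : seriesCoef ω (-k) = conj (seriesCoef ω k) := by
  simp only [seriesCoef, lam_neg, neg_neg, map_mul, map_div₀, map_add, map_sub, map_one, Complex.conj_I,
    Complex.conj_ofReal, map_ofNat]
  ring

lemma norm_seriesCoef_sq (ω : ℤ × ℤ → ℝ) (k : ℤ × ℤ) :
    ‖seriesCoef ω k‖ ^ 2 = lam k ^ (-1 : ℝ) * ((ω k ^ 2 + ω (-k) ^ 2) / 2) := by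
  have h1 : (((1 + Complex.I) * ω k + (1 - Complex.I) * ω (-k)) / 2 : ℂ)
      = (((ω k + ω (-k)) / 2 : ℝ) : ℂ) + (((ω k - ω (-k)) / 2 : ℝ) : ℂ) * Complex.I := by
    push_cast; ring
  rw [seriesCoef, norm_mul, mul_pow, Complex.norm_real, Real.norm_of_nonneg (Real.rpow_nonneg (lam_pos k).le _),
    ← Real.rpow_natCast, ← Real.rpow_mul (lam_pos k).le, h1, ← Complex.normSq_eq_norm_sq,
    Complex.normSq_add_mul_I]
  congr 1
  · congr 1; norm_num
  · ring

lemma seriesCoef_sq (ω : ℤ × ℤ → ℝ) (k : ℤ × ℤ) :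
    lam k ^ (-δ) * ‖seriesCoef ω k‖ ^ 2
      = lam k ^ (-(1 + δ)) * ω k ^ 2 / 2 + lam (-k) ^ (-(1 + δ)) * ω (-k) ^ 2 / 2 := by
  rw [norm_seriesCoef_sq, lam_neg, ← mul_assoc, ← Real.rpow_add (lam_pos k)]
  rw [show -δ + -1 = -(1 + δ) by ring]
  ring

lemma hasSum_seriesCoef {ω : ℤ × ℤ → ℝ} {S : ℝ} (h : HasSum (fun k => lam k ^ (-(1 + δ)) * ω k ^ 2) S) :
    HasSum (fun k => lam k ^ (-δ) * ‖seriesCoef ω k‖ ^ 2) S := by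
  have h1 := h.div_const 2
  have h2 : HasSum (fun k => lam (-k) ^ (-(1 + δ)) * ω (-k) ^ 2 / 2) (S / 2) :=
    (Equiv.neg (ℤ × ℤ)).hasSum_iff.2 h1
  have := h1.add h2
  rw [add_halves] at this
  simpa only [seriesCoef_sq] using this

open Classical in
/-- The random series. -/
def series (ω : ℤ × ℤ → ℝ) : Sobolev (-δ) :=
  if h : Summable (fun k => lam k ^ (-(1 + δ)) * ω k ^ 2) then
    Sobolev.ofCoeff (seriesCoef ω) (hasSum_seriesCoef h.hasSum).summable (seriesCoef_neg ω)
  else 0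

lemma hat_series {ω : ℤ × ℤ → ℝ} (h : Summable (fun k => lam k ^ (-(1 + δ)) * ω k ^ 2)) (k : ℤ × ℤ) :
    (series ω : Sobolev (-δ)).hat k = seriesCoef ω k := by
  rw [series, dif_pos h, Sobolev.hat_ofCoeff]

lemma norm_series_sq {ω : ℤ × ℤ → ℝ} (h : Summable (fun k => lam k ^ (-(1 + δ)) * ω k ^ 2)) :
    ‖(series ω : Sobolev (-δ))‖ ^ 2 = ∑' k, lam k ^ (-(1 + δ)) * ω k ^ 2 := by
  rw [Sobolev.norm_sq_eq]
  simp only [hat_series h]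
  exact (hasSum_seriesCoef h.hasSum).tsum_eq

open Classical in
/-- The terms of the random series. -/
def seriesTerm (δ : ℝ) (k : ℤ × ℤ) : Sobolev (-δ) := series (Pi.single k 1)

open Classical in
lemma single_hasSum (k : ℤ × ℤ) : HasSum (fun j => lam j ^ (-(1 + δ)) * (Pi.single k 1 : ℤ × ℤ → ℝ) j ^ 2)
    (lam k ^ (-(1 + δ))) := by
  have := hasSum_single (f := fun j => lam j ^ (-(1 + δ)) * (Pi.single k 1 : ℤ × ℤ → ℝ) j ^ 2) k
    (fun j hj => by simp [hj])
  simpa using this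

open Classical in
lemma norm_term_sq (k : ℤ × ℤ) : ‖seriesTerm δ k‖ ^ 2 = lam k ^ (-(1 + δ)) := by
  rw [seriesTerm, norm_series_sq (single_hasSum k).summable, (single_hasSum k).tsum_eq]

lemma seriesCoef_add (ω η : ℤ × ℤ → ℝ) (k : ℤ × ℤ) :
    seriesCoef (ω + η) k = seriesCoef ω k + seriesCoef η k := by
  simp only [seriesCoef, Pi.add_apply, Complex.ofReal_add]; ring

lemma seriesCoef_smul (c : ℝ) (ω : ℤ × ℤ → ℝ) (k : ℤ × ℤ) :
    seriesCoef (c • ω) k = c * seriesCoef ω k := by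
  simp only [seriesCoef, Pi.smul_apply, smul_eq_mul, Complex.ofReal_mul]; ring

lemma Sobolev.hat_sum {ι : Type*} (F : Finset ι) (u : ι → Sobolev (-δ)) (k : ℤ × ℤ) :
    (∑ i ∈ F, u i).hat k = ∑ i ∈ F, (u i).hat k := by
  classical
  induction F using Finset.induction_on with
  | empty => simp [Sobolev.hat_zero]
  | insert a F ha ih => rw [Finset.sum_insert ha, Finset.sum_insert ha, Sobolev.hat_add, ih]

open Classical in
lemma tendsto_series {ω : ℤ × ℤ → ℝ} (h : Summable (fun k => lam k ^ (-(1 + δ)) * ω k ^ 2)) :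
    Tendsto (fun F : Finset (ℤ × ℤ) => ∑ k ∈ F, ω k • seriesTerm δ k) atTop (𝓝 (series ω)) := by
  rw [tendsto_iff_norm_sub_tendsto_zero]
  have hrem : ∀ F : Finset (ℤ × ℤ), ‖∑ k ∈ F, ω k • seriesTerm δ k - series ω‖ ^ 2
      = ∑' k : { k // k ∉ F }, lam k ^ (-(1 + δ)) * ω k ^ 2 := by
    intro F
    set η : ℤ × ℤ → ℝ := fun k => if k ∈ F then 0 else ω k with hη
    have e1 : (fun k => lam k ^ (-(1 + δ)) * η k ^ 2)
        = Set.indicator {k | k ∉ F} (fun k => lam k ^ (-(1 + δ)) * ω k ^ 2) := by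
      funext k
      by_cases hk : k ∈ F
      · simp [hη, hk]
      · rw [Set.indicator_of_mem (by exact hk)]
        simp [hη, hk]
    have hsη : Summable fun k => lam k ^ (-(1 + δ)) * η k ^ 2 := by
      rw [e1]; exact h.indicator _
    have e2 : series ω - ∑ k ∈ F, ω k • seriesTerm δ k = series η := by
      refine Sobolev.ext_hat fun j => ?_
      have h1 : (series ω - ∑ k ∈ F, ω k • seriesTerm δ k).hat j
          = (series ω : Sobolev (-δ)).hat j - (∑ k ∈ F, ω k • seriesTerm δ k).hat j := rfl
      rw [h1, Sobolev.hat_sum, hat_series h, hat_series hsη]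
      simp only [Sobolev.hat_smul, seriesTerm, hat_series (single_hasSum _).summable]
      have h2 : ω = η + ∑ k ∈ F, ω k • (Pi.single k 1 : ℤ × ℤ → ℝ) := by
        funext i
        simp only [Pi.add_apply, Finset.sum_apply, Pi.smul_apply, smul_eq_mul, Pi.single_apply, mul_ite,
          mul_one, mul_zero, Finset.sum_ite_eq, hη]
        split_ifs <;> simp
      have h3 : ∀ G : Finset (ℤ × ℤ), seriesCoef (∑ k ∈ G, ω k • (Pi.single k 1 : ℤ × ℤ → ℝ)) j
          = ∑ k ∈ G, ω k * seriesCoef (Pi.single k 1) j := by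
        intro G
        induction G using Finset.induction_on with
        | empty => simp [seriesCoef]
        | insert a G ha ih => rw [Finset.sum_insert ha, Finset.sum_insert ha, seriesCoef_add, seriesCoef_smul, ih]
      conv_lhs => rw [h2]
      rw [seriesCoef_add, h3]
      have h4 : ∀ k ∈ F, ω k = (η + ∑ k ∈ F, ω k • (Pi.single k 1 : ℤ × ℤ → ℝ)) k :=
        fun k _ => congrFun h2 k
      rw [← Finset.sum_congr rfl fun k hk => by rw [h4 k hk]]
      ring
    rw [norm_sub_rev, e2, norm_series_sq hsη, e1]
    exact (tsum_subtype {k | k ∉ F} (fun k => lam k ^ (-(1 + δ)) * ω k ^ 2)).symm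
  have ht := (tendsto_tsum_compl_atTop_zero (fun k => lam k ^ (-(1 + δ)) * ω k ^ 2)).sqrt
  rw [Real.sqrt_zero] at ht
  refine ht.congr fun F => ?_
  rw [← hrem, Real.sqrt_sq (norm_nonneg _)]

/-- The law of independent standard Gaussian variables. -/
def noise : Measure (ℤ × ℤ → ℝ) := Measure.infinitePi fun _ => gaussianReal 0 1

instance : IsProbabilityMeasure noise := by unfold noise; infer_instance

lemma noise_map (k : ℤ × ℤ) : noise.map (fun ω => ω k) = gaussianReal 0 1 :=
  Measure.infinitePi_map_eval _ k

lemma ae_summable (hδ : 0 < δ) : ∀ᵐ ω ∂noise, Summable fun k => lam k ^ (-(1 + δ)) * ω k ^ 2 := by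
  have hm : ∀ k : ℤ × ℤ, Measurable fun ω : ℤ × ℤ → ℝ => ENNReal.ofReal (lam k ^ (-(1 + δ)) * ω k ^ 2) :=
    fun k => by fun_prop
  have h1 : ∀ k : ℤ × ℤ, ∫⁻ ω, ENNReal.ofReal (lam k ^ (-(1 + δ)) * ω k ^ 2) ∂noise
      = ENNReal.ofReal (lam k ^ (-(1 + δ))) := by
    intro k
    have hl := Real.rpow_nonneg (lam_pos k).le (-(1 + δ))
    change ∫⁻ ω : ℤ × ℤ → ℝ, (fun y : ℝ => ENNReal.ofReal (lam k ^ (-(1 + δ)) * y ^ 2)) (ω k) ∂noise = _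
    rw [← lintegral_map (f := fun y : ℝ => ENNReal.ofReal (lam k ^ (-(1 + δ)) * y ^ 2))
      (g := fun ω : ℤ × ℤ → ℝ => ω k) (by fun_prop) (by fun_prop), noise_map]
    have hint : Integrable (fun y : ℝ => y ^ 2) (gaussianReal 0 1) := (memLp_id_gaussianReal 2).integrable_sq
    rw [← ofReal_integral_eq_lintegral_ofReal (hint.const_mul _) (Eventually.of_forall fun y => by positivity),
      integral_const_mul]
    have hv : ∫ y, y ^ 2 ∂(gaussianReal 0 1) = 1 := by
      have := variance_fun_id_gaussianReal (μ := 0) (v := 1)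
      rw [variance_eq_integral (by fun_prop)] at this
      simpa using this
    rw [hv, mul_one]
  have h2 : ∫⁻ ω, ∑' k : ℤ × ℤ, ENNReal.ofReal (lam k ^ (-(1 + δ)) * ω k ^ 2) ∂noise ≠ ⊤ := by
    rw [lintegral_tsum fun k => (hm k).aemeasurable]
    simp only [h1]
    rw [← ENNReal.ofReal_tsum_of_nonneg (fun k => Real.rpow_nonneg (lam_pos k).le _)
      (summable_lam_rpow (by linarith))]
    exact ENNReal.ofReal_ne_top
  filter_upwards [ae_lt_top' (AEMeasurable.tsum fun k => (hm k).aemeasurable) h2] with ω hω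
  have h3 := ENNReal.summable_toReal hω.ne
  refine h3.congr fun k => ?_
  exact ENNReal.toReal_ofReal (mul_nonneg (Real.rpow_nonneg (lam_pos k).le _) (sq_nonneg _))

lemma measurable_partial (F : Finset (ℤ × ℤ)) :
    Measurable fun ω : ℤ × ℤ → ℝ => ∑ k ∈ F, ω k • seriesTerm δ k := by
  have h1 : Continuous fun y : F → ℝ => ∑ k : F, y k • seriesTerm δ k := by fun_prop
  have h2 := h1.measurable.comp (by fun_prop : Measurable fun (ω : ℤ × ℤ → ℝ) (k : F) => ω k)
  convert h2 using 1
  funext ω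
  exact (Finset.sum_coe_sort F fun k => ω k • seriesTerm δ k).symm

lemma aemeasurable_series (hδ : 0 < δ) : AEMeasurable (series : _ → Sobolev (-δ)) noise := by
  refine aemeasurable_of_tendsto_metrizable_ae atTop (fun F => (measurable_partial F).aemeasurable) ?_
  filter_upwards [ae_summable hδ] with ω hω
  exact tendsto_series hω

lemma charFun_partial (b : ℤ × ℤ → ℝ) (F : Finset (ℤ × ℤ)) (t : ℝ) :
    ∫ ω, Complex.exp (t * (∑ k ∈ F, b k * ω k : ℝ) * Complex.I) ∂noise
      = Complex.exp (-(∑ k ∈ F, b k ^ 2 : ℝ) * t ^ 2 / 2) := by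
  have hind : iIndepFun (fun (k : ℤ × ℤ) (ω : ℤ × ℤ → ℝ) => b k * ω k) noise :=
    iIndepFun_infinitePi (P := fun _ : ℤ × ℤ => gaussianReal 0 1) (X := fun k y => b k * y)
      (fun k => by fun_prop)
  have h := iIndepFun.charFun_map_fun_finsetSum_eq_prod (s := F)
    (X := fun (k : ℤ × ℤ) (ω : ℤ × ℤ → ℝ) => b k * ω k) (P := noise)
    (fun k _ => (by fun_prop : Measurable fun ω : ℤ × ℤ → ℝ => b k * ω k).aemeasurable) (hind.precomp (g := fun k : F => (k : ℤ × ℤ)) Subtype.val_injective)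
  have h' := congrFun h t
  rw [charFun_apply_real, integral_map
    (by fun_prop : Measurable fun ω : ℤ × ℤ → ℝ => ∑ k ∈ F, b k * ω k).aemeasurable (by fun_prop)] at h'
  rw [h', Finset.prod_apply]
  have h2 : ∀ k : ℤ × ℤ, charFun (noise.map fun ω : ℤ × ℤ → ℝ => b k * ω k) t
      = Complex.exp (-(b k ^ 2) * t ^ 2 / 2) := by
    intro k
    rw [charFun_map_mul_comp (measurable_pi_apply k).aemeasurable, noise_map, charFun_gaussianReal]
    congr 1
    push_cast
    ring
  simp only [h2]
  rw [← Complex.exp_sum]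
  congr 1
  push_cast
  rw [← Finset.sum_neg_distrib, Finset.sum_mul, Finset.sum_div]

lemma map_series (hδ : 0 < δ) (L : Sobolev (-δ) →L[ℝ] ℝ) :
    Summable (fun k => L (seriesTerm δ k) ^ 2) ∧
    (noise.map (series : _ → Sobolev (-δ))).map L
      = gaussianReal 0 (∑' k, L (seriesTerm δ k) ^ 2).toNNReal := by
  have hs : Summable fun k => L (seriesTerm δ k) ^ 2 := by
    refine Summable.of_nonneg_of_le (fun _ => sq_nonneg _) (fun k => ?_)
      ((summable_lam_rpow (r := 1 + δ) (by linarith)).mul_left (‖L‖ ^ 2))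
    rw [← norm_term_sq, ← mul_pow, ← sq_abs]
    exact pow_le_pow_left₀ (abs_nonneg _) (L.le_opNorm _) 2
  refine ⟨hs, ?_⟩
  have hX := aemeasurable_series hδ
  have hLX : AEMeasurable (fun ω => L (series ω : Sobolev (-δ))) noise := L.continuous.measurable.comp_aemeasurable hX
  rw [AEMeasurable.map_map_of_aemeasurable L.continuous.aemeasurable hX]
  have : IsProbabilityMeasure (noise.map (L ∘ (series : _ → Sobolev (-δ)))) := Measure.isProbabilityMeasure_map hLX
  refine Measure.ext_of_charFun ?_
  funext t
  change charFun (noise.map (fun ω => L (series ω : Sobolev (-δ)))) t = _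
  rw [charFun_apply_real, integral_map hLX (by fun_prop), charFun_gaussianReal]
  have h1 : Tendsto (fun F : Finset (ℤ × ℤ) => ∫ ω, Complex.exp (t * (∑ k ∈ F, L (seriesTerm δ k) * ω k : ℝ) * Complex.I) ∂noise)
      atTop (𝓝 (∫ ω, Complex.exp (t * (L (series ω : Sobolev (-δ)) : ℝ) * Complex.I) ∂noise)) := by
    refine tendsto_integral_filter_of_dominated_convergence (fun _ => (1 : ℝ))
      (Eventually.of_forall fun F => by
        have hm : Measurable fun ω : ℤ × ℤ → ℝ => ∑ k ∈ F, L (seriesTerm δ k) * ω k := by fun_prop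
        exact (Complex.continuous_exp.measurable.comp
          (((Complex.continuous_ofReal.measurable.comp hm).const_mul (t : ℂ)).mul_const
            Complex.I)).aestronglyMeasurable) (Eventually.of_forall fun F => Eventually.of_forall fun ω => ?_)
      (integrable_const _) ?_
    · rw [← Complex.ofReal_mul, Complex.norm_exp_ofReal_mul_I]
    · filter_upwards [ae_summable hδ] with ω hω
      have h2 := (L.continuous.tendsto _).comp (tendsto_series hω)
      have h3 : Tendsto (fun F : Finset (ℤ × ℤ) => ∑ k ∈ F, L (seriesTerm δ k) * ω k) atTop (𝓝 (L (series ω))) := by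
        refine h2.congr fun F => ?_
        simp [mul_comm]
      exact (Complex.continuous_exp.tendsto _).comp
        ((((Complex.continuous_ofReal.tendsto _).comp h3).const_mul (t : ℂ)).mul_const Complex.I)
  simp only [charFun_partial] at h1
  have h4 : Tendsto (fun F : Finset (ℤ × ℤ) => Complex.exp (-(∑ k ∈ F, L (seriesTerm δ k) ^ 2 : ℝ) * t ^ 2 / 2))
      atTop (𝓝 (Complex.exp (-(∑' k, L (seriesTerm δ k) ^ 2 : ℝ) * t ^ 2 / 2))) :=
    (Complex.continuous_exp.tendsto _).comp
      (((((Complex.continuous_ofReal.tendsto _).comp hs.hasSum).neg).mul_const _).div_const _)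
  have h5 := tendsto_nhds_unique h1 h4
  have h6 : ((∑' k, L (seriesTerm δ k) ^ 2).toNNReal : ℝ) = ∑' k, L (seriesTerm δ k) ^ 2 :=
    Real.coe_toNNReal _ (tsum_nonneg fun _ => sq_nonneg _)
  have h7 : (((∑' k, L (seriesTerm δ k) ^ 2).toNNReal : ℝ≥0) : ℂ) = ((∑' k, L (seriesTerm δ k) ^ 2 : ℝ) : ℂ) := by
    exact_mod_cast congrArg (fun r : ℝ => (r : ℂ)) h6
  rw [h7]
  convert h5 using 2
  push_cast
  ring

open Classical in
lemma inner_term (l : Sobolev (-δ)) (k : ℤ × ℤ) :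
    inner ℝ l (seriesTerm δ k) = lam k ^ (-δ - 1 / 2) * ((l.hat k).re + (l.hat k).im) := by
  have hk : ∀ j, lam j ^ (-δ) * (l.hat j * (seriesTerm δ k).hat (-j)).re
      = (if j = k then lam k ^ (-δ - 1 / 2) * (((l.hat k).re + (l.hat k).im) / 2) else 0)
        + (if j = -k then lam k ^ (-δ - 1 / 2) * (((l.hat k).re + (l.hat k).im) / 2) else 0) := by
    intro j
    have e1 : ((1 + Complex.I) * ((Pi.single k 1 : ℤ × ℤ → ℝ) j : ℂ)
        + (1 - Complex.I) * ((Pi.single k 1 : ℤ × ℤ → ℝ) (-j) : ℂ)) / 2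
        = (if j = k then (⟨1 / 2, 1 / 2⟩ : ℂ) else 0) + (if j = -k then (⟨1 / 2, -(1 / 2)⟩ : ℂ) else 0) := by
      have a1 : (⟨1 / 2, 1 / 2⟩ : ℂ) = (1 + Complex.I) / 2 := by
        apply Complex.ext <;> simp
      have a2 : (⟨1 / 2, -(1 / 2)⟩ : ℂ) = (1 - Complex.I) / 2 := by
        apply Complex.ext <;> simp [neg_div]
      simp only [Pi.single_apply, neg_eq_iff_eq_neg, a1, a2]
      split_ifs <;> push_cast <;> ring
    have e2 : lam j ^ (-δ - 1 / 2) = lam j ^ (-δ) * lam j ^ (-(1 / 2) : ℝ) := by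
      rw [← Real.rpow_add (lam_pos j)]; congr 1
    rw [Sobolev.hat_neg, seriesTerm, hat_series (single_hasSum _).summable, seriesCoef, e1, map_mul,
      Complex.conj_ofReal, mul_left_comm, Complex.re_ofReal_mul, ← mul_assoc, ← e2]
    by_cases h1 : j = k
    · subst h1
      by_cases h2 : j = -j
      · have h3 : (l.hat j).im = 0 := by
          have := l.hat_neg j
          rw [← h2] at this
          have := congrArg Complex.im this
          simp only [Complex.conj_im] at this
          linarith
        simp [← h2, h3]
        ring
      · simp [h2]
        left
        ring
    · by_cases h2 : j = -k
      · subst h2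
        have h3 := l.hat_neg k
        simp [h1, h3, lam_neg]
        left
        ring
      · simp [h1, h2]
  rw [Sobolev.inner_eq]
  simp only [hk]
  rw [Summable.tsum_add (hasSum_ite_eq k _).summable (hasSum_ite_eq (-k) _).summable,
    (hasSum_ite_eq k _).tsum_eq, (hasSum_ite_eq (-k) _).tsum_eq]
  ring

lemma tsum_inner_term (hδ : 0 ≤ 1 + δ) (l₁ l₂ : Sobolev (-δ))
    (hs : Summable fun k => inner ℝ l₁ (seriesTerm δ k) * inner ℝ l₂ (seriesTerm δ k)) :
    ∑' k, inner ℝ l₁ (seriesTerm δ k) * inner ℝ l₂ (seriesTerm δ k) = inner ℝ (l₁.resolventPow (1 + δ) hδ) l₂ := by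
  have hs' : Summable fun k => inner ℝ l₁ (seriesTerm δ (-k)) * inner ℝ l₂ (seriesTerm δ (-k)) :=
    (Equiv.neg (ℤ × ℤ)).summable_iff.2 hs
  have h1 : ∑' k, inner ℝ l₁ (seriesTerm δ (-k)) * inner ℝ l₂ (seriesTerm δ (-k))
      = ∑' k, inner ℝ l₁ (seriesTerm δ k) * inner ℝ l₂ (seriesTerm δ k) :=
    (Equiv.neg (ℤ × ℤ)).tsum_eq (fun k => inner ℝ l₁ (seriesTerm δ k) * inner ℝ l₂ (seriesTerm δ k))
  have h2 : ∀ k, lam k ^ (-δ) * ((l₁.resolventPow (1 + δ) hδ).hat k * l₂.hat (-k)).re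
      = (inner ℝ l₁ (seriesTerm δ k) * inner ℝ l₂ (seriesTerm δ k)
        + inner ℝ l₁ (seriesTerm δ (-k)) * inner ℝ l₂ (seriesTerm δ (-k))) / 2 := by
    intro k
    have e2 : lam k ^ (-δ - 1 / 2) * lam k ^ (-δ - 1 / 2) = lam k ^ (-δ) * lam k ^ (-(1 + δ)) := by
      rw [← Real.rpow_add (lam_pos k), ← Real.rpow_add (lam_pos k)]; congr 1; ring
    simp only [inner_term, Sobolev.resolventPow, Sobolev.hat_ofCoeff, Sobolev.hat_neg, lam_neg,
      Complex.conj_re, Complex.conj_im]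
    rw [mul_assoc, Complex.re_ofReal_mul, ← mul_assoc, ← e2]
    simp only [Complex.mul_re, Complex.conj_re, Complex.conj_im]
    ring
  rw [Sobolev.inner_eq]
  simp only [h2]
  rw [tsum_div_const, hs.tsum_add hs', h1, add_self_div_two]

/-- The free field exists. -/
theorem exists_isFreeField (δ : ℝ) (hδ : 0 < δ) : ∃ μ, IsFreeField δ hδ μ := by
  set μ := noise.map (series : _ → Sobolev (-δ)) with hμ
  have hG : IsGaussian μ := isGaussian_of_map_eq_gaussianReal fun L => ⟨_, _, (map_series hδ L).2⟩
  have hmean : ∀ L : Sobolev (-δ) →L[ℝ] ℝ, ∫ z, L z ∂μ = 0 := by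
    intro L
    have := integral_map (μ := μ) (φ := L) L.continuous.aemeasurable (f := fun y => y) (by fun_prop)
    rw [← this, (map_series hδ L).2, integral_id_gaussianReal]
  have hsq : ∀ L : Sobolev (-δ) →L[ℝ] ℝ, ∫ z, L z ^ 2 ∂μ = ∑' k, L (seriesTerm δ k) ^ 2 := by
    intro L
    have := integral_map (μ := μ) (φ := L) L.continuous.aemeasurable (f := fun y => y ^ 2) (by fun_prop)
    rw [← this, (map_series hδ L).2]
    have hv := variance_fun_id_gaussianReal (μ := 0) (v := (∑' k, L (seriesTerm δ k) ^ 2).toNNReal)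
    rw [variance_eq_integral (by fun_prop)] at hv
    simp only [integral_id_gaussianReal, sub_zero] at hv
    rw [hv, Real.coe_toNNReal _ (tsum_nonneg fun _ => sq_nonneg _)]
  have hint : ∀ L : Sobolev (-δ) →L[ℝ] ℝ, Integrable (fun z => L z ^ 2) μ := fun L =>
    (IsGaussian.memLp_dual μ L 2 (by simp)).integrable_sq
  refine ⟨μ, hG, fun l => hmean (innerSL ℝ l), fun l₁ l₂ => ?_⟩
  have p1 := hsq (innerSL ℝ l₁ + innerSL ℝ l₂)
  have p2 := hsq (innerSL ℝ l₁ - innerSL ℝ l₂)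
  have s1 := (map_series hδ (innerSL ℝ l₁ + innerSL ℝ l₂)).1
  have s2 := (map_series hδ (innerSL ℝ l₁ - innerSL ℝ l₂)).1
  have i1 := hint (innerSL ℝ l₁ + innerSL ℝ l₂)
  have i2 := hint (innerSL ℝ l₁ - innerSL ℝ l₂)
  have hpol : ∀ z, inner ℝ l₁ z * inner ℝ l₂ z = (1 / 4) * (((innerSL ℝ l₁ + innerSL ℝ l₂) z) ^ 2
      - ((innerSL ℝ l₁ - innerSL ℝ l₂) z) ^ 2) := by
    intro z
    simp only [add_apply, sub_apply, innerSL_apply_apply]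
    ring
  have hs : Summable fun k => inner ℝ l₁ (seriesTerm δ k) * inner ℝ l₂ (seriesTerm δ k) := by
    simp only [hpol]
    exact (s1.sub s2).mul_left _
  rw [← tsum_inner_term _ l₁ l₂ hs]
  simp only [hpol]
  rw [integral_const_mul, integral_sub i1 i2, p1, p2, tsum_mul_left, s1.tsum_sub s2]

end Existence

end

end WickExp

open WickExp

namespace WickExp

/-! ### The two-point inequality -/

/-! Under the free field the numbers √λ_k (Re ẑ(k) + Im ẑ(k)) are independent standard Gaussian
variables, so the field cut off to a symmetric finite set F of frequencies is a finite Gaussian sum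
X_F with E X_F(x) X_G(y) = `green (F ∩ G)` (x - y), the cut-off Green function of 1 - Δ. By Gaussian
integration by parts the correlation of two Wick functionals depends on the covariance C only: n! Cⁿ
for Hermite functionals of order n, exp(a² C) for Wick exponentials, (aC)ⁿ for one of each. Hence
the squared L² norm of a difference of tested Wick functionals is an energy ∑_i ∬ φ_i(x) φ_i(y) κ(x
- y) dx dy with an explicit kernel κ (`eLpNorm_sub_sq`). Both targets are of this kind: for H^{-α}
the φ_i are weighted cosines and sines, for the tested functionals there is the single function g.
One abstract theorem, `exists_wick`, serves both.

Convergence comes from monotonicity. Order the even kernels by declaring R above S when R - S is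
positive definite. Positive definite functions are stable under sums, products and uniform limits,
so the powers and the exponential of `green F` increase with F, and so do their energies. As soon as
these are bounded, the energy gained beyond a large box is small, which makes the Wick functionals
Cauchy in L² along every exhaustion, with a common limit (`IsMonoPD.exists_oscillation`,
`exists_limit`). The squared distance from an exponential to a partial sum of its series is the
energy of the tail of exp(a² G), at most (a²/β)^m times the energy of exp(β G) for β > a².

What has to be proved is that the energy of exp(β G) is bounded for β < 4πα
(`exists_exp_green_bound`). Heuristically G behaves like -(1/2π) log |x|, so exp(β G) is of size
|x|^{-β/2π}; the weights λ_k^{-α} belong, for α < 1, to a kernel of size |x|^{2α-2}, and the product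
is integrable in the plane when β < 4πα. To avoid asymptotic analysis, both factors are first
replaced by larger ones in the positive definite order: the Green function by the explicit kernel
-log |1 - r exp(i x₁ - |x₂|)| / 2π plus a bounded rest, the weights by a dyadic sum of products of
Poisson kernels. Only these explicit functions are estimated pointwise, by powers of |x₁||x₂|. For g
in L², the form of a non-negative kernel is at most its integral times ∫ g², so the threshold is
that of α = 1.

Convergence of the Wick powers in every L^p and the higher integrability of the exponentials rest on
Nelson's hypercontractivity (`gauss_hypercontractive`). It follows from Bonami's two-point
inequality by induction over the discrete cube and the central limit theorem. The passage to the
limit is algebraic: multilinear polynomials in the signs are, by Newton's identities, polynomials in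
power sums, of which only the first two survive in the limit, and these generate the Hermite
polynomials. The factor (p-1)ⁿ on the n-th chaos replaces exp(a² G) by exp(a² (p-1) G), whence the
condition a² (p-1) < 4πα. -/

lemma two_mul_le_rpow_sub_rpow {r y : ℝ} (hr0 : 0 < r) (hr1 : r ≤ 1) (hy : y ∈ Set.Icc (0 : ℝ) 1) :
    2 * r * y ≤ (1 + y) ^ r - (1 - y) ^ r := by
  have hmono : MonotoneOn (fun y : ℝ => (1 + y) ^ r - (1 - y) ^ r - 2 * r * y) (Set.Icc 0 1) := by
    refine monotoneOn_of_hasDerivWithinAt_nonneg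
      (f' := fun y => r * (1 + y) ^ (r - 1) + r * (1 - y) ^ (r - 1) - 2 * r) (convex_Icc 0 1) ?_ ?_ ?_
    · refine ContinuousOn.sub (ContinuousOn.sub ?_ ?_) (by fun_prop)
      · exact ContinuousOn.rpow_const (by fun_prop) fun x _ => Or.inr hr0.le
      · exact ContinuousOn.rpow_const (by fun_prop) fun x _ => Or.inr hr0.le
    · intro x hx
      rw [interior_Icc] at hx
      have h1 : HasDerivAt (fun y : ℝ => (1 + y) ^ r) (1 * r * (1 + x) ^ (r - 1)) x :=
        ((hasDerivAt_id x).const_add 1).rpow_const (Or.inl (by simp only [id]; linarith [hx.1]))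
      have h2 : HasDerivAt (fun y : ℝ => (1 - y) ^ r) (-1 * r * (1 - x) ^ (r - 1)) x :=
        ((hasDerivAt_id x).const_sub 1).rpow_const (Or.inl (by simp only [id]; linarith [hx.2]))
      have h3 := (h1.sub h2).sub ((hasDerivAt_id x).const_mul (2 * r))
      refine (h3.congr_deriv ?_).hasDerivWithinAt
      ring
    · intro x hx
      rw [interior_Icc] at hx
      have hA : 0 < (1 + x) ^ (r - 1) := Real.rpow_pos_of_pos (by linarith [hx.1]) _
      have hB : 0 < (1 - x) ^ (r - 1) := Real.rpow_pos_of_pos (by linarith [hx.2]) _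
      -- The product is (1 - x²)^{r-1} ≥ 1 because r ≤ 1; by the inequality of the means the sum is
      -- then at least 2.
      have hAB : 1 ≤ (1 + x) ^ (r - 1) * (1 - x) ^ (r - 1) := by
        rw [← Real.mul_rpow (by linarith [hx.1]) (by linarith [hx.2])]
        exact Real.one_le_rpow_of_pos_of_le_one_of_nonpos (by nlinarith [hx.1, hx.2])
          (by nlinarith [hx.1, hx.2]) (by linarith)
      have : 2 ≤ (1 + x) ^ (r - 1) + (1 - x) ^ (r - 1) := by
        nlinarith [sq_nonneg ((1 + x) ^ (r - 1) - (1 - x) ^ (r - 1))]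
      nlinarith
  have := hmono (Set.left_mem_Icc.2 zero_le_one) hy hy.1
  simp only [add_zero, sub_zero, Real.one_rpow, mul_zero, sub_self] at this
  linarith

/-- The derivative in y of the difference of the two sides is a multiple of
`two_mul_le_rpow_sub_rpow` with exponent q - 1 ∈ (0, 1]. The left side is the second-order Taylor
polynomial of the right. -/
lemma one_add_sq_le_rpow_add_rpow {q y : ℝ} (hq1 : 1 < q) (hq2 : q ≤ 2) (hy : y ∈ Set.Icc (0 : ℝ) 1) :
    1 + q * (q - 1) / 2 * y ^ 2 ≤ ((1 + y) ^ q + (1 - y) ^ q) / 2 := by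
  have hmono : MonotoneOn (fun y : ℝ => (1 + y) ^ q + (1 - y) ^ q - q * (q - 1) * y ^ 2) (Set.Icc 0 1) := by
    refine monotoneOn_of_hasDerivWithinAt_nonneg
      (f' := fun y => q * (1 + y) ^ (q - 1) - q * (1 - y) ^ (q - 1) - q * (q - 1) * (2 * y)) (convex_Icc 0 1) ?_ ?_ ?_
    · refine ContinuousOn.sub (ContinuousOn.add ?_ ?_) (by fun_prop)
      · exact ContinuousOn.rpow_const (by fun_prop) fun x _ => Or.inr (by linarith)
      · exact ContinuousOn.rpow_const (by fun_prop) fun x _ => Or.inr (by linarith)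
    · intro x hx
      rw [interior_Icc] at hx
      have h1 : HasDerivAt (fun y : ℝ => (1 + y) ^ q) (1 * q * (1 + x) ^ (q - 1)) x :=
        ((hasDerivAt_id x).const_add 1).rpow_const (Or.inr hq1.le)
      have h2 : HasDerivAt (fun y : ℝ => (1 - y) ^ q) (-1 * q * (1 - x) ^ (q - 1)) x :=
        ((hasDerivAt_id x).const_sub 1).rpow_const (Or.inr hq1.le)
      have h3 := (h1.add h2).sub ((hasDerivAt_pow 2 x).const_mul (q * (q - 1)))
      refine (h3.congr_deriv ?_).hasDerivWithinAt
      norm_num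
      ring
    · intro x hx
      rw [interior_Icc] at hx
      have := two_mul_le_rpow_sub_rpow (r := q - 1) (y := x) (by linarith) (by linarith) ⟨hx.1.le, hx.2.le⟩
      nlinarith
  have := hmono (Set.left_mem_Icc.2 zero_le_one) hy hy.1
  simp only [add_zero, sub_zero, Real.one_rpow] at this
  linarith

/-- The two-point inequality of Bonami, in the form `L^q → L²` with `1 < q ≤ 2`. -/
lemma rpow_add_sq_le {q s d : ℝ} (hq1 : 1 < q) (hq2 : q ≤ 2) :
    (s ^ 2 + (q - 1) * d ^ 2) ^ (q / 2) ≤ (|s + d| ^ q + |s - d| ^ q) / 2 := by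
  -- The right side is symmetric in s and d, and since q - 1 ≤ 1 moving the weight q - 1 to the
  -- smaller of the two squares only enlarges the left side. So |d| ≤ |s| may be assumed, and by
  -- homogeneity s = 1, d = y ∈ [0, 1].
  have key : ∀ s d : ℝ, |d| ≤ |s| →
      (s ^ 2 + (q - 1) * d ^ 2) ^ (q / 2) ≤ (|s + d| ^ q + |s - d| ^ q) / 2 := by
    intro s d hds
    have red : |s + d| ^ q + |s - d| ^ q = (|s| + |d|) ^ q + (|s| - |d|) ^ q := by
      have h1 : 0 ≤ |s| - |d| := by linarith
      have h2 : 0 ≤ |s| + |d| := by positivity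
      rcases abs_cases s with ⟨hs, _⟩ | ⟨hs, _⟩ <;> rcases abs_cases d with ⟨hd, _⟩ | ⟨hd, _⟩ <;>
        rw [hs, hd] at h1 h2 ⊢
      · rw [abs_of_nonneg h2, abs_of_nonneg h1]
      · rw [abs_of_nonneg (by linarith : 0 ≤ s + d), abs_of_nonneg (by linarith : 0 ≤ s - d), add_comm]
        congr 2 <;> ring
      · rw [abs_of_nonpos (by linarith : s + d ≤ 0), abs_of_nonpos (by linarith : s - d ≤ 0), add_comm]
        congr 2 <;> ring
      · rw [abs_of_nonpos (by linarith : s + d ≤ 0), abs_of_nonpos (by linarith : s - d ≤ 0)]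
        congr 2 <;> ring
    rw [red, ← sq_abs s, ← sq_abs d]
    rcases (abs_nonneg s).eq_or_lt with h0 | h0
    · have hd : |d| = 0 := le_antisymm (by linarith) (abs_nonneg d)
      rw [← h0, hd]
      simp [Real.zero_rpow (by linarith : q / 2 ≠ 0), Real.zero_rpow (by linarith : q ≠ 0)]
    · set S := |s|
      set y := |d| / S with hy
      have hy1 : y ∈ Set.Icc (0 : ℝ) 1 := ⟨by positivity, (div_le_one h0).2 hds⟩
      have hd : |d| = S * y := by rw [hy]; field_simp
      rw [hd]
      have e1 : S ^ 2 + (q - 1) * (S * y) ^ 2 = S ^ 2 * (1 + (q - 1) * y ^ 2) := by ring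
      have e2 : S + S * y = S * (1 + y) := by ring
      have e3 : S - S * y = S * (1 - y) := by ring
      have h5 : 0 ≤ 1 + (q - 1) * y ^ 2 := by nlinarith [sq_nonneg y]
      rw [e1, e2, e3, Real.mul_rpow (by positivity) h5, Real.mul_rpow h0.le (by linarith [hy1.1]),
        Real.mul_rpow h0.le (by linarith [hy1.2]), ← Real.rpow_natCast, ← Real.rpow_mul h0.le]
      have e4 : ((2 : ℕ) : ℝ) * (q / 2) = q := by push_cast; ring
      rw [e4, ← mul_add, mul_div_assoc]
      gcongr
      refine le_trans ?_ (one_add_sq_le_rpow_add_rpow hq1 hq2 hy1)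
      -- Bernoulli's inequality with exponent q/2 ≤ 1 linearizes the left side to 1 + q(q-1)y²/2.
      have := rpow_one_add_le_one_add_mul_self (s := (q - 1) * y ^ 2) (by nlinarith [sq_nonneg y])
        (p := q / 2) (by linarith) (by linarith)
      refine this.trans (le_of_eq ?_)
      ring
  rcases le_total |d| |s| with h | h
  · exact key s d h
  · have := key d s h
    rw [add_comm s d, abs_sub_comm s d]
    refine le_trans ?_ this
    have hsd : s ^ 2 ≤ d ^ 2 := sq_le_sq.2 h
    apply Real.rpow_le_rpow
    · nlinarith [sq_nonneg s, sq_nonneg d]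
    · nlinarith
    · linarith

/-- The two-point inequality in the form `L² → L^p` with `2 ≤ p`. -/
lemma two_point {p a b ρ : ℝ} (hp : 2 ≤ p) (hρ : ρ ^ 2 * (p - 1) = 1) :
    (|a + ρ * b| ^ p + |a - ρ * b| ^ p) / 2 ≤ (a ^ 2 + b ^ 2) ^ (p / 2) := by
  have hp1 : 0 < p - 1 := by linarith
  -- The claim is dual to `rpow_add_sq_le` at the conjugate exponent q, for which ρ² = 1/(p-1) = q -
  -- 1.
  set q := p / (p - 1) with hq
  have hq1 : 1 < q := by rw [hq, lt_div_iff₀ hp1]; linarith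
  have hq2 : q ≤ 2 := by rw [hq, div_le_iff₀ hp1]; linarith
  have hρq : ρ ^ 2 = q - 1 := by rw [hq]; field_simp; linarith
  set x := a + ρ * b
  set y := a - ρ * b
  -- The function g = x|x|^{p-2} gives equality in Hölder's inequality.
  have hg : ∀ x : ℝ, ∃ g : ℝ, x * g = |x| ^ p ∧ |g| ^ q = |x| ^ p := by
    intro x
    rcases eq_or_ne x 0 with rfl | hx
    · exact ⟨0, by simp [Real.zero_rpow (by linarith : p ≠ 0)],
        by simp [Real.zero_rpow (by linarith : p ≠ 0), Real.zero_rpow (by linarith : q ≠ 0)]⟩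
    · have hx' : 0 < |x| := abs_pos.2 hx
      refine ⟨x * |x| ^ (p - 2), ?_, ?_⟩
      · rw [← mul_assoc, ← sq, ← sq_abs, ← Real.rpow_natCast, ← Real.rpow_add hx']
        congr 1; push_cast; ring
      · rw [abs_mul, abs_of_nonneg (Real.rpow_nonneg hx'.le _)]
        nth_rw 1 [← Real.rpow_one |x|]
        rw [← Real.rpow_add hx', ← Real.rpow_mul hx'.le]
        congr 1
        rw [hq]; field_simp; ring
  obtain ⟨g₁, h1, h1'⟩ := hg x
  obtain ⟨g₂, h2, h2'⟩ := hg y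
  set M := (|x| ^ p + |y| ^ p) / 2 with hM
  have hM0 : 0 ≤ M := by positivity
  have hk := rpow_add_sq_le (s := (g₁ + g₂) / 2) (d := (g₁ - g₂) / 2) hq1 hq2
  rw [show (g₁ + g₂) / 2 + (g₁ - g₂) / 2 = g₁ by ring, show (g₁ + g₂) / 2 - (g₁ - g₂) / 2 = g₂ by ring,
    h1', h2', ← hM] at hk
  set Q := ((g₁ + g₂) / 2) ^ 2 + (q - 1) * ((g₁ - g₂) / 2) ^ 2 with hQ
  have hQ0 : 0 ≤ Q := by have := sq_nonneg ((g₁ - g₂) / 2); have := sq_nonneg ((g₁ + g₂) / 2); nlinarith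
  -- Cauchy–Schwarz: M pairs (a, b) with (s, ρd), where s and d are the half sum and half difference
  -- of g₁ and g₂. As Q ≤ M^{2/q}, a power of M cancels, and 2 - 2/q = 2/p.
  have hM2 : M ^ 2 ≤ (a ^ 2 + b ^ 2) * Q := by
    have e : M = a * ((g₁ + g₂) / 2) + b * (ρ * ((g₁ - g₂) / 2)) := by
      rw [hM, ← h1, ← h2]; simp only [x, y]; ring
    rw [e, hQ, ← hρq]
    nlinarith [sq_nonneg (a * (ρ * ((g₁ - g₂) / 2)) - b * ((g₁ + g₂) / 2))]
  rcases hM0.eq_or_lt with h0 | h0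
  · rw [← h0]; positivity
  have hQM : Q ≤ M ^ (2 / q) := by
    have := Real.rpow_le_rpow (by positivity) hk (by positivity : 0 ≤ 2 / q)
    rwa [← Real.rpow_mul hQ0, show q / 2 * (2 / q) = 1 by field_simp, Real.rpow_one] at this
  have hM3 : M ^ (2 / p) ≤ a ^ 2 + b ^ 2 := by
    have h3 : M ^ 2 ≤ (a ^ 2 + b ^ 2) * M ^ (2 / q) := hM2.trans (by gcongr)
    have h4 : M ^ 2 = M ^ (2 / p) * M ^ (2 / q) := by
      rw [← Real.rpow_add h0, ← Real.rpow_natCast]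
      congr 1
      rw [hq]; push_cast; field_simp; ring
    rw [h4] at h3
    exact le_of_mul_le_mul_right h3 (by positivity)
  have := Real.rpow_le_rpow (by positivity) hM3 (by positivity : 0 ≤ p / 2)
  rwa [← Real.rpow_mul hM0, show 2 / p * (p / 2) = 1 by field_simp, Real.rpow_one] at this

/-! ### Hypercontractivity on the discrete cube -/

/-- The sign of the coordinates in `S` at the vertex `T` of the cube. -/
def walsh {ι : Type*} [DecidableEq ι] (T S : Finset ι) : ℝ := ∏ m ∈ S, if m ∈ T then 1 else -1

/-- Hypercontractivity on the discrete cube. -/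
lemma cube_hypercontractive {ι : Type*} [DecidableEq ι] {p ρ : ℝ} (hp : 2 ≤ p) (hρ : ρ ^ 2 * (p - 1) = 1)
    (M : Finset ι) (c : Finset ι → ℝ) :
    (∑ T ∈ M.powerset, |∑ S ∈ M.powerset, ρ ^ S.card * c S * walsh T S| ^ p) / 2 ^ M.card
      ≤ (∑ S ∈ M.powerset, c S ^ 2) ^ (p / 2) := by
  induction M using Finset.induction_on generalizing c with
  | empty =>
    simp only [Finset.powerset_empty, Finset.sum_singleton, Finset.card_empty, pow_zero, walsh,
      Finset.prod_empty, one_mul, mul_one, div_one]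
    rw [← sq_abs, ← Real.rpow_natCast, ← Real.rpow_mul (abs_nonneg _)]
    apply le_of_eq
    congr 1
    push_cast
    ring
  | insert a M ha ih =>
    -- The coordinate a is split off: on its two faces the polynomial takes the values A - ρB and A
    -- + ρB, to which the two-point inequality applies for each T.
    set A : Finset ι → ℝ := fun T => ∑ S ∈ M.powerset, ρ ^ S.card * c S * walsh T S with hA
    set B : Finset ι → ℝ := fun T => ∑ S ∈ M.powerset, ρ ^ S.card * c (insert a S) * walsh T S with hB
    have hna : ∀ {S}, S ∈ M.powerset → a ∉ S := fun hS h => ha (Finset.mem_powerset.1 hS h)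
    have h1 : ∀ T ∈ M.powerset, ∑ S ∈ (insert a M).powerset, ρ ^ S.card * c S * walsh T S
        = A T - ρ * B T := by
      intro T hT
      rw [Finset.sum_powerset_insert ha, hA, hB, Finset.mul_sum, sub_eq_add_neg, ← Finset.sum_neg_distrib]
      congr 1
      refine Finset.sum_congr rfl fun S hS => ?_
      rw [Finset.card_insert_of_notMem (hna hS), walsh, Finset.prod_insert (hna hS), if_neg (hna hT), walsh]
      ring
    have h2 : ∀ T ∈ M.powerset, ∑ S ∈ (insert a M).powerset, ρ ^ S.card * c S * walsh (insert a T) S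
        = A T + ρ * B T := by
      intro T hT
      have hw : ∀ S ∈ M.powerset, walsh (insert a T) S = walsh T S := by
        intro S hS
        refine Finset.prod_congr rfl fun m hm => ?_
        have : m ≠ a := fun h => hna hS (h ▸ hm)
        simp [Finset.mem_insert, this]
      rw [Finset.sum_powerset_insert ha, hA, hB, Finset.mul_sum]
      congr 1
      · exact Finset.sum_congr rfl fun S hS => by rw [hw S hS]
      · refine Finset.sum_congr rfl fun S hS => ?_
        have := hw S hS
        rw [walsh] at this
        rw [Finset.card_insert_of_notMem (hna hS), walsh, Finset.prod_insert (hna hS),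
          if_pos (Finset.mem_insert_self a T), this]
        ring
    have ihA := ih c
    have ihB := ih fun S => c (insert a S)
    rw [Finset.sum_powerset_insert ha, Finset.sum_powerset_insert ha,
      Finset.sum_congr rfl fun T hT => by rw [h1 T hT],
      Finset.sum_congr (s₁ := M.powerset) (f := fun T => |∑ S ∈ (insert a M).powerset, ρ ^ S.card * c S * walsh (insert a T) S| ^ p) rfl fun T hT => by rw [h2 T hT],
      ← Finset.sum_add_distrib, Finset.card_insert_of_notMem ha]
    set SA := ∑ S ∈ M.powerset, c S ^ 2
    set SB := ∑ S ∈ M.powerset, c (insert a S) ^ 2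
    have hSA : 0 ≤ SA := Finset.sum_nonneg fun _ _ => sq_nonneg _
    have hSB : 0 ≤ SB := Finset.sum_nonneg fun _ _ => sq_nonneg _
    have step : ∀ (u : Finset ι → ℝ) (Q : ℝ), 0 ≤ Q → (∑ T ∈ M.powerset, |u T| ^ p) / 2 ^ M.card ≤ Q ^ (p / 2) →
        (∑ T ∈ M.powerset, (u T ^ 2) ^ (p / 2)) ^ (1 / (p / 2)) ≤ ((2 : ℝ) ^ M.card) ^ (1 / (p / 2)) * Q := by
      intro u Q hQ h
      have e : ∀ T, (u T ^ 2) ^ (p / 2) = |u T| ^ p := fun T => by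
        rw [← sq_abs, ← Real.rpow_natCast, ← Real.rpow_mul (abs_nonneg _)]
        congr 1; push_cast; ring
      simp only [e]
      rw [div_le_iff₀ (by positivity), mul_comm] at h
      have := Real.rpow_le_rpow (Finset.sum_nonneg fun _ _ => by positivity) h
        (by positivity : 0 ≤ 1 / (p / 2))
      rwa [Real.mul_rpow (by positivity) (by positivity), ← Real.rpow_mul hQ,
        show p / 2 * (1 / (p / 2)) = 1 by field_simp, Real.rpow_one] at this
    -- Since p/2 ≥ 1, Minkowski's inequality separates A² from B², and the induction hypothesis
    -- bounds each of them.
    have mink := Real.Lp_add_le_of_nonneg M.powerset (f := fun T => A T ^ 2) (g := fun T => B T ^ 2)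
      (p := p / 2) (by linarith) (fun _ _ => sq_nonneg _) (fun _ _ => sq_nonneg _)
    have h3 : (∑ T ∈ M.powerset, (A T ^ 2 + B T ^ 2) ^ (p / 2)) ^ (1 / (p / 2))
        ≤ ((2 : ℝ) ^ M.card) ^ (1 / (p / 2)) * (SA + SB) := by
      refine mink.trans ?_
      rw [mul_add]
      exact add_le_add (step A SA hSA ihA) (step B SB hSB ihB)
    have h4 : ∑ T ∈ M.powerset, (A T ^ 2 + B T ^ 2) ^ (p / 2) ≤ 2 ^ M.card * (SA + SB) ^ (p / 2) := by
      have h0 : 0 ≤ ∑ T ∈ M.powerset, (A T ^ 2 + B T ^ 2) ^ (p / 2) :=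
        Finset.sum_nonneg fun _ _ => by positivity
      have := Real.rpow_le_rpow (by positivity) h3 (by positivity : 0 ≤ p / 2)
      rwa [Real.mul_rpow (by positivity) (by positivity), ← Real.rpow_mul h0, ← Real.rpow_mul (by positivity),
        show 1 / (p / 2) * (p / 2) = 1 by field_simp, Real.rpow_one, Real.rpow_one] at this
    rw [div_le_iff₀ (by positivity), pow_succ]
    calc ∑ T ∈ M.powerset, (|A T - ρ * B T| ^ p + |A T + ρ * B T| ^ p)
        ≤ ∑ T ∈ M.powerset, 2 * (A T ^ 2 + B T ^ 2) ^ (p / 2) := by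
          refine Finset.sum_le_sum fun T _ => ?_
          have := two_point (a := A T) (b := B T) hp hρ
          linarith
      _ ≤ _ := by rw [← Finset.mul_sum]; linarith

end WickExp

namespace WickExp

/-! ### Integration against a fixed integrable function -/

section Wint

variable {X : Type*} [TopologicalSpace X] [CompactSpace X] [MeasurableSpace X] [BorelSpace X]
  {ν : Measure X} {φ : X → ℝ}

lemma integrable_continuousMap_mul (hφ : Integrable φ ν) (f : C(X, ℝ)) : Integrable (fun x => f x * φ x) ν :=
  hφ.bdd_mul (c := ‖f‖) f.continuous.aestronglyMeasurable (Eventually.of_forall fun x => f.norm_coe_le_norm x)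

/-- The functional `f ↦ ∫ f φ` on continuous functions. -/
noncomputable def wint (hφ : Integrable φ ν) : C(X, ℝ) →L[ℝ] ℝ :=
  LinearMap.mkContinuous
    { toFun := fun f => ∫ x, f x * φ x ∂ν
      map_add' := fun f g => by
        rw [← integral_add (integrable_continuousMap_mul hφ f) (integrable_continuousMap_mul hφ g)]
        simp only [ContinuousMap.add_apply, add_mul]
      map_smul' := fun c f => by
        simp only [ContinuousMap.smul_apply, smul_eq_mul, mul_assoc, RingHom.id_apply, integral_const_mul] }
    (∫ x, ‖φ x‖ ∂ν) fun f => by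
      change ‖∫ x, f x * φ x ∂ν‖ ≤ _
      rw [mul_comm, ← integral_const_mul]
      refine norm_integral_le_of_norm_le (hφ.norm.const_mul _) (Eventually.of_forall fun x => ?_)
      rw [norm_mul]
      gcongr
      exact f.norm_coe_le_norm x

lemma wint_apply (hφ : Integrable φ ν) (f : C(X, ℝ)) : wint hφ f = ∫ x, f x * φ x ∂ν := rfl

end Wint

/-! ### Hermite polynomials and Newton's identities -/

/-- The Hermite polynomials with variance parameter `v`. -/
def hp (v x : ℝ) : ℕ → ℝ
  | 0 => 1
  | 1 => x
  | n + 2 => x * hp v x (n + 1) - (n + 1) * v * hp v x n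

/-- The elementary symmetric polynomials as functions of the power sums. -/
noncomputable def newton (p : ℕ → ℝ) : ℕ → ℝ
  | 0 => 1
  | n + 1 => (-1) ^ n / (n + 1) * ∑ i : Fin (n + 1), (-1) ^ (i : ℕ) * newton p i * p (n + 1 - i)

lemma newton_succ (p : ℕ → ℝ) (n : ℕ) :
    newton p (n + 1) = (-1) ^ n / (n + 1) * ∑ i ∈ Finset.range (n + 1), (-1) ^ i * newton p i * p (n + 1 - i) := by
  rw [newton, Finset.sum_range fun i => (-1) ^ i * newton p i * p (n + 1 - i)]

/-- Newton's identities have the recursion of `newton`. The point is that elementary symmetric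
polynomials in many small variables become fixed polynomials in the power sums, which have limits.
The value p 0 never enters. -/
lemma newton_eq_esymm {σ : Type*} [Fintype σ] [DecidableEq σ] {a : σ → ℝ} {p : ℕ → ℝ}
    (hp : ∀ j, 0 < j → ∑ m, a m ^ j = p j) (n : ℕ) :
    ∑ S ∈ Finset.powersetCard n Finset.univ, ∏ m ∈ S, a m = newton p n := by
  have he : ∀ n, ∑ S ∈ Finset.powersetCard n Finset.univ, ∏ m ∈ S, a m = MvPolynomial.aeval a (MvPolynomial.esymm σ ℝ n) := by
    intro n; simp [MvPolynomial.esymm]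
  induction n using Nat.strong_induction_on with
  | _ n ih =>
    rcases n with _ | n
    · simp [newton]
    · have h := congrArg (MvPolynomial.aeval a) (MvPolynomial.mul_esymm_eq_sum σ ℝ (n + 1))
      simp only [map_mul, map_natCast, map_pow, map_neg, map_one, map_sum] at h
      have h2 : ∑ i ∈ Finset.HasAntidiagonal.antidiagonal (n + 1) with i.1 < n + 1,
          (-1) ^ i.1 * (MvPolynomial.aeval a) (MvPolynomial.esymm σ ℝ i.1) * (MvPolynomial.aeval a) (MvPolynomial.psum σ ℝ i.2)
          = ∑ i ∈ Finset.range (n + 1), (-1) ^ i * newton p i * p (n + 1 - i) := by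
        rw [Finset.sum_filter, Finset.Nat.sum_antidiagonal_eq_sum_range_succ_mk, Finset.sum_range_succ]
        simp only [lt_irrefl, if_false, add_zero]
        refine Finset.sum_congr rfl fun i hi => ?_
        have hi' := Finset.mem_range.1 hi
        rw [if_pos hi', ← he, ih i hi', ← hp (n + 1 - i) (by omega)]
        simp [MvPolynomial.psum]
      rw [h2] at h
      rw [he, newton_succ]
      have hn : ((n : ℝ) + 1) ≠ 0 := by positivity
      push_cast at h
      field_simp
      rw [mul_comm, h]
      ring

/-- When only the first two power sums are non-zero, two terms of Newton's recursion remain, and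
multiplied by n! they form the three-term recursion of the Hermite polynomials. The generating
function is exp(xt - vt²/2). -/
lemma newton_hermite {v x : ℝ} {p : ℕ → ℝ} (h1 : p 1 = x) (h2 : p 2 = v) (h3 : ∀ j, 3 ≤ j → p j = 0) (n : ℕ) :
    n.factorial * newton p n = hp v x n := by
  have key : ∀ n, ((n + 1).factorial * newton p (n + 1) = hp v x (n + 1)) ∧ n.factorial * newton p n = hp v x n := by
    intro n
    induction n with
    | zero => simp [newton_succ, newton, hp, h1]
    | succ n ih =>
      refine ⟨?_, ih.1⟩
      rw [newton_succ, Finset.sum_range_succ, Finset.sum_range_succ, Finset.sum_eq_zero, hp, ← ih.1, ← ih.2]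
      · rw [show n + 1 + 1 - n = 2 by omega, show n + 1 + 1 - (n + 1) = 1 by omega, h1, h2,
          Nat.factorial_succ (n + 1), Nat.factorial_succ n]
        have e : ((-1 : ℝ) ^ n) * (-1) ^ n = 1 := by rw [← mul_pow]; simp
        have hn : ((n : ℝ) + 1 + 1) ≠ 0 := by positivity
        push_cast
        field_simp
        rw [pow_succ]
        linear_combination (v * newton p n * (-1) + newton p (n + 1) * x) * e
      · intro i hi
        have := Finset.mem_range.1 hi
        rw [h3 _ (by omega), mul_zero]
  exact (key n).2

/-- A single term of the recursion remains; the generating function is exp(ct). -/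
lemma newton_pow {c : ℝ} {p : ℕ → ℝ} (h1 : p 1 = c) (h2 : ∀ j, 2 ≤ j → p j = 0) (n : ℕ) :
    n.factorial * newton p n = c ^ n := by
  induction n with
  | zero => simp [newton]
  | succ n ih =>
    rw [newton_succ, Finset.sum_range_succ, Finset.sum_eq_zero, pow_succ, ← ih]
    · rw [show n + 1 - n = 1 by omega, h1, Nat.factorial_succ n]
      have e : ((-1 : ℝ) ^ n) * (-1) ^ n = 1 := by rw [← mul_pow]; simp
      have hn : ((n : ℝ) + 1) ≠ 0 := by positivity
      push_cast
      field_simp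
      linear_combination (newton p n * c) * e
    · intro i hi
      have := Finset.mem_range.1 hi
      rw [h2 _ (by omega), mul_zero]

lemma continuous_newton {Y : Type*} [TopologicalSpace Y] {p : Y → ℕ → ℝ} (hp : ∀ j, Continuous fun y => p y j)
    (n : ℕ) : Continuous fun y => newton (p y) n := by
  induction n using Nat.strong_induction_on with
  | _ n ih =>
    rcases n with _ | n
    · simp only [newton]; exact continuous_const
    · simp only [newton_succ]
      refine continuous_const.mul (continuous_finsetSum _ fun i hi => ?_)
      exact (continuous_const.mul (ih i (Finset.mem_range.1 hi))).mul (hp _)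

lemma continuous_hp (n : ℕ) : Continuous fun q : ℝ × ℝ => hp q.1 q.2 n := by
  have key : ∀ n, Continuous (fun q : ℝ × ℝ => hp q.1 q.2 n) ∧ Continuous fun q : ℝ × ℝ => hp q.1 q.2 (n + 1) := by
    intro n
    induction n with
    | zero => simp only [hp]; exact ⟨continuous_const, continuous_snd⟩
    | succ n ih =>
      refine ⟨ih.2, ?_⟩
      simp only [hp]
      exact (continuous_snd.mul ih.2).sub ((continuous_const.mul continuous_fst).mul ih.1)
  exact (key n).1

/-! ### Random signs converge to Gaussian variables -/

section Signs

variable {ι : Type*} [Fintype ι] [DecidableEq ι]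

/-- The normalized sums of signs at the vertex `T` of a cube, and the normalization. -/
noncomputable def signVector (N : ℕ) (T : Finset (ι × Fin (N + 1))) : EuclideanSpace ℝ (Option ι) :=
  -- The coordinate `none` carries the mesh (N+1)^{-1/2}. The power sums are then one continuous
  -- function of the vector, the same for all N, and the limit is its value at mesh 0.
  WithLp.toLp 2 fun o => o.elim (√(N + 1 : ℝ))⁻¹
    fun i => (√(N + 1 : ℝ))⁻¹ * ∑ l, if (i, l) ∈ T then (1 : ℝ) else -1

/-- The law of the normalized sums of independent signs. -/
noncomputable def signLaw (ι : Type*) [Fintype ι] [DecidableEq ι] (N : ℕ) : Measure (EuclideanSpace ℝ (Option ι)) :=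
  ∑ T : Finset (ι × Fin (N + 1)), ((2 : ℝ≥0) ^ Fintype.card (ι × Fin (N + 1)))⁻¹ • Measure.dirac (signVector N T)

instance (N : ℕ) : IsProbabilityMeasure (signLaw ι N) := by
  constructor
  simp only [signLaw, Measure.coe_finsetSum, Finset.sum_apply, Measure.smul_apply,
    measure_univ, Finset.sum_const, Finset.card_univ, Fintype.card_finset]
  rw [nsmul_eq_mul, ENNReal.smul_def, smul_eq_mul, mul_one, ENNReal.coe_inv (by positivity)]
  push_cast
  exact ENNReal.mul_inv_cancel (by simp) (by simp)

lemma lintegral_signLaw (N : ℕ) (f : EuclideanSpace ℝ (Option ι) → ℝ) (hf : ∀ x, 0 ≤ f x) :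
    ∫⁻ x, ENNReal.ofReal (f x) ∂(signLaw ι N)
      = ENNReal.ofReal ((∑ T : Finset (ι × Fin (N + 1)), f (signVector N T)) / 2 ^ Fintype.card (ι × Fin (N + 1))) := by
  rw [signLaw, lintegral_finsetSum_measure, Finset.sum_div, ENNReal.ofReal_sum_of_nonneg fun T _ => by
    have := hf (signVector N T); positivity]
  refine Finset.sum_congr rfl fun T _ => ?_
  rw [lintegral_smul_measure, lintegral_dirac, ENNReal.smul_def, smul_eq_mul, div_eq_inv_mul,
    ENNReal.ofReal_mul (by positivity)]
  congr 1
  rw [ENNReal.ofReal, Real.toNNReal_inv, Real.toNNReal_pow (by norm_num)]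
  simp

lemma integral_signLaw (N : ℕ) (f : EuclideanSpace ℝ (Option ι) → ℂ) :
    ∫ x, f x ∂(signLaw ι N)
      = (∑ T : Finset (ι × Fin (N + 1)), f (signVector N T)) / 2 ^ Fintype.card (ι × Fin (N + 1)) := by
  rw [signLaw, integral_finsetSum_measure fun T _ => (integrable_dirac (by simp)).smul_measure_nnreal, Finset.sum_div]
  refine Finset.sum_congr rfl fun T _ => ?_
  rw [integral_smul_nnreal_measure, integral_dirac, NNReal.smul_def, div_eq_inv_mul]
  simp

/-- The cosine is the characteristic function of a fair sign, so this is the central limit theorem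
for signs. -/
lemma tendsto_cos_pow (t : ℝ) :
    Tendsto (fun N : ℕ => Complex.cos ((√(N : ℝ))⁻¹ * t : ℝ) ^ N) atTop (𝓝 (Complex.exp (-t ^ 2 / 2))) := by
  set P : Measure ℝ := (2 : ℝ≥0)⁻¹ • Measure.dirac 1 + (2 : ℝ≥0)⁻¹ • Measure.dirac (-1) with hP
  have hint : ∀ f : ℝ → ℝ, ∫ x, f x ∂P = (f 1 + f (-1)) / 2 := by
    intro f
    rw [hP, integral_add_measure (integrable_dirac (by simp)).smul_measure_nnreal
      (integrable_dirac (by simp)).smul_measure_nnreal, integral_smul_nnreal_measure,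
      integral_smul_nnreal_measure, integral_dirac, integral_dirac, NNReal.smul_def, NNReal.smul_def]
    push_cast
    simp only [smul_eq_mul]
    ring
  have hintc : ∀ f : ℝ → ℂ, ∫ x, f x ∂P = (f 1 + f (-1)) / 2 := by
    intro f
    rw [hP, integral_add_measure (integrable_dirac (by simp)).smul_measure_nnreal
      (integrable_dirac (by simp)).smul_measure_nnreal, integral_smul_nnreal_measure,
      integral_smul_nnreal_measure, integral_dirac, integral_dirac, NNReal.smul_def, NNReal.smul_def]
    push_cast
    simp only [Complex.real_smul]
    push_cast
    ring
  have : IsProbabilityMeasure P := by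
    constructor
    simp only [hP, Measure.add_apply, Measure.smul_apply, measure_univ, ENNReal.smul_def, smul_eq_mul, mul_one]
    rw [ENNReal.coe_inv (by norm_num)]
    exact ENNReal.inv_two_add_inv_two
  have h := tendsto_charFun_inv_sqrt_mul_pow (P := P) (X := id) aemeasurable_id (by rw [hint]; simp)
    (by rw [hint]; simp) t
  refine h.congr fun N => ?_
  rw [Measure.map_id, charFun_apply_real, hintc, Complex.cos]
  congr 3
  · push_cast; ring_nf
  · push_cast; ring_nf

lemma sum_prod_ite {σ : Type*} [Fintype σ] [DecidableEq σ] (f g : σ → ℂ) :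
    ∑ T : Finset σ, ∏ m, (if m ∈ T then f m else g m) = ∏ m, (f m + g m) := by
  rw [Finset.prod_add, Finset.powerset_univ]
  refine Finset.sum_congr rfl fun T _ => ?_
  rw [Finset.prod_ite]
  congr 1
  · congr 1; ext; simp
  · congr 1; ext; simp

/-- The signs are independent, so the characteristic function factors over the pairs (i, l); the
coordinate `none` is deterministic and contributes a phase. -/
lemma charFun_signLaw (N : ℕ) (t : EuclideanSpace ℝ (Option ι)) :
    charFun (signLaw ι N) t = Complex.exp (((√(N + 1 : ℝ))⁻¹ * t none : ℝ) * Complex.I)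
      * ∏ i, Complex.cos ((√(N + 1 : ℝ))⁻¹ * t (some i) : ℝ) ^ (N + 1) := by
  rw [charFun_apply, integral_signLaw]
  set η := (√(N + 1 : ℝ))⁻¹ with hη
  have h1 : ∀ T : Finset (ι × Fin (N + 1)), Complex.exp ((inner ℝ (signVector N T) t : ℝ) * Complex.I)
      = Complex.exp ((η * t none : ℝ) * Complex.I) * ∏ m : ι × Fin (N + 1),
        (if m ∈ T then Complex.exp ((η * t (some m.1) : ℝ) * Complex.I)
          else Complex.exp (-(η * t (some m.1) : ℝ) * Complex.I)) := by
    intro T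
    have e : ∀ m : ι × Fin (N + 1), (if m ∈ T then Complex.exp ((η * t (some m.1) : ℝ) * Complex.I)
          else Complex.exp (-(η * t (some m.1) : ℝ) * Complex.I))
        = Complex.exp ((η * t (some m.1) * (if m ∈ T then 1 else -1) : ℝ) * Complex.I) := by
      intro m; split_ifs <;> simp
    simp only [e]
    rw [← Complex.exp_sum, ← Complex.exp_add]
    congr 1
    rw [← Finset.sum_mul, ← add_mul, ← Complex.ofReal_sum, ← Complex.ofReal_add]
    congr 2
    rw [PiLp.inner_apply, Fintype.sum_option, Fintype.sum_prod_type]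
    simp only [signVector, Option.elim, ← hη, RCLike.inner_apply, conj_trivial]
    congr 1
    · ring
    · refine Finset.sum_congr rfl fun i _ => ?_
      rw [Finset.mul_sum, Finset.mul_sum]
      refine Finset.sum_congr rfl fun l _ => by ring
  simp only [h1]
  rw [← Finset.mul_sum, sum_prod_ite, mul_div_assoc, Fintype.prod_prod_type]
  congr 1
  have h2 : ∀ i : ι, (∏ _l : Fin (N + 1), (Complex.exp ((η * t (some i) : ℝ) * Complex.I)
      + Complex.exp (-(η * t (some i) : ℝ) * Complex.I))) = 2 ^ (N + 1) * Complex.cos ((η * t (some i) : ℝ)) ^ (N + 1) := by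
    intro i
    rw [Finset.prod_const, Finset.card_univ, Fintype.card_fin, ← mul_pow, Complex.two_cos]
  simp only [h2]
  rw [Finset.prod_mul_distrib, Finset.prod_const, Finset.card_univ, ← pow_mul, Fintype.card_prod, Fintype.card_fin,
    mul_comm (Fintype.card ι)]
  field_simp

variable {Ω : Type*} [MeasurableSpace Ω] {μ : Measure Ω}

/-- Independent standard Gaussian variables, characterized by the laws of their linear combinations. -/
structure IsStdGaussian {κ : Type*} (ξ : κ → Ω → ℝ) (μ : Measure Ω) : Prop where
  measurable : ∀ k, Measurable (ξ k)
  map_sum : ∀ (F : Finset κ) (t : κ → ℝ), μ.map (fun ω => ∑ k ∈ F, t k * ξ k ω)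
    = gaussianReal 0 (∑ k ∈ F, t k ^ 2).toNNReal

/-- The limit of the normalized sums of signs. -/
noncomputable def gaussVector (ξ : ι → Ω → ℝ) (ω : Ω) : EuclideanSpace ℝ (Option ι) :=
  WithLp.toLp 2 fun o => o.elim 0 fun i => ξ i ω

lemma measurable_gaussVector {ξ : ι → Ω → ℝ} (hξ : IsStdGaussian ξ μ) : Measurable (gaussVector ξ) := by
  refine (WithLp.measurable_toLp 2 _).comp (measurable_pi_lambda _ fun o => ?_)
  cases o with
  | none => exact measurable_const
  | some i => exact hξ.measurable i

lemma charFun_gaussVector {ξ : ι → Ω → ℝ} (hξ : IsStdGaussian ξ μ) (t : EuclideanSpace ℝ (Option ι)) :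
    charFun (μ.map (gaussVector ξ)) t = ∏ i, Complex.exp (-(t (some i) : ℂ) ^ 2 / 2) := by
  rw [charFun_apply, integral_map (measurable_gaussVector hξ).aemeasurable (by fun_prop)]
  have h := congrArg (fun ν => charFun ν 1) (hξ.map_sum Finset.univ fun i => t (some i))
  simp only at h
  have hm : Measurable fun ω => ∑ i, t (some i) * ξ i ω :=
    Finset.measurable_fun_sum _ fun i _ => (hξ.measurable i).const_mul _
  rw [charFun_apply_real, integral_map hm.aemeasurable (by fun_prop), charFun_gaussianReal] at h
  rw [← Complex.exp_sum]
  convert h using 3 with ω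
  · simp [PiLp.inner_apply, Fintype.sum_option, gaussVector]
  · rw [Real.coe_toNNReal _ (Finset.sum_nonneg fun _ _ => sq_nonneg _)]
    push_cast
    rw [← Finset.sum_div, Finset.sum_neg_distrib]
    ring

/-- `signLaw` as a probability measure. -/
noncomputable def signProb (ι : Type*) [Fintype ι] [DecidableEq ι] (N : ℕ) :
    ProbabilityMeasure (EuclideanSpace ℝ (Option ι)) := ⟨signLaw ι N, inferInstance⟩

/-- The law of `gaussVector` as a probability measure. -/
noncomputable def gaussProb [IsProbabilityMeasure μ] {ξ : ι → Ω → ℝ} (hξ : IsStdGaussian ξ μ) :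
    ProbabilityMeasure (EuclideanSpace ℝ (Option ι)) :=
  ⟨μ.map (gaussVector ξ), Measure.isProbabilityMeasure_map (measurable_gaussVector hξ).aemeasurable⟩

/-- Lévy's continuity theorem: the phase of the mesh tends to 1 and every other factor is governed
by `tendsto_cos_pow`. -/
lemma tendsto_signProb [IsProbabilityMeasure μ] {ξ : ι → Ω → ℝ} (hξ : IsStdGaussian ξ μ) :
    Tendsto (signProb ι) atTop (𝓝 (gaussProb hξ)) := by
  refine ProbabilityMeasure.tendsto_of_tendsto_charFun fun t => ?_
  simp only [signProb, gaussProb, ProbabilityMeasure.coe_mk, charFun_signLaw, charFun_gaussVector hξ]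
  have h0 : Tendsto (fun N : ℕ => Complex.exp (((√(N + 1 : ℝ))⁻¹ * t none : ℝ) * Complex.I)) atTop (𝓝 1) := by
    have h1 : Tendsto (fun N : ℕ => ((√(N : ℝ))⁻¹ * t none)) atTop (𝓝 (0 * t none)) :=
      (tendsto_inv_atTop_zero.comp (Real.tendsto_sqrt_atTop.comp tendsto_natCast_atTop_atTop)).mul_const _
    have h2 := (h1.comp (tendsto_add_atTop_nat 1))
    have h3 : Continuous fun x : ℝ => Complex.exp (x * Complex.I) := by fun_prop
    have h4 := (h3.tendsto (0 * t none)).comp h2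
    simpa [Function.comp_def] using h4
  rw [← one_mul (∏ i, _)]
  refine h0.mul (tendsto_finsetProd _ fun i _ => ?_)
  have := (tendsto_cos_pow (t (some i))).comp (tendsto_add_atTop_nat 1)
  simpa [Function.comp_def] using this

end Signs

end WickExp

namespace WickExp

/-! ### Hypercontractivity for Gaussian variables -/

lemma sum_ite_card_lt {σ : Type*} [Fintype σ] [DecidableEq σ] (m : ℕ) (g : Finset σ → ℝ) :
    ∑ S ∈ (Finset.univ : Finset σ).powerset, (if S.card < m then g S else 0)
      = ∑ n ∈ Finset.range m, ∑ S ∈ Finset.powersetCard n Finset.univ, g S := by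
  have h : ∀ n, ∑ S ∈ Finset.powersetCard n (Finset.univ : Finset σ), g S
      = ∑ S ∈ (Finset.univ : Finset σ).powerset, if S.card = n then g S else 0 := by
    intro n
    rw [← Finset.sum_filter, Finset.powersetCard_eq_filter]
  simp only [h]
  rw [Finset.sum_comm]
  refine Finset.sum_congr rfl fun S _ => ?_
  rw [Finset.sum_ite_eq]
  simp

section Hyper

variable {ι : Type*} [Fintype ι] {X : Type*} [TopologicalSpace X] [CompactSpace X] [MeasurableSpace X]
  [BorelSpace X] {ν : Measure X} {φ : X → ℝ}

open Classical in
/-- The power sums of the variables `e_i(x) ε_{i,l} / √N`, in terms of `signVector`. -/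
noncomputable def powerSums (e : ι → C(X, ℝ)) (s : EuclideanSpace ℝ (Option ι)) (x : X) (j : ℕ) : ℝ :=
  -- An even power of a sign is 1, and N + 1 = η^{-2} equal terms lower the exponent of the mesh η
  -- to j - 2; for odd j one factor η is already inside `s (some i)`. For j = 1, 2 the exponent is
  -- 0, so these two power sums survive at mesh 0 while the later ones vanish. The value at j = 0 is
  -- never used.
  if Even j then s none ^ (j - 2) * ∑ i, e i x ^ j else s none ^ (j - 1) * ∑ i, e i x ^ j * s (some i)

lemma continuous_powerSums (e : ι → C(X, ℝ)) (j : ℕ) :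
    Continuous fun q : EuclideanSpace ℝ (Option ι) × X => powerSums e q.1 q.2 j := by
  unfold powerSums
  split_ifs <;> fun_prop

/-- The truncated chaos expansion as a function of `signVector`. -/
noncomputable def chaosSum (e : ι → C(X, ℝ)) (w : ℕ → ℝ) (m : ℕ) : C(EuclideanSpace ℝ (Option ι) × X, ℝ) where
  toFun q := ∑ n ∈ Finset.range m, w n * (n.factorial * newton (powerSums e q.1 q.2) n)
  continuous_toFun := continuous_finsetSum _ fun n _ =>
    continuous_const.mul (continuous_const.mul (continuous_newton (continuous_powerSums e) n))

/-- The truncated covariance expansion. -/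
noncomputable def covSum (e : ι → C(X, ℝ)) (w : ℕ → ℝ) (m : ℕ) (p : ℝ) : C(ℝ × (X × X), ℝ) where
  -- The variable `q.1` is the mesh η. The power sums are those of the products (η e_i(x)) (η
  -- e_i(y)), each occurring N + 1 = η^{-2} times; at η = 0 only the first one remains.
  toFun q := ∑ n ∈ Finset.range m, (w n * n.factorial) ^ 2 * (p - 1) ^ n *
    newton (fun j => q.1 ^ (2 * j - 2) * ∑ i, (e i q.2.1 * e i q.2.2) ^ j) n
  continuous_toFun := continuous_finsetSum _ fun n _ =>
    continuous_const.mul (continuous_newton (fun j => by fun_prop) n)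

variable [SecondCountableTopology X] [SFinite ν]

/-- With finitely many signs the integrated chaos sum is a multilinear polynomial on the cube.
`cube_hypercontractive` bounds its L^p norm by the ℓ² norm of its rescaled coefficients, and that
sum of squares is the covariance expansion integrated against φ ⊗ φ. -/
lemma lintegral_signLaw_chaosSum_le [DecidableEq ι] (e : ι → C(X, ℝ)) (hφ : Integrable φ ν) {p : ℝ} (hp : 2 ≤ p)
    (w : ℕ → ℝ) (m N : ℕ) :
    ∫⁻ s, ENNReal.ofReal (|wint hφ ((chaosSum e w m).curry s)| ^ p) ∂(signLaw ι N)
      ≤ ENNReal.ofReal ((wint (hφ.mul_prod hφ) ((covSum e w m p).curry (√(N + 1 : ℝ))⁻¹)) ^ (p / 2)) := by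
  set η : ℝ := (√(N + 1 : ℝ))⁻¹ with hη
  have hη2 : η ^ 2 * (N + 1) = 1 := by
    rw [hη, inv_pow, Real.sq_sqrt (by positivity)]
    exact inv_mul_cancel₀ (by positivity)
  set ρ : ℝ := (√(p - 1))⁻¹ with hρ
  have hρ2 : ρ ^ 2 * (p - 1) = 1 := by
    rw [hρ, inv_pow, Real.sq_sqrt (by linarith)]
    exact inv_mul_cancel₀ (by linarith)
  have hρ0 : ρ ≠ 0 := fun h => by rw [h] at hρ2; norm_num at hρ2
  set f : Finset (ι × Fin (N + 1)) → C(X, ℝ) := fun S => ∏ k ∈ S, η • e k.1 with hf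
  have hfx : ∀ S x, f S x = ∏ k ∈ S, η * e k.1 x := by
    intro S x; rw [hf, ContinuousMap.coe_prod, Finset.prod_apply]; rfl
  -- The factor ρ^{-|S|} undoes the damping in the cube inequality; its square is (p-1)^{|S|}.
  set c : Finset (ι × Fin (N + 1)) → ℝ := fun S =>
    if S.card < m then (ρ⁻¹) ^ S.card * (w S.card * S.card.factorial) * wint hφ (f S) else 0 with hc
  -- For |S| = n the products of the variables η e_i(x) ε_{i,l} over S add up to an elementary
  -- symmetric polynomial, hence to `newton` of the power sums.
  have claim1 : ∀ T, wint hφ ((chaosSum e w m).curry (signVector N T))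
      = ∑ S ∈ (Finset.univ : Finset (ι × Fin (N + 1))).powerset, ρ ^ S.card * c S * walsh T S := by
    intro T
    have h1 : (chaosSum e w m).curry (signVector N T) = ∑ n ∈ Finset.range m,
        ∑ S ∈ Finset.powersetCard n Finset.univ, (w S.card * S.card.factorial * walsh T S) • f S := by
      ext x
      rw [ContinuousMap.coe_sum, Finset.sum_apply]
      change ∑ n ∈ Finset.range m, _ = _
      refine Finset.sum_congr rfl fun n _ => ?_
      rw [ContinuousMap.coe_sum, Finset.sum_apply, ← newton_eq_esymm
        (a := fun k : ι × Fin (N + 1) => η * e k.1 x * if k ∈ T then 1 else -1), Finset.mul_sum, Finset.mul_sum]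
      · refine Finset.sum_congr rfl fun S hS => ?_
        rw [ContinuousMap.smul_apply, hfx, (Finset.mem_powersetCard.1 hS).2, Finset.prod_mul_distrib, walsh, smul_eq_mul]
        ring
      · intro j hj
        rw [Fintype.sum_prod_type]
        simp only [mul_pow, ← Finset.mul_sum, powerSums]
        split_ifs with hev
        · have hs : ∀ k, (if k ∈ T then (1 : ℝ) else -1) ^ j = 1 := by
            intro k; split_ifs
            · exact one_pow _
            · rw [hev.neg_pow, one_pow]
          simp only [hs, Finset.sum_const, Finset.card_univ, Fintype.card_fin,
            nsmul_eq_mul, mul_one, signVector, Option.elim, ← hη]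
          obtain ⟨k, rfl⟩ : ∃ k, j = k + 2 := ⟨j - 2, by rcases hev with ⟨r, hr⟩; omega⟩
          rw [Nat.add_sub_cancel, Finset.mul_sum]
          refine Finset.sum_congr rfl fun i _ => ?_
          push_cast
          rw [pow_add η]
          linear_combination (η ^ k * e i x ^ (k + 2)) * hη2
        · have hodd := Nat.not_even_iff_odd.1 hev
          have hs : ∀ k, (if k ∈ T then (1 : ℝ) else -1) ^ j = if k ∈ T then 1 else -1 := by
            intro k; split_ifs
            · exact one_pow _
            · rw [hodd.neg_pow, one_pow]
          simp only [hs, signVector, Option.elim, ← hη]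
          rw [Finset.mul_sum]
          refine Finset.sum_congr rfl fun i _ => ?_
          obtain ⟨k, rfl⟩ : ∃ k, j = k + 1 := ⟨j - 1, by omega⟩
          rw [Nat.add_sub_cancel, pow_succ]
          ring
    rw [h1, map_sum]
    have h2 : ∀ S : Finset (ι × Fin (N + 1)), ρ ^ S.card * c S * walsh T S
        = if S.card < m then w S.card * S.card.factorial * walsh T S * wint hφ (f S) else 0 := by
      intro S
      rw [hc]
      simp only
      split_ifs
      · have : ρ ^ S.card * ρ⁻¹ ^ S.card = 1 := by rw [← mul_pow, mul_inv_cancel₀ hρ0, one_pow]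
        linear_combination (w S.card * S.card.factorial * walsh T S * wint hφ (f S)) * this
      · ring
    simp only [h2]
    rw [sum_ite_card_lt]
    refine Finset.sum_congr rfl fun n _ => ?_
    rw [map_sum]
    refine Finset.sum_congr rfl fun S _ => ?_
    rw [map_smul, smul_eq_mul]
  -- The square of an integral is a double integral, so the squared coefficients add up to
  -- elementary symmetric polynomials in the products η² e_i(x) e_i(y).
  have claim2 : ∑ S ∈ (Finset.univ : Finset (ι × Fin (N + 1))).powerset, c S ^ 2
      = wint (hφ.mul_prod hφ) ((covSum e w m p).curry η) := by
    have hsq : ∀ S, wint hφ (f S) ^ 2 = wint (hφ.mul_prod hφ)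
        (((f S).comp ⟨Prod.fst, continuous_fst⟩) * ((f S).comp ⟨Prod.snd, continuous_snd⟩)) := by
      intro S
      rw [sq, wint_apply, wint_apply, ← integral_prod_mul]
      congr 1
      funext q
      simp only [ContinuousMap.mul_apply, ContinuousMap.comp_apply, ContinuousMap.coe_mk]
      ring
    have h1 : (covSum e w m p).curry η = ∑ n ∈ Finset.range m, ∑ S ∈ Finset.powersetCard n Finset.univ,
        ((w S.card * S.card.factorial) ^ 2 * (p - 1) ^ S.card) •
          (((f S).comp ⟨Prod.fst, continuous_fst⟩) * ((f S).comp ⟨Prod.snd, continuous_snd⟩) : C(X × X, ℝ)) := by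
      ext q
      rw [ContinuousMap.coe_sum, Finset.sum_apply]
      change ∑ n ∈ Finset.range m, _ = _
      refine Finset.sum_congr rfl fun n _ => ?_
      rw [ContinuousMap.coe_sum, Finset.sum_apply, ← newton_eq_esymm
        (a := fun k : ι × Fin (N + 1) => (η * e k.1 q.1) * (η * e k.1 q.2)), Finset.mul_sum]
      · refine Finset.sum_congr rfl fun S hS => ?_
        rw [ContinuousMap.smul_apply, ContinuousMap.mul_apply, ContinuousMap.comp_apply, ContinuousMap.comp_apply,
          hfx, hfx, (Finset.mem_powersetCard.1 hS).2, Finset.prod_mul_distrib, smul_eq_mul]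
        rfl
      · intro j hj
        rw [Fintype.sum_prod_type, Finset.mul_sum]
        refine Finset.sum_congr rfl fun i _ => ?_
        dsimp only
        rw [Finset.sum_const, Finset.card_univ, Fintype.card_fin, nsmul_eq_mul]
        obtain ⟨k, rfl⟩ : ∃ k, j = k + 1 := ⟨j - 1, by omega⟩
        rw [show 2 * (k + 1) - 2 = 2 * k by omega]
        push_cast
        have e1 : (η * e i q.1 * (η * e i q.2)) ^ (k + 1) = η ^ (2 * k) * η ^ 2 * (e i q.1 * e i q.2) ^ (k + 1) := by
          rw [← pow_add, show 2 * k + 2 = 2 * (k + 1) by ring, pow_mul, ← mul_pow]; ring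
        simp only [e1]
        linear_combination (η ^ (2 * k) * (e i q.1 * e i q.2) ^ (k + 1)) * hη2
    rw [h1, map_sum]
    have h2 : ∀ S : Finset (ι × Fin (N + 1)), c S ^ 2
        = if S.card < m then (w S.card * S.card.factorial) ^ 2 * (p - 1) ^ S.card * wint hφ (f S) ^ 2 else 0 := by
      intro S
      rw [hc]
      simp only
      split_ifs
      · have : (ρ⁻¹ ^ S.card) ^ 2 = (p - 1) ^ S.card := by
          rw [← pow_mul, mul_comm, pow_mul, hρ, inv_inv, Real.sq_sqrt (by linarith)]
        rw [mul_pow, mul_pow, this]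
        ring
      · ring
    simp only [h2]
    rw [sum_ite_card_lt]
    refine Finset.sum_congr rfl fun n _ => ?_
    rw [map_sum]
    refine Finset.sum_congr rfl fun S _ => ?_
    rw [map_smul, smul_eq_mul, hsq]
  rw [lintegral_signLaw _ _ fun s => by positivity]
  apply ENNReal.ofReal_le_ofReal
  rw [← claim2]
  simp only [claim1]
  have := cube_hypercontractive hp hρ2 (Finset.univ : Finset (ι × Fin (N + 1))) c
  rw [Finset.powerset_univ, Finset.card_univ] at this
  rw [Finset.powerset_univ]
  exact this

variable {Ω : Type*} [MeasurableSpace Ω] {μ : Measure Ω}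

/-- A Gaussian vector sits at mesh 0, where the power sums from the third on vanish and
`newton_hermite` applies. -/
lemma wint_chaosSum (e : ι → C(X, ℝ)) (hφ : Integrable φ ν) (w : ℕ → ℝ) (m : ℕ) (ξ : ι → Ω → ℝ) (ω : Ω) :
    wint hφ ((chaosSum e w m).curry (gaussVector ξ ω))
      = ∫ x, (∑ n ∈ Finset.range m, w n * hp (∑ i, e i x ^ 2) (∑ i, e i x * ξ i ω) n) * φ x ∂ν := by
  rw [wint_apply]
  refine integral_congr_ae (Eventually.of_forall fun x => ?_)
  change (∑ n ∈ Finset.range m, w n * (n.factorial * newton (powerSums e (gaussVector ξ ω) x) n)) * φ x = _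
  dsimp only
  congr 1
  refine Finset.sum_congr rfl fun n _ => ?_
  congr 1
  refine newton_hermite ?_ ?_ ?_ n
  · simp [powerSums, gaussVector]
  · simp [powerSums]
  · intro j hj
    have h1 : j - 1 ≠ 0 := by omega
    have h2 : j - 2 ≠ 0 := by omega
    simp [powerSums, gaussVector, h1, h2]

/-- At mesh 0 only the covariance itself is left among the power sums, so `newton_pow` applies. -/
lemma wint_covSum (e : ι → C(X, ℝ)) (hφ : Integrable φ ν) (w : ℕ → ℝ) (m : ℕ) (p : ℝ) :
    wint (hφ.mul_prod hφ) ((covSum e w m p).curry 0) = ∫ q, (∑ n ∈ Finset.range m, w n ^ 2 * n.factorial * (p - 1) ^ n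
          * (∑ i, e i q.1 * e i q.2) ^ n) * (φ q.1 * φ q.2) ∂(ν.prod ν) := by
  rw [wint_apply]
  refine integral_congr_ae (Eventually.of_forall fun q => ?_)
  change (∑ n ∈ Finset.range m, (w n * n.factorial) ^ 2 * (p - 1) ^ n *
    newton (fun j => (0 : ℝ) ^ (2 * j - 2) * ∑ i, (e i q.1 * e i q.2) ^ j) n) * (φ q.1 * φ q.2) = _
  dsimp only
  congr 1
  refine Finset.sum_congr rfl fun n _ => ?_
  rw [← newton_pow (p := fun j => (0 : ℝ) ^ (2 * j - 2) * ∑ i, (e i q.1 * e i q.2) ^ j) (c := ∑ i, e i q.1 * e i q.2)]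
  · ring
  · simp
  · intro j hj
    have : 2 * j - 2 ≠ 0 := by omega
    simp [this]

/-- The function Ψ may be unbounded, so weak convergence does not give convergence of the integrals.
An upper bound needs only lower semicontinuity, which the portmanteau inequality for open sets
provides. -/
lemma lintegral_gaussVector_le [DecidableEq ι] [IsProbabilityMeasure μ] {ξ : ι → Ω → ℝ} (hξ : IsStdGaussian ξ μ)
    {Ψ : EuclideanSpace ℝ (Option ι) → ℝ} (hΨ : Continuous Ψ) (h0 : 0 ≤ Ψ) {b : ℕ → ℝ≥0∞} {B : ℝ≥0∞}
    (hb : ∀ N, ∫⁻ s, ENNReal.ofReal (Ψ s) ∂(signLaw ι N) ≤ b N) (hB : Tendsto b atTop (𝓝 B)) :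
    ∫⁻ ω, ENNReal.ofReal (Ψ (gaussVector ξ ω)) ∂μ ≤ B := by
  have hlim := lintegral_le_liminf_lintegral_of_forall_isOpen_measure_le_liminf_measure (f := Ψ)
    (μ := μ.map (gaussVector ξ)) (μs := signLaw ι) hΨ h0
    (fun G hG => ProbabilityMeasure.le_liminf_measure_open_of_tendsto (tendsto_signProb hξ) hG)
  rw [lintegral_map (by fun_prop) (measurable_gaussVector hξ)] at hlim
  rw [← hB.liminf_eq]
  exact hlim.trans (liminf_le_liminf (Eventually.of_forall hb))

/-- Nelson's hypercontractivity for finite chaos expansions. -/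
theorem gauss_hypercontractive [IsProbabilityMeasure μ] {ξ : ι → Ω → ℝ} (hξ : IsStdGaussian ξ μ)
    (e : ι → C(X, ℝ)) (hφ : Integrable φ ν) {p : ℝ} (hp2 : 2 ≤ p) (w : ℕ → ℝ) (m : ℕ) :
    ∫⁻ ω, ENNReal.ofReal (|∫ x, (∑ n ∈ Finset.range m, w n * hp (∑ i, e i x ^ 2) (∑ i, e i x * ξ i ω) n) * φ x ∂ν| ^ p) ∂μ
      ≤ ENNReal.ofReal ((∫ q, (∑ n ∈ Finset.range m, w n ^ 2 * n.factorial * (p - 1) ^ n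
          * (∑ i, e i q.1 * e i q.2) ^ n) * (φ q.1 * φ q.2) ∂(ν.prod ν)) ^ (p / 2)) := by
  classical
  have hΨc : Continuous fun s => |wint hφ ((chaosSum e w m).curry s)| ^ p :=
    ((wint hφ).continuous.comp (chaosSum e w m).curry.continuous).abs.rpow_const
      fun _ => Or.inr (by linarith)
  have hQc : Continuous fun η : ℝ => ENNReal.ofReal ((wint (hφ.mul_prod hφ) ((covSum e w m p).curry η)) ^ (p / 2)) :=
    ENNReal.continuous_ofReal.comp (((wint (hφ.mul_prod hφ)).continuous.comp
      (covSum e w m p).curry.continuous).rpow_const fun _ => Or.inr (by linarith))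
  have hη : Tendsto (fun N : ℕ => (√(N + 1 : ℝ))⁻¹) atTop (𝓝 0) := by
    have := (tendsto_inv_atTop_zero.comp (Real.tendsto_sqrt_atTop.comp tendsto_natCast_atTop_atTop)).comp
      (tendsto_add_atTop_nat 1)
    simpa [Function.comp_def] using this
  have h := lintegral_gaussVector_le hξ hΨc (fun s => Real.rpow_nonneg (abs_nonneg _) _)
    (fun N => lintegral_signLaw_chaosSum_le e hφ hp2 w m N) ((hQc.tendsto 0).comp hη)
  rw [wint_covSum e hφ] at h
  simpa only [wint_chaosSum] using h

end Hyper

end WickExp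

namespace WickExp

/-! ### Gaussian integration by parts and moments -/

/-- Continuous functions of at most exponential growth. -/
def ExpBdd (f : ℝ → ℝ) : Prop := Continuous f ∧ ∃ A B : ℝ, 0 ≤ A ∧ 0 ≤ B ∧ ∀ x, |f x| ≤ A * Real.exp (B * |x|)

namespace ExpBdd

variable {f g : ℝ → ℝ}

lemma const (c : ℝ) : ExpBdd fun _ => c :=
  ⟨continuous_const, |c|, 0, abs_nonneg _, le_rfl, fun x => by simp⟩

lemma id : ExpBdd fun x => x :=
  ⟨continuous_id, 1, 1, zero_le_one, zero_le_one, fun x => by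
    have := Real.add_one_le_exp |x|
    simp only [one_mul]; linarith⟩

lemma mul (hf : ExpBdd f) (hg : ExpBdd g) : ExpBdd fun x => f x * g x := by
  obtain ⟨hf, A, B, hA, hB, h⟩ := hf
  obtain ⟨hg, A', B', hA', hB', h'⟩ := hg
  refine ⟨hf.mul hg, A * A', B + B', by positivity, by positivity, fun x => ?_⟩
  rw [abs_mul, add_mul, Real.exp_add]
  calc |f x| * |g x| ≤ (A * Real.exp (B * |x|)) * (A' * Real.exp (B' * |x|)) := by
        gcongr
        · exact h x
        · exact h' x
    _ = _ := by ring

lemma add (hf : ExpBdd f) (hg : ExpBdd g) : ExpBdd fun x => f x + g x := by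
  obtain ⟨hf, A, B, hA, hB, h⟩ := hf
  obtain ⟨hg, A', B', hA', hB', h'⟩ := hg
  refine ⟨hf.add hg, A + A', B + B', by positivity, by positivity, fun x => ?_⟩
  calc |f x + g x| ≤ |f x| + |g x| := abs_add_le _ _
    _ ≤ A * Real.exp (B * |x|) + A' * Real.exp (B' * |x|) := add_le_add (h x) (h' x)
    _ ≤ A * Real.exp ((B + B') * |x|) + A' * Real.exp ((B + B') * |x|) := by
        have := abs_nonneg x
        gcongr <;> linarith
    _ = _ := by ring

lemma sub (hf : ExpBdd f) (hg : ExpBdd g) : ExpBdd fun x => f x - g x := by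
  have := hf.add ((const (-1)).mul hg)
  convert this using 2
  ring

lemma comp_affine (hg : ExpBdd g) (c v : ℝ) : ExpBdd fun x => g (c * x + v) := by
  obtain ⟨hg, A, B, hA, hB, h⟩ := hg
  refine ⟨by fun_prop, A * Real.exp (B * |v|), B * |c|, by positivity, by positivity, fun x => ?_⟩
  refine (h _).trans ?_
  rw [mul_assoc, ← Real.exp_add]
  gcongr
  have := abs_add_le (c * x) v
  rw [abs_mul] at this
  nlinarith

lemma exp (a : ℝ) : ExpBdd fun x => Real.exp (a * x) :=
  ⟨by fun_prop, 1, |a|, zero_le_one, abs_nonneg _, fun x => by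
    rw [abs_of_pos (Real.exp_pos _), one_mul, ← abs_mul]
    exact Real.exp_le_exp.2 (le_abs_self _)⟩

lemma integrable (hf : ExpBdd f) (v : ℝ≥0) : Integrable f (gaussianReal 0 v) := by
  obtain ⟨hf, A, B, hA, hB, h⟩ := hf
  refine Integrable.mono' (((integrable_exp_mul_gaussianReal (μ := 0) (v := v) B).add
    (integrable_exp_mul_gaussianReal (μ := 0) (v := v) (-B))).const_mul A) hf.aestronglyMeasurable
    (Eventually.of_forall fun x => (h x).trans ?_)
  gcongr
  simp only [Pi.add_apply]
  rcases abs_cases x with ⟨hx, _⟩ | ⟨hx, _⟩ <;> rw [hx]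
  · exact le_add_of_nonneg_right (Real.exp_pos _).le
  · rw [mul_neg, ← neg_mul]; exact le_add_of_nonneg_left (Real.exp_pos _).le

end ExpBdd

/-- Integration by parts for a Gaussian measure on the line. -/
lemma stein_one {f f' : ℝ → ℝ} (hf : ExpBdd f) (hf' : ExpBdd f') (h : ∀ x, HasDerivAt f (f' x) x) {v : ℝ≥0}
    (hv : v ≠ 0) : ∫ x, x * f x ∂(gaussianReal 0 v) = v * ∫ x, f' x ∂(gaussianReal 0 v) := by
  have hv' : (v : ℝ) ≠ 0 := by exact_mod_cast hv
  have hI : ∀ {g : ℝ → ℝ}, ExpBdd g → Integrable (fun x => g x * gaussianPDFReal 0 v x) := by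
    intro g hg
    have := hg.integrable v
    rw [gaussianReal_of_var_ne_zero _ hv, integrable_withDensity_iff_integrable_smul'
      (measurable_gaussianPDF 0 v) (Eventually.of_forall fun x => gaussianPDF_lt_top)] at this
    refine this.congr (Eventually.of_forall fun x => ?_)
    simp only [toReal_gaussianPDF, smul_eq_mul]
    ring
  have hpdf : ∀ x, HasDerivAt (gaussianPDFReal 0 v) (-(x / v) * gaussianPDFReal 0 v x) x := by
    intro x
    rw [gaussianPDFReal_def]
    have h1 : HasDerivAt (fun x : ℝ => -(x - 0) ^ 2 / (2 * v)) (-(x / v)) x := by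
      have := ((((hasDerivAt_id x).sub_const 0).pow 2).neg).div_const (2 * (v : ℝ))
      refine this.congr_deriv ?_
      simp
      field_simp
    refine (h1.exp.const_mul _).congr_deriv ?_
    ring
  rw [integral_gaussianReal_eq_integral_smul hv, integral_gaussianReal_eq_integral_smul hv]
  simp only [smul_eq_mul]
  have ibp := integral_mul_deriv_eq_deriv_mul_of_integrable (u := f) (u' := f') (v := gaussianPDFReal 0 v)
    (v' := fun x => -(x / v) * gaussianPDFReal 0 v x) (fun x _ => h x) (fun x _ => hpdf x)
    ((hI (((ExpBdd.const (-(v : ℝ)⁻¹)).mul ExpBdd.id).mul hf)).congr (Eventually.of_forall fun x => by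
      simp only [Pi.mul_apply]; ring))
    (hI hf') (hI hf)
  have e1 : ∫ x, f x * (-(x / v) * gaussianPDFReal 0 v x) = -(v : ℝ)⁻¹ * ∫ x, gaussianPDFReal 0 v x * (x * f x) := by
    rw [← integral_const_mul]
    congr 1
    funext x
    ring
  have e2 : ∫ x, gaussianPDFReal 0 v x * f' x = ∫ x, f' x * gaussianPDFReal 0 v x := by
    congr 1; funext x; ring
  rw [e2]
  rw [e1] at ibp
  generalize ∫ x, gaussianPDFReal 0 v x * (x * f x) = J at ibp ⊢
  field_simp at ibp
  linarith

section Pair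

variable {Ω : Type*} [MeasurableSpace Ω] {μ : Measure Ω}

/-- `(X, Y)` is a centred Gaussian vector with variances `σ`, `τ` and covariance `C`. -/
structure IsGaussPair (X Y : Ω → ℝ) (μ : Measure Ω) (σ τ C : ℝ) : Prop where
  fst : Measurable X
  snd : Measurable Y
  -- `Real.toNNReal` truncates negative numbers, so the law alone would not determine the quadratic
  -- form.
  nonneg : ∀ a b : ℝ, 0 ≤ a ^ 2 * σ + 2 * a * b * C + b ^ 2 * τ
  map_eq : ∀ a b : ℝ, μ.map (fun ω => a * X ω + b * Y ω)
    = gaussianReal 0 (a ^ 2 * σ + 2 * a * b * C + b ^ 2 * τ).toNNReal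

namespace IsGaussPair

variable {X Y : Ω → ℝ} {σ τ C : ℝ}

lemma symm (h : IsGaussPair X Y μ σ τ C) : IsGaussPair Y X μ τ σ C where
  fst := h.snd
  snd := h.fst
  nonneg a b := by have := h.nonneg b a; linarith
  map_eq a b := by
    have := h.map_eq b a
    rw [show a ^ 2 * τ + 2 * a * b * C + b ^ 2 * σ = b ^ 2 * σ + 2 * b * a * C + a ^ 2 * τ by ring, ← this]
    congr 1
    funext ω
    ring

lemma map_fst (h : IsGaussPair X Y μ σ τ C) : μ.map X = gaussianReal 0 σ.toNNReal := by
  simpa using h.map_eq 1 0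

lemma memLp_fst (h : IsGaussPair X Y μ σ τ C) {f : ℝ → ℝ} (hf : ExpBdd f) : MemLp (fun ω => f (X ω)) 2 μ := by
  have h1 : AEStronglyMeasurable (fun ω => f (X ω)) μ := (hf.1.measurable.comp h.fst).aestronglyMeasurable
  rw [memLp_two_iff_integrable_sq h1]
  have h2 : Integrable (fun x => f x * f x) (μ.map X) := by
    rw [h.map_fst]; exact (hf.mul hf).integrable _
  have h3 := (integrable_map_measure (by exact (hf.1.mul hf.1).aestronglyMeasurable) h.fst.aemeasurable).1 h2
  exact h3.congr (Eventually.of_forall fun ω => by simp [sq])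

lemma integrable_mul (h : IsGaussPair X Y μ σ τ C) {f g : ℝ → ℝ} (hf : ExpBdd f) (hg : ExpBdd g) :
    Integrable (fun ω => f (X ω) * g (Y ω)) μ :=
  (h.memLp_fst hf).integrable_mul (h.symm.memLp_fst hg)

/-- Gaussian integration by parts. -/
lemma stein [IsProbabilityMeasure μ] (h : IsGaussPair X Y μ σ τ C) (hσ : 0 < σ) {f f' g g' : ℝ → ℝ}
    (hf : ExpBdd f) (hf' : ExpBdd f') (hg : ExpBdd g) (hg' : ExpBdd g')
    (hff : ∀ x, HasDerivAt f (f' x) x) (hgg : ∀ x, HasDerivAt g (g' x) x) :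
    ∫ ω, X ω * f (X ω) * g (Y ω) ∂μ
      = σ * ∫ ω, f' (X ω) * g (Y ω) ∂μ + C * ∫ ω, f (X ω) * g' (Y ω) ∂μ := by
  -- Regression of Y on X: V = Y - cX is uncorrelated with X, hence independent of it, and possibly
  -- degenerate. For fixed V the identity is the one-dimensional integration by parts for x ↦ f(x)
  -- g(cx + V), with cσ = C.
  set c := C / σ with hc
  have hcσ : c * σ = C := by rw [hc]; field_simp
  set V : Ω → ℝ := fun ω => Y ω - c * X ω with hV
  have hVm : Measurable V := h.snd.sub (h.fst.const_mul c)
  have hYV : ∀ ω, Y ω = c * X ω + V ω := fun ω => by simp [hV]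
  have hmapX := h.map_fst
  have hcom : ∀ a b : ℝ, μ.map (fun ω => a * X ω + b * V ω)
      = gaussianReal 0 (a ^ 2 * σ + b ^ 2 * (τ - c * C)).toNNReal := by
    intro a b
    have := h.map_eq (a - b * c) b
    rw [show (a - b * c) ^ 2 * σ + 2 * (a - b * c) * b * C + b ^ 2 * τ = a ^ 2 * σ + b ^ 2 * (τ - c * C) by
      rw [← hcσ]; ring] at this
    rw [← this]
    congr 1
    funext ω
    simp only [hV]; ring
  have hnn : 0 ≤ τ - c * C := by
    have := h.nonneg (-c) 1
    rw [← hcσ] at this ⊢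
    nlinarith
  have hmapV : μ.map V = gaussianReal 0 (τ - c * C).toNNReal := by simpa using hcom 0 1
  have hind : IndepFun X V μ := by
    rw [indepFun_iff_charFun_prod h.fst.aemeasurable hVm.aemeasurable]
    intro t
    have hadd : ∀ a b : ℝ, Measurable fun ω => a * X ω + b * V ω :=
      fun a b => (h.fst.const_mul a).add (hVm.const_mul b)
    have hpair : Measurable fun ω => WithLp.toLp 2 (X ω, V ω) :=
      (WithLp.measurable_toLp 2 _).comp (h.fst.prodMk hVm)
    have h1 := congrArg (fun ν => charFun ν 1) (hcom t.fst t.snd)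
    beta_reduce at h1
    rw [charFun_apply_real, integral_map (hadd _ _).aemeasurable (by fun_prop),
      charFun_gaussianReal] at h1
    rw [charFun_apply, integral_map hpair.aemeasurable (by fun_prop), hmapX, hmapV, charFun_gaussianReal, charFun_gaussianReal,
      ← Complex.exp_add]
    convert h1 using 3 with ω
    · simp [WithLp.prod_inner_apply]
    · rw [Real.coe_toNNReal _ hσ.le, Real.coe_toNNReal _ hnn, Real.coe_toNNReal _ (by positivity)]
      push_cast
      simp only [WithLp.ofLp_fst, WithLp.ofLp_snd]
      ring
  have hprod : μ.map (fun ω => (X ω, V ω)) = (gaussianReal 0 σ.toNNReal).prod (gaussianReal 0 (τ - c * C).toNNReal) := by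
    rw [(indepFun_iff_map_prod_eq_prod_map_map h.fst.aemeasurable hVm.aemeasurable).1 hind, hmapX, hmapV]
  have hE : ∀ {f g : ℝ → ℝ}, ExpBdd f → ExpBdd g → ∫ ω, f (X ω) * g (Y ω) ∂μ
      = ∫ v, ∫ x, f x * g (c * x + v) ∂(gaussianReal 0 σ.toNNReal) ∂(gaussianReal 0 (τ - c * C).toNNReal) := by
    intro f g hf hg
    have hcont : Continuous fun q : ℝ × ℝ => f q.1 * g (c * q.1 + q.2) := by
      have := hf.1; have := hg.1; fun_prop
    have hm : AEMeasurable (fun ω => (X ω, V ω)) μ := (h.fst.prodMk hVm).aemeasurable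
    have h1 := integral_map hm (f := fun q : ℝ × ℝ => f q.1 * g (c * q.1 + q.2)) hcont.aestronglyMeasurable
    have h2 : Integrable (fun q : ℝ × ℝ => f q.1 * g (c * q.1 + q.2)) (μ.map fun ω => (X ω, V ω)) := by
      rw [integrable_map_measure hcont.aestronglyMeasurable hm]
      refine (h.integrable_mul hf hg).congr (Eventually.of_forall fun ω => ?_)
      simp [hYV]
    rw [hprod] at h1 h2
    rw [integral_prod_symm _ h2] at h1
    rw [h1]
    congr 1
    funext ω
    simp [hYV]
  have h1 := hE (ExpBdd.id.mul hf) hg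
  have h2 := hE hf' hg
  have h3 := hE hf hg'
  have hσn : σ.toNNReal ≠ 0 := by simpa using hσ
  have hinner : ∀ v : ℝ, ∫ x, x * f x * g (c * x + v) ∂(gaussianReal 0 σ.toNNReal)
      = σ * ∫ x, f' x * g (c * x + v) ∂(gaussianReal 0 σ.toNNReal)
        + C * ∫ x, f x * g' (c * x + v) ∂(gaussianReal 0 σ.toNNReal) := by
    intro v
    have hga := hg.comp_affine c v
    have hga' := hg'.comp_affine c v
    have := stein_one (f := fun x => f x * g (c * x + v)) (f' := fun x => f' x * g (c * x + v) + c * (f x * g' (c * x + v)))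
      (hf.mul hga) ((hf'.mul hga).add ((ExpBdd.const c).mul (hf.mul hga'))) (fun x => by
        have hl : HasDerivAt (fun x : ℝ => c * x + v) c x := by
          simpa using ((hasDerivAt_id x).const_mul c).add_const v
        have := (hff x).mul ((hgg (c * x + v)).comp x hl)
        refine this.congr_deriv ?_
        simp only [Function.comp_apply]
        ring) hσn
    simp only [mul_assoc]
    rw [this, integral_add ((hf'.mul hga).integrable _)
      (((ExpBdd.const c).mul (hf.mul hga')).integrable _), Real.coe_toNNReal _ hσ.le, mul_add,
      integral_const_mul, ← mul_assoc σ c, mul_comm σ c, hcσ]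
  rw [h1, h2, h3]
  simp only [hinner]
  have hi : ∀ {f g : ℝ → ℝ}, ExpBdd f → ExpBdd g → Integrable (fun v => ∫ x, f x * g (c * x + v) ∂(gaussianReal 0 σ.toNNReal))
      (gaussianReal 0 (τ - c * C).toNNReal) := by
    intro f g hf hg
    have hcont : Continuous fun q : ℝ × ℝ => f q.1 * g (c * q.1 + q.2) := by
      have := hf.1; have := hg.1; fun_prop
    have hm : AEMeasurable (fun ω => (X ω, V ω)) μ := (h.fst.prodMk hVm).aemeasurable
    have h2 : Integrable (fun q : ℝ × ℝ => f q.1 * g (c * q.1 + q.2)) (μ.map fun ω => (X ω, V ω)) := by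
      rw [integrable_map_measure hcont.aestronglyMeasurable hm]
      refine (h.integrable_mul hf hg).congr (Eventually.of_forall fun ω => ?_)
      simp [hYV]
    rw [hprod] at h2
    exact h2.integral_prod_right
  rw [integral_add ((hi hf' hg).const_mul _) ((hi hf hg').const_mul _), integral_const_mul, integral_const_mul]

end IsGaussPair

end Pair

/-! ### Hermite moments -/

/-- The derivative of `hp`. -/
def hpDeriv (v x : ℝ) (n : ℕ) : ℝ := n * hp v x (n - 1)

/-- In this form of the recursion the subtracted derivative matches the variance term of Gaussian
integration by parts. -/
lemma hp_succ (v x : ℝ) (n : ℕ) : hp v x (n + 1) = x * hp v x n - v * hpDeriv v x n := by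
  cases n with
  | zero => simp [hp, hpDeriv]
  | succ n => simp only [hp, hpDeriv, Nat.add_sub_cancel]; push_cast; ring

lemma hasDerivAt_hp (v x : ℝ) (n : ℕ) : HasDerivAt (fun x => hp v x n) (hpDeriv v x n) x := by
  have key : ∀ n, HasDerivAt (fun x => hp v x n) (hpDeriv v x n) x ∧
      HasDerivAt (fun x => hp v x (n + 1)) (hpDeriv v x (n + 1)) x := by
    intro n
    induction n with
    | zero =>
      simp only [hp, hpDeriv]
      refine ⟨(hasDerivAt_const x 1).congr_deriv (by simp), (hasDerivAt_id' x).congr_deriv (by simp [hp])⟩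
    | succ n ih =>
      refine ⟨ih.2, ?_⟩
      simp only [hp]
      have := ((hasDerivAt_id' x).mul ih.2).sub (ih.1.const_mul ((n + 1) * v))
      refine this.congr_deriv ?_
      have e := hp_succ v x n
      simp only [hpDeriv, Nat.add_sub_cancel] at e ⊢
      rw [e]
      push_cast
      ring
  exact (key n).1

lemma expBdd_hp (v : ℝ) (n : ℕ) : ExpBdd fun x => hp v x n := by
  have key : ∀ n, (ExpBdd fun x => hp v x n) ∧ ExpBdd fun x => hp v x (n + 1) := by
    intro n
    induction n with
    | zero => simp only [hp]; exact ⟨ExpBdd.const 1, ExpBdd.id⟩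
    | succ n ih =>
      refine ⟨ih.2, ?_⟩
      simp only [hp]
      exact (ExpBdd.id.mul ih.2).sub ((ExpBdd.const _).mul ih.1)
  exact (key n).1

lemma expBdd_hpDeriv (v : ℝ) (n : ℕ) : ExpBdd fun x => hpDeriv v x n :=
  (ExpBdd.const _).mul (expBdd_hp v (n - 1))

namespace IsGaussPair

variable {Ω : Type*} [MeasurableSpace Ω] {μ : Measure Ω} [IsProbabilityMeasure μ] {X Y : Ω → ℝ} {σ τ C : ℝ}

/-- In `stein` the variance term cancels against the derivative in `hp_succ`. What remains trades
one degree of the Hermite polynomial for a factor C and a derivative of g. -/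
lemma integral_hp_succ_mul (h : IsGaussPair X Y μ σ τ C) (hσ : 0 < σ) {g g' : ℝ → ℝ} (hg : ExpBdd g)
    (hg' : ExpBdd g') (hgg : ∀ x, HasDerivAt g (g' x) x) (n : ℕ) :
    ∫ ω, hp σ (X ω) (n + 1) * g (Y ω) ∂μ = C * ∫ ω, hp σ (X ω) n * g' (Y ω) ∂μ := by
  have hs := h.stein hσ (expBdd_hp σ n) (expBdd_hpDeriv σ n) hg hg' (fun x => hasDerivAt_hp σ x n) hgg
  have e : ∀ ω, hp σ (X ω) (n + 1) * g (Y ω)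
      = X ω * hp σ (X ω) n * g (Y ω) - σ * (hpDeriv σ (X ω) n * g (Y ω)) := fun ω => by rw [hp_succ]; ring
  simp only [e]
  rw [integral_sub (h.integrable_mul (ExpBdd.id.mul (expBdd_hp σ n)) hg)
    ((h.integrable_mul (expBdd_hpDeriv σ n) hg).const_mul σ), integral_const_mul, hs]
  ring

/-- Both degrees drop together. If they differ, the recursion ends either with the derivative of a
constant or with the mean of a Hermite polynomial of positive degree, and both are 0. -/
lemma integral_hp_mul_hp (h : IsGaussPair X Y μ σ τ C) (hσ : 0 < σ) (hτ : 0 < τ) (n m : ℕ) :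
    ∫ ω, hp σ (X ω) n * hp τ (Y ω) m ∂μ = if n = m then n.factorial * C ^ n else 0 := by
  induction n generalizing m with
  | zero =>
    rcases m with _ | m
    · simp [hp]
    · have := h.symm.integral_hp_succ_mul hτ (ExpBdd.const 1) (ExpBdd.const 0) (fun x => hasDerivAt_const x 1) m
      simpa [hp] using this
  | succ n ih =>
    rw [h.integral_hp_succ_mul hσ (expBdd_hp τ m) (expBdd_hpDeriv τ m) (fun x => hasDerivAt_hp τ x m)]
    rcases m with _ | m
    · simp [hpDeriv]
    · have e : ∀ ω, hp σ (X ω) n * hpDeriv τ (Y ω) (m + 1) = (m + 1) * (hp σ (X ω) n * hp τ (Y ω) m) := fun ω => by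
        simp only [hpDeriv, Nat.add_sub_cancel]; push_cast; ring
      simp only [e]
      rw [integral_const_mul, ih]
      by_cases hnm : n = m
      · subst hnm
        simp only [if_true, Nat.factorial_succ, pow_succ]
        push_cast; ring
      · simp [hnm]

lemma integral_exp (h : IsGaussPair X Y μ σ τ C) (hσ : 0 ≤ σ) (a : ℝ) :
    ∫ ω, Real.exp (a * X ω - a ^ 2 * σ / 2) ∂μ = 1 := by
  have h1 := mgf_gaussianReal (X := X) h.map_fst a
  rw [mgf, Real.coe_toNNReal _ hσ] at h1
  simp only [sub_eq_add_neg, Real.exp_add]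
  rw [integral_mul_const, h1, ← Real.exp_add]
  simp only [Real.exp_eq_one_iff]
  ring

/-- Differentiation multiplies the exponential by a, so each step of the induction contributes a
factor aC. -/
lemma integral_hp_mul_exp (h : IsGaussPair X Y μ σ τ C) (hσ : 0 < σ) (hτ : 0 < τ) (n : ℕ) (a : ℝ) :
    ∫ ω, hp σ (X ω) n * Real.exp (a * Y ω - a ^ 2 * τ / 2) ∂μ = (a * C) ^ n := by
  have hE : ExpBdd fun y => Real.exp (a * y - a ^ 2 * τ / 2) := by
    have := (ExpBdd.exp a).mul (ExpBdd.const (Real.exp (-(a ^ 2 * τ / 2))))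
    simpa only [← Real.exp_add, ← sub_eq_add_neg] using this
  induction n with
  | zero => simpa [hp] using h.symm.integral_exp hτ.le a
  | succ n ih =>
    rw [h.integral_hp_succ_mul hσ (g' := fun y => a * Real.exp (a * y - a ^ 2 * τ / 2)) hE ((ExpBdd.const a).mul hE)]
    · have e : ∀ ω, hp σ (X ω) n * (a * Real.exp (a * Y ω - a ^ 2 * τ / 2))
          = a * (hp σ (X ω) n * Real.exp (a * Y ω - a ^ 2 * τ / 2)) := fun ω => by ring
      simp only [e]
      rw [integral_const_mul, ih, pow_succ]
      ring
    · intro y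
      have := (((hasDerivAt_id' y).const_mul a).sub_const (a ^ 2 * τ / 2)).exp
      refine this.congr_deriv ?_
      ring

lemma integral_exp_mul_exp (h : IsGaussPair X Y μ σ τ C) (a : ℝ) :
    ∫ ω, Real.exp (a * X ω - a ^ 2 * σ / 2) * Real.exp (a * Y ω - a ^ 2 * τ / 2) ∂μ = Real.exp (a ^ 2 * C) := by
  have h1 := mgf_gaussianReal (h.map_eq a a) 1
  rw [mgf, Real.coe_toNNReal _ (h.nonneg a a)] at h1
  have e : ∀ ω, Real.exp (a * X ω - a ^ 2 * σ / 2) * Real.exp (a * Y ω - a ^ 2 * τ / 2)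
      = Real.exp (1 * (a * X ω + a * Y ω)) * Real.exp (-(a ^ 2 * σ / 2) - a ^ 2 * τ / 2) := fun ω => by
    rw [← Real.exp_add, ← Real.exp_add]; congr 1; ring
  simp only [e]
  rw [integral_mul_const, h1, ← Real.exp_add]
  congr 1
  ring

end IsGaussPair

end WickExp

namespace WickExp

noncomputable section

/-! ### Positive definite functions on the torus -/

/-- The difference map of the torus. -/
def diffMap : C(Torus × Torus, Torus) := ⟨fun q => q.1 - q.2, by fun_prop⟩

/-- The quadratic form `∬ φ(x) φ(y) f(x - y) dx dy`, as a functional of `f`. -/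
def form {φ : Torus → ℝ} (hφ : Integrable φ volume) : C(Torus, ℝ) →L[ℝ] ℝ :=
  wint (hφ.mul_prod hφ) ∘L ContinuousMap.compCLM ℝ ℝ diffMap

lemma form_apply {φ : Torus → ℝ} (hφ : Integrable φ volume) (f : C(Torus, ℝ)) :
    form hφ f = ∫ q : Torus × Torus, f (q.1 - q.2) * (φ q.1 * φ q.2) ∂(volume.prod volume) := rfl

/-- The character `x ↦ e^{i k · x}`. -/
def ch (k : ℤ × ℤ) : C(Torus, ℂ) := ⟨fun x => fourier k.1 x.1 * fourier k.2 x.2, by fun_prop⟩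

/-- The function `x ↦ cos (k · x)`. -/
def cosT (k : ℤ × ℤ) : C(Torus, ℝ) := ⟨fun x => (ch k x).re, by fun_prop⟩

/-- The function `x ↦ sin (k · x)`. -/
def sinT (k : ℤ × ℤ) : C(Torus, ℝ) := ⟨fun x => (ch k x).im, by fun_prop⟩

lemma ch_apply (k : ℤ × ℤ) (x : Torus) : ch k x = fourier k.1 x.1 * fourier k.2 x.2 := rfl

lemma cosT_apply (k : ℤ × ℤ) (x : Torus) : cosT k x = (ch k x).re := rfl

lemma sinT_apply (k : ℤ × ℤ) (x : Torus) : sinT k x = (ch k x).im := rfl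

lemma mode_eq_ch (k : ℤ × ℤ) (x : Torus) : mode k x = (2 * π : ℂ)⁻¹ * ch k x := rfl

lemma fourier_sub_apply (n : ℤ) (x y : AddCircle (2 * π)) :
    fourier n (x - y) = fourier n x * conj (fourier n y) := by
  rw [← fourier_neg, fourier_apply, fourier_apply, fourier_apply, smul_sub, sub_eq_add_neg, AddCircle.toCircle_add,
    Circle.coe_mul, neg_smul]

lemma ch_sub (k : ℤ × ℤ) (x y : Torus) : ch k (x - y) = ch k x * conj (ch k y) := by
  simp only [ch_apply, Prod.fst_sub, Prod.snd_sub, fourier_sub_apply, map_mul]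
  ring

lemma cosT_sub (k : ℤ × ℤ) (x y : Torus) : cosT k (x - y) = cosT k x * cosT k y + sinT k x * sinT k y := by
  simp only [cosT_apply, sinT_apply, ch_sub, Complex.mul_re, Complex.conj_re, Complex.conj_im]
  ring

lemma norm_ch (k : ℤ × ℤ) (x : Torus) : ‖ch k x‖ = 1 := by
  have h1 : ‖fourier k.1 x.1‖ = 1 := Circle.norm_coe _
  have h2 : ‖fourier k.2 x.2‖ = 1 := Circle.norm_coe _
  rw [ch_apply, norm_mul, h1, h2, one_mul]

lemma abs_cosT_le (k : ℤ × ℤ) (x : Torus) : |cosT k x| ≤ 1 :=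
  (Complex.abs_re_le_norm _).trans (norm_ch k x).le

lemma ch_zero (k : ℤ × ℤ) : ch k 0 = 1 := by
  rw [ch_apply]; simp only [Prod.fst_zero, Prod.snd_zero, fourier_eval_zero, mul_one]

lemma cosT_apply_zero (k : ℤ × ℤ) : cosT k 0 = 1 := by simp [cosT_apply, ch_zero]

lemma cosT_zero : cosT 0 = 1 := by
  ext x
  rw [cosT_apply, ch_apply]
  simp only [Prod.fst_zero, Prod.snd_zero, fourier_zero, mul_one, Complex.one_re, ContinuousMap.one_apply]

lemma ch_neg (k : ℤ × ℤ) (x : Torus) : ch (-k) x = conj (ch k x) := by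
  simp only [ch_apply, Prod.fst_neg, Prod.snd_neg, fourier_neg, map_mul]

lemma cosT_neg (k : ℤ × ℤ) : cosT (-k) = cosT k := by ext x; rw [cosT_apply, cosT_apply, ch_neg, Complex.conj_re]

/-- The addition formula for cos k·(x - y) splits the form in two, with φ multiplied by the cosine
and by the sine. This makes `cosT k` positive definite and later merges the two test functions of
one frequency. -/
lemma form_cosT_mul {φ : Torus → ℝ} (hφ : Integrable φ volume) (k : ℤ × ℤ) (f : C(Torus, ℝ)) :
    form hφ (cosT k * f) = form (integrable_continuousMap_mul hφ (cosT k)) f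
      + form (integrable_continuousMap_mul hφ (sinT k)) f := by
  have h1 := integrable_continuousMap_mul hφ (cosT k)
  have h2 := integrable_continuousMap_mul hφ (sinT k)
  rw [form_apply, form_apply, form_apply]
  refine Eq.trans ?_ (integral_add (integrable_continuousMap_mul (h1.mul_prod h1) (f.comp diffMap))
    (integrable_continuousMap_mul (h2.mul_prod h2) (f.comp diffMap)))
  congr 1
  funext q
  rw [ContinuousMap.mul_apply, cosT_sub]
  change _ = f (q.1 - q.2) * (cosT k q.1 * φ q.1 * (cosT k q.2 * φ q.2))
    + f (q.1 - q.2) * (sinT k q.1 * φ q.1 * (sinT k q.2 * φ q.2))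
  ring

/-- `R` is positive definite: multiplication by `R` preserves the functions `f` for which all the
forms `∬ φ(x) φ(y) f(x - y) dx dy` are non-negative. -/
def IsPD (R : C(Torus, ℝ)) : Prop :=
  ∀ f : C(Torus, ℝ), (∀ (φ : Torus → ℝ) (hφ : Integrable φ volume), 0 ≤ form hφ f) →
    ∀ (φ : Torus → ℝ) (hφ : Integrable φ volume), 0 ≤ form hφ (R * f)

namespace IsPD

variable {R S : C(Torus, ℝ)}

lemma add (hR : IsPD R) (hS : IsPD S) : IsPD (R + S) := fun f hf φ hφ => by
  rw [add_mul, map_add]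
  exact add_nonneg (hR f hf φ hφ) (hS f hf φ hφ)

/-- Schur's product theorem; it is immediate because positive definiteness is defined through
multipliers. -/
lemma mul (hR : IsPD R) (hS : IsPD S) : IsPD (R * S) := fun f hf φ hφ => by
  rw [mul_assoc]
  exact hR _ (hS f hf) φ hφ

lemma smul (hR : IsPD R) {c : ℝ} (hc : 0 ≤ c) : IsPD (c • R) := fun f hf φ hφ => by
  rw [smul_mul_assoc, map_smul]
  exact mul_nonneg hc (hR f hf φ hφ)

protected lemma zero : IsPD 0 := fun f _ φ hφ => by rw [zero_mul, map_zero]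

protected lemma one : IsPD 1 := fun f hf φ hφ => by rw [one_mul]; exact hf φ hφ

lemma cosT (k : ℤ × ℤ) : IsPD (cosT k) := fun f hf φ hφ => by
  rw [form_cosT_mul]
  exact add_nonneg (hf _ _) (hf _ _)

lemma sum {ι : Type*} {s : Finset ι} {R : ι → C(Torus, ℝ)} (h : ∀ i ∈ s, IsPD (R i)) : IsPD (∑ i ∈ s, R i) :=
  Finset.sum_induction R IsPD (fun _ _ => add) IsPD.zero h

lemma pow (hR : IsPD R) (n : ℕ) : IsPD (R ^ n) := by
  induction n with
  | zero => rw [pow_zero]; exact IsPD.one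
  | succ n ih => rw [pow_succ]; exact ih.mul hR

lemma of_tendsto {ι : Type*} {l : Filter ι} [l.NeBot] {R : ι → C(Torus, ℝ)} (h : ∀ᶠ i in l, IsPD (R i))
    (hl : Tendsto R l (𝓝 S)) : IsPD S := fun f hf φ hφ => by
  have h1 : Tendsto (fun i => form hφ (R i * f)) l (𝓝 (form hφ (S * f))) :=
    ((form hφ).continuous.tendsto _).comp (hl.mul_const f)
  exact ge_of_tendsto h1 (h.mono fun i hi => hi f hf φ hφ)

lemma of_hasSum {ι : Type*} {R : ι → C(Torus, ℝ)} (h : ∀ i, IsPD (R i)) (hs : HasSum R S) : IsPD S :=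
  of_tendsto (Eventually.of_forall fun _ => sum fun i _ => h i) hs

/-- The remainder of a convergent series of positive definite functions is a series of the same
kind, so truncation goes down in the order. -/
lemma sub_sum {ι : Type*} {R : ι → C(Torus, ℝ)} (h : ∀ i, IsPD (R i)) (hs : HasSum R S) (s : Finset ι) :
    IsPD (S - ∑ i ∈ s, R i) := by
  classical
  have h' := (hs.sub (hasSum_sum_of_ne_finset_zero (s := s)
    (f := fun i => if i ∈ s then R i else 0) fun i hi => if_neg hi))
  rw [Finset.sum_congr rfl fun i hi => if_pos hi] at h'
  refine IsPD.of_hasSum (fun i => ?_) h'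
  split_ifs
  · simpa using IsPD.zero
  · simpa using h i

lemma sub_trans {Q : C(Torus, ℝ)} (h₁ : IsPD (Q - R)) (h₂ : IsPD (R - S)) : IsPD (Q - S) := by
  simpa using h₁.add h₂

lemma sum_sub {ι : Type*} {s : Finset ι} {Q R : ι → C(Torus, ℝ)} (h : ∀ i ∈ s, IsPD (Q i - R i)) :
    IsPD (∑ i ∈ s, Q i - ∑ i ∈ s, R i) := by
  rw [← Finset.sum_sub_distrib]
  exact IsPD.sum h

lemma smul_sub' (h : IsPD (R - S)) {c : ℝ} (hc : 0 ≤ c) : IsPD (c • R - c • S) := by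
  rw [← smul_sub]
  exact h.smul hc

lemma smul_sub_smul (hR : IsPD R) {c d : ℝ} (h : d ≤ c) : IsPD (c • R - d • R) := by
  rw [← sub_smul]
  exact hR.smul (sub_nonneg.2 h)

lemma mul_sub' (h : IsPD (R - S)) {Q : C(Torus, ℝ)} (hQ : IsPD Q) : IsPD (Q * R - Q * S) := by
  rw [← mul_sub]
  exact hQ.mul h

lemma mul_sub_mul {Q Q' : C(Torus, ℝ)} (hQ : IsPD Q) (hS : IsPD S) (h : IsPD (R - S)) (h' : IsPD (Q - Q')) :
    IsPD (Q * R - Q' * S) := by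
  have : Q * R - Q' * S = Q * (R - S) + (Q - Q') * S := by ring
  rw [this]
  exact (hQ.mul h).add (h'.mul hS)

/-- The constant function 1 has the forms (∫ φ)² ≥ 0, and R is R · 1. -/
lemma form_nonneg (hR : IsPD R) {φ : Torus → ℝ} (hφ : Integrable φ volume) : 0 ≤ form hφ R := by
  have h1 : ∀ (φ : Torus → ℝ) (hφ : Integrable φ volume), 0 ≤ form hφ 1 := fun φ hφ => by
    rw [form_apply]
    simp only [ContinuousMap.one_apply, one_mul]
    rw [integral_prod_mul φ φ]
    exact mul_self_nonneg _
  have := hR 1 h1 φ hφ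
  rwa [mul_one] at this

/-- By translation invariance the form at φ = 1 is (2π)² ∫ R. -/
lemma integral_nonneg (hR : IsPD R) : 0 ≤ ∫ x, R x := by
  have h := hR.form_nonneg (φ := fun _ => 1) (integrable_const 1)
  rw [form_apply] at h
  simp only [mul_one] at h
  have hint : Integrable (fun q : Torus × Torus => R (q.1 - q.2)) (volume.prod volume) :=
    (R.comp diffMap).continuous.integrable_of_hasCompactSupport (HasCompactSupport.of_compactSpace _)
  rw [integral_prod_symm _ hint] at h
  simp only [integral_sub_right_eq_self (fun x => R x)] at h
  rw [integral_const, volume_torus, smul_eq_mul] at h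
  have hpi := Real.pi_pos
  exact nonneg_of_mul_nonneg_right h (by positivity)

lemma pow_sub_pow (hS : IsPD S) (hRS : IsPD (R - S)) (n : ℕ) : IsPD (R ^ n - S ^ n) := by
  have hR : IsPD R := by simpa using hRS.add hS
  induction n with
  | zero => simpa using IsPD.zero
  | succ n ih =>
    have : R ^ (n + 1) - S ^ (n + 1) = R ^ n * (R - S) + (R ^ n - S ^ n) * S := by ring
    rw [this]
    exact ((hR.pow n).mul hRS).add (ih.mul hS)

end IsPD

/-- The exponential of a continuous function. -/
def expT (f : C(Torus, ℝ)) : C(Torus, ℝ) := ⟨fun x => Real.exp (f x), by fun_prop⟩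

lemma expT_apply (f : C(Torus, ℝ)) (x : Torus) : expT f x = Real.exp (f x) := rfl

lemma hasSum_expT (f : C(Torus, ℝ)) : HasSum (fun n : ℕ => ((n.factorial : ℝ)⁻¹) • f ^ n) (expT f) := by
  have h1 := NormedSpace.exp_series_hasSum_exp' (𝕂 := ℝ) f
  have h2 : NormedSpace.exp f = expT f := by
    ext x
    have h3 := h1.mapL (ContinuousMap.evalCLM ℝ x)
    have h4 := NormedSpace.exp_series_hasSum_exp' (𝕂 := ℝ) (f x)
    rw [expT_apply, Real.exp_eq_exp_ℝ]
    refine h3.unique (h4.congr_fun fun n => ?_)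
    simp
  rwa [h2] at h1

/-- Powers are monotone in the positive definite order by telescoping, hence so is the exponential,
term by term. This carries all later comparisons from Green functions to their exponentials. -/
lemma IsPD.expT_sub {R S : C(Torus, ℝ)} (hS : IsPD S) (hRS : IsPD (R - S)) : IsPD (expT R - expT S) := by
  refine IsPD.of_hasSum (fun n => ?_) ((hasSum_expT R).sub (hasSum_expT S))
  rw [← smul_sub]
  exact (hS.pow_sub_pow hRS n).smul (by positivity)

lemma IsPD.expT {R : C(Torus, ℝ)} (hR : IsPD R) : IsPD (expT R) :=
  IsPD.of_hasSum (fun n => (hR.pow n).smul (by positivity)) (hasSum_expT R)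

lemma IsPD.expT_sub_sum {R : C(Torus, ℝ)} (hR : IsPD R) (s : Finset ℕ) :
    IsPD (WickExp.expT R - ∑ n ∈ s, ((n.factorial : ℝ)⁻¹) • R ^ n) :=
  IsPD.sub_sum (fun n => (hR.pow n).smul (by positivity)) (hasSum_expT R) s

/-! ### The cut-off Green function -/

/-- The covariance function `(2π)⁻² ∑_{k ∈ F} λ_k⁻¹ cos (k · x)` of the field cut off to `F`. -/
def green (F : Finset (ℤ × ℤ)) : C(Torus, ℝ) := ∑ k ∈ F, ((2 * π) ^ 2 * lam k)⁻¹ • cosT k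

lemma green_apply (F : Finset (ℤ × ℤ)) (x : Torus) : green F x = ∑ k ∈ F, ((2 * π) ^ 2 * lam k)⁻¹ * cosT k x := by
  simp [green, ContinuousMap.sum_apply]

lemma isPD_green (F : Finset (ℤ × ℤ)) : IsPD (green F) :=
  IsPD.sum fun k _ => (IsPD.cosT k).smul (by have := lam_pos k; positivity)

lemma isPD_green_sub {F G : Finset (ℤ × ℤ)} (h : F ⊆ G) : IsPD (green G - green F) := by
  rw [green, green, ← Finset.sum_sdiff h, add_sub_cancel_right]
  exact IsPD.sum fun k _ => (IsPD.cosT k).smul (by have := lam_pos k; positivity)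

lemma isPD_exp_green_sub {F G : Finset (ℤ × ℤ)} (h : F ⊆ G) {β : ℝ} (hβ : 0 ≤ β) :
    IsPD (expT (β • green G) - expT (β • green F)) := by
  refine ((isPD_green F).smul hβ).expT_sub ?_
  rw [← smul_sub]
  exact (isPD_green_sub h).smul hβ

end

end WickExp

namespace WickExp

noncomputable section

/-! ### Explicit positive definite functions -/

lemma hasSum_of_pointwise {X ι : Type*} [TopologicalSpace X] [CompactSpace X] [Nonempty X] {c : ι → C(X, ℝ)} {f : C(X, ℝ)}
    {b : ι → ℝ} (hb : Summable b) (hc : ∀ i x, |c i x| ≤ b i) (h : ∀ x, HasSum (fun i => c i x) (f x)) :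
    HasSum c f := by
  have hs : Summable c := Summable.of_norm_bounded hb fun i =>
    (ContinuousMap.norm_le_of_nonempty _).2 (hc i)
  convert hs.hasSum
  ext x
  exact (h x).unique (hs.hasSum.mapL (ContinuousMap.evalCLM ℝ x))

lemma summable_int_inv : Summable fun n : ℤ => (1 + (n : ℝ) ^ 2)⁻¹ := by
  refine Summable.of_norm_bounded_eventually (Real.summable_one_div_int_pow.2 one_lt_two) ?_
  rw [Filter.eventually_cofinite]
  refine (Set.finite_singleton (0 : ℤ)).subset fun n hn => ?_
  by_contra hn0
  apply hn
  have hn1 : (0 : ℝ) < (n : ℝ) ^ 2 := by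
    have : (n : ℝ) ≠ 0 := by exact_mod_cast hn0
    positivity
  rw [Real.norm_of_nonneg (by positivity), one_div]
  exact inv_anti₀ hn1 (by linarith)

lemma exists_rep_Ioc (x : AddCircle (2 * π)) : ∃ s : ℝ, |s| ≤ π ∧ ‖x‖ = |s| ∧ (s : AddCircle (2 * π)) = x := by
  have hpi := Real.pi_pos
  have h := (AddCircle.equivIoc (2 * π) (-π) x).2
  refine ⟨AddCircle.equivIoc (2 * π) (-π) x, ?_, ?_, (AddCircle.equivIoc (2 * π) (-π)).symm_apply_apply x⟩
  · rw [abs_le]; constructor <;> linarith [h.1, h.2]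
  · conv_lhs => rw [← (AddCircle.equivIoc (2 * π) (-π)).symm_apply_apply x]
    refine (AddCircle.norm_coe_eq_abs_iff (2 * π) (by positivity)).2 ?_
    rw [abs_of_pos (by positivity : 0 < 2 * π), abs_le]
    constructor <;> linarith [h.1, h.2]

lemma norm_circle_le (x : AddCircle (2 * π)) : ‖x‖ ≤ π := by
  obtain ⟨s, h1, h2, -⟩ := exists_rep_Ioc x
  rwa [h2]

/-- The Fourier coefficients of `y ↦ e^{-n|y|}`. -/
def expAbsCoef (n : ℝ) (m : ℤ) : ℝ := π⁻¹ * (n * (1 - Real.cos (m * π) * Real.exp (-n * π)) / (n ^ 2 + m ^ 2))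

lemma fourierCoeff_expAbs {n : ℝ} (hn : 0 < n) (m : ℤ) :
    fourierCoeff (fun y : AddCircle (2 * π) => (Real.exp (-n * ‖y‖) : ℂ)) m = expAbsCoef n m := by
  have hpi := Real.pi_pos
  rw [fourierCoeff_eq_intervalIntegral _ m (-π), show -π + 2 * π = π by ring]
  have hpos : ∫ x in (0 : ℝ)..π, fourier (-m) (x : AddCircle (2 * π)) • (Real.exp (-n * ‖(x : AddCircle (2 * π))‖) : ℂ)
      = ∫ x in (0 : ℝ)..π, Complex.exp ((-n - m * Complex.I) * x) := by
    refine intervalIntegral.integral_congr fun x hx => ?_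
    rw [Set.uIcc_of_le hpi.le] at hx
    have hx1 : ‖(x : AddCircle (2 * π))‖ = x := by
      rw [(AddCircle.norm_coe_eq_abs_iff (2 * π) (by positivity)).2, abs_of_nonneg hx.1]
      rw [abs_of_pos (by positivity : 0 < 2 * π), abs_of_nonneg hx.1]
      linarith [hx.2]
    simp only [hx1, fourier_coe_apply, smul_eq_mul]
    rw [Complex.ofReal_exp, ← Complex.exp_add]
    congr 1
    push_cast
    field_simp
    ring
  have hneg : ∫ x in (-π : ℝ)..0, fourier (-m) (x : AddCircle (2 * π)) • (Real.exp (-n * ‖(x : AddCircle (2 * π))‖) : ℂ)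
      = ∫ x in (-π : ℝ)..0, Complex.exp ((n - m * Complex.I) * x) := by
    refine intervalIntegral.integral_congr fun x hx => ?_
    rw [Set.uIcc_of_le (by linarith)] at hx
    have hx1 : ‖(x : AddCircle (2 * π))‖ = -x := by
      rw [(AddCircle.norm_coe_eq_abs_iff (2 * π) (by positivity)).2, abs_of_nonpos hx.2]
      rw [abs_of_pos (by positivity : 0 < 2 * π), abs_of_nonpos hx.2]
      linarith [hx.1]
    simp only [hx1, fourier_coe_apply, smul_eq_mul]
    rw [Complex.ofReal_exp, ← Complex.exp_add]
    congr 1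
    push_cast
    field_simp
    ring
  have hI : ∀ a b : ℝ, IntervalIntegrable (fun x : ℝ => fourier (-m) (x : AddCircle (2 * π)) •
      (Real.exp (-n * ‖(x : AddCircle (2 * π))‖) : ℂ)) volume a b := fun a b => by
    refine Continuous.intervalIntegrable ?_ a b
    have h1 : Continuous fun x : ℝ => (x : AddCircle (2 * π)) := AddCircle.continuous_mk' _
    have h2 : Continuous fun y : AddCircle (2 * π) => fourier (-m) y • (Real.exp (-n * ‖y‖) : ℂ) := by fun_prop
    exact h2.comp h1
  rw [← intervalIntegral.integral_add_adjacent_intervals (hI (-π) 0) (hI 0 π), hpos, hneg]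
  have c1 : (-n - m * Complex.I : ℂ) ≠ 0 := fun h => by
    have := congrArg Complex.re h; simp at this; linarith
  have c2 : (n - m * Complex.I : ℂ) ≠ 0 := fun h => by
    have := congrArg Complex.re h; simp at this; linarith
  rw [integral_exp_mul_complex c1, integral_exp_mul_complex c2]
  have e1 : Complex.exp ((-n - m * Complex.I) * (π : ℝ)) = Real.cos (m * π) * Real.exp (-n * π) := by
    rw [show ((-n - m * Complex.I) * (π : ℝ) : ℂ) = ((-n * π : ℝ) : ℂ) + (-(m * π : ℝ) : ℝ) * Complex.I by push_cast; ring,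
      Complex.exp_add_mul_I, ← Complex.ofReal_exp, ← Complex.ofReal_cos, ← Complex.ofReal_sin, Real.cos_neg, Real.sin_neg,
      Real.sin_int_mul_pi]
    push_cast; ring
  have e2 : Complex.exp ((n - m * Complex.I) * (-π : ℝ)) = Real.cos (m * π) * Real.exp (-n * π) := by
    rw [show ((n - m * Complex.I) * (-π : ℝ) : ℂ) = ((-n * π : ℝ) : ℂ) + ((m * π : ℝ) : ℝ) * Complex.I by push_cast; ring,
      Complex.exp_add_mul_I, ← Complex.ofReal_exp, ← Complex.ofReal_cos, ← Complex.ofReal_sin, Real.sin_int_mul_pi]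
    push_cast; ring
  rw [e1, e2, expAbsCoef]
  have c3 : (n ^ 2 + m ^ 2 : ℂ) = (n - m * Complex.I) * (n + m * Complex.I) := by
    ring_nf; rw [Complex.I_sq]; ring
  have c4 : (n + m * Complex.I : ℂ) ≠ 0 := fun h => by
    have := congrArg Complex.re h; simp at this; linarith
  have c5 : (π : ℂ) ≠ 0 := by exact_mod_cast hpi.ne'
  rw [show (-n - m * Complex.I : ℂ) = -(n + m * Complex.I) by ring]
  simp only [Complex.ofReal_zero, mul_zero, Complex.exp_zero, Complex.real_smul]
  push_cast
  rw [c3]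
  field_simp
  ring

/-- Here cos(mπ) is replaced by 1. The bound is, up to the factor 1 - e^{-nπ}, proportional to n/(n²
+ m²), which explains why `ell`, a sum of `expAbs` with weights 1/n, reproduces the Green function.
-/
lemma expAbsCoef_lower {n : ℝ} (hn : 0 < n) (m : ℤ) :
    π⁻¹ * (n * (1 - Real.exp (-n * π)) / (n ^ 2 + m ^ 2)) ≤ expAbsCoef n m := by
  have hpi := Real.pi_pos
  have h1 := Real.cos_le_one (m * π)
  have h2 := Real.exp_pos (-n * π)
  unfold expAbsCoef
  gcongr
  nlinarith

lemma expAbsCoef_nonneg {n : ℝ} (hn : 0 < n) (m : ℤ) : 0 ≤ expAbsCoef n m := by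
  refine le_trans ?_ (expAbsCoef_lower hn m)
  have hpi := Real.pi_pos
  have : Real.exp (-n * π) ≤ 1 := Real.exp_le_one_iff.2 (by nlinarith)
  have : 0 ≤ 1 - Real.exp (-n * π) := by linarith
  positivity

lemma summable_expAbsCoef {n : ℝ} (hn : 1 ≤ n) : Summable (expAbsCoef n) := by
  refine Summable.of_nonneg_of_le (expAbsCoef_nonneg (by linarith)) (fun m => ?_)
    (summable_int_inv.mul_left (π⁻¹ * (n * 2)))
  have hpi := Real.pi_pos
  have h1 := Real.neg_one_le_cos (m * π)
  have h2 := Real.exp_pos (-n * π)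
  have h3 : Real.exp (-n * π) ≤ 1 := Real.exp_le_one_iff.2 (by nlinarith)
  rw [expAbsCoef, mul_assoc, div_eq_mul_inv]
  gcongr
  · nlinarith
  · nlinarith

/-- The function `x ↦ e^{-n|x₂|}`. -/
def expAbs (n : ℝ) : C(Torus, ℝ) := ⟨fun x => Real.exp (-n * ‖x.2‖), by fun_prop⟩

lemma cosT_snd (m : ℤ) (x : Torus) : cosT (0, m) x = (fourier m x.2).re := by
  rw [cosT_apply, ch_apply]; simp only [fourier_zero, one_mul]

lemma hasSum_expAbs {n : ℝ} (hn : 1 ≤ n) : HasSum (fun m : ℤ => expAbsCoef n m • cosT (0, m)) (expAbs n) := by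
  refine hasSum_of_pointwise (summable_expAbsCoef hn) (fun m x => ?_) fun x => ?_
  · rw [ContinuousMap.smul_apply, smul_eq_mul, abs_mul, abs_of_nonneg (expAbsCoef_nonneg (by linarith) m)]
    exact mul_le_of_le_one_right (expAbsCoef_nonneg (by linarith) m) (abs_cosT_le _ _)
  · let f : C(AddCircle (2 * π), ℂ) := ⟨fun y => (Real.exp (-n * ‖y‖) : ℂ), by fun_prop⟩
    have hf : ∀ m, fourierCoeff f m = expAbsCoef n m := fourierCoeff_expAbs (by linarith)
    have hs : Summable (fourierCoeff f) := by
      simp only [show fourierCoeff f = fun m => (expAbsCoef n m : ℂ) from funext hf]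
      exact_mod_cast summable_expAbsCoef hn
    have h := Complex.hasSum_re (has_pointwise_sum_fourier_series_of_summable hs x.2)
    have e1 : (f x.2).re = expAbs n x := Complex.ofReal_re _
    rw [e1] at h
    refine h.congr_fun fun m => ?_
    rw [hf, ContinuousMap.smul_apply, cosT_snd, smul_eq_mul, smul_eq_mul, Complex.re_ofReal_mul]

lemma ch_nsmul (n : ℕ) (v : ℤ × ℤ) (x : Torus) : ch (n • v) x = ch v x ^ n := by
  induction n with
  | zero => rw [zero_smul, pow_zero, ch_apply]; simp only [Prod.fst_zero, Prod.snd_zero, fourier_zero, mul_one]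
  | succ n ih =>
    rw [succ_nsmul, pow_succ, ← ih]
    simp only [ch_apply, Prod.fst_add, Prod.snd_add, fourier_add]
    ring

/-- The function `x ↦ -log |1 - r e^{i x₁ - |x₂|}|`. -/
def ell (r : ℝ) (hr : |r| < 1) : C(Torus, ℝ) :=
  ⟨fun x => -Real.log ‖1 - (r * Real.exp (-‖x.2‖) : ℝ) * ch (1, 0) x‖, by
    refine (Continuous.log (by fun_prop) fun x => ?_).neg
    rw [norm_ne_zero_iff, sub_ne_zero]
    intro h
    have := congrArg norm h
    rw [norm_one, norm_mul, norm_ch, mul_one, Complex.norm_real, Real.norm_eq_abs, abs_mul, Real.abs_exp] at this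
    have h2 : Real.exp (-‖x.2‖) ≤ 1 := Real.exp_le_one_iff.2 (by have := norm_nonneg x.2; linarith)
    have h3 := abs_nonneg r
    nlinarith [Real.exp_pos (-‖x.2‖)]⟩

/-- Real part of the Taylor series of -log(1 - w) at w = r exp(i x₁ - |x₂|). The term n = 0 vanishes
because division by 0 gives 0. -/
lemma hasSum_ell {r : ℝ} (hr0 : 0 ≤ r) (hr : |r| < 1) :
    HasSum (fun n : ℕ => (r ^ n / n) • (cosT (n, 0) * expAbs n)) (ell r hr) := by
  have hr1 : r < 1 := by rwa [abs_of_nonneg hr0] at hr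
  refine hasSum_of_pointwise (summable_geometric_of_lt_one hr0 hr1) (fun n x => ?_) fun x => ?_
  · rw [ContinuousMap.smul_apply, smul_eq_mul, ContinuousMap.mul_apply, abs_mul, abs_mul]
    have h1 : |expAbs n x| ≤ 1 := by
      change |Real.exp (-(n : ℝ) * ‖x.2‖)| ≤ 1
      rw [Real.abs_exp, Real.exp_le_one_iff]
      have := norm_nonneg x.2
      have : (0 : ℝ) ≤ n := n.cast_nonneg
      nlinarith
    have h2 : |r ^ n / n| ≤ r ^ n := by
      rw [abs_of_nonneg (by positivity)]
      rcases Nat.eq_zero_or_pos n with rfl | hn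
      · simp
      · exact div_le_self (by positivity) (by exact_mod_cast hn)
    calc |r ^ n / n| * (|cosT (n, 0) x| * |expAbs n x|) ≤ r ^ n * (1 * 1) := by
          gcongr
          exact abs_cosT_le _ _
      _ = r ^ n := by ring
  · set w : ℂ := (r * Real.exp (-‖x.2‖) : ℝ) * ch (1, 0) x with hw
    have hwn : ‖w‖ < 1 := by
      rw [hw, norm_mul, norm_ch, mul_one, Complex.norm_real, Real.norm_eq_abs, abs_mul, Real.abs_exp, abs_of_nonneg hr0]
      have h2 : Real.exp (-‖x.2‖) ≤ 1 := Real.exp_le_one_iff.2 (by have := norm_nonneg x.2; linarith)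
      nlinarith [Real.exp_pos (-‖x.2‖)]
    have h := Complex.hasSum_re (Complex.hasSum_taylorSeries_neg_log hwn)
    have e1 : (-Complex.log (1 - w)).re = ell r hr x := by
      rw [Complex.neg_re, Complex.log_re]; rfl
    rw [e1] at h
    refine h.congr_fun fun n => ?_
    have e2 : w ^ n / n = ((r ^ n / n * Real.exp (-(n : ℝ) * ‖x.2‖) : ℝ) : ℂ) * ch (n • (1, 0)) x := by
      rw [hw, ch_nsmul, mul_pow, ← Complex.ofReal_pow, mul_pow, ← Real.exp_nat_mul,
        show (n : ℝ) * -‖x.2‖ = -n * ‖x.2‖ by ring]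
      push_cast
      ring
    rw [e2, Complex.re_ofReal_mul, ContinuousMap.smul_apply, smul_eq_mul, ContinuousMap.mul_apply]
    have e3 : (ch (n • (1, 0)) x).re = cosT (n, 0) x := by
      rw [cosT_apply]; congr 3; simp
    rw [e3]
    change r ^ n / n * (_ * Real.exp (-(n : ℝ) * ‖x.2‖)) = _
    ring

/-- The Poisson kernel in the direction `v`. -/
def poisson (ρ : ℝ) (hρ : |ρ| < 1) (v : ℤ × ℤ) : C(Torus, ℝ) :=
  ⟨fun x => (1 - ρ ^ 2) / ‖1 - ρ * ch v x‖ ^ 2, by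
    refine continuous_const.div (by fun_prop) fun x => ?_
    refine pow_ne_zero _ ?_
    rw [norm_ne_zero_iff, sub_ne_zero]
    intro h
    have := congrArg norm h
    rw [norm_one, norm_mul, norm_ch, mul_one, Complex.norm_real, Real.norm_eq_abs] at this
    linarith⟩

lemma hasSum_poisson {ρ : ℝ} (hρ : |ρ| < 1) (v : ℤ × ℤ) :
    HasSum (fun n : ℕ => (2 * ρ ^ (n + 1)) • cosT ((n + 1) • v)) (poisson ρ hρ v - 1) := by
  have hs : Summable fun n : ℕ => 2 * |ρ| ^ (n + 1) :=
    (((summable_nat_add_iff 1).2 (summable_geometric_of_lt_one (abs_nonneg ρ) hρ))).mul_left 2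
  refine hasSum_of_pointwise hs (fun n x => ?_) fun x => ?_
  · rw [ContinuousMap.smul_apply, smul_eq_mul, abs_mul, abs_mul, abs_pow, abs_two]
    exact mul_le_of_le_one_right (by positivity) (abs_cosT_le _ _)
  · set w : ℂ := ρ * ch v x with hw
    have hwn : ‖w‖ = |ρ| := by rw [hw, norm_mul, norm_ch, mul_one, Complex.norm_real, Real.norm_eq_abs]
    have h1 := (hasSum_geometric_of_norm_lt_one (by rwa [hwn] : ‖w‖ < 1)).mul_left (2 * w)
    have h := Complex.hasSum_re h1
    have hne : 1 - w ≠ 0 := by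
      rw [sub_ne_zero]; intro h; rw [← h, norm_one] at hwn; linarith
    have e1 : (2 * w * (1 - w)⁻¹).re = (poisson ρ hρ v - 1) x := by
      have e : (poisson ρ hρ v - 1) x = (1 - ‖w‖ ^ 2) / ‖1 - w‖ ^ 2 - 1 := by rw [hwn, sq_abs]; rfl
      have hne' : Complex.normSq (1 - w) ≠ 0 := by rwa [ne_eq, Complex.normSq_eq_zero]
      rw [e, ← Complex.normSq_eq_norm_sq, ← Complex.normSq_eq_norm_sq, Complex.inv_def, ← mul_assoc,
        Complex.re_mul_ofReal, eq_sub_iff_add_eq, div_eq_mul_inv]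
      have e3 : (2 * w * conj (1 - w)).re + Complex.normSq (1 - w) = 1 - Complex.normSq w := by
        simp [Complex.normSq_apply]
        ring
      rw [← e3, add_mul, mul_inv_cancel₀ hne']
    rw [e1] at h
    refine h.congr_fun fun n => ?_
    have e2 : 2 * w * w ^ n = ((2 * ρ ^ (n + 1) : ℝ) : ℂ) * ch ((n + 1) • v) x := by
      rw [hw, ch_nsmul, mul_assoc, ← pow_succ', mul_pow]
      push_cast
      ring
    rw [e2, Complex.re_ofReal_mul]
    rfl

/-! ### Pointwise bounds -/

/-- One has |1 - ρe^{is}|² = (ρ - cos s)² + sin² s. If cos s ≤ 0 this is at least 1; otherwise it is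
at least sin² s, and |sin s| ≥ 2|s|/π by concavity. The bound does not depend on ρ. -/
lemma norm_one_sub_ge {ρ : ℝ} (hρ : 0 ≤ ρ) (x : AddCircle (2 * π)) : ‖x‖ / π ≤ ‖1 - ρ * fourier 1 x‖ := by
  have hpi := Real.pi_pos
  obtain ⟨s, h1, h2, rfl⟩ := exists_rep_Ioc x
  rw [h2]
  refine abs_le_of_sq_le_sq' ?_ (norm_nonneg _) |>.2
  have e : fourier 1 (s : AddCircle (2 * π)) = Real.cos s + Real.sin s * Complex.I := by
    rw [fourier_coe_apply, Complex.ofReal_cos, Complex.ofReal_sin, ← Complex.exp_mul_I]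
    congr 1
    push_cast
    field_simp
  rw [← Complex.normSq_eq_norm_sq, e, Complex.normSq_apply]
  simp only [Complex.sub_re, Complex.sub_im, Complex.one_re, Complex.one_im, Complex.re_ofReal_mul, Complex.im_ofReal_mul,
    Complex.add_re, Complex.add_im, Complex.ofReal_re, Complex.ofReal_im, Complex.mul_re, Complex.mul_im, Complex.I_re,
    Complex.I_im]
  have hcs := Real.sin_sq_add_cos_sq s
  have h3 : (|s| / π) ^ 2 ≤ 1 := by
    rw [div_pow, div_le_one (by positivity)]
    exact pow_le_pow_left₀ (abs_nonneg _) h1 2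
  rcases le_total (Real.cos s) 0 with hc | hc
  · nlinarith [mul_nonneg hρ (neg_nonneg.2 hc)]
  · have h4 : |s| ≤ π / 2 := by
      by_contra hlt
      push Not at hlt
      have := Real.cos_neg_of_pi_div_two_lt_of_lt hlt (by linarith)
      rw [Real.cos_abs] at this
      linarith
    have h5 := Real.mul_abs_le_abs_sin h4
    have h6 : |s| / π ≤ |Real.sin s| := by
      refine le_trans ?_ h5
      rw [div_mul_eq_mul_div]
      gcongr
      linarith [abs_nonneg s]
    have h7 := pow_le_pow_left₀ (by positivity) h6 2
    rw [sq_abs] at h7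
    nlinarith [sq_nonneg (ρ - Real.cos s)]

lemma one_sub_le_norm {ρ : ℝ} (hρ : 0 ≤ ρ) {z : ℂ} (hz : ‖z‖ = 1) : 1 - ρ ≤ ‖1 - ρ * z‖ := by
  have := norm_sub_norm_le (1 : ℂ) (ρ * z)
  rwa [norm_one, norm_mul, hz, mul_one, Complex.norm_real, Real.norm_of_nonneg hρ] at this

end

end WickExp

namespace WickExp

noncomputable section

/-! ### Uniform bounds for the exponential of the Green function -/

/-- The box `[-R, R]²` of frequencies. -/
def box (R : ℕ) : Finset (ℤ × ℤ) := Finset.Icc (-R : ℤ) R ×ˢ Finset.Icc (-R : ℤ) R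

lemma subset_box (F : Finset (ℤ × ℤ)) : ∃ R, F ⊆ box R := by
  refine ⟨∑ k ∈ F, (k.1.natAbs + k.2.natAbs), fun k hk => ?_⟩
  have := Finset.single_le_sum (f := fun k : ℤ × ℤ => k.1.natAbs + k.2.natAbs) (fun _ _ => Nat.zero_le _) hk
  simp only [box, Finset.mem_product, Finset.mem_Icc]
  omega

lemma cosT_mul_cosT (n m : ℤ) :
    cosT (n, 0) * cosT (0, m) = (1 / 2 : ℝ) • cosT (n, m) + (1 / 2 : ℝ) • cosT (n, -m) := by
  ext x
  simp only [ContinuousMap.mul_apply, ContinuousMap.add_apply, ContinuousMap.smul_apply, cosT_apply, ch_apply,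
    fourier_zero, fourier_neg, smul_eq_mul, mul_one, one_mul, Complex.mul_re, Complex.conj_re, Complex.conj_im]
  ring

/-- The product cos(n x₁) cos(m x₂) is the average of the cosines at (n, m) and (n, -m). On
coefficients even in m the cosine sum therefore separates the two variables, as the explicit kernels
do. -/
lemma sum_box {c : ℤ → ℤ → ℝ} (hc : ∀ n m, c n (-m) = c n m) (R : ℕ) :
    ∑ k ∈ box R, c k.1 k.2 • cosT k = ∑ n ∈ Finset.Icc (-R : ℤ) R, ∑ m ∈ Finset.Icc (-R : ℤ) R,
      c n m • (cosT (n, 0) * cosT (0, m)) := by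
  rw [box, Finset.sum_product]
  refine Finset.sum_congr rfl fun n _ => ?_
  have h1 : ∑ m ∈ Finset.Icc (-R : ℤ) R, c n m • cosT (n, -m) = ∑ m ∈ Finset.Icc (-R : ℤ) R, c n m • cosT (n, m) := by
    refine Finset.sum_nbij' (fun m => -m) (fun m => -m) ?_ ?_ (by simp) (by simp) (by simp [hc])
    · intro m hm; rw [Finset.mem_Icc] at hm ⊢; omega
    · intro m hm; rw [Finset.mem_Icc] at hm ⊢; omega
  simp only [cosT_mul_cosT, smul_add, smul_comm (c n _) (1 / 2 : ℝ)]
  rw [Finset.sum_add_distrib, ← Finset.smul_sum, ← Finset.smul_sum, h1, ← add_smul]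
  norm_num

lemma sum_Icc_fold {M : Type*} [AddCommMonoid M] (f : ℤ → M) (R : ℕ) :
    ∑ j ∈ Finset.Icc (-R : ℤ) R, f j = f 0 + ∑ n ∈ Finset.range R, (f (n + 1) + f (-(n + 1))) := by
  induction R with
  | zero => simp
  | succ R ih =>
    have : Finset.Icc (-(R + 1 : ℕ) : ℤ) (R + 1 : ℕ)
        = insert ((R : ℤ) + 1) (insert (-((R : ℤ) + 1)) (Finset.Icc (-R : ℤ) R)) := by
      ext j; simp only [Finset.mem_Icc, Finset.mem_insert]; push_cast; omega
    rw [this, Finset.sum_insert, Finset.sum_insert, ih, Finset.sum_range_succ]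
    · abel
    · simp only [Finset.mem_Icc]; omega
    · simp only [Finset.mem_insert, Finset.mem_Icc]; omega

/-- Three lowerings in the positive definite order: the series of `ell` is truncated, then that of
each `expAbs`, and finally the coefficients are replaced by those of `expAbsCoef_lower`. -/
lemma isPD_ell_sub {r : ℝ} (hr0 : 0 ≤ r) (hr : |r| < 1) (R : ℕ) :
    IsPD ((2 * π)⁻¹ • ell r hr - ∑ n ∈ Finset.range R, ∑ m ∈ Finset.Icc (-R : ℤ) R,
      (2 * ((2 * π) ^ 2)⁻¹ * (r ^ (n + 1) * (1 - Real.exp (-(n + 1) * π)) / ((n + 1) ^ 2 + m ^ 2))) •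
        (cosT (n + 1, 0) * cosT (0, m))) := by
  have hpi := Real.pi_pos
  have hexp : ∀ n : ℕ, 1 ≤ n → IsPD (expAbs n) := fun n hn =>
    IsPD.of_hasSum (fun m => (IsPD.cosT _).smul (expAbsCoef_nonneg (by exact_mod_cast hn) m))
      (hasSum_expAbs (by exact_mod_cast hn))
  have h1 := IsPD.sub_sum (fun n => by
    rcases Nat.eq_zero_or_pos n with rfl | hn
    · simpa using IsPD.zero
    · exact ((IsPD.cosT (n, 0)).mul (hexp n hn)).smul (by positivity)) (hasSum_ell hr0 hr) (Finset.range (R + 1))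
  rw [Finset.sum_range_succ'] at h1
  simp only [Nat.cast_zero, div_zero, zero_smul, add_zero] at h1
  have h2 := h1.smul_sub' (c := (2 * π)⁻¹) (by positivity)
  refine h2.sub_trans ?_
  rw [Finset.smul_sum]
  refine IsPD.sum_sub fun n _ => ?_
  have hn : (1 : ℝ) ≤ ((n + 1 : ℕ) : ℝ) := by push_cast; linarith [(n.cast_nonneg : (0 : ℝ) ≤ n)]
  have h3 := IsPD.sub_sum (fun m => (IsPD.cosT (0, m)).smul (expAbsCoef_nonneg (by linarith) m)) (hasSum_expAbs hn)
    (Finset.Icc (-R : ℤ) R)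
  have h4 := (((h3.mul_sub' (IsPD.cosT (((n + 1 : ℕ) : ℤ), 0))).smul_sub'
    (c := r ^ (n + 1) / ((n + 1 : ℕ) : ℝ)) (by positivity))).smul_sub' (c := (2 * π)⁻¹) (by positivity)
  refine h4.sub_trans ?_
  rw [Finset.mul_sum, Finset.smul_sum, Finset.smul_sum]
  refine IsPD.sum_sub fun m _ => ?_
  rw [mul_smul_comm, smul_smul, smul_smul]
  have h5 := expAbsCoef_lower (n := ((n + 1 : ℕ) : ℝ)) (by linarith) m
  push_cast
  refine ((IsPD.cosT _).mul (IsPD.cosT _)).smul_sub_smul ?_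
  push_cast at h5
  calc 2 * ((2 * π) ^ 2)⁻¹ * (r ^ (n + 1) * (1 - Real.exp (-(n + 1) * π)) / ((n + 1) ^ 2 + m ^ 2))
      = (2 * π)⁻¹ * (r ^ (n + 1) / (n + 1) * (π⁻¹ * ((n + 1) * (1 - Real.exp (-(n + 1) * π)) / ((n + 1) ^ 2 + m ^ 2)))) := by
        field_simp
    _ ≤ _ := by rw [mul_assoc]; gcongr

/-- The part of the Green function that the explicit kernel `ell` does not control. -/
def rest (R : ℕ) : C(Torus, ℝ) := ∑ k ∈ box R, (((2 * π) ^ 2 * lam k)⁻¹ * Real.exp (-|(k.1 : ℝ)| * π)) • cosT k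

/-- The factor e^{-|k₁|π} is at most 1/(1 + k₁²), so the coefficients are dominated by a summable
family independent of R. -/
lemma exists_rest_le : ∃ D, ∀ R x, rest R x ≤ D := by
  have hpi := Real.pi_pos
  have hs := summable_int_inv.mul_of_nonneg summable_int_inv (fun n => by positivity) (fun n => by positivity)
  refine ⟨∑' k : ℤ × ℤ, (1 + (k.1 : ℝ) ^ 2)⁻¹ * (1 + (k.2 : ℝ) ^ 2)⁻¹, fun R x => ?_⟩
  rw [rest, ContinuousMap.sum_apply]
  refine le_trans (Finset.sum_le_sum fun k _ => ?_) (hs.sum_le_tsum (box R) fun k _ => by positivity)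
  have hl := lam_pos k
  have h1 : Real.exp (-|(k.1 : ℝ)| * π) ≤ (1 + (k.1 : ℝ) ^ 2)⁻¹ := by
    rw [neg_mul, Real.exp_neg]
    refine inv_anti₀ (by positivity) ?_
    have := Real.quadratic_le_exp_of_nonneg (x := |(k.1 : ℝ)| * π) (by positivity)
    have h3 := Real.pi_gt_three
    have h4 := sq_abs (k.1 : ℝ)
    have h5 : 0 ≤ |(k.1 : ℝ)| * π := by positivity
    have h6 : (k.1 : ℝ) ^ 2 * 2 ≤ (|(k.1 : ℝ)| * π) ^ 2 := by
      rw [mul_pow, h4]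
      gcongr
      nlinarith
    linarith
  have h2 : ((2 * π) ^ 2 * lam k)⁻¹ ≤ (1 + (k.2 : ℝ) ^ 2)⁻¹ := by
    refine inv_anti₀ (by positivity) ?_
    have h3 := Real.pi_gt_three
    have h4 : 1 + (k.2 : ℝ) ^ 2 ≤ lam k := by unfold lam; nlinarith [sq_nonneg (k.1 : ℝ)]
    have h5 : 1 ≤ (2 * π) ^ 2 := by nlinarith
    nlinarith
  have h3 := (abs_le.1 (abs_cosT_le k x)).2
  rw [ContinuousMap.smul_apply, smul_eq_mul]
  calc ((2 * π) ^ 2 * lam k)⁻¹ * Real.exp (-|(k.1 : ℝ)| * π) * cosT k x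
      ≤ ((2 * π) ^ 2 * lam k)⁻¹ * Real.exp (-|(k.1 : ℝ)| * π) * 1 := by gcongr
    _ ≤ (1 + (k.2 : ℝ) ^ 2)⁻¹ * (1 + (k.1 : ℝ) ^ 2)⁻¹ := by rw [mul_one]; gcongr
    _ = _ := mul_comm _ _

/-- A comparison of coefficients. For n ≥ 1 the columns ±n of the Green function combine and lie
below those of `ell`, since r^R ≤ rⁿ and λ_k ≥ n² + m². The kernel `rest` compensates both the
factors 1 - e^{-nπ} and the column n = 0, where `ell` has no modes. -/
lemma isPD_ell_sub_green {r : ℝ} (hr0 : 0 ≤ r) (hr : |r| < 1) (R : ℕ) :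
    IsPD ((2 * π)⁻¹ • ell r hr + rest R - r ^ R • green (box R)) := by
  have hpi := Real.pi_pos
  have hr1 : r ≤ 1 := by rw [abs_of_nonneg hr0] at hr; exact hr.le
  set c : ℤ → ℤ → ℝ := fun n m => ((2 * π) ^ 2 * lam (n, m))⁻¹ * (r ^ R - Real.exp (-|(n : ℝ)| * π)) with hc
  have e1 : (2 * π)⁻¹ • ell r hr + rest R - r ^ R • green (box R)
      = (2 * π)⁻¹ • ell r hr - ∑ k ∈ box R, c k.1 k.2 • cosT k := by
    rw [rest, green, Finset.smul_sum, add_sub_assoc, ← Finset.sum_sub_distrib, sub_eq_add_neg, ← Finset.sum_neg_distrib]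
    congr 1
    refine Finset.sum_congr rfl fun k _ => ?_
    rw [smul_smul, ← sub_smul, ← neg_smul, hc]
    congr 1
    ring
  rw [e1, sum_box (fun n m => by simp [hc, lam]), sum_Icc_fold]
  refine (isPD_ell_sub hr0 hr R).sub_trans ?_
  rw [add_comm]
  -- On the column n = 0 the coefficients left after subtracting `rest` are multiples of r^R - 1 ≤
  -- 0.
  have h0 : IsPD (-∑ m ∈ Finset.Icc (-R : ℤ) R, c 0 m • (cosT (0, 0) * cosT (0, m))) := by
    rw [← Finset.sum_neg_distrib]
    refine IsPD.sum fun m _ => ?_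
    rw [← neg_smul]
    refine ((IsPD.cosT _).mul (IsPD.cosT _)).smul ?_
    have hl := lam_pos (0, m)
    have h1 : r ^ R ≤ 1 := pow_le_one₀ hr0 hr1
    simp only [hc, Int.cast_zero, abs_zero, neg_zero, zero_mul, Real.exp_zero, ← mul_neg, neg_sub]
    have : 0 ≤ 1 - r ^ R := by linarith
    positivity
  rw [← sub_sub, sub_eq_add_neg _ (∑ m ∈ _, _)]
  refine IsPD.add (IsPD.sum_sub fun n hn => ?_) h0
  rw [← Finset.sum_add_distrib]
  refine IsPD.sum_sub fun m _ => ?_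
  have e2 : cosT (-((n : ℤ) + 1), 0) = cosT ((n : ℤ) + 1, 0) := by
    rw [← cosT_neg]; simp
  have e3 : c (-((n : ℤ) + 1)) m = c (n + 1) m := by
    simp only [hc, lam]; push_cast; rw [abs_neg]; ring_nf
  rw [e2, e3, ← add_smul]
  refine ((IsPD.cosT _).mul (IsPD.cosT _)).smul_sub_smul ?_
  have hn0 : (0 : ℝ) ≤ n := n.cast_nonneg
  simp only [hc, lam]
  push_cast
  rw [abs_of_nonneg (by positivity : (0 : ℝ) ≤ n + 1), ← two_mul, mul_assoc 2, mul_inv, mul_assoc _⁻¹]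
  gcongr
  rw [div_eq_inv_mul]
  set e := Real.exp (-(n + 1) * π)
  have he0 : 0 ≤ e := (Real.exp_pos _).le
  have he1 : e ≤ 1 := Real.exp_le_one_iff.2 (by nlinarith)
  have hrn : r ^ R ≤ r ^ (n + 1) := pow_le_pow_of_le_one hr0 hr1 (by rw [Finset.mem_range] at hn; omega)
  have hq1 : r ^ (n + 1) ≤ 1 := pow_le_one₀ hr0 hr1
  have hq0 : 0 ≤ r ^ (n + 1) := pow_nonneg hr0 _
  have k1 : r ^ R - e ≤ r ^ (n + 1) * (1 - e) := by nlinarith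
  have k2 : 0 ≤ r ^ (n + 1) * (1 - e) := mul_nonneg hq0 (by linarith)
  calc (1 + (((n : ℝ) + 1) ^ 2 + (m : ℝ) ^ 2))⁻¹ * (r ^ R - e)
      ≤ (1 + (((n : ℝ) + 1) ^ 2 + (m : ℝ) ^ 2))⁻¹ * (r ^ (n + 1) * (1 - e)) := by gcongr
    _ ≤ _ := mul_le_mul_of_nonneg_right (inv_anti₀ (by positivity) (by linarith)) k2

end

end WickExp

/-! ### Dyadic Poisson kernels and the uniform energy bound -/

namespace WickExp

noncomputable section

/-- The parameters of a dyadic family of Poisson kernels. -/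
def dyadic (j : ℕ) : ℝ := 1 - (1 / 2) ^ (j + 1)

lemma dyadic_nonneg (j : ℕ) : 0 ≤ dyadic j :=
  sub_nonneg.2 (pow_le_one₀ (by norm_num) (by norm_num))

lemma abs_dyadic (j : ℕ) : |dyadic j| < 1 := by
  rw [abs_of_nonneg (dyadic_nonneg j), dyadic]
  linarith [pow_pos (by norm_num : (0 : ℝ) < 1 / 2) (j + 1)]

/-- One term suffices, the one with 2^j ≤ max(1, |k₁|, |k₂|) < 2^{j+1}. There λ_k ≥ 4^j, and by
Bernoulli (1 - 2^{-j-1})ⁿ ≥ 1/4 for n ≤ 2^{j+1}; the constant 16 compensates one factor 1/4 per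
coordinate. -/
lemma lam_rpow_le {α : ℝ} (hα : 0 < α) {R : ℕ} {k : ℤ × ℤ} (hk : k ∈ box R) :
    lam k ^ (-α) ≤ ∑ j ∈ Finset.range (R + 1), 16 * ((2 : ℝ) ^ j) ^ (-2 * α) *
      (dyadic j ^ k.1.natAbs * dyadic j ^ k.2.natAbs) := by
  set M : ℕ := max 1 (max k.1.natAbs k.2.natAbs) with hM
  set j := Nat.log 2 M with hj
  simp only [box, Finset.mem_product, Finset.mem_Icc] at hk
  have hM1 : 1 ≤ M := le_max_left _ _
  have hMa : k.1.natAbs ≤ M := (le_max_left _ _).trans (le_max_right _ _)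
  have hMb : k.2.natAbs ≤ M := (le_max_right _ _).trans (le_max_right _ _)
  have hjM : 2 ^ j ≤ M := Nat.pow_log_le_self 2 (by omega)
  have hMj : M < 2 ^ (j + 1) := Nat.lt_pow_succ_log_self one_lt_two M
  have hjR : j ∈ Finset.range (R + 1) := by
    rw [Finset.mem_range]
    have h1 : M ≤ max 1 R := by omega
    have h2 : j < 2 ^ j := Nat.lt_two_pow_self
    omega
  refine le_trans ?_ (Finset.single_le_sum (f := fun j => 16 * ((2 : ℝ) ^ j) ^ (-2 * α) *
      (dyadic j ^ k.1.natAbs * dyadic j ^ k.2.natAbs)) (fun j _ => by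
        have := dyadic_nonneg j; positivity) hjR)
  have h1 : ((2 : ℝ) ^ j) ^ 2 ≤ lam k := by
    have h2 : (2 : ℝ) ^ j ≤ M := by exact_mod_cast hjM
    refine (pow_le_pow_left₀ (by positivity) h2 2).trans ?_
    have e1 : ((k.1.natAbs : ℕ) : ℝ) ^ 2 = (k.1 : ℝ) ^ 2 := by
      rw [Nat.cast_natAbs, Int.cast_abs, sq_abs]
    have e2 : ((k.2.natAbs : ℕ) : ℝ) ^ 2 = (k.2 : ℝ) ^ 2 := by
      rw [Nat.cast_natAbs, Int.cast_abs, sq_abs]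
    unfold lam
    rw [← e1, ← e2]
    rcases max_choice 1 (max k.1.natAbs k.2.natAbs) with h | h
    · rw [hM, h]; push_cast; nlinarith [sq_nonneg (k.1.natAbs : ℝ), sq_nonneg (k.2.natAbs : ℝ)]
    · rcases max_choice k.1.natAbs k.2.natAbs with h' | h'
      · rw [hM, h, h']; nlinarith [sq_nonneg (k.2.natAbs : ℝ)]
      · rw [hM, h, h']; nlinarith [sq_nonneg (k.1.natAbs : ℝ)]
  have h2 : lam k ^ (-α) ≤ ((2 : ℝ) ^ j) ^ (-2 * α) := by
    have : ((2 : ℝ) ^ j) ^ (-2 * α) = (((2 : ℝ) ^ j) ^ 2) ^ (-α) := by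
      rw [← Real.rpow_natCast _ 2, ← Real.rpow_mul (by positivity)]
      congr 1
      push_cast; ring
    rw [this]
    exact Real.rpow_le_rpow_of_nonpos (by positivity) h1 (by linarith)
  have h3 : (1 / 2 : ℝ) ≤ dyadic j ^ 2 ^ j := by
    have := one_add_mul_le_pow (a := -(1 / 2 : ℝ) ^ (j + 1)) (by
      have := pow_le_one₀ (n := j + 1) (by norm_num : (0 : ℝ) ≤ 1 / 2) (by norm_num); linarith) (2 ^ j)
    rw [← sub_eq_add_neg] at this
    refine le_trans (le_of_eq ?_) this
    push_cast
    rw [pow_succ]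
    have e : (2 : ℝ) ^ j * (1 / 2) ^ j = 1 := by rw [← mul_pow]; norm_num
    linear_combination (1 / 2) * e
  have h4 : (1 / 4 : ℝ) ≤ dyadic j ^ 2 ^ (j + 1) := by
    rw [pow_succ, pow_mul]
    nlinarith
  have h5 : ∀ n, n ≤ M → (1 / 4 : ℝ) ≤ dyadic j ^ n := fun n hn => h4.trans
    (pow_le_pow_of_le_one (dyadic_nonneg j) (by have := abs_dyadic j; rw [abs_lt] at this; linarith [this.2]) (by omega))
  have h6 := mul_le_mul (h5 _ hMa) (h5 _ hMb) (by norm_num) (pow_nonneg (dyadic_nonneg j) _)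
  have h7 : (0 : ℝ) ≤ ((2 : ℝ) ^ j) ^ (-2 * α) := by positivity
  nlinarith

lemma isPD_poisson_sub {ρ : ℝ} (hρ0 : 0 ≤ ρ) (hρ : |ρ| < 1) (v : ℤ × ℤ) (R : ℕ) :
    IsPD (poisson ρ hρ v - ∑ n ∈ Finset.Icc (-R : ℤ) R, ρ ^ n.natAbs • cosT (n • v)) := by
  have h := IsPD.sub_sum (fun n => (IsPD.cosT ((n + 1) • v)).smul (by positivity : 0 ≤ 2 * ρ ^ (n + 1)))
    (hasSum_poisson hρ v) (Finset.range R)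
  convert h using 1
  rw [sum_Icc_fold, sub_sub]
  congr 2
  · simp [cosT_zero]
  · refine Finset.sum_congr rfl fun n _ => ?_
    have e : ((n : ℤ) + 1) • v = (n + 1) • v := by exact_mod_cast natCast_zsmul v (n + 1)
    rw [neg_smul, cosT_neg, Int.natAbs_neg, ← add_smul, show ((n : ℤ) + 1).natAbs = n + 1 by omega,
      ← two_mul (ρ ^ (n + 1)), e]

lemma isPD_poisson {ρ : ℝ} (hρ0 : 0 ≤ ρ) (hρ : |ρ| < 1) (v : ℤ × ℤ) : IsPD (poisson ρ hρ v) := by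
  have h1 := isPD_poisson_sub hρ0 hρ v 0
  have h2 : IsPD (∑ n ∈ Finset.Icc (-(0 : ℕ) : ℤ) (0 : ℕ), ρ ^ n.natAbs • cosT (n • v)) :=
    IsPD.sum fun n _ => (IsPD.cosT _).smul (by positivity)
  simpa using h1.add h2

/-- A positive definite function whose Fourier coefficients dominate `λ_k^{-α}` on the box. -/
def dom (α : ℝ) (R : ℕ) : C(Torus, ℝ) := ∑ j ∈ Finset.range (R + 1), (16 * ((2 : ℝ) ^ j) ^ (-2 * α)) •
  (poisson (dyadic j) (abs_dyadic j) (1, 0) * poisson (dyadic j) (abs_dyadic j) (0, 1))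

/-- The product of two Poisson kernels has the coefficients ρ^{|k₁|+|k₂|}. Truncation to the box
lowers it in the order, and `lam_rpow_le` compares the sums over j. -/
lemma isPD_dom_sub {α : ℝ} (hα : 0 < α) (R : ℕ) : IsPD (dom α R - ∑ k ∈ box R, lam k ^ (-α) • cosT k) := by
  have h1 : IsPD (dom α R - ∑ j ∈ Finset.range (R + 1), (16 * ((2 : ℝ) ^ j) ^ (-2 * α)) •
      ∑ k ∈ box R, (dyadic j ^ k.1.natAbs * dyadic j ^ k.2.natAbs) • cosT k) := by
    refine IsPD.sum_sub fun j _ => IsPD.smul_sub' ?_ (by positivity)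
    have h0 := dyadic_nonneg j
    rw [sum_box (c := fun n m => dyadic j ^ n.natAbs * dyadic j ^ m.natAbs) (fun n m => by simp)]
    have e : ∑ n ∈ Finset.Icc (-R : ℤ) R, ∑ m ∈ Finset.Icc (-R : ℤ) R,
        (dyadic j ^ n.natAbs * dyadic j ^ m.natAbs) • (cosT (n, 0) * cosT (0, m))
        = (∑ n ∈ Finset.Icc (-R : ℤ) R, dyadic j ^ n.natAbs • cosT (n • (1, 0)))
          * ∑ m ∈ Finset.Icc (-R : ℤ) R, dyadic j ^ m.natAbs • cosT (m • (0, 1)) := by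
      rw [Finset.sum_mul_sum]
      refine Finset.sum_congr rfl fun n _ => Finset.sum_congr rfl fun m _ => ?_
      rw [smul_mul_smul_comm]
      simp
    rw [e]
    exact (isPD_poisson h0 _ _).mul_sub_mul (IsPD.sum fun n _ => (IsPD.cosT _).smul (by positivity))
      (isPD_poisson_sub h0 _ _ _) (isPD_poisson_sub h0 _ _ _)
  refine h1.sub_trans ?_
  simp only [Finset.smul_sum]
  rw [Finset.sum_comm]
  refine IsPD.sum_sub fun k hk => ?_
  simp only [smul_smul]
  rw [← Finset.sum_smul]
  exact (IsPD.cosT k).smul_sub_smul (lam_rpow_le hα hk)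

lemma ch_fst (x : Torus) : ch (1, 0) x = fourier 1 x.1 := by rw [ch_apply]; simp only [fourier_zero, mul_one]

lemma ch_snd (x : Torus) : ch (0, 1) x = fourier 1 x.2 := by rw [ch_apply]; simp only [fourier_zero, one_mul]

/-- With t = 2^{-j-1} the modulus in the denominator is at least t and at least ‖y‖/π. Interpolating
its square between the two bounds with weights 2 - s and s trades growth in j for a singularity of
order s. -/
lemma poisson_le {j : ℕ} {v : ℤ × ℤ} {x : Torus} {y : AddCircle (2 * π)} (hv : ch v x = fourier 1 y) (hy : 0 < ‖y‖)
    {s : ℝ} (hs0 : 0 ≤ s) (hs2 : s ≤ 2) :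
    poisson (dyadic j) (abs_dyadic j) v x ≤ 2 * π ^ s * ((1 / 2 : ℝ) ^ (j + 1)) ^ (s - 1) * ‖y‖ ^ (-s) := by
  have hpi := Real.pi_pos
  set t : ℝ := (1 / 2 : ℝ) ^ (j + 1) with ht
  have ht0 : 0 < t := by positivity
  have hd0 := dyadic_nonneg j
  have hd : dyadic j = 1 - t := rfl
  set A := ‖1 - dyadic j * ch v x‖ with hA
  have h1 : t ≤ A := by
    have := one_sub_le_norm hd0 (norm_ch v x)
    rw [hd] at this
    rw [hA, hd]
    linarith
  have h2 : ‖y‖ / π ≤ A := by rw [hA, hv]; exact norm_one_sub_ge hd0 y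
  have hA0 : 0 < A := ht0.trans_le h1
  have h3 : t ^ (2 - s) * (‖y‖ / π) ^ s ≤ A ^ 2 := by
    rw [← Real.rpow_natCast A 2, show ((2 : ℕ) : ℝ) = (2 - s) + s by push_cast; ring, Real.rpow_add hA0]
    gcongr
  change (1 - dyadic j ^ 2) / A ^ 2 ≤ _
  have h4 : 1 - dyadic j ^ 2 ≤ 2 * t := by rw [hd]; nlinarith
  calc (1 - dyadic j ^ 2) / A ^ 2 ≤ 2 * t / (t ^ (2 - s) * (‖y‖ / π) ^ s) := by
        gcongr
    _ = _ := by
        rw [Real.div_rpow hy.le hpi.le, Real.rpow_neg hy.le, show (2 - s) = 1 - (s - 1) by ring, Real.rpow_sub ht0 1,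
          Real.rpow_one]
        have := Real.rpow_pos_of_pos ht0 (s - 1)
        have := Real.rpow_pos_of_pos hy s
        have := Real.rpow_pos_of_pos hpi s
        field_simp

lemma poisson_nonneg {ρ : ℝ} (hρ : |ρ| < 1) (v : ℤ × ℤ) (x : Torus) : 0 ≤ poisson ρ hρ v x := by
  refine div_nonneg ?_ (sq_nonneg _)
  rw [sub_nonneg, sq_le_one_iff_abs_le_one]
  exact hρ.le

/-- The modulus under the logarithm is at least ‖x₁‖/(1+π) and at least ‖x₂‖/(1+π), so its square
dominates their product. The planar singularity becomes a product of one-dimensional ones, uniformly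
in r. -/
lemma exp_ell_le {r : ℝ} (hr0 : 0 ≤ r) (hr : |r| < 1) {x : Torus} (h1 : 0 < ‖x.1‖) (h2 : 0 < ‖x.2‖) {c : ℝ} (hc : 0 ≤ c) :
    Real.exp (c * ell r hr x) ≤ (1 + π) ^ c * (‖x.1‖ * ‖x.2‖) ^ (-(c / 2)) := by
  have hpi := Real.pi_pos
  have hr1 : r ≤ 1 := by rw [abs_of_nonneg hr0] at hr; exact hr.le
  set A := ‖1 - (r * Real.exp (-‖x.2‖) : ℝ) * ch (1, 0) x‖ with hA
  have hρ : 0 ≤ r * Real.exp (-‖x.2‖) := by positivity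
  have k1 : ‖x.1‖ / (1 + π) ≤ A := by
    have := norm_one_sub_ge hρ x.1
    rw [← ch_fst] at this
    refine le_trans ?_ this
    gcongr
    linarith
  have k2 : ‖x.2‖ / (1 + π) ≤ A := by
    refine le_trans ?_ (one_sub_le_norm hρ (norm_ch (1, 0) x))
    have e1 : r * Real.exp (-‖x.2‖) ≤ (1 + ‖x.2‖)⁻¹ := by
      calc r * Real.exp (-‖x.2‖) ≤ 1 * Real.exp (-‖x.2‖) := by gcongr
        _ ≤ _ := by
            rw [one_mul, Real.exp_neg]
            exact inv_anti₀ (by positivity) (by linarith [Real.add_one_le_exp ‖x.2‖])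
    have e2 : ‖x.2‖ / (1 + π) ≤ 1 - (1 + ‖x.2‖)⁻¹ := by
      have : 1 - (1 + ‖x.2‖)⁻¹ = ‖x.2‖ / (1 + ‖x.2‖) := by field_simp; ring
      rw [this]
      gcongr
      exact norm_circle_le _
    linarith
  have hA0 : 0 < A := lt_of_lt_of_le (by positivity) k1
  have k3 : ‖x.1‖ * ‖x.2‖ / (1 + π) ^ 2 ≤ A ^ 2 := by
    have := mul_le_mul k1 k2 (by positivity) hA0.le
    rw [sq, sq, mul_div_mul_comm]; exact this
  have e : Real.exp (c * ell r hr x) = (A ^ 2) ^ (-(c / 2)) := by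
    rw [← Real.rpow_natCast A 2, ← Real.rpow_mul hA0.le, Real.rpow_def_of_pos hA0]
    congr 1
    change c * -Real.log A = _
    push_cast; ring
  rw [e]
  calc (A ^ 2) ^ (-(c / 2)) ≤ (‖x.1‖ * ‖x.2‖ / (1 + π) ^ 2) ^ (-(c / 2)) :=
        Real.rpow_le_rpow_of_nonpos (by positivity) k3 (by linarith)
    _ = _ := by
        rw [Real.div_rpow (by positivity) (by positivity), ← Real.rpow_natCast (1 + π) 2, ← Real.rpow_mul (by positivity),
          div_eq_mul_inv, ← Real.rpow_neg (by positivity), mul_comm]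
        congr 2
        push_cast; ring

lemma integrable_norm_circle {τ : ℝ} (hτ : τ < 1) :
    Integrable (fun x : AddCircle (2 * π) => ‖x‖ ^ (-τ)) volume := by
  have hpi := Real.pi_pos
  have hmp := AddCircle.measurePreserving_mk (2 * π) (-π)
  have hm : Measurable fun x : AddCircle (2 * π) => ‖x‖ ^ (-τ) := by fun_prop
  rw [← hmp.integrable_comp hm.aestronglyMeasurable, show -π + 2 * π = π by ring]
  have h1 : IntervalIntegrable (fun x : ℝ => |x| ^ (-τ)) volume 0 π := by
    refine (intervalIntegral.intervalIntegrable_rpow' (r := -τ) (by linarith)).congr ?_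
    intro x hx
    rw [Set.uIoc_of_le hpi.le] at hx
    simp only [abs_of_pos hx.1]
  have h2 : IntervalIntegrable (fun x : ℝ => |x| ^ (-τ)) volume (-π) 0 := by
    have := (IntervalIntegrable.iff_comp_neg (f := fun x : ℝ => |x| ^ (-τ)) (a := 0) (b := π)).1 h1
    simpa using this.symm
  have h3 := (h2.trans h1).1
  refine h3.congr_fun (fun x hx => ?_) measurableSet_Ioc
  simp only [Function.comp_apply]
  rw [(AddCircle.norm_coe_eq_abs_iff (2 * π) (by positivity)).2]
  rw [abs_of_pos (by positivity : 0 < 2 * π), abs_le]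
  constructor <;> linarith [hx.1, hx.2]

lemma integrable_norm_torus {τ : ℝ} (hτ : τ < 1) :
    Integrable (fun x : Torus => (‖x.1‖ * ‖x.2‖) ^ (-τ)) volume := by
  refine ((integrable_norm_circle hτ).mul_prod (integrable_norm_circle hτ)).congr (Eventually.of_forall fun x => ?_)
  exact (Real.mul_rpow (norm_nonneg _) (norm_nonneg _)).symm

lemma ae_norm_pos : ∀ᵐ x : Torus ∂volume, 0 < ‖x.1‖ ∧ 0 < ‖x.2‖ := by
  have h : ∀ᵐ y : AddCircle (2 * π) ∂volume, 0 < ‖y‖ := by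
    rw [ae_iff]
    have e : {y : AddCircle (2 * π) | ¬0 < ‖y‖} = Metric.closedBall 0 0 := by
      ext y; simp
    rw [e, AddCircle.volume_closedBall, mul_zero, min_eq_right (by positivity), ENNReal.ofReal_zero]
  have h1 := Measure.quasiMeasurePreserving_fst (μ := (volume : Measure (AddCircle (2 * π))))
    (ν := (volume : Measure (AddCircle (2 * π)))) |>.ae h
  have h2 := Measure.quasiMeasurePreserving_snd (μ := (volume : Measure (AddCircle (2 * π))))
    (ν := (volume : Measure (AddCircle (2 * π)))) |>.ae h
  filter_upwards [h1, h2] with x hx hx' using ⟨hx, hx'⟩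

lemma integrable_cont (f : C(Torus, ℝ)) : Integrable f volume :=
  f.continuous.integrable_of_hasCompactSupport (HasCompactSupport.of_compactSpace _)

lemma IsPD.integral_le {R S : C(Torus, ℝ)} (h : IsPD (R - S)) : ∫ x, S x ≤ ∫ x, R x := by
  have := h.integral_nonneg
  simp only [ContinuousMap.sub_apply] at this
  rw [integral_sub (integrable_cont R) (integrable_cont S)] at this
  linarith

/-- The uniform bound on which the construction of the Wick exponential rests. -/
theorem exists_exp_green_bound {α : ℝ} (hα : 0 < α) (hα1 : α ≤ 1) {β : ℝ} (hβ : 0 ≤ β) (hβα : β < 4 * π * α) :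
    ∃ C, ∀ F K : Finset (ℤ × ℤ), ∑ k ∈ K, lam k ^ (-α) * ∫ x, cosT k x * expT (β • green F) x ≤ C := by
  have hpi := Real.pi_pos
  -- The room between β and β' will absorb the factor r^R of `isPD_ell_sub_green`.
  set β' := (β + 4 * π * α) / 2 with hβ'
  have h1 : β < β' := by linarith
  have h2 : β' < 4 * π * α := by linarith
  have h0 : 0 < β' := by linarith
  -- The condition s > 1 - α makes the dyadic sum geometric with ratio q < 1, and s + β'/(4π) < 1
  -- makes the singularity integrable. The two are compatible because β' < 4πα.
  obtain ⟨s, hs1, hs2⟩ : ∃ s, 1 - α < s ∧ s < 1 - β' / (4 * π) := exists_between (by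
    have : β' / (4 * π) < α := by rw [div_lt_iff₀ (by positivity)]; linarith
    linarith)
  have hβπ : 0 < β' / (4 * π) := by positivity
  have hs0 : 0 ≤ s := by linarith
  set τ := s + β' / (4 * π) with hτ
  obtain ⟨D, hD⟩ := exists_rest_le
  set B : ℝ := Real.exp (β' * D) * (1 + π) ^ (β' / (2 * π)) * (2 * π ^ s) ^ 2 with hB
  have hB0 : 0 ≤ B := by positivity
  set H : ℝ := ∫ x : Torus, (‖x.1‖ * ‖x.2‖) ^ (-τ) with hH
  set q : ℝ := (2 : ℝ) ^ (-2 * (α + s - 1)) with hq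
  have hq0 : 0 < q := by positivity
  have hq1 : q < 1 := Real.rpow_lt_one_of_one_lt_of_neg one_lt_two (by linarith)
  refine ⟨16 * (2 : ℝ) ^ (2 * (1 - s)) * B * H * (1 - q)⁻¹, fun F K => ?_⟩
  obtain ⟨R, hR₁⟩ := subset_box (F ∪ K)
  have hF : F ⊆ box R := Finset.subset_union_left.trans hR₁
  have hK : K ⊆ box R := Finset.subset_union_right.trans hR₁
  -- The parameter r is chosen after R and close to 1; no bound below depends on r.
  obtain ⟨r, hr0, hr1, hr2⟩ : ∃ r : ℝ, 0 ≤ r ∧ r < 1 ∧ β ≤ β' * r ^ R := by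
    have hcont : Tendsto (fun r : ℝ => β' * r ^ R) (𝓝[<] 1) (𝓝 (β' * 1 ^ R)) :=
      (Continuous.tendsto (by fun_prop) _).mono_left nhdsWithin_le_nhds
    rw [one_pow, mul_one] at hcont
    have e1 := hcont.eventually (lt_mem_nhds h1)
    have e2 : ∀ᶠ r : ℝ in 𝓝[<] 1, 0 < r := nhdsWithin_le_nhds (lt_mem_nhds one_pos)
    obtain ⟨r, hr⟩ := (e1.and (e2.and self_mem_nhdsWithin)).exists
    exact ⟨r, hr.2.1.le, hr.2.2, hr.1.le⟩
  have hr : |r| < 1 := by rwa [abs_of_nonneg hr0]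
  set M : C(Torus, ℝ) := expT (β' • ((2 * π)⁻¹ • ell r hr + rest R)) with hM
  have hPDM : IsPD (M - expT (β • green F)) := by
    refine ((isPD_green F).smul hβ).expT_sub ?_
    have k1 := (isPD_ell_sub_green hr0 hr R).smul_sub' h0.le
    have k2 := (isPD_green (box R)).smul_sub_smul hr2
    rw [← smul_smul] at k2
    exact (k1.sub_trans k2).sub_trans ((isPD_green_sub hF).smul_sub' hβ)
  have hMx : ∀ x : Torus, 0 < ‖x.1‖ → 0 < ‖x.2‖ → M x ≤ Real.exp (β' * D) * (1 + π) ^ (β' / (2 * π))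
      * (‖x.1‖ * ‖x.2‖) ^ (-(β' / (4 * π))) := by
    intro x hx1 hx2
    have e : M x = Real.exp (β' / (2 * π) * ell r hr x) * Real.exp (β' * rest R x) := by
      rw [← Real.exp_add]
      change Real.exp (β' * ((2 * π)⁻¹ * ell r hr x + rest R x)) = _
      congr 1
      ring
    have k1 := exp_ell_le hr0 hr hx1 hx2 (c := β' / (2 * π)) (by positivity)
    have k2 : Real.exp (β' * rest R x) ≤ Real.exp (β' * D) := by
      gcongr
      exact hD R x
    rw [e]
    rw [show β' / (2 * π) / 2 = β' / (4 * π) by field_simp; norm_num] at k1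
    calc _ ≤ ((1 + π) ^ (β' / (2 * π)) * (‖x.1‖ * ‖x.2‖) ^ (-(β' / (4 * π)))) * Real.exp (β' * D) := by gcongr
      _ = _ := by ring
  have e1 : ∑ k ∈ K, lam k ^ (-α) * ∫ x, cosT k x * expT (β • green F) x
      = ∫ x, ((∑ k ∈ K, lam k ^ (-α) • cosT k) * expT (β • green F)) x := by
    simp only [ContinuousMap.mul_apply, ContinuousMap.sum_apply, ContinuousMap.smul_apply, smul_eq_mul, Finset.sum_mul,
      mul_assoc]
    rw [integral_finsetSum]
    · simp only [integral_const_mul]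
    · intro k _
      have := (integrable_cont (cosT k * expT (β • green F))).const_mul (lam k ^ (-α))
      exact this
  have e2 : IsPD (dom α R - ∑ k ∈ K, lam k ^ (-α) • cosT k) := by
    refine (isPD_dom_sub hα R).sub_trans ?_
    rw [← Finset.sum_sdiff hK, add_sub_cancel_right]
    exact IsPD.sum fun k _ => (IsPD.cosT k).smul (Real.rpow_nonneg (lam_pos k).le _)
  have hPDdom : IsPD (dom α R) := by
    have := e2.add (IsPD.sum (s := K) fun k _ => (IsPD.cosT k).smul (Real.rpow_nonneg (lam_pos k).le (-α)))
    simpa using this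
  -- Both factors are enlarged in the positive definite order before any pointwise estimate; the
  -- integral of the product is monotone for that order.
  have e3 := (hPDdom.mul_sub_mul ((isPD_green F).smul hβ).expT hPDM e2).integral_le
  rw [e1]
  refine e3.trans ?_
  set c : ℕ → ℝ := fun j => 16 * ((2 : ℝ) ^ j) ^ (-2 * α) with hc
  have e4 : ∫ x, (dom α R * M) x = ∑ j ∈ Finset.range (R + 1), c j *
      ∫ x, poisson (dyadic j) (abs_dyadic j) (1, 0) x * poisson (dyadic j) (abs_dyadic j) (0, 1) x * M x := by
    simp only [dom, ContinuousMap.mul_apply, ContinuousMap.sum_apply, ContinuousMap.smul_apply, smul_eq_mul, Finset.sum_mul,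
      mul_assoc]
    rw [integral_finsetSum]
    · simp only [integral_const_mul, hc, mul_assoc]
    · intro j _
      have := ((integrable_cont (poisson (dyadic j) (abs_dyadic j) (1, 0) * (poisson (dyadic j) (abs_dyadic j) (0, 1) * M))).const_mul
        (((2 : ℝ) ^ j) ^ (-2 * α))).const_mul 16
      exact this
  rw [e4]
  have e5 : ∀ j, ∫ x, poisson (dyadic j) (abs_dyadic j) (1, 0) x * poisson (dyadic j) (abs_dyadic j) (0, 1) x * M x
      ≤ B * (((1 / 2 : ℝ) ^ (j + 1)) ^ (s - 1)) ^ 2 * H := by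
    intro j
    rw [hH, ← integral_const_mul]
    refine integral_mono_ae (integrable_cont (poisson (dyadic j) (abs_dyadic j) (1, 0)
      * poisson (dyadic j) (abs_dyadic j) (0, 1) * M)) ((integrable_norm_torus (by linarith)).const_mul _) ?_
    filter_upwards [ae_norm_pos] with x hx
    have p1 := poisson_le (j := j) (ch_fst x) hx.1 hs0 (by linarith)
    have p2 := poisson_le (j := j) (ch_snd x) hx.2 hs0 (by linarith)
    have p3 := hMx x hx.1 hx.2
    have p4 : 0 ≤ M x := (Real.exp_pos _).le
    have hx1 := hx.1
    have hx2 := hx.2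
    refine (mul_le_mul (mul_le_mul p1 p2 (poisson_nonneg _ _ _) (by positivity)) p3 p4 (by positivity)).trans
      (le_of_eq ?_)
    have hsplit : (‖x.1‖ * ‖x.2‖) ^ (-τ) = ‖x.1‖ ^ (-s) * ‖x.2‖ ^ (-s) * (‖x.1‖ * ‖x.2‖) ^ (-(β' / (4 * π))) := by
      rw [← Real.mul_rpow hx1.le hx2.le, ← Real.rpow_add (by positivity)]
      congr 1
      rw [hτ]; ring
    rw [hsplit, hB]
    ring
  have hH0 : 0 ≤ H := integral_nonneg fun x => by positivity
  have e6 : ∀ j, c j * (((1 / 2 : ℝ) ^ (j + 1)) ^ (s - 1)) ^ 2 = 16 * (2 : ℝ) ^ (2 * (1 - s)) * q ^ j := by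
    intro j
    have a1 : ((2 : ℝ) ^ j) ^ (-2 * α) = (2 : ℝ) ^ (-2 * α * j) := by
      rw [← Real.rpow_natCast, ← Real.rpow_mul (by norm_num)]; congr 1; ring
    have a2 : (((1 / 2 : ℝ) ^ (j + 1)) ^ (s - 1)) ^ 2 = (2 : ℝ) ^ (2 * (1 - s) * (j + 1)) := by
      rw [one_div, inv_pow, ← Real.rpow_natCast, ← Real.rpow_natCast, ← Real.rpow_neg (by norm_num),
        ← Real.rpow_mul (by positivity), ← Real.rpow_mul (by positivity)]
      congr 1; push_cast; ring
    have a3 : q ^ j = (2 : ℝ) ^ (-2 * (α + s - 1) * j) := by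
      rw [hq, ← Real.rpow_natCast, ← Real.rpow_mul (by norm_num)]
    rw [hc, a2, a3]
    simp only
    rw [a1, mul_assoc 16, mul_assoc 16, ← Real.rpow_add (by norm_num), ← Real.rpow_add (by norm_num)]
    congr 2
    ring
  calc ∑ j ∈ Finset.range (R + 1), c j *
      ∫ x, poisson (dyadic j) (abs_dyadic j) (1, 0) x * poisson (dyadic j) (abs_dyadic j) (0, 1) x * M x
      ≤ ∑ j ∈ Finset.range (R + 1), 16 * (2 : ℝ) ^ (2 * (1 - s)) * B * H * q ^ j := by
        refine Finset.sum_le_sum fun j _ => ?_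
        have hcj : 0 ≤ c j := by positivity
        calc _ ≤ c j * (B * (((1 / 2 : ℝ) ^ (j + 1)) ^ (s - 1)) ^ 2 * H) := by gcongr; exact e5 j
          _ = (c j * (((1 / 2 : ℝ) ^ (j + 1)) ^ (s - 1)) ^ 2) * B * H := by ring
          _ = _ := by rw [e6]; ring
    _ = 16 * (2 : ℝ) ^ (2 * (1 - s)) * B * H * ∑ j ∈ Finset.range (R + 1), q ^ j := by rw [Finset.mul_sum]
    _ ≤ _ := by
        gcongr
        rw [← tsum_geometric_of_lt_one hq0.le hq1]
        exact (summable_geometric_of_lt_one hq0.le hq1).sum_le_tsum _ fun j _ => by positivity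

end

end WickExp

namespace WickExp

noncomputable section

/-! ### The cut-off Gaussian field and its Wick functionals -/

/-- The functions in which the cut-off field is expanded with independent coefficients. -/
def eT (k : ℤ × ℤ) : C(Torus, ℝ) := ((2 * π)⁻¹ * (√(lam k))⁻¹) • (cosT k - sinT k)

/-- A set of frequencies that is invariant under `k ↦ -k` and contains `0`. -/
def IsSymm (F : Finset (ℤ × ℤ)) : Prop := 0 ∈ F ∧ ∀ k ∈ F, -k ∈ F

lemma IsSymm.inter {F G : Finset (ℤ × ℤ)} (hF : IsSymm F) (hG : IsSymm G) : IsSymm (F ∩ G) :=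
  ⟨Finset.mem_inter.2 ⟨hF.1, hG.1⟩, fun k hk =>
    Finset.mem_inter.2 ⟨hF.2 k (Finset.mem_inter.1 hk).1, hG.2 k (Finset.mem_inter.1 hk).2⟩⟩

lemma isSymm_box (R : ℕ) : IsSymm (box R) := by
  refine ⟨?_, fun k hk => ?_⟩
  · simp [box]
  · simp only [box, Finset.mem_product, Finset.mem_Icc, Prod.fst_neg, Prod.snd_neg] at hk ⊢
    omega

lemma sinT_neg (k : ℤ × ℤ) (x : Torus) : sinT (-k) x = -sinT k x := by
  rw [sinT_apply, sinT_apply, ch_neg, Complex.conj_im]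

/-- In (cos - sin)(k·x) (cos - sin)(k·y) the mixed terms are odd in k and cancel over a symmetric
set, leaving cos k·(x - y). One function per frequency thus suffices, with no choice of a
half-plane. -/
lemma sum_eT_mul {F : Finset (ℤ × ℤ)} (hF : IsSymm F) (x y : Torus) :
    ∑ k ∈ F, eT k x * eT k y = green F (x - y) := by
  have h1 : ∑ k ∈ F, ((2 * π) ^ 2 * lam k)⁻¹ * (cosT k x * sinT k y + sinT k x * cosT k y) = 0 := by
    have h2 : ∑ k ∈ F, ((2 * π) ^ 2 * lam k)⁻¹ * (cosT k x * sinT k y + sinT k x * cosT k y)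
        = ∑ k ∈ F, -(((2 * π) ^ 2 * lam k)⁻¹ * (cosT k x * sinT k y + sinT k x * cosT k y)) := by
      refine Finset.sum_nbij' (fun k => -k) (fun k => -k) (fun k hk => hF.2 k hk) (fun k hk => hF.2 k hk)
        (by simp) (by simp) fun k _ => ?_
      rw [lam_neg, sinT_neg, sinT_neg, cosT_neg]
      ring
    rw [Finset.sum_neg_distrib] at h2
    linarith
  rw [green_apply, ← sub_zero (∑ k ∈ F, ((2 * π) ^ 2 * lam k)⁻¹ * cosT k (x - y)), ← h1, ← Finset.sum_sub_distrib]
  refine Finset.sum_congr rfl fun k _ => ?_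
  have hs : (√(lam k))⁻¹ * (√(lam k))⁻¹ = (lam k)⁻¹ := by
    rw [← mul_inv, Real.mul_self_sqrt (lam_pos k).le]
  rw [cosT_sub, mul_inv, ← hs]
  simp only [eT, ContinuousMap.smul_apply, ContinuousMap.sub_apply, smul_eq_mul]
  ring

lemma green_zero_pos {F : Finset (ℤ × ℤ)} (hF : IsSymm F) : 0 < green F 0 := by
  rw [green_apply]
  have hpi := Real.pi_pos
  refine Finset.sum_pos (fun k _ => ?_) ⟨0, hF.1⟩
  have := lam_pos k
  rw [cosT_apply_zero]
  positivity

variable {Ω : Type*} [MeasurableSpace Ω] {μ : Measure Ω} [IsProbabilityMeasure μ] {ξ : ℤ × ℤ → Ω → ℝ}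

/-- The cut-off field. -/
def fld (ξ : ℤ × ℤ → Ω → ℝ) (F : Finset (ℤ × ℤ)) (ω : Ω) : C(Torus, ℝ) := ∑ k ∈ F, ξ k ω • eT k

lemma fld_apply (F : Finset (ℤ × ℤ)) (ω : Ω) (x : Torus) : fld ξ F ω x = ∑ k ∈ F, ξ k ω * eT k x := by
  simp [fld, ContinuousMap.sum_apply]

/-- Distinct coordinates are independent, so only the frequencies common to F and G contribute to
the covariance; hence F ∩ G. -/
lemma isGaussPair_fld (hξ : IsStdGaussian ξ μ) {F G : Finset (ℤ × ℤ)} (hF : IsSymm F) (hG : IsSymm G) (x y : Torus) :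
    IsGaussPair (fun ω => fld ξ F ω x) (fun ω => fld ξ G ω y) μ (green F 0) (green G 0) (green (F ∩ G) (x - y)) := by
  classical
  have hm : ∀ (F : Finset (ℤ × ℤ)) (x : Torus), Measurable fun ω => fld ξ F ω x := fun F x => by
    simp only [fld_apply]
    exact Finset.measurable_sum _ fun k _ => (hξ.measurable k).mul_const _
  have hcomb : ∀ (a b : ℝ), ∑ k ∈ F ∪ G, ((if k ∈ F then a * eT k x else 0) + (if k ∈ G then b * eT k y else 0)) ^ 2
      = a ^ 2 * green F 0 + 2 * a * b * green (F ∩ G) (x - y) + b ^ 2 * green G 0 := by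
    intro a b
    have e : ∀ k, ((if k ∈ F then a * eT k x else 0) + (if k ∈ G then b * eT k y else 0)) ^ 2
        = a ^ 2 * (if k ∈ F then eT k x * eT k x else 0) + 2 * a * b * (if k ∈ F ∩ G then eT k x * eT k y else 0)
          + b ^ 2 * (if k ∈ G then eT k y * eT k y else 0) := by
      intro k
      by_cases h1 : k ∈ F <;> by_cases h2 : k ∈ G <;> simp [h1, h2] <;> ring
    simp only [e]
    rw [Finset.sum_add_distrib, Finset.sum_add_distrib, ← Finset.mul_sum, ← Finset.mul_sum, ← Finset.mul_sum,
      Finset.sum_ite_mem, Finset.sum_ite_mem, Finset.sum_ite_mem, Finset.inter_eq_right.2 Finset.subset_union_left,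
      Finset.inter_eq_right.2 Finset.subset_union_right,
      Finset.inter_eq_right.2 (Finset.inter_subset_left.trans Finset.subset_union_left), sum_eT_mul hF, sum_eT_mul hG,
      sum_eT_mul (hF.inter hG), sub_self, sub_self]
  refine ⟨hm F x, hm G y, fun a b => ?_, fun a b => ?_⟩
  · rw [← hcomb]
    exact Finset.sum_nonneg fun k _ => sq_nonneg _
  · rw [← hcomb, ← hξ.map_sum]
    congr 1
    funext ω
    simp only [fld_apply, add_mul, Finset.sum_add_distrib, ite_mul, zero_mul, Finset.sum_ite_mem,
      Finset.inter_eq_right.2 Finset.subset_union_left, Finset.inter_eq_right.2 Finset.subset_union_right, Finset.mul_sum]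
    congr 1 <;> exact Finset.sum_congr rfl fun k _ => by ring

/-- The function `x ↦ W(σ, X(x))` of the cut-off field `X` with variance `σ`. -/
def wickField (W : ℝ → C(ℝ, ℝ)) (ξ : ℤ × ℤ → Ω → ℝ) (F : Finset (ℤ × ℤ)) (ω : Ω) : C(Torus, ℝ) :=
  (W (green F 0)).comp (fld ξ F ω)

lemma stronglyMeasurable_wickField (hξ : IsStdGaussian ξ μ) (W : ℝ → C(ℝ, ℝ)) (F : Finset (ℤ × ℤ)) :
    StronglyMeasurable (wickField W ξ F) := by
  have h1 : StronglyMeasurable (fld ξ F) :=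
    Finset.stronglyMeasurable_fun_sum _ fun k _ => (hξ.measurable k).stronglyMeasurable.smul_const _
  exact (ContinuousMap.continuous_postcomp (W (green F 0))).comp_stronglyMeasurable h1

lemma measurable_wickField (hξ : IsStdGaussian ξ μ) (W : ℝ → C(ℝ, ℝ)) (F : Finset (ℤ × ℤ)) :
    Measurable fun q : Ω × Torus => wickField W ξ F q.1 q.2 := by
  change Measurable fun q : Ω × Torus => W (green F 0) (fld ξ F q.1 q.2)
  refine (W (green F 0)).continuous.measurable.comp ?_
  simp only [fld_apply]
  exact Finset.measurable_sum _ fun k _ =>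
    ((hξ.measurable k).comp measurable_fst).mul ((eT k).continuous.measurable.comp measurable_snd)

/-- The correlation of the Wick functionals `U` and `V` of a Gaussian vector with covariance `C` is `K C`. -/
def Corr (μ : Measure Ω) (U V : ℝ → C(ℝ, ℝ)) (K : ℝ → ℝ) : Prop :=
  ∀ (X Y : Ω → ℝ) (σ τ C : ℝ), IsGaussPair X Y μ σ τ C → 0 < σ → 0 < τ →
    ∫ ω, U σ (X ω) * V τ (Y ω) ∂μ = K C

lemma Corr.symm {U V : ℝ → C(ℝ, ℝ)} {K : ℝ → ℝ} (h : Corr μ U V K) : Corr μ V U K := fun X Y σ τ C hp hσ hτ => by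
  rw [← h Y X τ σ C hp.symm hτ hσ]
  simp only [mul_comm]

/-- The Hermite functional. -/
def herm (n : ℕ) (v : ℝ) : C(ℝ, ℝ) := ⟨fun x => hp v x n, by have := continuous_hp n; fun_prop⟩

/-- The Wick exponential functional. -/
def wexp (a : ℝ) (v : ℝ) : C(ℝ, ℝ) := ⟨fun x => Real.exp (a * x - a ^ 2 * v / 2), by fun_prop⟩

/-- Finite combinations of Hermite functionals. -/
def pol (w : ℕ → ℝ) (m : ℕ) (v : ℝ) : C(ℝ, ℝ) := ∑ n ∈ Finset.range m, w n • herm n v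

lemma pol_apply (w : ℕ → ℝ) (m : ℕ) (v x : ℝ) : pol w m v x = ∑ n ∈ Finset.range m, w n * herm n v x := by
  simp [pol, ContinuousMap.sum_apply]

lemma expBdd_wexp (a v : ℝ) : ExpBdd (wexp a v) := by
  have := (ExpBdd.exp a).mul (ExpBdd.const (Real.exp (-(a ^ 2 * v / 2))))
  simp only [← Real.exp_add, ← sub_eq_add_neg] at this
  exact this

lemma expBdd_herm (n : ℕ) (v : ℝ) : ExpBdd (herm n v) := expBdd_hp v n

lemma expBdd_pol (w : ℕ → ℝ) (m : ℕ) (v : ℝ) : ExpBdd (pol w m v) := by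
  induction m with
  | zero =>
    have : ⇑(pol w 0 v) = fun _ => (0 : ℝ) := by funext x; simp [pol]
    rw [this]
    exact ExpBdd.const 0
  | succ m ih =>
    have := ih.add ((ExpBdd.const (w m)).mul (expBdd_herm m v))
    convert this using 1
    funext x
    rw [pol_apply, Finset.sum_range_succ, pol_apply]

lemma corr_wexp (a : ℝ) : Corr μ (wexp a) (wexp a) fun C => Real.exp (a ^ 2 * C) :=
  fun _ _ _ _ _ h _ _ => h.integral_exp_mul_exp a

lemma corr_herm (n : ℕ) : Corr μ (herm n) (herm n) fun C => n.factorial * C ^ n := fun X Y σ τ C h hσ hτ => by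
  have := h.integral_hp_mul_hp hσ hτ n n
  rwa [if_pos rfl] at this

lemma corr_pol_wexp (w : ℕ → ℝ) (m : ℕ) (a : ℝ) :
    Corr μ (pol w m) (wexp a) fun C => ∑ n ∈ Finset.range m, w n * (a * C) ^ n := fun X Y σ τ C h hσ hτ => by
  simp only [pol_apply, Finset.sum_mul, mul_assoc]
  rw [integral_finsetSum _ fun n _ => (h.integrable_mul (expBdd_herm n σ) (expBdd_wexp a τ)).const_mul _]
  refine Finset.sum_congr rfl fun n _ => ?_
  rw [integral_const_mul]
  congr 1
  exact h.integral_hp_mul_exp hσ hτ n a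

lemma corr_pol (w : ℕ → ℝ) (m : ℕ) :
    Corr μ (pol w m) (pol w m) fun C => ∑ n ∈ Finset.range m, w n ^ 2 * n.factorial * C ^ n := fun X Y σ τ C h hσ hτ => by
  simp only [pol_apply, Finset.sum_mul, mul_assoc]
  rw [integral_finsetSum _ fun n _ => (h.integrable_mul (expBdd_herm n σ) (expBdd_pol w m τ)).const_mul _ |>.congr
    (Eventually.of_forall fun ω => by simp only [pol_apply]; rfl)]
  refine Finset.sum_congr rfl fun n hn => ?_
  rw [integral_const_mul, sq, mul_assoc]
  congr 1
  simp only [Finset.mul_sum]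
  rw [integral_finsetSum _ fun j _ => ((h.integrable_mul (expBdd_herm n σ) (expBdd_herm j τ)).const_mul (w j)).congr
    (Eventually.of_forall fun ω => mul_left_comm _ _ _)]
  rw [Finset.sum_eq_single n]
  · have := h.integral_hp_mul_hp hσ hτ n n
    rw [if_pos rfl] at this
    rw [← this, ← integral_const_mul]
    congr 1; funext ω; exact mul_left_comm _ _ _
  · intro j _ hj
    have := h.integral_hp_mul_hp hσ hτ n j
    rw [if_neg hj.symm] at this
    rw [← mul_zero (w j), ← this, ← integral_const_mul]
    congr 1; funext ω; exact mul_left_comm _ _ _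
  · intro h; exact absurd hn h

/-- The second moment of the integral of a random function against `φ`. -/
lemma integral_sq_wint {φ : Torus → ℝ} (hφ : Integrable φ volume) {Y : Ω → C(Torus, ℝ)}
    (hY : Measurable fun q : Ω × Torus => Y q.1 q.2) {κ : C(Torus, ℝ)}
    (hY2 : ∀ x, MemLp (fun ω => Y ω x) 2 μ) (hκ : ∀ x y, ∫ ω, Y ω x * Y ω y ∂μ = κ (x - y)) :
    Integrable (fun ω => wint hφ (Y ω) ^ 2) μ ∧ ∫ ω, wint hφ (Y ω) ^ 2 ∂μ = form hφ κ := by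
  set f : Ω × (Torus × Torus) → ℝ := fun r => (Y r.1 r.2.1 * Y r.1 r.2.2) * (φ r.2.1 * φ r.2.2) with hf
  have hφφ := hφ.mul_prod hφ
  have hmeas : AEStronglyMeasurable f (μ.prod ((volume : Measure Torus).prod (volume : Measure Torus))) := by
    have h1 : Measurable fun r : Ω × (Torus × Torus) => Y r.1 r.2.1 := hY.comp (by fun_prop : Measurable fun r : Ω × (Torus × Torus) => (r.1, r.2.1))
    have h2 : Measurable fun r : Ω × (Torus × Torus) => Y r.1 r.2.2 := hY.comp (by fun_prop : Measurable fun r : Ω × (Torus × Torus) => (r.1, r.2.2))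
    exact (h1.mul h2).aestronglyMeasurable.mul (hφφ.aestronglyMeasurable.comp_snd)
  have hint : ∀ x y, Integrable (fun ω => Y ω x * Y ω y) μ := fun x y => (hY2 x).integrable_mul (hY2 y)
  -- The domination for Fubini's theorem: a product is at most the mean of the two squares, each of
  -- which has expectation κ(0).
  have habs : ∀ x y, ∫ ω, |Y ω x * Y ω y| ∂μ ≤ κ 0 := by
    intro x y
    have h1 : ∀ ω, |Y ω x * Y ω y| ≤ (Y ω x * Y ω x + Y ω y * Y ω y) / 2 := fun ω => by
      rw [abs_mul]
      nlinarith [sq_nonneg (|Y ω x| - |Y ω y|), abs_mul_abs_self (Y ω x), abs_mul_abs_self (Y ω y)]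
    refine (integral_mono (hint x y).abs (((hint x x).add (hint y y)).div_const 2) h1).trans (le_of_eq ?_)
    simp only [Pi.add_apply]
    rw [integral_div, integral_add (hint x x) (hint y y), hκ, hκ, sub_self, sub_self]
    ring
  have hI : Integrable f (μ.prod ((volume : Measure Torus).prod (volume : Measure Torus))) := by
    rw [integrable_prod_iff' hmeas]
    refine ⟨Eventually.of_forall fun q => (hint q.1 q.2).mul_const (φ q.1 * φ q.2), ?_⟩
    refine Integrable.mono' (hφφ.norm.const_mul (κ 0)) hmeas.norm.prod_swap.integral_prod_right' (Eventually.of_forall fun q => ?_)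
    rw [Real.norm_of_nonneg (integral_nonneg fun _ => norm_nonneg _)]
    simp only [hf, norm_mul (_ * _) (φ _ * φ _), integral_mul_const]
    gcongr
    exact habs q.1 q.2
  have hsq : ∀ ω, wint hφ (Y ω) ^ 2 = ∫ q, f (ω, q) ∂((volume : Measure Torus).prod (volume : Measure Torus)) := by
    intro ω
    rw [wint_apply, sq, ← integral_prod_mul]
    congr 1
    funext q
    simp only [hf]
    ring
  simp only [hsq]
  refine ⟨hI.integral_prod_left, ?_⟩
  have := integral_prod f hI
  rw [← this, integral_prod_symm f hI, form_apply]
  congr 1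
  funext q
  simp only [hf]
  rw [integral_mul_const, hκ]

/-- The covariance of the difference of two Wick functionals of the field. -/
lemma covariance_wickField_sub (hξ : IsStdGaussian ξ μ) {F G : Finset (ℤ × ℤ)} (hF : IsSymm F) (hG : IsSymm G)
    {U V : ℝ → C(ℝ, ℝ)} {K₁ K₂ K₃ : ℝ → ℝ} (hU : ∀ v, ExpBdd (U v)) (hV : ∀ v, ExpBdd (V v))
    (h₁ : Corr μ U U K₁) (h₂ : Corr μ U V K₂) (h₃ : Corr μ V V K₃) (x y : Torus) :
    ∫ ω, (wickField U ξ F ω - wickField V ξ G ω) x * (wickField U ξ F ω - wickField V ξ G ω) y ∂μ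
      = K₁ (green F (x - y)) - 2 * K₂ (green (F ∩ G) (x - y)) + K₃ (green G (x - y)) := by
  have pFF := isGaussPair_fld hξ hF hF x y
  have pFG := isGaussPair_fld hξ hF hG x y
  have pGF := isGaussPair_fld hξ hG hF x y
  have pGG := isGaussPair_fld hξ hG hG x y
  have e : ∀ ω, (wickField U ξ F ω - wickField V ξ G ω) x * (wickField U ξ F ω - wickField V ξ G ω) y
      = (U (green F 0) (fld ξ F ω x) * U (green F 0) (fld ξ F ω y)
          - U (green F 0) (fld ξ F ω x) * V (green G 0) (fld ξ G ω y))
        - (V (green G 0) (fld ξ G ω x) * U (green F 0) (fld ξ F ω y)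
          - V (green G 0) (fld ξ G ω x) * V (green G 0) (fld ξ G ω y)) := fun ω => by
    change (U _ _ - V _ _) * (U _ _ - V _ _) = _
    ring
  simp only [e]
  have i1 := pFF.integrable_mul (hU (green F 0)) (hU (green F 0))
  have i2 := pFG.integrable_mul (hU (green F 0)) (hV (green G 0))
  have i3 := pGF.integrable_mul (hV (green G 0)) (hU (green F 0))
  have i4 := pGG.integrable_mul (hV (green G 0)) (hV (green G 0))
  have hFp := green_zero_pos hF
  have hGp := green_zero_pos hG
  rw [integral_sub (by exact i1.sub i2) (by exact i3.sub i4), integral_sub i1 i2, integral_sub i3 i4, h₁ _ _ _ _ _ pFF hFp hFp,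
    h₂ _ _ _ _ _ pFG hFp hGp, h₂.symm _ _ _ _ _ pGF hGp hFp, h₃ _ _ _ _ _ pGG hGp hGp, Finset.inter_self,
    Finset.inter_self, Finset.inter_comm G F]
  ring

lemma memLp_wickField (hξ : IsStdGaussian ξ μ) {F : Finset (ℤ × ℤ)} (hF : IsSymm F) {U : ℝ → C(ℝ, ℝ)}
    (hU : ∀ v, ExpBdd (U v)) (x : Torus) : MemLp (fun ω => wickField U ξ F ω x) 2 μ :=
  (isGaussPair_fld hξ hF hF x x).memLp_fst (hU (green F 0))

end

end WickExp

namespace WickExp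

noncomputable section

/-! ### Energies -/

section Energy

variable {I : Type*} {φ : I → Torus → ℝ} (hφ : ∀ i, Integrable (φ i) volume)

/-- The energy of a kernel with respect to a family of test functions. -/
def energy (κ : C(Torus, ℝ)) : ℝ≥0∞ := ∑' i, ENNReal.ofReal (form (hφ i) κ)

lemma energy_add {κ κ' : C(Torus, ℝ)} (h : IsPD κ) (h' : IsPD κ') :
    energy hφ (κ + κ') = energy hφ κ + energy hφ κ' := by
  rw [energy, energy, energy, ← ENNReal.tsum_add]
  congr 1
  funext i
  rw [map_add, ENNReal.ofReal_add (h.form_nonneg _) (h'.form_nonneg _)]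

lemma energy_smul (κ : C(Torus, ℝ)) {c : ℝ} (hc : 0 ≤ c) : energy hφ (c • κ) = ENNReal.ofReal c * energy hφ κ := by
  rw [energy, energy, ← ENNReal.tsum_mul_left]
  congr 1
  funext i
  rw [map_smul, smul_eq_mul, ENNReal.ofReal_mul hc]

lemma energy_mono {κ κ' : C(Torus, ℝ)} (h : IsPD (κ' - κ)) : energy hφ κ ≤ energy hφ κ' :=
  ENNReal.tsum_le_tsum fun i => ENNReal.ofReal_le_ofReal (by
    have := h.form_nonneg (hφ i)
    rw [map_sub] at this
    linarith)

end Energy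

/-! ### Moments of tested Wick functionals -/

section Testing

variable {Ω : Type*} [MeasurableSpace Ω] {μ : Measure Ω} [IsProbabilityMeasure μ] {ξ : ℤ × ℤ → Ω → ℝ}
  {K : Type*} [NormedAddCommGroup K] [NormedSpace ℝ K] {ι : C(Torus, ℝ) →L[ℝ] K}
  {I : Type*} [Countable I] {φ : I → Torus → ℝ} {hφ : ∀ i, Integrable (φ i) volume}

/-- The norm of `ι f` is the `ℓ²` norm of the integrals of `f` against the functions `φ`. -/
def IsTesting (ι : C(Torus, ℝ) →L[ℝ] K) (hφ : ∀ i, Integrable (φ i) volume) : Prop :=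
  ∀ f, HasSum (fun i => wint (hφ i) f ^ 2) (‖ι f‖ ^ 2)

lemma IsTesting.enorm_sq (hι : IsTesting ι hφ) (f : C(Torus, ℝ)) :
    ‖ι f‖ₑ ^ 2 = ∑' i, ENNReal.ofReal (wint (hφ i) f ^ 2) := by
  rw [← ENNReal.ofReal_tsum_of_nonneg (fun i => sq_nonneg _) (hι f).summable, (hι f).tsum_eq,
    ENNReal.ofReal_pow (norm_nonneg _), ofReal_norm]

lemma eLpNorm_two_sq {E : Type*} [NormedAddCommGroup E] (f : Ω → E) : eLpNorm f 2 μ ^ 2 = ∫⁻ ω, ‖f ω‖ₑ ^ 2 ∂μ := by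
  have := eLpNorm_nnreal_pow_eq_lintegral (f := f) (μ := μ) (p := 2) two_ne_zero
  simp only [NNReal.coe_ofNat, ENNReal.coe_ofNat] at this
  exact_mod_cast this

/-- The second moment of the difference of two Wick functionals. -/
lemma eLpNorm_sub_sq (hι : IsTesting ι hφ) (hξ : IsStdGaussian ξ μ) {F G : Finset (ℤ × ℤ)} (hF : IsSymm F) (hG : IsSymm G)
    {U V : ℝ → C(ℝ, ℝ)} {K₁ K₂ K₃ : ℝ → ℝ} (hU : ∀ v, ExpBdd (U v)) (hV : ∀ v, ExpBdd (V v))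
    (h₁ : Corr μ U U K₁) (h₂ : Corr μ U V K₂) (h₃ : Corr μ V V K₃) (κ : C(Torus, ℝ))
    (hκ : ∀ u, κ u = K₁ (green F u) - 2 * K₂ (green (F ∩ G) u) + K₃ (green G u)) :
    eLpNorm (fun ω => ι (wickField U ξ F ω) - ι (wickField V ξ G ω)) 2 μ ^ 2 = energy hφ κ := by
  set Y : Ω → C(Torus, ℝ) := fun ω => wickField U ξ F ω - wickField V ξ G ω with hY
  have hYm : Measurable fun q : Ω × Torus => Y q.1 q.2 :=
    (measurable_wickField hξ U F).sub (measurable_wickField hξ V G)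
  have hYs : StronglyMeasurable Y := (stronglyMeasurable_wickField hξ U F).sub (stronglyMeasurable_wickField hξ V G)
  have hY2 : ∀ x, MemLp (fun ω => Y ω x) 2 μ := fun x => (memLp_wickField hξ hF hU x).sub (memLp_wickField hξ hG hV x)
  have hcov : ∀ x y, ∫ ω, Y ω x * Y ω y ∂μ = κ (x - y) := fun x y => by
    rw [hκ]; exact covariance_wickField_sub hξ hF hG hU hV h₁ h₂ h₃ x y
  rw [eLpNorm_two_sq]
  have e : ∀ ω, ‖ι (wickField U ξ F ω) - ι (wickField V ξ G ω)‖ₑ ^ 2 = ∑' i, ENNReal.ofReal (wint (hφ i) (Y ω) ^ 2) := fun ω => by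
    rw [← map_sub, hι.enorm_sq]
  simp only [e]
  rw [lintegral_tsum]
  · congr 1
    funext i
    have h := integral_sq_wint (hφ i) hYm hY2 hcov
    rw [← h.2, ofReal_integral_eq_lintegral_ofReal h.1 (Eventually.of_forall fun ω => sq_nonneg _)]
  · intro i
    exact (((wint (hφ i)).continuous.comp_stronglyMeasurable hYs).measurable.pow_const 2).ennreal_ofReal.aemeasurable

lemma expBdd_zero (v : ℝ) : ExpBdd ((0 : ℝ → C(ℝ, ℝ)) v) := ExpBdd.const 0

lemma corr_zero_right (U : ℝ → C(ℝ, ℝ)) : Corr μ U 0 fun _ => 0 := fun _ _ _ _ _ _ _ _ => by simp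

/-- The second moment of a Wick functional. -/
lemma eLpNorm_sq (hι : IsTesting ι hφ) (hξ : IsStdGaussian ξ μ) {F : Finset (ℤ × ℤ)} (hF : IsSymm F)
    {U : ℝ → C(ℝ, ℝ)} {K₁ : ℝ → ℝ} (hU : ∀ v, ExpBdd (U v)) (h₁ : Corr μ U U K₁) (κ : C(Torus, ℝ))
    (hκ : ∀ u, κ u = K₁ (green F u)) : eLpNorm (fun ω => ι (wickField U ξ F ω)) 2 μ ^ 2 = energy hφ κ := by
  rw [← eLpNorm_sub_sq hι hξ hF hF hU expBdd_zero h₁ (corr_zero_right U) (corr_zero_right 0) κ (fun u => by rw [hκ]; ring)]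
  have : ∀ ω, wickField (0 : ℝ → C(ℝ, ℝ)) ξ F ω = 0 := fun ω => rfl
  simp only [this, map_zero, sub_zero]

lemma aestronglyMeasurable_wick (hξ : IsStdGaussian ξ μ) (U : ℝ → C(ℝ, ℝ)) (F : Finset (ℤ × ℤ)) :
    AEStronglyMeasurable (fun ω => ι (wickField U ξ F ω)) μ :=
  (ι.continuous.comp_stronglyMeasurable (stronglyMeasurable_wickField hξ U F)).aestronglyMeasurable

lemma IsStdGaussian.restrict (hξ : IsStdGaussian ξ μ) (F : Finset (ℤ × ℤ)) :
    IsStdGaussian (fun k : F => ξ k) μ := by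
  classical
  refine ⟨fun k => hξ.measurable k, fun S t => ?_⟩
  have h := hξ.map_sum (S.map (Function.Embedding.subtype _)) fun k => if h : k ∈ F then t ⟨k, h⟩ else 0
  simp only [Finset.sum_map, Function.Embedding.subtype_apply, Finset.coe_mem, dite_true, Subtype.coe_eta] at h
  exact h

/-- Hypercontractivity for polynomial Wick functionals with values in `K`. -/
lemma eLpNorm_pol_sq_le (hι : IsTesting ι hφ) (hξ : IsStdGaussian ξ μ) {F : Finset (ℤ × ℤ)} (hF : IsSymm F)
    (w : ℕ → ℝ) (m : ℕ) {p : ℝ} (hp : 2 ≤ p) :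
    eLpNorm (fun ω => ι (wickField (pol w m) ξ F ω)) (ENNReal.ofReal p) μ ^ 2
      ≤ energy hφ (∑ n ∈ Finset.range m, (w n ^ 2 * n.factorial * (p - 1) ^ n) • green F ^ n) := by
  set Y : Ω → C(Torus, ℝ) := wickField (pol w m) ξ F with hY
  have hYs : StronglyMeasurable Y := stronglyMeasurable_wickField hξ _ F
  set κ : C(Torus, ℝ) := ∑ n ∈ Finset.range m, (w n ^ 2 * n.factorial * (p - 1) ^ n) • green F ^ n with hκ
  have hκPD : IsPD κ := IsPD.sum fun n _ => ((isPD_green F).pow n).smul (by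
    have : 0 ≤ p - 1 := by linarith
    positivity)
  have hp0 : 0 < p := by linarith
  have hofp : ENNReal.ofReal p ≠ 0 := by simpa using hp0
  have hsm : ∀ i, StronglyMeasurable fun ω => wint (hφ i) (Y ω) :=
    fun i => (wint (hφ i)).continuous.comp_stronglyMeasurable hYs
  -- Scalar hypercontractivity for one test function. The L^{p/2} norm of a square is the square of
  -- the L^p norm.
  have hone : ∀ i, eLpNorm (fun ω => wint (hφ i) (Y ω) ^ 2) (ENNReal.ofReal (p / 2)) μ ≤ ENNReal.ofReal (form (hφ i) κ) := by
    intro i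
    have h1 := gauss_hypercontractive (hξ.restrict F) (fun k : F => eT k) (hφ i) hp w m
    have e1 : ∀ ω x, ∑ n ∈ Finset.range m, w n * WickExp.hp (∑ k : F, eT k x ^ 2) (∑ k : F, eT k x * ξ k ω) n = Y ω x := by
      intro ω x
      have hg : ∑ k : F, eT k x ^ 2 = green F 0 := by
        rw [← sub_self x, ← sum_eT_mul hF, ← Finset.sum_coe_sort F]
        simp only [sq]
      have hf : ∑ k : F, eT k x * ξ k ω = fld ξ F ω x := by
        rw [fld_apply, ← Finset.sum_coe_sort F]
        simp only [mul_comm]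
      rw [hg, hf]
      exact (pol_apply w m _ _).symm
    have e2 : ∀ q : Torus × Torus, ∑ n ∈ Finset.range m, w n ^ 2 * n.factorial * (p - 1) ^ n * (∑ k : F, eT k q.1 * eT k q.2) ^ n
        = κ (q.1 - q.2) := by
      intro q
      rw [Finset.sum_coe_sort F (fun k => eT k q.1 * eT k q.2), sum_eT_mul hF]
      simp [hκ, ContinuousMap.sum_apply]
    simp only [e1, e2] at h1
    rw [← form_apply (hφ i)] at h1
    have hp2 : ENNReal.ofReal (p / 2) ≠ 0 := by
      have : 0 < p / 2 := by linarith
      simpa using this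
    rw [eLpNorm_eq_lintegral_rpow_enorm_toReal hp2 ENNReal.ofReal_ne_top, ENNReal.toReal_ofReal (by linarith)]
    have e3 : ∀ ω, ‖wint (hφ i) (Y ω) ^ 2‖ₑ ^ (p / 2) = ENNReal.ofReal (|∫ x, Y ω x * φ i x| ^ p) := by
      intro ω
      rw [wint_apply, Real.enorm_eq_ofReal (sq_nonneg _), ENNReal.ofReal_rpow_of_nonneg (sq_nonneg _) (by linarith),
        ← sq_abs, ← Real.rpow_natCast, ← Real.rpow_mul (abs_nonneg _)]
      congr 2
      push_cast
      ring
    simp only [e3]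
    refine (ENNReal.rpow_le_rpow h1 (by positivity)).trans (le_of_eq ?_)
    have hf0 := hκPD.form_nonneg (hφ i)
    rw [ENNReal.ofReal_rpow_of_nonneg (by positivity) (by positivity), ← Real.rpow_mul hf0,
      mul_one_div_cancel (by linarith), Real.rpow_one]
  have hsq : eLpNorm (fun ω => ι (Y ω)) (ENNReal.ofReal p) μ ^ 2 = eLpNorm (fun ω => ‖ι (Y ω)‖ ^ 2) (ENNReal.ofReal (p / 2)) μ := by
    have := eLpNorm_norm_rpow (μ := μ) (p := ENNReal.ofReal (p / 2)) (fun ω => ι (Y ω)) (q := 2) two_pos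
    rw [← ENNReal.ofReal_mul (by linarith), div_mul_cancel₀ _ two_ne_zero] at this
    simp only [Real.rpow_two, ENNReal.rpow_two] at this
    exact this.symm
  rw [hsq]
  -- Since ‖ι Y‖² is the sum of the squared tests and p/2 ≥ 1, Minkowski's inequality in L^{p/2}
  -- adds the scalar bounds over finite sets of tests, and lower semicontinuity of the norm extends
  -- this to all of them.
  refine Lp.eLpNorm_le_of_ae_tendsto (u := (atTop : Filter (Finset I)))
    (f := fun s => ∑ i ∈ s, fun ω => wint (hφ i) (Y ω) ^ 2) (Eventually.of_forall fun s => ?_) (fun s => ?_)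
    (Eventually.of_forall fun ω => ?_)
  · refine (eLpNorm_sum_le (fun i _ => ((hsm i).pow 2).aestronglyMeasurable) ?_).trans ?_
    · rw [← ENNReal.ofReal_one]
      exact ENNReal.ofReal_le_ofReal (by linarith)
    · exact (Finset.sum_le_sum fun i _ => hone i).trans (ENNReal.sum_le_tsum s)
  · exact Finset.aestronglyMeasurable_sum s fun i _ => ((hsm i).pow 2).aestronglyMeasurable
  · have := hι (Y ω)
    simp only [Finset.sum_apply]
    exact this

end Testing

end

end WickExp

namespace WickExp

noncomputable section

/-! ### Convergence in `L^p` -/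

section Convergence

variable {Ω : Type*} [MeasurableSpace Ω] {μ : Measure Ω} {K : Type*} [NormedAddCommGroup K]

lemma TendstoLp.const_smul [NormedSpace ℝ K] {p : ℝ≥0∞} {F : ℕ → Ω → K} {G : Ω → K} (h : TendstoLp p μ F G)
    (c : ℝ) : TendstoLp p μ (fun N ω => c • F N ω) (fun ω => c • G ω) := by
  refine ⟨fun N => (h.1 N).const_smul c, h.2.1.const_smul c, ?_⟩
  have e : ∀ N, eLpNorm ((fun ω => c • F N ω) - fun ω => c • G ω) p μ = ‖c‖ₑ * eLpNorm (F N - G) p μ := fun N => by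
    rw [← eLpNorm_const_smul]
    congr 1
    funext ω
    simp [smul_sub]
  simp only [e]
  have := ENNReal.Tendsto.const_mul (a := ‖c‖ₑ) h.2.2 (Or.inr enorm_ne_top)
  rwa [mul_zero] at this

lemma TendstoLp.add {p : ℝ≥0∞} (hp : 1 ≤ p) {F F' : ℕ → Ω → K} {G G' : Ω → K} (h : TendstoLp p μ F G)
    (h' : TendstoLp p μ F' G') : TendstoLp p μ (fun N ω => F N ω + F' N ω) (fun ω => G ω + G' ω) := by
  refine ⟨fun N => (h.1 N).add (h'.1 N), h.2.1.add h'.2.1, ?_⟩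
  have := h.2.2.add h'.2.2
  rw [add_zero] at this
  refine tendsto_of_tendsto_of_tendsto_of_le_of_le tendsto_const_nhds this (fun _ => zero_le) fun N => ?_
  have e : ((fun ω => F N ω + F' N ω) - fun ω => G ω + G' ω) = (F N - G) + (F' N - G') := by
    funext ω
    simp only [Pi.sub_apply, Pi.add_apply]
    abel
  rw [e]
  exact eLpNorm_add_le ((h.1 N).sub h.2.1).1 ((h'.1 N).sub h'.2.1).1 hp

lemma TendstoLp.sum {J : Type*} {p : ℝ≥0∞} (hp : 1 ≤ p) {F : J → ℕ → Ω → K} {G : J → Ω → K} (s : Finset J)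
    (h : ∀ j ∈ s, TendstoLp p μ (F j) (G j)) : TendstoLp p μ (fun N ω => ∑ j ∈ s, F j N ω) (fun ω => ∑ j ∈ s, G j ω) := by
  classical
  induction s using Finset.induction_on with
  | empty =>
    simp only [Finset.sum_empty]
    have e : ((fun _ => 0) - fun _ => 0 : Ω → K) = 0 := by funext; simp
    refine ⟨fun N => MemLp.zero', MemLp.zero', ?_⟩
    simp only [e, eLpNorm_zero]
    exact tendsto_const_nhds
  | insert j s hj ih =>
    simp only [Finset.sum_insert hj]
    exact (h j (Finset.mem_insert_self _ _)).add hp (ih fun i hi => h i (Finset.mem_insert_of_mem hi))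

lemma TendstoLp.tendstoInMeasure {p : ℝ≥0∞} (hp : 1 ≤ p) {F : ℕ → Ω → K} {G : Ω → K} (h : TendstoLp p μ F G) :
    TendstoInMeasure μ F atTop G :=
  tendstoInMeasure_of_tendsto_eLpNorm (zero_lt_one.trans_le hp).ne' (fun N => (h.1 N).1) h.2.1.1 h.2.2

/-- The exponents p and q are unrelated: the L^q norm is lower semicontinuous under convergence in
measure. In this way L² limits inherit hypercontractive bounds. -/
lemma TendstoLp.eLpNorm_le {p : ℝ≥0∞} (hp : 1 ≤ p) {F : ℕ → Ω → K} {G : Ω → K} (h : TendstoLp p μ F G) {q C : ℝ≥0∞}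
    (hC : ∀ N, eLpNorm (F N) q μ ≤ C) : eLpNorm G q μ ≤ C :=
  eLpNorm_le_of_tendstoInMeasure (Eventually.of_forall hC) (h.tendstoInMeasure hp) fun N => (h.1 N).1

lemma TendstoLp.ae_eq {p : ℝ≥0∞} (hp : 1 ≤ p) {F : ℕ → Ω → K} {G G' : Ω → K} (h : TendstoLp p μ F G)
    (h' : TendstoLp p μ F G') : G =ᵐ[μ] G' :=
  tendstoInMeasure_ae_unique (h.tendstoInMeasure hp) (h'.tendstoInMeasure hp)

lemma TendstoLp.neg {p : ℝ≥0∞} {F : ℕ → Ω → K} {G : Ω → K} (h : TendstoLp p μ F G) :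
    TendstoLp p μ (fun N ω => -F N ω) (fun ω => -G ω) := by
  refine ⟨fun N => (h.1 N).neg, h.2.1.neg, ?_⟩
  have e : ∀ N, eLpNorm ((fun ω => -F N ω) - fun ω => -G ω) p μ = eLpNorm (F N - G) p μ := fun N => by
    rw [← eLpNorm_neg]
    congr 1
    funext ω
    simp only [Pi.neg_apply, Pi.sub_apply]
    abel
  simp only [e]
  exact h.2.2

/-- If `F N → G` and `F' N → G'`, a bound on `F N - F' N` passes to the limit. -/
lemma TendstoLp.eLpNorm_sub_le {p : ℝ≥0∞} (hp : 1 ≤ p) {F F' : ℕ → Ω → K} {G G' : Ω → K} (h : TendstoLp p μ F G)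
    (h' : TendstoLp p μ F' G') {C : ℝ≥0∞} (hC : ∀ N, eLpNorm (fun ω => F N ω - F' N ω) p μ ≤ C) :
    eLpNorm (fun ω => G ω - G' ω) p μ ≤ C := by
  have := (h.add hp h'.neg).eLpNorm_le hp (q := p) (C := C)
  simp only [← sub_eq_add_neg] at this
  exact this hC

lemma tendsto_zero_of_eventually_le {f : ℕ → ℝ≥0∞} {c : ℕ → ℝ≥0∞} (hc : Tendsto c atTop (𝓝 0))
    (h : ∀ M, ∀ᶠ N in atTop, f N ≤ c M) : Tendsto f atTop (𝓝 0) := by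
  rw [ENNReal.tendsto_nhds_zero] at hc ⊢
  intro ε hε
  obtain ⟨M, hM⟩ := (hc ε hε).exists
  exact (h M).mono fun N hN => hN.trans hM

/-- A sequence of sets of frequencies that increases to `ℤ²`. -/
def Exhaust (F : ℕ → Finset (ℤ × ℤ)) : Prop := (∀ N, IsSymm (F N)) ∧ ∀ M, ∀ᶠ N in atTop, box M ⊆ F N

lemma box_mono {M R : ℕ} (h : M ≤ R) : box M ⊆ box R := by
  intro k hk
  simp only [box, Finset.mem_product, Finset.mem_Icc] at hk ⊢
  omega

lemma exhaust_box : Exhaust box := ⟨isSymm_box, fun M => (eventually_ge_atTop M).mono fun _ h => box_mono h⟩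

/-- The boxes give a Cauchy sequence. As the bound depends only on a box contained in both sets,
their limit is also the limit along every exhaustion, and hence does not depend on Λ. -/
lemma exists_limit [CompleteSpace K] {A : Finset (ℤ × ℤ) → Ω → K} (hA : ∀ F, IsSymm F → MemLp (A F) 2 μ)
    {b : ℕ → ℝ≥0∞} (hb : Tendsto b atTop (𝓝 0))
    (h : ∀ M F G, IsSymm F → IsSymm G → box M ⊆ F → box M ⊆ G → eLpNorm (A F - A G) 2 μ ≤ b M) :
    ∃ Φ : Ω → K, ∀ F, Exhaust F → TendstoLp 2 μ (fun N => A (F N)) Φ := by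
  have hbox := fun N => hA _ (isSymm_box N)
  set f : ℕ → Lp K 2 μ := fun N => (hbox N).toLp (A (box N)) with hf
  have hc : CauchySeq f := by
    rw [Lp.cauchySeq_Lp_iff_cauchySeq_eLpNorm]
    have e : ∀ n : ℕ × ℕ, eLpNorm (⇑(f n.1) - ⇑(f n.2)) 2 μ = eLpNorm (A (box n.1) - A (box n.2)) 2 μ := fun n =>
      eLpNorm_congr_ae ((hbox n.1).coeFn_toLp.sub (hbox n.2).coeFn_toLp)
    simp only [e]
    rw [ENNReal.tendsto_nhds_zero] at hb ⊢
    intro ε hε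
    obtain ⟨M, hM⟩ := (hb ε hε).exists
    filter_upwards [eventually_ge_atTop ((M, M) : ℕ × ℕ)] with n hn
    exact (h M _ _ (isSymm_box _) (isSymm_box _) (box_mono hn.1) (box_mono hn.2)).trans hM
  obtain ⟨v, hv⟩ := cauchySeq_tendsto_of_complete hc
  obtain ⟨g, hgv⟩ : ∃ g : Ω → K, g = v := ⟨_, rfl⟩
  have hgm : MemLp g 2 μ := hgv ▸ Lp.memLp v
  have hg' : Tendsto (fun N => eLpNorm (A (box N) - g) 2 μ) atTop (𝓝 0) := by
    subst hgv
    rw [← Lp.tendsto_Lp_iff_tendsto_eLpNorm'' _ hbox _ hgm, Lp.toLp_coeFn]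
    exact hv
  refine ⟨g, fun F hF => ⟨fun N => hA _ (hF.1 N), hgm, ?_⟩⟩
  have hc : Tendsto (fun M => b M + eLpNorm (A (box M) - g) 2 μ) atTop (𝓝 0) := by simpa using hb.add hg'
  refine tendsto_zero_of_eventually_le hc fun M => (hF.2 M).mono fun N hN => ?_
  have e : A (F N) - g = (A (F N) - A (box M)) + (A (box M) - g) := by abel
  rw [e]
  refine (eLpNorm_add_le ((hA _ (hF.1 N)).sub (hbox M)).1 ((hbox M).sub hgm).1 one_le_two).trans ?_
  gcongr
  exact h M _ _ (hF.1 N) (isSymm_box M) hN subset_rfl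

/-- Convergence in `L²` of a sequence bounded in all `L^p` is convergence in all `L^p`. -/
lemma tendsto_eLpNorm_of_bounded [IsProbabilityMeasure μ] {f : ℕ → Ω → K} (hf : ∀ N, AEStronglyMeasurable (f N) μ)
    (h2 : Tendsto (fun N => eLpNorm (f N) 2 μ) atTop (𝓝 0))
    (hb : ∀ q : ℝ, 2 ≤ q → ∃ C : ℝ≥0∞, C ≠ ∞ ∧ ∀ N, eLpNorm (f N) (ENNReal.ofReal q) μ ≤ C) {p : ℝ≥0∞} (hp : p ≠ ∞) :
    Tendsto (fun N => eLpNorm (f N) p μ) atTop (𝓝 0) := by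
  set q : ℝ := max p.toReal 2 with hq
  have hq2 : 2 ≤ q := le_max_right _ _
  have hpq : p ≤ ENNReal.ofReal q := by
    rw [← ENNReal.ofReal_toReal hp]
    exact ENNReal.ofReal_le_ofReal (le_max_left _ _)
  obtain ⟨C, hC, hCb⟩ := hb (2 * (q - 1)) (by linarith)
  -- Cauchy–Schwarz for |f|^q = |f| · |f|^{q-1}; this is why boundedness is used at the exponent 2(q
  -- - 1).
  have key : ∀ N, eLpNorm (f N) (ENNReal.ofReal q) μ ^ q ≤ eLpNorm (f N) 2 μ * C ^ (q - 1) := by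
    intro N
    have h1 := eLpNorm_norm_rpow (μ := μ) (p := 1) (f N) (q := q) (by linarith)
    have h3 := eLpNorm_norm_rpow (μ := μ) (p := 2) (f N) (q := q - 1) (by linarith)
    rw [one_mul] at h1
    have e2 : (2 : ℝ≥0∞) * ENNReal.ofReal (q - 1) = ENNReal.ofReal (2 * (q - 1)) := by
      rw [ENNReal.ofReal_mul (by norm_num)]
      norm_num
    rw [e2] at h3
    rw [← h1]
    have e : (fun ω => ‖f N ω‖ ^ q) = (fun ω => ‖f N ω‖) • fun ω => ‖f N ω‖ ^ (q - 1) := by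
      funext ω
      simp only [Pi.smul_apply', smul_eq_mul]
      rcases eq_or_ne ‖f N ω‖ 0 with h0 | h0
      · rw [h0, Real.zero_rpow (by linarith), zero_mul]
      · rw [← Real.rpow_one_add' (norm_nonneg _) (by linarith)]
        congr 1
        ring
    rw [e]
    refine (eLpNorm_smul_le_mul_eLpNorm (p := 2) (q := 2) ((hf N).norm.aemeasurable.pow_const _).aestronglyMeasurable
      (hf N).norm).trans ?_
    rw [h3, eLpNorm_norm]
    exact mul_le_mul_right (ENNReal.rpow_le_rpow (hCb N) (by linarith)) _
  have hlim : Tendsto (fun N => (eLpNorm (f N) 2 μ * C ^ (q - 1)) ^ (1 / q)) atTop (𝓝 0) := by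
    have h3 : Tendsto (fun N => eLpNorm (f N) 2 μ * C ^ (q - 1)) atTop (𝓝 0) := by
      have := ENNReal.Tendsto.mul_const (b := C ^ (q - 1)) h2
        (Or.inr (ENNReal.rpow_ne_top_of_nonneg (by linarith) hC))
      rwa [zero_mul] at this
    have h4 := (ENNReal.continuous_rpow_const (y := 1 / q)).tendsto 0 |>.comp h3
    rwa [ENNReal.zero_rpow_of_pos (by positivity)] at h4
  refine tendsto_of_tendsto_of_tendsto_of_le_of_le tendsto_const_nhds hlim (fun _ => zero_le) fun N => ?_
  refine (eLpNorm_le_eLpNorm_of_exponent_le hpq (hf N)).trans ?_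
  have h5 := ENNReal.rpow_le_rpow (key N) (by positivity : (0 : ℝ) ≤ 1 / q)
  rwa [← ENNReal.rpow_mul, mul_one_div_cancel (by linarith), ENNReal.rpow_one] at h5

end Convergence

/-! ### Monotone families of kernels -/

section Monotone

variable {I : Type*} {φ : I → Torus → ℝ} {hφ : ∀ i, Integrable (φ i) volume}

/-- A family of positive definite kernels that increases with the cut-off. -/
structure IsMonoPD (κ : Finset (ℤ × ℤ) → C(Torus, ℝ)) : Prop where
  isPD : ∀ F, IsPD (κ F)
  mono : ∀ F G, F ⊆ G → IsPD (κ G - κ F)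

/-- The kernel of the difference of two Wick functionals splits into the increments from F ∩ G to F
and from F ∩ G to G. As F ∩ G contains the box, each has energy at most what is still missing at box
M from the finite supremum over all boxes. -/
lemma IsMonoPD.exists_oscillation {κ : Finset (ℤ × ℤ) → C(Torus, ℝ)} (h : IsMonoPD κ) {C : ℝ≥0∞} (hC : C ≠ ∞)
    (hκ : ∀ F, energy hφ (κ F) ≤ C) :
    ∃ b : ℕ → ℝ≥0∞, Tendsto b atTop (𝓝 0) ∧ ∀ M F G, box M ⊆ F → box M ⊆ G →
      energy hφ (κ F - (2 : ℝ) • κ (F ∩ G) + κ G) ≤ b M := by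
  set T : ℕ → ℝ≥0∞ := fun M => energy hφ (κ (box M)) with hT
  have hTm : Monotone T := fun M R hMR => energy_mono hφ (h.mono _ _ (box_mono hMR))
  have hTC : ⨆ M, T M ≤ C := iSup_le fun M => hκ _
  have hTt : ⨆ M, T M ≠ ∞ := ne_top_of_le_ne_top hC hTC
  have hdiff : ∀ M F, box M ⊆ F → energy hφ (κ F - κ (box M)) ≤ (⨆ M, T M) - T M := by
    intro M F hF
    obtain ⟨R, hR⟩ := subset_box F
    have h1 : energy hφ (κ F - κ (box M)) + T M = energy hφ (κ F) := by
      rw [hT, ← energy_add hφ (h.mono _ _ hF) (h.isPD _), sub_add_cancel]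
    rw [ENNReal.eq_sub_of_add_eq (ne_top_of_le_ne_top hC (hκ _)) h1]
    exact tsub_le_tsub_right ((energy_mono hφ (h.mono _ _ hR)).trans (le_iSup T R)) _
  refine ⟨fun M => ((⨆ M, T M) - T M) + ((⨆ M, T M) - T M), ?_, fun M F G hF hG => ?_⟩
  · have h1 := ENNReal.Tendsto.sub (tendsto_const_nhds (x := ⨆ M, T M)) (tendsto_atTop_iSup hTm) (Or.inl hTt)
    rw [tsub_self] at h1
    simpa using h1.add h1
  · have hFG : box M ⊆ F ∩ G := Finset.subset_inter hF hG
    have e : κ F - (2 : ℝ) • κ (F ∩ G) + κ G = (κ F - κ (F ∩ G)) + (κ G - κ (F ∩ G)) := by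
      rw [two_smul]; abel
    have hle : ∀ H, F ∩ G ⊆ H → box M ⊆ H → energy hφ (κ H - κ (F ∩ G)) ≤ (⨆ M, T M) - T M := fun H hH hM => by
      refine (energy_mono hφ ?_).trans (hdiff M H hM)
      rw [sub_sub_sub_cancel_left]
      exact h.mono _ _ hFG
    rw [e, energy_add hφ (h.mono _ _ Finset.inter_subset_left) (h.mono _ _ Finset.inter_subset_right)]
    exact add_le_add (hle F Finset.inter_subset_left hF) (hle G Finset.inter_subset_right hG)

lemma isMonoPD_green_pow (n : ℕ) {c : ℝ} (hc : 0 ≤ c) : IsMonoPD fun F => c • green F ^ n :=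
  ⟨fun F => ((isPD_green F).pow n).smul hc, fun F G h => by
    rw [← smul_sub]
    exact ((isPD_green F).pow_sub_pow (isPD_green_sub h) n).smul hc⟩

lemma isMonoPD_expT {β : ℝ} (hβ : 0 ≤ β) : IsMonoPD fun F => expT (β • green F) :=
  ⟨fun F => ((isPD_green F).smul hβ).expT, fun _ _ h => isPD_exp_green_sub h hβ⟩

/-- A single term of the exponential series lies below the exponential in the positive definite
order. So the bound for one small β controls the Wick powers of every order. -/
lemma energy_pow_le (F : Finset (ℤ × ℤ)) (n : ℕ) {β : ℝ} (hβ : 0 < β) {c : ℝ} (hc : 0 ≤ c) :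
    energy hφ (c • green F ^ n) ≤ ENNReal.ofReal (c * n.factorial / β ^ n) * energy hφ (expT (β • green F)) := by
  have h1 := ((isPD_green F).smul hβ.le).expT_sub_sum {n}
  rw [Finset.sum_singleton] at h1
  rw [← energy_smul hφ _ (by positivity)]
  refine energy_mono hφ ?_
  have h2 := h1.smul (c := c * n.factorial / β ^ n) (by positivity)
  convert h2 using 1
  rw [smul_sub, smul_pow, smul_smul, smul_smul]
  congr 2
  have : (n.factorial : ℝ) ≠ 0 := by positivity
  field_simp

end Monotone

end

end WickExp

namespace WickExp

noncomputable section

/-! ### Wick powers and Wick exponentials of the field, tested by `ι` -/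

variable {Ω : Type*} [MeasurableSpace Ω] {μ : Measure Ω} [IsProbabilityMeasure μ] {ξ : ℤ × ℤ → Ω → ℝ}
  {K : Type*} [NormedAddCommGroup K] [NormedSpace ℝ K] {ι : C(Torus, ℝ) →L[ℝ] K}
  {I : Type*} [Countable I] {φ : I → Torus → ℝ} {hφ : ∀ i, Integrable (φ i) volume}

/-- The exponential energies of the cut-off Green functions are bounded, below the threshold `θ`. -/
def BddEnergy (hφ : ∀ i, Integrable (φ i) volume) (θ : ℝ) : Prop :=
  ∀ β, 0 ≤ β → β < θ → ∃ C : ℝ≥0∞, C ≠ ∞ ∧ ∀ F, energy hφ (expT (β • green F)) ≤ C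

lemma le_sqrt_of_sq_le {x b : ℝ≥0∞} (h : x ^ 2 ≤ b) : x ≤ b ^ (1 / 2 : ℝ) := by
  rw [one_div, ENNReal.le_rpow_inv_iff two_pos, ENNReal.rpow_two]
  exact h

lemma tendsto_sqrt_zero {b : ℕ → ℝ≥0∞} (h : Tendsto b atTop (𝓝 0)) : Tendsto (fun M => b M ^ (1 / 2 : ℝ)) atTop (𝓝 0) := by
  have h4 := (ENNReal.continuous_rpow_const (y := 1 / 2)).tendsto 0 |>.comp h
  rwa [ENNReal.zero_rpow_of_pos (by norm_num)] at h4

/-- Wick functionals with a monotone bounded family of correlation kernels converge in `L²`. -/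
lemma exists_wick_limit [CompleteSpace K] (hι : IsTesting ι hφ) (hξ : IsStdGaussian ξ μ) {U : ℝ → C(ℝ, ℝ)} {k : ℝ → ℝ}
    (hU : ∀ v, ExpBdd (U v)) (hk : Corr μ U U k) {κ : Finset (ℤ × ℤ) → C(Torus, ℝ)} (hκ : ∀ F u, κ F u = k (green F u))
    (hm : IsMonoPD κ) {C : ℝ≥0∞} (hC : C ≠ ∞) (hκC : ∀ F, energy hφ (κ F) ≤ C) :
    ∃ Φ : Ω → K, ∀ F, Exhaust F → TendstoLp 2 μ (fun N ω => ι (wickField U ξ (F N) ω)) Φ := by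
  obtain ⟨b, hb, hbκ⟩ := hm.exists_oscillation (hφ := hφ) hC hκC
  refine exists_limit (A := fun F ω => ι (wickField U ξ F ω)) (fun F hF => ⟨aestronglyMeasurable_wick hξ U F, ?_⟩)
    (tendsto_sqrt_zero hb) fun M F G hF hG hMF hMG => ?_
  · refine (le_sqrt_of_sq_le ((eLpNorm_sq hι hξ hF hU hk _ (hκ F)).trans_le (hκC F))).trans_lt ?_
    exact (ENNReal.rpow_ne_top_of_nonneg (by norm_num) hC).lt_top
  · refine le_sqrt_of_sq_le ((eLpNorm_sub_sq hι hξ hF hG hU hU hk hk hk _ fun u => ?_).trans_le (hbκ M F G hMF hMG))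
    simp only [ContinuousMap.add_apply, ContinuousMap.sub_apply, ContinuousMap.smul_apply, smul_eq_mul, hκ]

lemma BddEnergy.pow {θ : ℝ} (h : BddEnergy hφ θ) (hθ : 0 < θ) (n : ℕ) {c : ℝ} (hc : 0 ≤ c) :
    ∃ C : ℝ≥0∞, C ≠ ∞ ∧ ∀ F, energy hφ (c • green F ^ n) ≤ C := by
  obtain ⟨C, hC, hF⟩ := h (θ / 2) (by positivity) (by linarith)
  refine ⟨ENNReal.ofReal (c * n.factorial / (θ / 2) ^ n) * C, ENNReal.mul_ne_top ENNReal.ofReal_ne_top hC, fun F => ?_⟩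
  refine (energy_pow_le F n (by positivity : 0 < θ / 2) hc).trans ?_
  gcongr
  exact hF F

lemma pol_single (n : ℕ) : pol (Pi.single n 1) (n + 1) = herm n := by
  funext v
  rw [pol, Finset.sum_eq_single n]
  · simp
  · intro j _ hj
    simp [hj]
  · simp

/-- The Wick powers converge in all `L^p`. -/
lemma exists_wickPower [CompleteSpace K] (hι : IsTesting ι hφ) (hξ : IsStdGaussian ξ μ) {θ : ℝ} (hθ : 0 < θ)
    (hE : BddEnergy hφ θ) (n : ℕ) :
    ∃ Φ : Ω → K, ∀ F, Exhaust F → ∀ p : ℝ≥0∞, 1 ≤ p → p ≠ ∞ →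
      TendstoLp p μ (fun N ω => ι (wickField (herm n) ξ (F N) ω)) Φ := by
  obtain ⟨C, hC, hCF⟩ := hE.pow hθ n (c := n.factorial) (by positivity)
  obtain ⟨Φ, hΦ⟩ := exists_wick_limit hι hξ (expBdd_herm n) (corr_herm n) (κ := fun F => (n.factorial : ℝ) • green F ^ n)
    (fun F u => by simp) (isMonoPD_green_pow n (by positivity)) hC hCF
  -- Hypercontractivity for a single chaos costs the factor (q-1)ⁿ and is uniform in the cut-off.
  have hb : ∀ q : ℝ, 2 ≤ q → ∃ C : ℝ≥0∞, C ≠ ∞ ∧ ∀ F, IsSymm F →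
      eLpNorm (fun ω => ι (wickField (herm n) ξ F ω)) (ENNReal.ofReal q) μ ≤ C := by
    intro q hq
    have hq0 : 0 ≤ q - 1 := by linarith
    obtain ⟨C, hC, hCF⟩ := hE.pow hθ n (c := n.factorial * (q - 1) ^ n) (by positivity)
    refine ⟨C ^ (1 / 2 : ℝ), ENNReal.rpow_ne_top_of_nonneg (by norm_num) hC, fun F hF => le_sqrt_of_sq_le ?_⟩
    have h1 := eLpNorm_pol_sq_le hι hξ hF (Pi.single n 1) (n + 1) hq
    rw [pol_single, Finset.sum_eq_single n] at h1
    · refine h1.trans (le_trans (le_of_eq ?_) (hCF F))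
      simp
    · intro j _ hj
      simp [hj]
    · simp
  have hbΦ : ∀ q : ℝ, 2 ≤ q → ∃ C : ℝ≥0∞, C ≠ ∞ ∧ eLpNorm Φ (ENNReal.ofReal q) μ ≤ C := fun q hq => by
    obtain ⟨C, hC, h⟩ := hb q hq
    exact ⟨C, hC, (hΦ box exhaust_box).eLpNorm_le one_le_two fun N => h _ (isSymm_box N)⟩
  have hmem : ∀ {f : Ω → K}, AEStronglyMeasurable f μ → (∀ q : ℝ, 2 ≤ q → ∃ C : ℝ≥0∞, C ≠ ∞ ∧ eLpNorm f (ENNReal.ofReal q) μ ≤ C) →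
      ∀ p : ℝ≥0∞, p ≠ ∞ → MemLp f p μ := by
    intro f hf h p hp
    obtain ⟨C, hC, h'⟩ := h (max p.toReal 2) (le_max_right _ _)
    refine MemLp.mono_exponent (q := ENNReal.ofReal (max p.toReal 2)) ⟨hf, h'.trans_lt hC.lt_top⟩ ?_
    rw [← ENNReal.ofReal_toReal hp]
    exact ENNReal.ofReal_le_ofReal (by simp)
  refine ⟨Φ, fun F hF p hp hpt => ⟨fun N => hmem ((hΦ F hF).1 N).1 (fun q hq => ?_) p hpt, hmem (hΦ F hF).2.1.1 hbΦ p hpt, ?_⟩⟩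
  · obtain ⟨C, hC, h⟩ := hb q hq
    exact ⟨C, hC, h _ (hF.1 N)⟩
  · refine tendsto_eLpNorm_of_bounded (fun N => (((hΦ F hF).1 N).sub (hΦ F hF).2.1).1) (hΦ F hF).2.2 (fun q hq => ?_) hpt
    obtain ⟨C, hC, h⟩ := hb q hq
    obtain ⟨C', hC', h'⟩ := hbΦ q hq
    refine ⟨C + C', ENNReal.add_ne_top.2 ⟨hC, hC'⟩, fun N => ?_⟩
    refine (eLpNorm_sub_le ((hΦ F hF).1 N).1 (hΦ F hF).2.1.1 ?_).trans (add_le_add (h _ (hF.1 N)) h')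
    rw [← ENNReal.ofReal_one]
    exact ENNReal.ofReal_le_ofReal (by linarith)

/-- The remainder of the exponential series of a kernel, in terms of a larger exponential. -/
lemma IsPD.expT_tail {R : C(Torus, ℝ)} (hR : IsPD R) {s β : ℝ} (hs : 0 ≤ s) (hβ : 0 < β) (hsβ : s ≤ β) (m : ℕ) :
    IsPD ((s / β) ^ m • WickExp.expT (β • R) - (WickExp.expT (s • R) - ∑ n ∈ Finset.range m, (s ^ n / n.factorial) • R ^ n)) := by
  have h1 := (hasSum_expT (β • R)).const_smul ((s / β) ^ m)
  have h2 := (hasSum_expT (s • R)).sub (hasSum_sum_of_ne_finset_zero (s := Finset.range m)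
    (f := fun n => if n ∈ Finset.range m then (s ^ n / n.factorial) • R ^ n else 0) fun n hn => if_neg hn)
  have e : ∑ n ∈ Finset.range m, (if n ∈ Finset.range m then (s ^ n / n.factorial) • R ^ n else 0)
      = ∑ n ∈ Finset.range m, (s ^ n / n.factorial) • R ^ n := Finset.sum_congr rfl fun n hn => if_pos hn
  rw [e] at h2
  refine IsPD.of_hasSum (fun n => ?_) (h1.sub h2)
  have hn0 : (0 : ℝ) < n.factorial := by positivity
  simp only [smul_pow, smul_smul]
  split_ifs with hn
  · have : ((n.factorial : ℝ)⁻¹ * s ^ n) = s ^ n / n.factorial := by ring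
    rw [this, sub_self, sub_zero]
    exact (hR.pow n).smul (by positivity)
  · rw [sub_zero, ← sub_smul]
    refine (hR.pow n).smul ?_
    have hmn : m ≤ n := by simpa using hn
    -- Beyond order m each coefficient sⁿ = (s/β)ⁿ βⁿ is at most (s/β)^m βⁿ.
    have h3 : (s / β) ^ n ≤ (s / β) ^ m := pow_le_pow_of_le_one (by positivity) ((div_le_one hβ).2 hsβ) hmn
    have h4 : s ^ n = (s / β) ^ n * β ^ n := by rw [← mul_pow, div_mul_cancel₀ _ hβ.ne']
    rw [h4, sub_nonneg]
    calc (n.factorial : ℝ)⁻¹ * ((s / β) ^ n * β ^ n) = (s / β) ^ n * ((n.factorial : ℝ)⁻¹ * β ^ n) := by ring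
      _ ≤ (s / β) ^ m * ((n.factorial : ℝ)⁻¹ * β ^ n) := by gcongr

/-- The distance between a Wick exponential and the partial sums of its series. -/
lemma eLpNorm_pol_sub_wexp_sq_le (hι : IsTesting ι hφ) (hξ : IsStdGaussian ξ μ) {F : Finset (ℤ × ℤ)} (hF : IsSymm F)
    (a : ℝ) {β : ℝ} (hβ : 0 < β) (ha : a ^ 2 ≤ β) (m : ℕ) :
    eLpNorm (fun ω => ι (wickField (pol (fun n => a ^ n / n.factorial) m) ξ F ω) - ι (wickField (wexp a) ξ F ω)) 2 μ ^ 2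
      ≤ ENNReal.ofReal ((a ^ 2 / β) ^ m) * energy hφ (expT (β • green F)) := by
  rw [eLpNorm_sub_sq hι hξ hF hF (expBdd_pol _ m) (expBdd_wexp a) (corr_pol _ m) (corr_pol_wexp _ m a) (corr_wexp a)
    (expT (a ^ 2 • green F) - ∑ n ∈ Finset.range m, ((a ^ 2) ^ n / n.factorial) • green F ^ n), ← energy_smul hφ _ (by positivity)]
  · exact energy_mono hφ ((isPD_green F).expT_tail (sq_nonneg a) hβ ha m)
  · intro u
    simp only [ContinuousMap.sub_apply, expT_apply, ContinuousMap.smul_apply, smul_eq_mul, ContinuousMap.sum_apply,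
      ContinuousMap.pow_apply, Finset.inter_self, Finset.mul_sum]
    rw [← sub_eq_zero]
    -- The second moment of the partial sum equals its correlation with the exponential, so the
    -- combination 1 - 2 leaves exactly minus the partial sum of exp(a² G).
    have e : ∀ n ∈ Finset.range m, (a ^ n / n.factorial) ^ 2 * n.factorial * green F u ^ n
        - 2 * (a ^ n / n.factorial * (a * green F u) ^ n) + (a ^ 2) ^ n / n.factorial * green F u ^ n = 0 := by
      intro n _
      have : (n.factorial : ℝ) ≠ 0 := by positivity
      rw [mul_pow]
      field_simp
      ring
    have e' := Finset.sum_eq_zero e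
    rw [Finset.sum_add_distrib, Finset.sum_sub_distrib] at e'
    linarith

/-- Wick powers and Wick exponentials of the field. -/
theorem exists_wick [CompleteSpace K] (hι : IsTesting ι hφ) (hξ : IsStdGaussian ξ μ) {θ : ℝ} (hθ : 0 < θ)
    (hE : BddEnergy hφ θ) :
    ∃ (Φ : ℕ → Ω → K) (W : ℝ → Ω → K),
      (∀ n F, Exhaust F → ∀ p : ℝ≥0∞, 1 ≤ p → p ≠ ∞ →
        TendstoLp p μ (fun N ω => ι (wickField (herm n) ξ (F N) ω)) (Φ n)) ∧
      (∀ a, a ^ 2 < θ →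
        TendstoLp 2 μ (fun m ω => ∑ n ∈ Finset.range m, (a ^ n / n.factorial) • Φ n ω) (W a) ∧
        ∀ F, Exhaust F → TendstoLp 2 μ (fun N ω => ι (wickField (wexp a) ξ (F N) ω)) (W a)) ∧
      (∀ p a : ℝ, 2 ≤ p → a ^ 2 * (p - 1) < θ → MemLp (W a) (ENNReal.ofReal p) μ) := by
  choose Φ hΦ using exists_wickPower (ι := ι) hι hξ hθ hE
  -- The bound on a is placed inside the existential, so that one function of a is chosen; above the
  -- threshold its value 0 is irrelevant.
  have hW : ∀ a : ℝ, ∃ W : Ω → K, a ^ 2 < θ → ∀ F, Exhaust F → TendstoLp 2 μ (fun N ω => ι (wickField (wexp a) ξ (F N) ω)) W := by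
    intro a
    by_cases ha : a ^ 2 < θ
    · obtain ⟨C, hC, hCF⟩ := hE (a ^ 2) (sq_nonneg a) ha
      obtain ⟨W, hW⟩ := exists_wick_limit hι hξ (expBdd_wexp a) (corr_wexp a) (κ := fun F => expT (a ^ 2 • green F))
        (fun F u => by simp [expT_apply]) (isMonoPD_expT (sq_nonneg a)) hC hCF
      exact ⟨W, fun _ => hW⟩
    · exact ⟨0, fun h => absurd h ha⟩
  choose W hW using hW
  have hpol : ∀ a m, TendstoLp 2 μ (fun N ω => ι (wickField (pol (fun n => a ^ n / n.factorial) m) ξ (box N) ω))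
      (fun ω => ∑ n ∈ Finset.range m, (a ^ n / n.factorial) • Φ n ω) := by
    intro a m
    have h := TendstoLp.sum one_le_two (Finset.range m) fun n _ =>
      (hΦ n box exhaust_box 2 one_le_two ENNReal.ofNat_ne_top).const_smul (a ^ n / n.factorial)
    convert h using 3 with N ω
    have : wickField (pol (fun n => a ^ n / n.factorial) m) ξ (box N) ω
        = ∑ n ∈ Finset.range m, (a ^ n / n.factorial) • wickField (herm n) ξ (box N) ω := by
      ext x
      simp only [ContinuousMap.sum_apply, ContinuousMap.smul_apply, smul_eq_mul]
      exact pol_apply _ _ _ _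
    rw [this, map_sum]
    simp only [map_smul]
  have hser : ∀ a, a ^ 2 < θ → TendstoLp 2 μ (fun m ω => ∑ n ∈ Finset.range m, (a ^ n / n.factorial) • Φ n ω) (W a) := by
    intro a ha
    have hWa := hW a ha box exhaust_box
    refine ⟨fun m => (hpol a m).2.1, hWa.2.1, ?_⟩
    -- An exponent strictly between a² and θ makes the remainders geometric, uniformly in the
    -- cut-off, so the bound survives the removal of the cut-off.
    set β := (a ^ 2 + θ) / 2 with hβ
    have h1 : a ^ 2 < β := by rw [hβ]; linarith
    have h2 : β < θ := by rw [hβ]; linarith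
    have h0 : 0 < β := (sq_nonneg a).trans_lt h1
    obtain ⟨C, hC, hCF⟩ := hE β h0.le h2
    have hlim : Tendsto (fun m => (ENNReal.ofReal ((a ^ 2 / β) ^ m) * C) ^ (1 / 2 : ℝ)) atTop (𝓝 0) := by
      refine tendsto_sqrt_zero ?_
      have h3 : Tendsto (fun m => (a ^ 2 / β) ^ m) atTop (𝓝 0) :=
        tendsto_pow_atTop_nhds_zero_of_lt_one (by positivity) ((div_lt_one h0).2 h1)
      have h4 := ENNReal.Tendsto.mul_const (b := C) (ENNReal.tendsto_ofReal h3) (Or.inr hC)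
      rwa [ENNReal.ofReal_zero, zero_mul] at h4
    refine tendsto_of_tendsto_of_tendsto_of_le_of_le tendsto_const_nhds hlim (fun _ => zero_le) fun m => ?_
    refine (hpol a m).eLpNorm_sub_le one_le_two hWa fun N => le_sqrt_of_sq_le ?_
    refine (eLpNorm_pol_sub_wexp_sq_le hι hξ (isSymm_box N) a h0 h1.le m).trans ?_
    gcongr
    exact hCF _
  refine ⟨Φ, W, hΦ, fun a ha => ⟨hser a ha, hW a ha⟩, fun p a hp ha => ?_⟩
  have hp1 : 1 ≤ p - 1 := by linarith
  have ha' : a ^ 2 < θ := lt_of_le_of_lt (by nlinarith [sq_nonneg a]) ha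
  obtain ⟨C, hC, hCF⟩ := hE (a ^ 2 * (p - 1)) (by positivity) ha
  refine ⟨(hser a ha').2.1.1, ?_⟩
  -- With weights aⁿ/n! the hypercontractive kernels are partial sums of exp(a² (p-1) G), which
  -- gives one bound for all m and N. Lower semicontinuity is used twice, for the cut-off and then
  -- for the series.
  have hle : eLpNorm (W a) (ENNReal.ofReal p) μ ≤ C ^ (1 / 2 : ℝ) := by
    refine (hser a ha').eLpNorm_le one_le_two fun m => (hpol a m).eLpNorm_le one_le_two fun N => le_sqrt_of_sq_le ?_
    refine (eLpNorm_pol_sq_le hι hξ (isSymm_box N) _ m hp).trans ((energy_mono hφ ?_).trans (hCF (box N)))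
    have h1 := ((isPD_green (box N)).smul (by positivity : 0 ≤ a ^ 2 * (p - 1))).expT_sub_sum (Finset.range m)
    convert h1 using 2
    refine Finset.sum_congr rfl fun n _ => ?_
    have : (n.factorial : ℝ) ≠ 0 := by positivity
    rw [smul_pow, smul_smul, mul_pow]
    congr 1
    field_simp
    ring
  exact hle.trans_lt (ENNReal.rpow_ne_top_of_nonneg (by norm_num) hC).lt_top

end

end WickExp

namespace WickExp

noncomputable section

/-! ### The free field in independent coordinates -/

section Coordinates

variable {δ : ℝ}

/-- The coordinates of `z` with respect to the functions `eT`. -/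
def coord (k : ℤ × ℤ) (z : Sobolev (-δ)) : ℝ := √(lam k) * ((z.hat k).re + (z.hat k).im)

/-- The factor λ_k^{1+δ} is the inverse of ‖seriesTerm δ k‖², so the coordinates are the continuous
functionals dual to the terms of the random series, as `coord_seriesTerm` confirms. -/
lemma coord_eq_inner (k : ℤ × ℤ) (z : Sobolev (-δ)) : coord k z = lam k ^ (1 + δ) * inner ℝ (seriesTerm δ k) z := by
  rw [real_inner_comm, inner_term, ← mul_assoc, ← Real.rpow_add (lam_pos k), coord, Real.sqrt_eq_rpow]
  congr 2
  ring

lemma continuous_coord (k : ℤ × ℤ) : Continuous (coord k : Sobolev (-δ) → ℝ) := by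
  have : (coord k : Sobolev (-δ) → ℝ) = fun z => lam k ^ (1 + δ) * inner ℝ (seriesTerm δ k) z := funext (coord_eq_inner k)
  rw [this]
  fun_prop

lemma coord_seriesTerm (k j : ℤ × ℤ) : coord k (seriesTerm δ j) = if j = k then 1 else 0 := by
  have h : (√(lam k)) * lam k ^ (-(1 / 2) : ℝ) = 1 := by
    rw [Real.sqrt_eq_rpow, ← Real.rpow_add (lam_pos k)]
    norm_num
  rw [coord, seriesTerm, hat_series (single_hasSum _).summable, seriesCoef, Complex.re_ofReal_mul, Complex.im_ofReal_mul,
    ← mul_add, ← mul_assoc, h, one_mul, Complex.div_ofNat_re, Complex.div_ofNat_im]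
  simp only [Complex.add_re, Complex.add_im, Complex.re_mul_ofReal, Complex.im_mul_ofReal, Complex.sub_re, Complex.sub_im,
    Complex.one_re, Complex.one_im, Complex.I_re, Complex.I_im, Pi.single_apply, eq_comm (a := k)]
  split_ifs <;> norm_num

/-- Under the free field the coordinates are independent standard Gaussian variables. -/
lemma IsFreeField.isStdGaussian {hδ : 0 < δ} {μ : Measure (Sobolev (-δ))} (hμ : IsFreeField δ hδ μ) :
    IsStdGaussian (coord (δ := δ)) μ := by
  have := hμ.isGaussian
  refine ⟨fun k => (continuous_coord k).measurable, fun F t => ?_⟩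
  -- The Riesz representative of the linear combination of coordinates. The operator A^{1+δ} cancels
  -- the powers of λ_k, so that A^{1+δ} l has coordinates t_k on F and the variance is ∑ t_k².
  set l : Sobolev (-δ) := ∑ k ∈ F, (t k * lam k ^ (1 + δ)) • seriesTerm δ k with hl
  have hlz : ∀ z, inner ℝ l z = ∑ k ∈ F, t k * coord k z := by
    intro z
    rw [hl, sum_inner]
    refine Finset.sum_congr rfl fun k _ => ?_
    rw [real_inner_smul_left, coord_eq_inner, mul_assoc]
  have hcl : ∀ k ∈ F, coord k l = t k * lam k ^ (1 + δ) := by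
    intro k hk
    rw [coord_eq_inner, hl, inner_sum, Finset.mul_sum, Finset.sum_eq_single k]
    · rw [real_inner_smul_right, mul_left_comm, ← coord_eq_inner, coord_seriesTerm, if_pos rfl, mul_one]
    · intro j _ hj
      rw [real_inner_smul_right, mul_left_comm, ← coord_eq_inner, coord_seriesTerm, if_neg hj, mul_zero]
    · exact fun h => absurd hk h
  have hA : ∀ k ∈ F, coord k (l.resolventPow (1 + δ) (by linarith)) = t k := by
    intro k hk
    have h1 : coord k (l.resolventPow (1 + δ) (by linarith)) = lam k ^ (-(1 + δ)) * coord k l := by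
      rw [coord, Sobolev.resolventPow, Sobolev.hat_ofCoeff, Complex.re_ofReal_mul, Complex.im_ofReal_mul, coord]
      ring
    rw [h1, hcl k hk, mul_left_comm, ← Real.rpow_add (lam_pos k), neg_add_cancel, Real.rpow_zero, mul_one]
  have hvar : inner ℝ (l.resolventPow (1 + δ) (by linarith)) l = ∑ k ∈ F, t k ^ 2 := by
    rw [real_inner_comm, hlz]
    exact Finset.sum_congr rfl fun k hk => by rw [hA k hk, sq]
  have h1 := IsGaussian.map_eq_gaussianReal (μ := μ) (innerSL ℝ l)
  have e : (fun z => ∑ k ∈ F, t k * coord k z) = innerSL ℝ l := by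
    funext z
    rw [← hlz]
    rfl
  have h0 : ∫ z, innerSL ℝ l z ∂μ = 0 := hμ.mean_zero l
  have hv : Var[innerSL ℝ l; μ] = ∑ k ∈ F, t k ^ 2 := by
    rw [variance_eq_integral (innerSL ℝ l).continuous.aemeasurable, h0, ← hvar, ← hμ.covariance l l]
    congr 1
    funext z
    rw [sub_zero, sq]
    rfl
  rw [e, h1, h0, hv]

/-- The product (Re ẑ + Im ẑ)(cos - sin) exceeds the real part Re ẑ cos - Im ẑ sin by Im ẑ cos - Re
ẑ sin. That term is odd in k for a real distribution and sums to 0 over a symmetric set. -/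
lemma proj_eq_fld {Λ : Set (ℝ × ℝ)} (hΛ : IsSymm (modes Λ)) (z : Sobolev (-δ)) : proj Λ z = fld coord (modes Λ) z := by
  ext x
  have h0 : ∑ k ∈ modes Λ, ((z.hat k).im * cosT k x - (z.hat k).re * sinT k x) = 0 := by
    have h2 : ∑ k ∈ modes Λ, ((z.hat k).im * cosT k x - (z.hat k).re * sinT k x)
        = ∑ k ∈ modes Λ, -((z.hat k).im * cosT k x - (z.hat k).re * sinT k x) := by
      refine Finset.sum_nbij' (fun k => -k) (fun k => -k) (fun k hk => hΛ.2 k hk) (fun k hk => hΛ.2 k hk)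
        (by simp) (by simp) fun k _ => ?_
      rw [sinT_neg, cosT_neg, Sobolev.hat_neg, Complex.conj_re, Complex.conj_im]
      ring
    rw [Finset.sum_neg_distrib] at h2
    linarith
  have h1 : proj Λ z x = ∑ k ∈ modes Λ, (2 * π)⁻¹ * ((z.hat k).re * cosT k x - (z.hat k).im * sinT k x) := by
    change (∑ k ∈ modes Λ, z.hat k * mode k x).re = _
    rw [Complex.re_sum]
    refine Finset.sum_congr rfl fun k _ => ?_
    have : (2 * π : ℂ)⁻¹ = (((2 * π)⁻¹ : ℝ) : ℂ) := by push_cast; rfl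
    rw [mode_eq_ch, this, mul_left_comm, Complex.re_ofReal_mul, Complex.mul_re, cosT_apply, sinT_apply]
  rw [h1, ← Finset.mul_sum, fld_apply, ← add_zero (∑ k ∈ modes Λ, _), ← h0, ← Finset.sum_add_distrib, Finset.mul_sum]
  refine Finset.sum_congr rfl fun k _ => ?_
  have hs : √(lam k) * (√(lam k))⁻¹ = 1 := mul_inv_cancel₀ (Real.sqrt_pos.2 (lam_pos k)).ne'
  simp only [coord, eT, ContinuousMap.smul_apply, ContinuousMap.sub_apply, smul_eq_mul]
  calc _ = (2 * π)⁻¹ * 1 * (((z.hat k).re + (z.hat k).im) * (cosT k x - sinT k x)) := by ring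
    _ = _ := by rw [← hs]; ring

lemma rho_sq (Λ : Set (ℝ × ℝ)) : rho Λ ^ 2 = green (modes Λ) 0 := by
  rw [rho, mul_pow, Real.sq_sqrt (Finset.sum_nonneg fun k _ => (inv_pos.2 (lam_pos k)).le), green_apply, Finset.mul_sum]
  refine Finset.sum_congr rfl fun k _ => ?_
  rw [cosT_apply_zero]
  ring

lemma rho_pos {Λ : Set (ℝ × ℝ)} (hΛ : IsSymm (modes Λ)) : 0 < rho Λ := by
  have h := green_zero_pos hΛ
  rw [← rho_sq] at h
  have h0 : 0 ≤ rho Λ := by unfold rho; have := Real.pi_pos; positivity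
  exact lt_of_le_of_ne h0 fun h1 => by rw [← h1] at h; simp at h

lemma wickExpCutoff_eq {Λ : Set (ℝ × ℝ)} (hΛ : IsSymm (modes Λ)) (a : ℝ) (z : Sobolev (-δ)) :
    wickExpCutoff a Λ z = wickField (wexp a) coord (modes Λ) z := by
  ext x
  change Real.exp (a * proj Λ z x - (a * rho Λ) ^ 2 / 2) = Real.exp (a * fld coord (modes Λ) z x - a ^ 2 * green (modes Λ) 0 / 2)
  rw [proj_eq_fld hΛ, mul_pow, rho_sq]

lemma aeval_hermite_add_two (x : ℝ) (n : ℕ) : Polynomial.aeval x (Polynomial.hermite (n + 2))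
    = x * Polynomial.aeval x (Polynomial.hermite (n + 1)) - (n + 1) * Polynomial.aeval x (Polynomial.hermite n) := by
  have hd : ∀ n : ℕ, Polynomial.derivative (Polynomial.hermite (n + 1)) = ((n : Polynomial ℤ) + 1) * Polynomial.hermite n := by
    intro n
    induction n with
    | zero => simp
    | succ n ih =>
      rw [Polynomial.hermite_succ (n + 1), Polynomial.derivative_sub, Polynomial.derivative_mul, Polynomial.derivative_X, ih,
        Polynomial.derivative_mul, Polynomial.hermite_succ n]
      simp only [Polynomial.derivative_add, Polynomial.derivative_natCast, Polynomial.derivative_one]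
      push_cast
      ring
  rw [Polynomial.hermite_succ (n + 1), hd]
  simp

lemma hp_eq_hermite {r : ℝ} (hr : 0 < r) (x : ℝ) (n : ℕ) :
    hp (r ^ 2) x n = r ^ n * Polynomial.aeval (r⁻¹ * x) (Polynomial.hermite n) := by
  induction n using Nat.twoStepInduction with
  | zero => simp [hp]
  | one => simp [hp, hr.ne']
  | more n h0 h1 =>
    rw [hp, h0, h1, aeval_hermite_add_two]
    field_simp
    ring

lemma wickPowerCutoff_eq {Λ : Set (ℝ × ℝ)} (hΛ : IsSymm (modes Λ)) (n : ℕ) (z : Sobolev (-δ)) :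
    wickPowerCutoff n Λ z = wickField (herm n) coord (modes Λ) z := by
  ext x
  change √(n.factorial : ℝ) * rho Λ ^ n * hermiteN n ((rho Λ)⁻¹ * proj Λ z x) = hp (green (modes Λ) 0) (fld coord (modes Λ) z x) n
  have hn : √(n.factorial : ℝ) ≠ 0 := by positivity
  rw [← rho_sq, hp_eq_hermite (rho_pos hΛ), proj_eq_fld hΛ, hermiteN]
  field_simp

/-- A ball of radius ε around 0 in Λ puts box M inside NΛ as soon as N > M/ε. The case N = 0 is
harmless, as 0 ∈ Λ keeps the zero mode in every NΛ. -/
lemma IsCutoff.exhaust {Λ : Set (ℝ × ℝ)} (hΛ : IsCutoff Λ) : Exhaust fun N : ℕ => modes ((N : ℝ) • Λ) := by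
  have hb : ∀ N : ℕ, Bornology.IsBounded ((N : ℝ) • Λ) := fun N => (hΛ.isCompact.smul (N : ℝ)).isBounded
  have h0 : (0 : ℝ × ℝ) ∈ Λ := interior_subset hΛ.zero_mem
  refine ⟨fun N => ⟨?_, fun k hk => ?_⟩, fun M => ?_⟩
  · rw [mem_modes (hb N)]
    exact ⟨0, h0, by simp; rfl⟩
  · rw [mem_modes (hb N)] at hk ⊢
    obtain ⟨y, hy, hyk⟩ := hk
    refine ⟨-y, ?_, ?_⟩
    · rw [← hΛ.neg_eq]
      simpa using hy
    · simp only [smul_neg] at hyk ⊢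
      rw [hyk]
      simp
  · obtain ⟨ε, hε, hball⟩ := Metric.mem_nhds_iff.1 (mem_interior_iff_mem_nhds.1 hΛ.zero_mem)
    obtain ⟨N₀, hN₀⟩ := exists_nat_gt (M / ε)
    filter_upwards [eventually_ge_atTop N₀] with N hN k hk
    have hMN : (M : ℝ) / ε < N := hN₀.trans_le (by exact_mod_cast hN)
    have hN0 : (0 : ℝ) < N := lt_of_le_of_lt (by positivity) hMN
    rw [mem_modes (hb N), Set.mem_smul_set_iff_inv_smul_mem₀ hN0.ne']
    apply hball
    simp only [box, Finset.mem_product, Finset.mem_Icc] at hk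
    have h1 : |(k.1 : ℝ)| ≤ M := abs_le.2 ⟨by exact_mod_cast hk.1.1, by exact_mod_cast hk.1.2⟩
    have h2 : |(k.2 : ℝ)| ≤ M := abs_le.2 ⟨by exact_mod_cast hk.2.1, by exact_mod_cast hk.2.2⟩
    rw [mem_ball_zero_iff, norm_smul, norm_inv, Real.norm_of_nonneg hN0.le, Prod.norm_def, inv_mul_lt_iff₀ hN0]
    rw [div_lt_iff₀ hε] at hMN
    exact (max_le h1 h2).trans_lt hMN

end Coordinates

end

end WickExp

namespace WickExp

noncomputable section

/-! ### Sobolev spaces as Hilbert spaces -/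

section SobolevSpace

variable {s : ℝ}

lemma Sobolev.hat_sub (u v : Sobolev s) (k : ℤ × ℤ) : (u - v).hat k = u.hat k - v.hat k := rfl

lemma Sobolev.norm_hat_sq_le (u : Sobolev s) (k : ℤ × ℤ) : lam k ^ s * ‖u.hat k‖ ^ 2 ≤ ‖u‖ ^ 2 := by
  rw [Sobolev.norm_sq_eq]
  exact u.summable_hat.le_tsum k fun j _ => mul_nonneg (Real.rpow_nonneg (lam_pos j).le _) (sq_nonneg _)

/-- The weighted Fourier coefficients as an element of `ℓ²`. -/
def Sobolev.toEll (u : Sobolev s) : lp (fun _ : ℤ × ℤ => ℂ) 2 :=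
  ⟨fun k => ((lam k ^ (s / 2) : ℝ) : ℂ) * u.hat k, by
    refine memℓp_gen ?_
    refine u.summable_hat.congr fun k => ?_
    rw [ENNReal.toReal_ofNat, Real.rpow_two, norm_mul, mul_pow, Complex.norm_real, Real.norm_of_nonneg (Real.rpow_nonneg (lam_pos k).le _),
      ← Real.rpow_natCast (lam k ^ (s / 2)), ← Real.rpow_mul (lam_pos k).le]
    congr 2
    push_cast
    ring⟩

lemma Sobolev.toEll_apply (u : Sobolev s) (k : ℤ × ℤ) : u.toEll k = ((lam k ^ (s / 2) : ℝ) : ℂ) * u.hat k := rfl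

lemma norm_rpow_half_mul_sq (k : ℤ × ℤ) (z : ℂ) : ‖((lam k ^ (s / 2) : ℝ) : ℂ) * z‖ ^ 2 = lam k ^ s * ‖z‖ ^ 2 := by
  rw [norm_mul, mul_pow, Complex.norm_real, Real.norm_of_nonneg (Real.rpow_nonneg (lam_pos k).le _),
    ← Real.rpow_natCast (lam k ^ (s / 2)), ← Real.rpow_mul (lam_pos k).le]
  congr 2
  push_cast
  ring

lemma Sobolev.isometry_toEll : Isometry (Sobolev.toEll : Sobolev s → _) := by
  refine Isometry.of_dist_eq fun u v => ?_
  have h1 : u.toEll - v.toEll = (u - v).toEll := by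
    ext k
    rw [lp.coeFn_sub, Pi.sub_apply, Sobolev.toEll_apply, Sobolev.toEll_apply, Sobolev.toEll_apply, Sobolev.hat_sub, mul_sub]
  rw [dist_eq_norm, dist_eq_norm, h1]
  have h2 := lp.norm_rpow_eq_tsum (p := 2) (by norm_num) (u - v).toEll
  simp only [ENNReal.toReal_ofNat, Real.rpow_two, Sobolev.toEll_apply, norm_rpow_half_mul_sq] at h2
  rw [← Sobolev.norm_sq_eq] at h2
  exact (sq_eq_sq₀ (norm_nonneg _) (norm_nonneg _)).1 h2

/-- The weighted Fourier coefficients embed H^s isometrically onto the subspace v(-k) = conj v(k) of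
ℓ², which is closed because evaluation at k is continuous. -/
instance : CompleteSpace (Sobolev s) := by
  rw [completeSpace_iff_isComplete_range (Sobolev.isometry_toEll (s := s)).isUniformInducing]
  refine IsClosed.isComplete ?_
  have hr : Set.range (Sobolev.toEll : Sobolev s → _) = ⋂ k : ℤ × ℤ, {v | v (-k) = conj (v k)} := by
    ext v
    simp only [Set.mem_range, Set.mem_iInter, Set.mem_ofPred_eq]
    constructor
    · rintro ⟨u, rfl⟩ k
      rw [Sobolev.toEll_apply, Sobolev.toEll_apply, lam_neg, Sobolev.hat_neg, map_mul, Complex.conj_ofReal]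
    · intro h
      have hc : ∀ k, ((lam k ^ (s / 2) : ℝ) : ℂ) ≠ 0 := fun k => by
        exact_mod_cast (Real.rpow_pos_of_pos (lam_pos k) _).ne'
      have hsum : Summable fun k => lam k ^ s * ‖(((lam k ^ (s / 2) : ℝ) : ℂ))⁻¹ * v k‖ ^ 2 := by
        have h2 := (lp.memℓp v).summable (p := 2) (by norm_num)
        simp only [ENNReal.toReal_ofNat, Real.rpow_two] at h2
        refine h2.congr fun k => ?_
        rw [← norm_rpow_half_mul_sq, ← mul_assoc, mul_inv_cancel₀ (hc k), one_mul]
      refine ⟨Sobolev.ofCoeff _ hsum fun k => ?_, ?_⟩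
      · rw [lam_neg, h k, map_mul, map_inv₀, Complex.conj_ofReal]
      · ext k
        rw [Sobolev.toEll_apply, Sobolev.hat_ofCoeff, ← mul_assoc, mul_inv_cancel₀ (hc k), one_mul]
  rw [hr]
  have hev : ∀ k : ℤ × ℤ, Continuous fun v : lp (fun _ : ℤ × ℤ => ℂ) 2 => v k := fun k =>
    (continuous_apply k).comp (lp.uniformContinuous_coe (p := 2)).continuous
  exact isClosed_iInter fun k => isClosed_eq (hev _) (Complex.continuous_conj.comp (hev k))

/-- The Riesz representative of `h` with respect to the duality pairing. -/
def Sobolev.dualRep (h : Sobolev s) : Sobolev (-s) :=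
  Sobolev.ofCoeff (fun k => ((lam k ^ s : ℝ) : ℂ) * h.hat k) (by
    refine h.summable_hat.congr fun k => ?_
    rw [norm_mul, Complex.norm_real, Real.norm_of_nonneg (Real.rpow_nonneg (lam_pos k).le _), mul_pow, ← mul_assoc, sq (lam k ^ s),
      ← mul_assoc, ← Real.rpow_add (lam_pos k), neg_add_cancel, Real.rpow_zero, one_mul]) (fun k => by
    rw [lam_neg, Sobolev.hat_neg, map_mul, Complex.conj_ofReal])

/-- This exhibits the pairing with h as a continuous linear functional on H^{-s}, so that it passes
to L² limits. -/
lemma Sobolev.pairing_eq_inner (u : Sobolev (-s)) (h : Sobolev s) : Sobolev.pairing u h = inner ℝ h.dualRep u := by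
  rw [real_inner_comm, Sobolev.inner_eq, Sobolev.pairing]
  congr 1
  funext k
  rw [Sobolev.dualRep, Sobolev.hat_ofCoeff, mul_left_comm, Complex.re_ofReal_mul, ← mul_assoc, lam_neg, ← Real.rpow_add (lam_pos k),
    neg_add_cancel, Real.rpow_zero, one_mul]

end SobolevSpace

/-! ### Continuous functions as elements of Sobolev spaces -/

section OfContinuous

variable {α : ℝ}

lemma hat_ofContinuous (hα : 0 ≤ α) (f : C(Torus, ℝ)) (k : ℤ × ℤ) :
    (Sobolev.ofContinuous hα f).hat k = coef (fun x => (f x : ℂ)) k := rfl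

lemma coef_ofReal (f : C(Torus, ℝ)) (k : ℤ × ℤ) : coef (fun x => (f x : ℂ)) k
    = (((2 * π)⁻¹ * ∫ x, f x * cosT k x : ℝ) : ℂ) - (((2 * π)⁻¹ * ∫ x, f x * sinT k x : ℝ) : ℂ) * Complex.I := by
  have h1 : Integrable (fun x => ((f x * cosT k x : ℝ) : ℂ)) volume := (integrable_cont (f * cosT k)).ofReal
  have h2 : Integrable (fun x => ((f x * sinT k x : ℝ) : ℂ)) volume := (integrable_cont (f * sinT k)).ofReal
  have e : ∀ x, (f x : ℂ) * mode (-k) x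
      = (2 * π : ℂ)⁻¹ * (((f x * cosT k x : ℝ) : ℂ) - ((f x * sinT k x : ℝ) : ℂ) * Complex.I) := fun x => by
    have : conj (ch k x) = (cosT k x : ℂ) - (sinT k x : ℂ) * Complex.I := by
      apply Complex.ext <;> simp [cosT_apply, sinT_apply]
    rw [mode_eq_ch, ch_neg, this]
    push_cast
    ring
  rw [coef]
  simp only [e]
  rw [integral_const_mul, integral_sub h1 (h2.mul_const _), integral_mul_const, integral_complex_ofReal, integral_complex_ofReal]
  push_cast
  ring

lemma norm_coef_ofReal_sq (f : C(Torus, ℝ)) (k : ℤ × ℤ) : ‖coef (fun x => (f x : ℂ)) k‖ ^ 2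
    = ((2 * π)⁻¹ * ∫ x, f x * cosT k x) ^ 2 + ((2 * π)⁻¹ * ∫ x, f x * sinT k x) ^ 2 := by
  rw [coef_ofReal, ← Complex.normSq_eq_norm_sq, sub_eq_add_neg, ← neg_mul, ← Complex.ofReal_neg, Complex.normSq_add_mul_I, neg_sq]

/-- The embedding of the continuous functions into `H^{-α}` as a continuous linear map. -/
def ofContinuousCLM (hα : 0 ≤ α) : C(Torus, ℝ) →L[ℝ] Sobolev (-α) :=
  let T : C(Torus, ℝ) →ₗ[ℝ] Sobolev (-α) :=
    { toFun := Sobolev.ofContinuous hα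
      map_add' := fun f g => Sobolev.ext_hat fun k => by
        rw [Sobolev.hat_add, hat_ofContinuous, hat_ofContinuous, hat_ofContinuous,
          ← coef_add (by fun_prop) (by fun_prop)]
        congr 1
        funext x
        exact Complex.ofReal_add _ _
      map_smul' := fun c f => Sobolev.ext_hat fun k => by
        rw [RingHom.id_apply, Sobolev.hat_smul, hat_ofContinuous, hat_ofContinuous, ← coef_smul]
        congr 1
        funext x
        exact Complex.ofReal_mul _ _ }
  ⟨T, by
    -- By the closed graph theorem it is enough that Fourier coefficients are continuous for both
    -- the uniform norm and the Sobolev norm, since they determine the element.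
    refine T.continuous_of_seq_closed_graph fun f g u hf hu => Sobolev.ext_hat fun k => ?_
    have h1 : Tendsto (fun n => (Sobolev.ofContinuous hα (f n)).hat k) atTop (𝓝 ((Sobolev.ofContinuous hα g).hat k)) := by
      rw [tendsto_iff_norm_sub_tendsto_zero]
      have h2 : Tendsto (fun n => 2 * π * ‖f n - g‖) atTop (𝓝 0) := by
        have := (tendsto_iff_norm_sub_tendsto_zero.1 hf).const_mul (2 * π)
        rwa [mul_zero] at this
      refine squeeze_zero (fun _ => norm_nonneg _) (fun n => ?_) h2
      rw [← Sobolev.hat_sub]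
      have h3 : Sobolev.ofContinuous hα (f n) - Sobolev.ofContinuous hα g = Sobolev.ofContinuous hα (f n - g) := (T.map_sub _ _).symm
      rw [h3, hat_ofContinuous]
      exact norm_coef_le (fun x => by rw [Complex.norm_real]; exact (f n - g).norm_coe_le_norm x) k
    have h2 : Tendsto (fun n => (Sobolev.ofContinuous hα (f n)).hat k) atTop (𝓝 (u.hat k)) := by
      rw [tendsto_iff_norm_sub_tendsto_zero]
      have hl := Real.rpow_pos_of_pos (lam_pos k) (-α)
      have h3 : Tendsto (fun n => √((lam k ^ (-α))⁻¹ * ‖T (f n) - u‖ ^ 2)) atTop (𝓝 0) := by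
        have := (((tendsto_iff_norm_sub_tendsto_zero.1 hu).pow 2).const_mul ((lam k ^ (-α))⁻¹)).sqrt
        simpa using this
      refine squeeze_zero (fun _ => norm_nonneg _) (fun n => Real.le_sqrt_of_sq_le ?_) h3
      rw [← Sobolev.hat_sub, ← div_eq_inv_mul, le_div_iff₀ hl, mul_comm]
      exact Sobolev.norm_hat_sq_le _ k
    exact tendsto_nhds_unique h2 h1⟩

lemma ofContinuousCLM_apply (hα : 0 ≤ α) (f : C(Torus, ℝ)) : ofContinuousCLM hα f = Sobolev.ofContinuous hα f := rfl

/-- The test functions that compute the norm of `H^{-α}`. -/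
def sobolevTest (α : ℝ) : (ℤ × ℤ) ⊕ (ℤ × ℤ) → Torus → ℝ
  | Sum.inl k => fun x => cosT k x * ((2 * π)⁻¹ * lam k ^ (-α / 2))
  | Sum.inr k => fun x => sinT k x * ((2 * π)⁻¹ * lam k ^ (-α / 2))

lemma integrable_sobolevTest (α : ℝ) : ∀ i, Integrable (sobolevTest α i) volume
  | Sum.inl k => integrable_continuousMap_mul (integrable_const _) (cosT k)
  | Sum.inr k => integrable_continuousMap_mul (integrable_const _) (sinT k)

lemma lam_rpow_half_sq (α : ℝ) (k : ℤ × ℤ) : (lam k ^ (-α / 2)) ^ 2 = lam k ^ (-α) := by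
  rw [← Real.rpow_natCast, ← Real.rpow_mul (lam_pos k).le]
  congr 1
  push_cast
  ring

lemma isTesting_sobolev (hα : 0 ≤ α) : IsTesting (ofContinuousCLM hα) (integrable_sobolevTest α) := by
  intro f
  have hs := (Sobolev.ofContinuous hα f).summable_hat
  simp only [hat_ofContinuous, norm_coef_ofReal_sq] at hs
  have hl : ∀ k, 0 ≤ lam k ^ (-α) := fun k => Real.rpow_nonneg (lam_pos k).le _
  have e1 : ∀ k, wint (integrable_sobolevTest α (Sum.inl k)) f ^ 2 = lam k ^ (-α) * ((2 * π)⁻¹ * ∫ x, f x * cosT k x) ^ 2 := fun k => by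
    have : ∀ x, f x * sobolevTest α (Sum.inl k) x = f x * cosT k x * ((2 * π)⁻¹ * lam k ^ (-α / 2)) := fun x => (mul_assoc _ _ _).symm
    rw [wint_apply]
    simp only [this]
    rw [integral_mul_const, ← lam_rpow_half_sq]
    ring
  have e2 : ∀ k, wint (integrable_sobolevTest α (Sum.inr k)) f ^ 2 = lam k ^ (-α) * ((2 * π)⁻¹ * ∫ x, f x * sinT k x) ^ 2 := fun k => by
    have : ∀ x, f x * sobolevTest α (Sum.inr k) x = f x * sinT k x * ((2 * π)⁻¹ * lam k ^ (-α / 2)) := fun x => (mul_assoc _ _ _).symm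
    rw [wint_apply]
    simp only [this]
    rw [integral_mul_const, ← lam_rpow_half_sq]
    ring
  have s1 : Summable fun k => lam k ^ (-α) * ((2 * π)⁻¹ * ∫ x, f x * cosT k x) ^ 2 :=
    Summable.of_nonneg_of_le (fun k => mul_nonneg (hl k) (sq_nonneg _))
      (fun k => mul_le_mul_of_nonneg_left (le_add_of_nonneg_right (sq_nonneg _)) (hl k)) hs
  have s2 : Summable fun k => lam k ^ (-α) * ((2 * π)⁻¹ * ∫ x, f x * sinT k x) ^ 2 :=
    Summable.of_nonneg_of_le (fun k => mul_nonneg (hl k) (sq_nonneg _))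
      (fun k => mul_le_mul_of_nonneg_left (le_add_of_nonneg_left (sq_nonneg _)) (hl k)) hs
  rw [ofContinuousCLM_apply, Sobolev.norm_sq_eq]
  simp only [hat_ofContinuous, norm_coef_ofReal_sq, mul_add]
  rw [s1.tsum_add s2]
  refine HasSum.sum ?_ ?_
  · simp only [Function.comp_def, e1]
    exact s1.hasSum
  · simp only [Function.comp_def, e2]
    exact s2.hasSum

lemma form_const (c : ℝ) (f : C(Torus, ℝ)) : form (integrable_const c) f = c ^ 2 * ((2 * π) ^ 2 * ∫ x, f x) := by
  have hint : Integrable (fun q : Torus × Torus => f (q.1 - q.2)) (volume.prod volume) :=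
    (f.comp diffMap).continuous.integrable_of_hasCompactSupport (HasCompactSupport.of_compactSpace _)
  rw [form_apply, integral_mul_const, integral_prod_symm _ hint]
  simp only [integral_sub_right_eq_self (fun x => f x)]
  rw [integral_const, volume_torus, smul_eq_mul]
  ring

/-- By `form_cosT_mul` the cosine and sine tests of frequency k add up to λ_k^{-α} ∫ cos(k·x) exp(β
G(x)) dx. The energy is then the supremum of the finite sums in `exists_exp_green_bound`. -/
lemma bddEnergy_sobolev (hα : 0 < α) (hα1 : α ≤ 1) : BddEnergy (integrable_sobolevTest α) (4 * π * α) := by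
  intro β hβ hβα
  obtain ⟨C, hC⟩ := exists_exp_green_bound hα hα1 hβ hβα
  refine ⟨ENNReal.ofReal C, ENNReal.ofReal_ne_top, fun F => ?_⟩
  have hPD := ((isPD_green F).smul hβ).expT
  have hpi := Real.pi_pos
  rw [energy, ENNReal.summable.tsum_sum ENNReal.summable, ← ENNReal.tsum_add]
  have e : ∀ k, ENNReal.ofReal (form (integrable_sobolevTest α (Sum.inl k)) (expT (β • green F)))
      + ENNReal.ofReal (form (integrable_sobolevTest α (Sum.inr k)) (expT (β • green F)))
      = ENNReal.ofReal (lam k ^ (-α) * ∫ x, cosT k x * expT (β • green F) x) := fun k => by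
    rw [← ENNReal.ofReal_add (hPD.form_nonneg _) (hPD.form_nonneg _)]
    have h1 := form_cosT_mul (integrable_const ((2 * π)⁻¹ * lam k ^ (-α / 2))) k (expT (β • green F))
    have h2 : form (integrable_sobolevTest α (Sum.inl k)) (expT (β • green F))
      + form (integrable_sobolevTest α (Sum.inr k)) (expT (β • green F))
      = form (integrable_const ((2 * π)⁻¹ * lam k ^ (-α / 2))) (cosT k * expT (β • green F)) := h1.symm
    rw [h2, form_const, mul_pow, lam_rpow_half_sq]
    simp only [ContinuousMap.mul_apply]
    congr 1
    field_simp
  simp only [e]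
  rw [ENNReal.tsum_eq_iSup_sum]
  refine iSup_le fun K => ?_
  rw [← ENNReal.ofReal_sum_of_nonneg fun k _ => ?_]
  · exact ENNReal.ofReal_le_ofReal (hC F K)
  · have h3 := ((IsPD.cosT k).mul hPD).integral_nonneg
    simp only [ContinuousMap.mul_apply] at h3
    exact mul_nonneg (Real.rpow_nonneg (lam_pos k).le _) h3

end OfContinuous

/-! ### Testing against a square integrable function -/

section Tested

lemma integrable_L2 (g : L2) : Integrable g volume := (Lp.memLp g).integrable one_le_two

lemma isTesting_L2 (g : L2) : IsTesting (wint (integrable_L2 g)) (fun _ : Unit => integrable_L2 g) := by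
  intro f
  rw [Real.norm_eq_abs, sq_abs]
  exact hasSum_unique _

/-- A case of Young's convolution inequality: 2 g(x) g(y) ≤ g(x)² + g(y)², and f ≥ 0 preserves this
under the integral. -/
lemma form_le_of_nonneg (g : L2) {f : C(Torus, ℝ)} (hf : ∀ x, 0 ≤ f x) :
    form (integrable_L2 g) f ≤ (∫ x, f x) * ∫ x, g x ^ 2 := by
  have hg2 : Integrable (fun x => g x ^ 2) volume := (Lp.memLp g).integrable_sq
  have h1 : Integrable (fun q : Torus × Torus => f (q.1 - q.2) * g q.1 ^ 2) (volume.prod volume) :=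
    integrable_continuousMap_mul (hg2.comp_fst _) (f.comp diffMap)
  have h2 : Integrable (fun q : Torus × Torus => f (q.1 - q.2) * g q.2 ^ 2) (volume.prod volume) :=
    integrable_continuousMap_mul (hg2.comp_snd _) (f.comp diffMap)
  have i1 : ∫ q : Torus × Torus, f (q.1 - q.2) * g q.1 ^ 2 ∂(volume.prod volume) = (∫ x, f x) * ∫ x, g x ^ 2 := by
    rw [integral_prod _ h1]
    have hn : (volume : Measure Torus).IsNegInvariant :=
      Measure.IsAddHaarMeasure.isNegInvariant_of_regular
        ((volume : Measure (AddCircle (2 * π))).prod (volume : Measure (AddCircle (2 * π))))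
    have hl : (volume : Measure Torus).IsAddLeftInvariant :=
      inferInstanceAs (((volume : Measure (AddCircle (2 * π))).prod (volume : Measure (AddCircle (2 * π)))).IsAddLeftInvariant)
    have h4 : ∀ x : Torus, ∫ a, f (x - a) = ∫ a, f a := fun x => integral_sub_left_eq_self (fun x => f x) volume x
    simp only [integral_mul_const, h4, integral_const_mul]
  have i2 : ∫ q : Torus × Torus, f (q.1 - q.2) * g q.2 ^ 2 ∂(volume.prod volume) = (∫ x, f x) * ∫ x, g x ^ 2 := by
    rw [integral_prod_symm _ h2]
    simp only [integral_mul_const, integral_sub_right_eq_self (fun x => f x), integral_const_mul]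
  have h3 : ∫ q : Torus × Torus, (f (q.1 - q.2) * g q.1 ^ 2 + f (q.1 - q.2) * g q.2 ^ 2) / 2 ∂(volume.prod volume)
      = (∫ x, f x) * ∫ x, g x ^ 2 := by
    rw [integral_div, integral_add h1 h2, i1, i2]
    ring
  rw [← h3, form_apply]
  refine integral_mono (integrable_continuousMap_mul ((integrable_L2 g).mul_prod (integrable_L2 g)) (f.comp diffMap))
    ((h1.add h2).div_const 2) fun q => ?_
  simp only
  nlinarith [mul_nonneg (hf (q.1 - q.2)) (sq_nonneg (g q.1 - g q.2))]

/-- Only the integral of exp(β G) is needed, which is the term k = 0 of `exists_exp_green_bound`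
with α = 1. Hence the threshold 4π. -/
lemma bddEnergy_L2 (g : L2) : BddEnergy (fun _ : Unit => integrable_L2 g) (4 * π) := by
  intro β hβ hβα
  obtain ⟨C, hC⟩ := exists_exp_green_bound one_pos le_rfl hβ (by rwa [mul_one])
  refine ⟨ENNReal.ofReal (C * ∫ x, g x ^ 2), ENNReal.ofReal_ne_top, fun F => ?_⟩
  rw [energy, tsum_fintype, Fintype.sum_unique]
  refine ENNReal.ofReal_le_ofReal ((form_le_of_nonneg g fun x => ?_).trans ?_)
  · rw [expT_apply]
    exact (Real.exp_pos _).le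
  · have h1 := hC F {0}
    have h2 : lam 0 = 1 := by simp [lam]
    rw [Finset.sum_singleton, h2, Real.one_rpow, one_mul, cosT_zero] at h1
    simp only [ContinuousMap.one_apply, one_mul] at h1
    exact mul_le_mul_of_nonneg_right h1 (integral_nonneg fun x => sq_nonneg _)

end Tested

end

end WickExp

namespace WickExp

noncomputable section

/-! ### The duality pairing with tested functions -/

section Pairing

/-- For smooth `f`, the integral against `g` is the duality pairing. -/
lemma test_eq_pairing {α : ℝ} (hα : 0 ≤ α) (f : C(Torus, ℝ)) (hf : (fun x => (f x : ℂ)) ∈ TestFn) {g : L2} {h : Sobolev α}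
    (hgh : SameDistr g h) : test f g = Sobolev.pairing (Sobolev.ofContinuous hα f) h := by
  have h1 := Distr.hasSum h.1 ⟨_, hf⟩
  have h2 : h.1.1 ⟨_, hf⟩ = ((test f g : ℝ) : ℂ) := by
    have : h.1.1 = functional g (integrable_L2 g) := hgh
    rw [this, test, ← integral_complex_ofReal]
    change ∫ x, (g x : ℂ) * (f x : ℂ) = _
    congr 1
    funext x
    push_cast
    ring
  rw [h2] at h1
  have h3 := h1.mapL Complex.reCLM
  rw [Sobolev.pairing]
  refine (HasSum.tsum_eq ?_).symm
  have e : ∀ k, h.1.1 (modeTest k) = h.hat (-k) := fun k => by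
    change _ = h.1.1 (modeTest (- -k))
    rw [neg_neg]
  simp only [e, Complex.reCLM_apply, Complex.ofReal_re] at h3
  exact h3

open scoped ContDiff in
-- The cut-off field is a trigonometric polynomial, so its exponential is a test function and
-- `test_eq_pairing` applies before the cut-off is removed.
lemma contDiff_wexp_fld {Ω : Type*} [MeasurableSpace Ω] (ξ : ℤ × ℤ → Ω → ℝ) (F : Finset (ℤ × ℤ)) (z : Ω) (a : ℝ) :
    (fun x => (wickField (wexp a) ξ F z x : ℂ)) ∈ TestFn := by
  have hch : ∀ k, ContDiff ℝ ∞ fun p : ℝ × ℝ => ch k ((p.1 : AddCircle (2 * π)), (p.2 : AddCircle (2 * π))) := fun k => by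
    have h1 : ContDiff ℝ ∞ fun p : ℝ × ℝ => mode k ((p.1 : AddCircle (2 * π)), (p.2 : AddCircle (2 * π))) := mode_mem k
    have h2 := (contDiff_const (c := (2 * π : ℂ))).mul h1
    have hpi : (2 * π : ℂ) ≠ 0 := by exact_mod_cast Real.two_pi_pos.ne'
    simpa only [mode_eq_ch, mul_inv_cancel_left₀ hpi] using h2
  have hfld : ContDiff ℝ ∞ fun p : ℝ × ℝ => fld ξ F z ((p.1 : AddCircle (2 * π)), (p.2 : AddCircle (2 * π))) := by
    simp only [fld_apply]
    refine ContDiff.sum fun k _ => contDiff_const.mul ?_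
    have h1 := Complex.reCLM.contDiff.comp (hch k)
    have h2 := Complex.imCLM.contDiff.comp (hch k)
    exact contDiff_const.mul (h1.sub h2)
  have h3 : ContDiff ℝ ∞ fun p : ℝ × ℝ => Real.exp (a * fld ξ F z ((p.1 : AddCircle (2 * π)), (p.2 : AddCircle (2 * π)))
      - a ^ 2 * green F 0 / 2) := ((contDiff_const.mul hfld).sub contDiff_const).exp
  exact Complex.ofRealCLM.contDiff.comp h3

lemma TendstoLp.clm_comp {Ω K L : Type*} [MeasurableSpace Ω] {μ : Measure Ω} [NormedAddCommGroup K] [NormedSpace ℝ K]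
    [NormedAddCommGroup L] [NormedSpace ℝ L] (T : K →L[ℝ] L) {p : ℝ≥0∞} {F : ℕ → Ω → K} {G : Ω → K} (h : TendstoLp p μ F G) :
    TendstoLp p μ (fun N ω => T (F N ω)) (fun ω => T (G ω)) := by
  refine ⟨fun N => T.comp_memLp' (h.1 N), T.comp_memLp' h.2.1, ?_⟩
  have hlim := ENNReal.Tendsto.const_mul (a := ENNReal.ofReal ‖T‖) h.2.2 (Or.inr ENNReal.ofReal_ne_top)
  rw [mul_zero] at hlim
  refine tendsto_of_tendsto_of_tendsto_of_le_of_le tendsto_const_nhds hlim (fun _ => zero_le) fun N => ?_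
  refine eLpNorm_le_mul_eLpNorm_of_ae_le_mul (Eventually.of_forall fun ω => ?_) p
  simp only [Pi.sub_apply, ← map_sub]
  exact T.le_opNorm _

end Pairing

end

end WickExp

/-! ### The theorem -/

theorem theorem3p1 (δ : ℝ) (hδ : 0 < δ) (μ₀ : Measure (Sobolev (-δ)))
    (hμ₀ : IsFreeField δ hδ μ₀) (α : ℝ) (hα : 0 < α) (hα1 : α ≤ 1) :
    ∃ (Φ : ℕ → Sobolev (-δ) → Sobolev (-α)) (Φg : ℕ → L2 → Sobolev (-δ) → ℝ)
      (W : ℝ → Sobolev (-δ) → Sobolev (-α)) (Wg : ℝ → L2 → Sobolev (-δ) → ℝ),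
      -- the Wick powers `Φ_n` and `Φ_n(·)(g)`
      (∀ n, IsWickPower hα.le μ₀ n (Φ n)) ∧
      (∀ n g, IsTestedWickPower μ₀ n g (Φg n g)) ∧
      -- the Wick exponential `W a`
      (∀ a : ℝ, |a| < √(4 * π * α) →
        TendstoLp 2 μ₀ (fun m z => ∑ n ∈ Finset.range m, (a ^ n / n.factorial) • Φ n z) (W a) ∧
        ∀ Λ, IsCutoff Λ → TendstoLp 2 μ₀
          (fun N z => Sobolev.ofContinuous hα.le (wickExpCutoff a ((N : ℝ) • Λ) z)) (W a)) ∧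
      -- the tested Wick exponential `Wg a g`
      (∀ a : ℝ, |a| < √(4 * π) → ∀ g : L2,
        TendstoLp 2 μ₀ (fun m z => ∑ n ∈ Finset.range m, (a ^ n / n.factorial) * Φg n g z) (Wg a g) ∧
        ∀ Λ, IsCutoff Λ → TendstoLp 2 μ₀
          (fun N z => test (wickExpCutoff a ((N : ℝ) • Λ) z) g) (Wg a g)) ∧
      (∀ a : ℝ, |a| < √(4 * π * α) → ∀ (g : L2) (h : Sobolev α), SameDistr g h →
        ∀ᵐ z ∂μ₀, Wg a g z = Sobolev.pairing (W a z) h) ∧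
      -- higher integrability
      (∀ p : ℝ, 2 ≤ p →
        (∀ a : ℝ, |a| < √(4 * π * α / (p - 1)) → MemLp (W a) (ENNReal.ofReal p) μ₀) ∧
        (∀ a : ℝ, |a| < √(4 * π / (p - 1)) → ∀ g : L2, MemLp (Wg a g) (ENNReal.ofReal p) μ₀)) := by
  have := hμ₀.isGaussian
  have hξ := hμ₀.isStdGaussian
  have hpi := Real.pi_pos
  -- The abstract theorem is used with values in H^{-α} and threshold 4πα, then for each g with
  -- values in ℝ and threshold 4π.
  obtain ⟨Φ, W, hΦ, hW, hWp⟩ := exists_wick (isTesting_sobolev hα.le) hξ (by positivity) (bddEnergy_sobolev hα hα1)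
  have hg := fun g : L2 => exists_wick (isTesting_L2 g) hξ (by positivity) (bddEnergy_L2 g)
  choose Φg Wg hΦg hWg hWgp using hg
  have hsq : ∀ {a b : ℝ}, |a| < √b → a ^ 2 < b := fun {a b} h => by
    rw [← sq_abs]
    exact (Real.lt_sqrt (abs_nonneg a)).1 h
  have hsq' : ∀ {a b p : ℝ}, 2 ≤ p → |a| < √(b / (p - 1)) → a ^ 2 * (p - 1) < b := fun {a b p} hp h =>
    (lt_div_iff₀ (by linarith)).1 (hsq h)
  refine ⟨Φ, fun n g => Φg g n, W, fun a g => Wg g a, fun n Λ hΛ p hp hpt => ?_, fun n g Λ hΛ p hp hpt => ?_, fun a ha => ?_,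
    fun a ha g => ?_, fun a ha g h hgh => ?_, fun p hp => ⟨fun a ha => hWp p a hp (hsq' hp ha), fun a ha g => hWgp g p a hp (hsq' hp ha)⟩⟩
  · simp only [wickPowerCutoff_eq (hΛ.exhaust.1 _)]
    exact hΦ n _ hΛ.exhaust p hp hpt
  · simp only [wickPowerCutoff_eq (hΛ.exhaust.1 _)]
    exact hΦg g n _ hΛ.exhaust p hp hpt
  · refine ⟨(hW a (hsq ha)).1, fun Λ hΛ => ?_⟩
    simp only [wickExpCutoff_eq (hΛ.exhaust.1 _)]
    exact (hW a (hsq ha)).2 _ hΛ.exhaust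
  · refine ⟨(hWg g a (hsq ha)).1, fun Λ hΛ => ?_⟩
    simp only [wickExpCutoff_eq (hΛ.exhaust.1 _)]
    exact (hWg g a (hsq ha)).2 _ hΛ.exhaust
  · have ha' : a ^ 2 < 4 * π := (hsq ha).trans_le (by nlinarith)
    have h1 := (hWg g a ha').2 _ exhaust_box
    have h2 := ((hW a (hsq ha)).2 _ exhaust_box).clm_comp (innerSL ℝ h.dualRep)
    have e : ∀ (N : ℕ) (z : Sobolev (-δ)), innerSL ℝ h.dualRep (ofContinuousCLM hα.le (wickField (wexp a) coord (box N) z))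
        = wint (integrable_L2 g) (wickField (wexp a) coord (box N) z) := fun N z => by
      rw [ofContinuousCLM_apply, innerSL_apply_apply, ← Sobolev.pairing_eq_inner]
      exact (test_eq_pairing hα.le _ (contDiff_wexp_fld coord (box N) z a) hgh).symm
    simp only [e] at h2
    filter_upwards [h1.ae_eq one_le_two h2] with z hz
    rw [hz, Sobolev.pairing_eq_inner]
    rfl
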